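/- Work over $\mathbb Q$. Let $A$ be a (possibly non-unital) differential graded commutative algebra, with cohomological grading, and let $n\ge 3$ be an integer such that $n-\dim(A)\ge 3$, where $\dim(A)$ is the largest degree in which $A$ is non-zero (that is, $A^i\ne 0$ implies $i\le n-3$). Let $A_*=\mathbb Q 1\oplus A$. **Hairy graphs.** Consider finite internally connected graphs with $k\ge 1$ numbered univalent external vertices (hairs) and with internal vertices of valence $\ge 3$; multiple edges and tadpoles are allowed, and the graph with one edge joining two external vertices is included. Such a graph with $\#E$ edges and $\#V$ internal vertices has degree $(n-1)\#E-n\#V$. An orientation is an ordering, up to even permutations, of the edges if $n$ is even, and of the half-edges and internal vertices if $n$ is odd; a graph with opposite orientation is identified with minus the graph. Let $\mathrm{pIG}_n(k)$ be the graded vector space spanned by the oriented graphs with $k$ hairs. The space $\mathrm{HGC}_{A,n}=\prod_{k\ge 1}\mathrm{Hom}_{\Sigma_k}(\mathrm{pIG}_n(k),A^{\otimes k})$ consists of the series of such graphs with hairs decorated by elements $a_1,\dots,a_k$ of $A$; a decorated graph has homological degree $(n-1)\#E-n\#V-\sum_i|a_i|$. **$L_\infty$-structure.** All operations $\ell_r$,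 $r\geq 1$, have degree $-1$. For a graded commutative algebra $R$ and $x\in (R\mathbin{\hat\otimes}\mathrm{HGC}_{A,n})_0$, let $F_x$ be the extension of $x$ to all graphs with numbered external vertices of arbitrary valence, with values in $R\otimes A_*^{\otimes k}$, that is multiplicative for the gluing of graphs along their external vertices and compatible with the fusion of external vertices (which multiplies decorations) and with the insertion of isolated external vertices (which are decorated by $1$). The operations are determined by $$\sum_{r\ge 1}\tfrac1{r!}\ell_r(x,\dots,x)(\Gamma)=d_A\bigl(x(\Gamma)\bigr)-F_x(d\Gamma),$$ where $d\Gamma$ is the signed sum of the graphs obtained from $\Gamma$ by contracting an edge which joins an internal vertex to a different (internal or external) vertex. Thus $\ell_1=d_A+\delta_{split}+\delta_{join}$, where $\delta_{split}$ splits internal vertices and $\delta_{join}$ joins a set of at least two hairs into one, and $\ell_r$, $r\ge 2$, joins a non-empty set of hairs of each of $r$ graphs into one hair; the decorations of the joined hairs are multiplied. **Unitrivalent trees.** Let $\mathrm{UTT}_{A,n}$ be the quotient of $\mathrm{HGC}_{A,n}$ by all graphs which are not unitrivalent trees (trees all of whose internal vertices are trivalent) and by the IHX relations, which are the images under $\delta_{split}$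 of the decorated trees all of whose internal vertices are trivalent except for one of valence four. It inherits from $\mathrm{HGC}_{A,n}$ the structure of a dg Lie algebra. **Maurer--Cartan elements.** For $\mathfrak g=\mathrm{HGC}_{A,n}$ or $\mathfrak g=\mathrm{UTT}_{A,n}$, a Maurer--Cartan element is an element $m\in\mathfrak g_0$ with $\sum_{r\ge1}\frac1{r!}\ell_r(m,\dots,m)=0$. Gauge equivalence is the equivalence relation generated by $m_0\sim m_1$ if there is a Maurer--Cartan element of $\mathfrak g\mathbin{\hat\otimes}\Omega^*(\Delta^1)$, $\Omega^*(\Delta^1)=\mathbb Q[t]\oplus\mathbb Q[t]\,dt$, that restricts to $m_0$ at $t=0$ and to $m_1$ at $t=1$. **Proposition.** The quotient map $\mathrm{HGC}_{A,n}\to\mathrm{UTT}_{A,n}$ induces a bijection on the sets of gauge equivalence classes of Maurer--Cartan elements. -/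

import Mathlib

noncomputable section

namespace HairyGraphs

universe u

/-- A (possibly non-unital) differential graded commutative algebra over `ℚ`, with a cohomological
grading. -/
structure DGCommAlgebra (A : Type u) [NonUnitalRing A] [Module ℚ A] where
  gr : ℤ → Submodule ℚ A
  isInternal : DirectSum.IsInternal gr
  mul_mem : ∀ {i j : ℤ} {a b : A}, a ∈ gr i → b ∈ gr j → a * b ∈ gr (i + j)
  graded_comm : ∀ {i j : ℤ} {a b : A}, a ∈ gr i → b ∈ gr j →
    a * b = (-1 : ℚ) ^ (i * j) • (b * a)
  d : A →ₗ[ℚ] A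
  d_mem : ∀ {i : ℤ} {a : A}, a ∈ gr i → d a ∈ gr (i + 1)
  leibniz : ∀ {i : ℤ} {a : A} (b : A), a ∈ gr i →
    d (a * b) = d a * b + (-1 : ℚ) ^ i • (a * d b)
  d_d : ∀ a : A, d (d a) = 0

/-- A unital differential graded commutative algebra; these serve as rings of coefficients. -/
structure CoeffAlgebra (R : Type) [Ring R] [Algebra ℚ R] extends DGCommAlgebra R where
  one_mem : (1 : R) ∈ gr 0

section Tensor

variable {R : Type} [Ring R] [Algebra ℚ R] (K : CoeffAlgebra R)
variable {A : Type u} [NonUnitalRing A] [Module ℚ A] (D : DGCommAlgebra A)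
variable (S T : Type)

/-- Homogeneous generators of `R ⊗ A_*^{⊗ S}`. -/
inductive Gen : Type u
  | base (i : ℤ) (r : K.gr i) : Gen
  | lab (s : S) (i : ℤ) (a : D.gr i) : Gen

variable {S} in
/-- The degree of a generator. -/
def Gen.deg : Gen K D S → ℤ
  | .base i _ => i
  | .lab _ i _ => i

open FreeAlgebra in
/-- The relations that define `R ⊗ A_*^{⊗ S}` as a graded commutative algebra. -/
inductive Rel : FreeAlgebra ℚ (Gen K D S) → FreeAlgebra ℚ (Gen K D S) → Prop
  | base_one : Rel (ι ℚ (.base 0 ⟨1, K.one_mem⟩)) 1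
  | base_add (i : ℤ) (r r' : K.gr i) :
      Rel (ι ℚ (.base i (r + r'))) (ι ℚ (.base i r) + ι ℚ (.base i r'))
  | base_smul (i : ℤ) (c : ℚ) (r : K.gr i) :
      Rel (ι ℚ (.base i (c • r))) (c • ι ℚ (.base i r))
  | base_mul (i j : ℤ) (r : K.gr i) (r' : K.gr j) :
      Rel (ι ℚ (.base (i + j) ⟨r * r', K.mul_mem r.2 r'.2⟩)) (ι ℚ (.base i r) * ι ℚ (.base j r'))
  | lab_add (s : S) (i : ℤ) (a a' : D.gr i) :
      Rel (ι ℚ (.lab s i (a + a'))) (ι ℚ (.lab s i a) + ι ℚ (.lab s i a'))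
  | lab_smul (s : S) (i : ℤ) (c : ℚ) (a : D.gr i) :
      Rel (ι ℚ (.lab s i (c • a))) (c • ι ℚ (.lab s i a))
  | lab_mul (s : S) (i j : ℤ) (a : D.gr i) (a' : D.gr j) :
      Rel (ι ℚ (.lab s (i + j) ⟨a * a', D.mul_mem a.2 a'.2⟩))
        (ι ℚ (.lab s i a) * ι ℚ (.lab s j a'))
  | base_lab (s : S) (i j : ℤ) (r : K.gr i) (a : D.gr j) :
      Rel (ι ℚ (.base i r) * ι ℚ (.lab s j a))
        ((-1 : ℚ) ^ (i * j) • (ι ℚ (.lab s j a) * ι ℚ (.base i r)))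
  | lab_lab (s t : S) (i j : ℤ) (a : D.gr i) (a' : D.gr j) :
      Rel (ι ℚ (.lab s i a) * ι ℚ (.lab t j a'))
        ((-1 : ℚ) ^ (i * j) • (ι ℚ (.lab t j a') * ι ℚ (.lab s i a)))

/-- The graded commutative algebra `R ⊗ A_*^{⊗ S}`. -/
def Tens : Type u := RingQuot (Rel K D S)

instance : Ring (Tens K D S) :=
  inferInstanceAs (Ring (RingQuot (Rel K D S)))

instance : Algebra ℚ (Tens K D S) :=
  inferInstanceAs (Algebra ℚ (RingQuot (Rel K D S)))

namespace Tens

variable {S T} {K D}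

variable (K D S) in
/-- The quotient map from the free algebra. -/
def mk : FreeAlgebra ℚ (Gen K D S) →ₐ[ℚ] Tens K D S := RingQuot.mkAlgHom ℚ (Rel K D S)

theorem mk_rel {x y : FreeAlgebra ℚ (Gen K D S)} (h : Rel K D S x y) :
    mk K D S x = mk K D S y :=
  RingQuot.mkAlgHom_rel ℚ h

/-- The class of a generator. -/
def gen (g : Gen K D S) : Tens K D S := mk K D S (FreeAlgebra.ι ℚ g)

variable (K D S) in
/-- The inclusion of the degree `i` part of the coefficients. -/
def base (i : ℤ) : K.gr i →ₗ[ℚ] Tens K D S where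
  toFun r := gen (.base i r)
  map_add' r r' := by
    simpa [gen] using mk_rel (Rel.base_add (K := K) (D := D) (S := S) i r r')
  map_smul' c r := by
    simpa [gen] using mk_rel (Rel.base_smul (K := K) (D := D) (S := S) i c r)

variable (K D) in
/-- The degree `i` part of the inclusion of the tensor factor `A` of index `s`. -/
def lab (s : S) (i : ℤ) : D.gr i →ₗ[ℚ] Tens K D S where
  toFun r := gen (.lab s i r)
  map_add' r r' := by
    simpa [gen] using mk_rel (Rel.lab_add (K := K) (D := D) (S := S) s i r r')
  map_smul' c r := by
    simpa [gen] using mk_rel (Rel.lab_smul (K := K) (D := D) (S := S) s i c r)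

theorem base_one : base K D S 0 ⟨1, K.one_mem⟩ = 1 := by
  simpa [gen, base] using mk_rel (Rel.base_one (K := K) (D := D) (S := S))

theorem base_mul {i j : ℤ} (r : K.gr i) (r' : K.gr j) :
    base K D S (i + j) ⟨r * r', K.mul_mem r.2 r'.2⟩ = base K D S i r * base K D S j r' := by
  simpa [gen, base] using mk_rel (Rel.base_mul (K := K) (D := D) (S := S) i j r r')

theorem lab_mul (s : S) {i j : ℤ} (r : D.gr i) (r' : D.gr j) :
    lab K D s (i + j) ⟨r * r', D.mul_mem r.2 r'.2⟩ = lab K D s i r * lab K D s j r' := by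
  simpa [gen, lab] using mk_rel (Rel.lab_mul (K := K) (D := D) (S := S) s i j r r')

theorem base_lab (s : S) {i j : ℤ} (r : K.gr i) (a : D.gr j) :
    base K D S i r * lab K D s j a = (-1 : ℚ) ^ (i * j) • (lab K D s j a * base K D S i r) := by
  simpa [gen, base, lab] using mk_rel (Rel.base_lab (K := K) (D := D) (S := S) s i j r a)

theorem lab_lab (s t : S) {i j : ℤ} (r : D.gr i) (a : D.gr j) :
    lab K D s i r * lab K D t j a = (-1 : ℚ) ^ (i * j) • (lab K D t j a * lab K D s i r) := by
  simpa [gen, lab] using mk_rel (Rel.lab_lab (K := K) (D := D) (S := S) s t i j r a)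

/-- The universal property of `R ⊗ A_*^{⊗ S}`. -/
def lift {B : Type*} [Ring B] [Algebra ℚ B]
    (β : ∀ i : ℤ, K.gr i →ₗ[ℚ] B) (l : S → ∀ i : ℤ, D.gr i →ₗ[ℚ] B)
    (h1 : β 0 ⟨1, K.one_mem⟩ = 1)
    (h2 : ∀ (i j : ℤ) (r : K.gr i) (r' : K.gr j),
      β (i + j) ⟨r * r', K.mul_mem r.2 r'.2⟩ = β i r * β j r')
    (h3 : ∀ (s : S) (i j : ℤ) (a : D.gr i) (a' : D.gr j),
      l s (i + j) ⟨a * a', D.mul_mem a.2 a'.2⟩ = l s i a * l s j a')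
    (h4 : ∀ (s : S) (i j : ℤ) (r : K.gr i) (a : D.gr j),
      β i r * l s j a = (-1 : ℚ) ^ (i * j) • (l s j a * β i r))
    (h5 : ∀ (s t : S) (i j : ℤ) (a : D.gr i) (a' : D.gr j),
      l s i a * l t j a' = (-1 : ℚ) ^ (i * j) • (l t j a' * l s i a)) :
    Tens K D S →ₐ[ℚ] B :=
  RingQuot.liftAlgHom ℚ (s := Rel K D S)
    ⟨FreeAlgebra.lift ℚ (fun g : Gen K D S => match g with
      | .base i r => β i r
      | .lab s i a => l s i a), by
      intro x y h
      cases h with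
      | base_one => simpa using h1
      | base_add => simp
      | base_smul => simp
      | base_mul => simp [h2]
      | lab_add => simp
      | lab_smul => simp
      | lab_mul => simp [h3]
      | base_lab => simpa using h4 ..
      | lab_lab => simpa using h5 ..⟩

theorem lift_gen {B : Type*} [Ring B] [Algebra ℚ B]
    (β : ∀ i : ℤ, K.gr i →ₗ[ℚ] B) (l : S → ∀ i : ℤ, D.gr i →ₗ[ℚ] B) (h1) (h2) (h3) (h4) (h5)
    (g : Gen K D S) : lift β l h1 h2 h3 h4 h5 (gen g) = match g with
      | .base i r => β i r
      | .lab s i a => l s i a := by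
  refine (RingQuot.liftAlgHom_mkAlgHom_apply ..).trans ?_
  exact FreeAlgebra.lift_ι_apply _ _

/-- The map `R ⊗ A_*^{⊗ S} → R ⊗ A_*^{⊗ T}` induced by a map `S → T`: it multiplies the factors
in each fibre. -/
def rename (f : S → T) : Tens K D S →ₐ[ℚ] Tens K D T :=
  lift (base K D T) (fun s i => lab K D (f s) i) base_one (fun _ _ => base_mul)
    (fun s _ _ => lab_mul (f s)) (fun s _ _ => base_lab (f s)) (fun s t _ _ => lab_lab (f s) (f t))

/-- The matrix `[[(-1)^i x, y], [0, x]]`. -/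
def triang {M B : Type*} [AddCommGroup M] [Module ℚ M] [Ring B] [Algebra ℚ B] (i : ℤ)
    (x y : M →ₗ[ℚ] B) : M →ₗ[ℚ] Matrix (Fin 2) (Fin 2) B where
  toFun m := !![(-1 : ℚ) ^ i • x m, y m; 0, x m]
  map_add' a b := by ext p q; fin_cases p <;> fin_cases q <;> simp
  map_smul' c a := by ext p q; fin_cases p <;> fin_cases q <;> simp [smul_comm c]

/-- The differential, as a map from the homogeneous part of degree `i` to that of degree `i + 1`. -/
def _root_.HairyGraphs.DGCommAlgebra.dGr {A : Type*} [NonUnitalRing A] [Module ℚ A]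
    (D : DGCommAlgebra A) (i : ℤ) : D.gr i →ₗ[ℚ] D.gr (i + 1) :=
  D.d.restrict fun _ ha => D.d_mem ha

theorem base_cast {i j : ℤ} (h : i = j) (r : K.gr i) (r' : K.gr j) (hr : (r : R) = r') :
    base K D S i r = base K D S j r' := by
  subst h; congr; exact Subtype.ext hr

theorem lab_cast (s : S) {i j : ℤ} (h : i = j) (r : D.gr i) (r' : D.gr j) (hr : (r : A) = r') :
    lab K D s i r = lab K D s j r' := by
  subst h; congr; exact Subtype.ext hr

theorem sign_mul (i j : ℤ) : (-1 : ℚ) ^ (i + j) = (-1) ^ i * (-1) ^ j :=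
  zpow_add₀ (by norm_num) i j

theorem sign_sq (i : ℤ) : (-1 : ℚ) ^ i * (-1) ^ i = 1 := by
  rw [← mul_zpow]; simp

theorem triang_comm {M N B : Type*} [AddCommGroup M] [Module ℚ M] [AddCommGroup N] [Module ℚ N]
    [Ring B] [Algebra ℚ B] (i j : ℤ) (x y : M →ₗ[ℚ] B) (x' y' : N →ₗ[ℚ] B) (a : M) (b : N)
    (h1 : x a * x' b = (-1 : ℚ) ^ (i * j) • (x' b * x a))
    (h2 : x a * y' b = (-1 : ℚ) ^ (i * (j + 1)) • (y' b * x a))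
    (h3 : y a * x' b = (-1 : ℚ) ^ ((i + 1) * j) • (x' b * y a)) :
    triang i x y a * triang j x' y' b =
      (-1 : ℚ) ^ (i * j) • (triang j x' y' b * triang i x y a) := by
  have e1 : (-1 : ℚ) ^ (i * (j + 1)) = (-1) ^ (i * j) * (-1) ^ i := by
    rw [← sign_mul]; ring_nf
  have e2 : (-1 : ℚ) ^ ((i + 1) * j) = (-1) ^ (i * j) * (-1) ^ j := by
    rw [← sign_mul]; ring_nf
  rw [e1] at h2
  rw [e2] at h3
  ext p q
  fin_cases p <;> fin_cases q
  · simp [triang, Matrix.mul_apply, h1, smul_smul, mul_comm, mul_assoc, mul_left_comm]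
  · simp only [triang, LinearMap.coe_mk, AddHom.coe_mk, Matrix.mul_apply, Matrix.smul_apply,
      Fin.sum_univ_two]
    simp [h2, h3, smul_smul]
    rw [add_comm, mul_left_comm, sign_sq, mul_one]
  · simp [triang, Matrix.mul_apply]
  · simp [triang, Matrix.mul_apply, h1]

/-- The algebra map `x ↦ [[(-1)^|x| x, dx], [0, x]]` that encodes the differential of
`R ⊗ A_*^{⊗ S}` as the derivation which extends the differentials of `R` and of the factors. -/
def dHom : Tens K D S →ₐ[ℚ] Matrix (Fin 2) (Fin 2) (Tens K D S) :=
  lift (fun i => triang i (base K D S i) (base K D S (i + 1) ∘ₗ K.dGr i))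
    (fun s i => triang i (lab K D s i) (lab K D s (i + 1) ∘ₗ D.dGr i))
    (by
      have h : K.d 1 = 0 := by
        have := K.leibniz (1 : R) K.one_mem
        simpa using this
      have h' : base K D S (0 + 1) (K.dGr 0 ⟨1, K.one_mem⟩) = 0 := by
        have : K.dGr 0 ⟨1, K.one_mem⟩ = 0 := Subtype.ext h
        rw [this, map_zero]
      ext p q
      fin_cases p <;> fin_cases q
      · simp [triang, base_one]
      · simpa [triang] using h'
      · simp [triang]
      · simp [triang, base_one])
    (by
      intro i j r r'
      have h' : base K D S (i + j + 1) (K.dGr (i + j) ⟨r * r', K.mul_mem r.2 r'.2⟩) =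
          (-1 : ℚ) ^ i • (base K D S i r * base K D S (j + 1) (K.dGr j r')) +
            base K D S (i + 1) (K.dGr i r) * base K D S j r' := by
        have m1 : (r * K.d r' : R) ∈ K.gr (i + j + 1) := by
          have := K.mul_mem r.2 (K.d_mem r'.2); rwa [← add_assoc] at this
        have m2 : (K.d r * r' : R) ∈ K.gr (i + j + 1) := by
          have := K.mul_mem (K.d_mem r.2) r'.2; rwa [add_right_comm] at this
        have : K.dGr (i + j) ⟨r * r', K.mul_mem r.2 r'.2⟩ =
            (-1 : ℚ) ^ i • ⟨_, m1⟩ + ⟨_, m2⟩ := by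
          apply Subtype.ext
          have := K.leibniz (r' : R) r.2
          simpa [DGCommAlgebra.dGr, add_comm] using this
        rw [this, map_add, map_smul, ← base_mul, ← base_mul]
        congr 1
        · congr 1
          exact base_cast (add_assoc _ _ _) _ _ rfl
        · exact base_cast (add_right_comm _ _ _) _ _ rfl
      ext p q
      fin_cases p <;> fin_cases q
      · simp [triang, base_mul, smul_smul, sign_mul]
      · simp [triang, h']
      · simp [triang]
      · simp [triang, base_mul])
    (by
      intro s i j r r'
      have h' : lab K D s (i + j + 1) (D.dGr (i + j) ⟨r * r', D.mul_mem r.2 r'.2⟩) =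
          (-1 : ℚ) ^ i • (lab K D s i r * lab K D s (j + 1) (D.dGr j r')) +
            lab K D s (i + 1) (D.dGr i r) * lab K D s j r' := by
        have m1 : (r * D.d r' : A) ∈ D.gr (i + j + 1) := by
          have := D.mul_mem r.2 (D.d_mem r'.2); rwa [← add_assoc] at this
        have m2 : (D.d r * r' : A) ∈ D.gr (i + j + 1) := by
          have := D.mul_mem (D.d_mem r.2) r'.2; rwa [add_right_comm] at this
        have : D.dGr (i + j) ⟨r * r', D.mul_mem r.2 r'.2⟩ =
            (-1 : ℚ) ^ i • ⟨_, m1⟩ + ⟨_, m2⟩ := by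
          apply Subtype.ext
          have := D.leibniz (r' : A) r.2
          simpa [DGCommAlgebra.dGr, add_comm] using this
        rw [this, map_add, map_smul, ← lab_mul, ← lab_mul]
        congr 1
        · congr 1
          exact lab_cast s (add_assoc _ _ _) _ _ rfl
        · exact lab_cast s (add_right_comm _ _ _) _ _ rfl
      ext p q
      fin_cases p <;> fin_cases q
      · simp [triang, lab_mul, smul_smul, sign_mul]
      · simp [triang, h']
      · simp [triang]
      · simp [triang, lab_mul])
    (by
      intro s i j r a
      exact triang_comm i j _ _ _ _ _ _ (base_lab s r a) (base_lab s r _) (base_lab s _ a))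
    (by
      intro s t i j a a'
      exact triang_comm i j _ _ _ _ _ _ (lab_lab s t a a') (lab_lab s t a _) (lab_lab s t _ a'))

/-- The differential of `R ⊗ A_*^{⊗ S}`. -/
def d : Tens K D S →ₗ[ℚ] Tens K D S :=
  Matrix.entryLinearMap ℚ (Tens K D S) 0 1 ∘ₗ dHom.toLinearMap

variable (K D S) in
/-- The degree `m` part of `R ⊗ A^{⊗ S} ⊆ R ⊗ A_*^{⊗ S}`: it is spanned by the products of
homogeneous generators of total degree `m` in which each of the tensor factors occurs. -/
def part (m : ℤ) : Submodule ℚ (Tens K D S) :=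
  Submodule.span ℚ {b | ∃ w : List (Gen K D S), (w.map (Gen.deg K D)).sum = m ∧
    (∀ s : S, ∃ i a, Gen.lab s i a ∈ w) ∧ b = (w.map gen).prod}


theorem hom_ext {B : Type*} [Ring B] [Algebra ℚ B] {f g : Tens K D S →ₐ[ℚ] B}
    (h : ∀ x : Gen K D S, f (gen x) = g (gen x)) : f = g := by
  refine RingQuot.ringQuot_ext' ℚ (s := Rel K D S) (B := B) f g ?_
  apply FreeAlgebra.hom_ext
  funext x
  exact h x

end Tens

/-- A morphism of coefficient algebras. -/
structure CoeffHom {R' : Type} [Ring R'] [Algebra ℚ R'] (K : CoeffAlgebra R)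
    (K' : CoeffAlgebra R') extends R →ₐ[ℚ] R' where
  map_mem : ∀ {i : ℤ} {r : R}, r ∈ K.gr i → toFun r ∈ K'.gr i
  map_d : ∀ r : R, toFun (K.d r) = K'.d (toFun r)

namespace Tens

variable {K D S}
variable {R' : Type} [Ring R'] [Algebra ℚ R'] {K' : CoeffAlgebra R'} (φ : CoeffHom K K')

/-- The degree `i` part of a morphism of coefficient algebras. -/
def _root_.HairyGraphs.CoeffHom.mapGr (i : ℤ) : K.gr i →ₗ[ℚ] K'.gr i :=
  φ.toAlgHom.toLinearMap.restrict fun _ h => φ.map_mem h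

/-- Extension of scalars. -/
def baseChange : Tens K D S →ₐ[ℚ] Tens K' D S :=
  lift (fun i => base K' D S i ∘ₗ φ.mapGr i) (lab K' D)
    (by
      have : φ.mapGr 0 ⟨1, K.one_mem⟩ = ⟨1, K'.one_mem⟩ := Subtype.ext (map_one φ.toAlgHom)
      simp [this, base_one])
    (by
      intro i j r r'
      simp only [LinearMap.comp_apply]
      rw [← base_mul]
      exact congrArg _ (Subtype.ext (map_mul φ.toAlgHom _ _)))
    (fun s _ _ => lab_mul s) (fun s _ _ _ => base_lab s _) (fun s t _ _ => lab_lab s t)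

/-- The action of a morphism of coefficient algebras on generators. -/
def _root_.HairyGraphs.Gen.map : Gen K D S → Gen K' D S
  | .base i r => .base i (φ.mapGr i r)
  | .lab s i a => .lab s i a

theorem baseChange_gen (g : Gen K D S) :
    baseChange φ (gen g : Tens K D S) = gen (g.map φ) := by
  cases g <;> simp only [baseChange, lift_gen, Gen.map] <;> rfl

theorem rename_gen_base (f : S → T) (i : ℤ) (r : K.gr i) :
    rename f (gen (.base i r) : Tens K D S) = gen (.base i r) := by
  exact lift_gen ..

theorem rename_gen_lab (f : S → T) (s : S) (i : ℤ) (a : D.gr i) :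
    rename f (gen (.lab s i a) : Tens K D S) = gen (.lab (f s) i a) := by
  exact lift_gen ..

theorem baseChange_rename (f : S → T) (b : Tens K D S) :
    baseChange φ (rename f b) = rename f (baseChange φ b) := by
  have : (baseChange φ).comp (rename f) =
      (rename f).comp (baseChange φ : Tens K D S →ₐ[ℚ] Tens K' D S) := by
    refine hom_ext fun g => ?_
    cases g <;>
      simp [rename_gen_base, rename_gen_lab, baseChange_gen, Gen.map]
  exact DFunLike.congr_fun this b

theorem baseChange_mem_part {m : ℤ} {b : Tens K D S} (h : b ∈ part K D S m) :
    baseChange φ b ∈ part K' D S m := by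
  refine Submodule.span_induction (p := fun b _ => baseChange φ b ∈ part K' D S m)
    ?_ ?_ ?_ ?_ h
  · rintro _ ⟨w, hw, hs, rfl⟩
    refine Submodule.subset_span ⟨w.map (Gen.map φ), ?_, ?_, ?_⟩
    · rw [← hw, List.map_map]
      congr 1
      apply List.map_congr_left
      intro g _
      cases g <;> rfl
    · intro s
      obtain ⟨i, a, ha⟩ := hs s
      exact ⟨i, a, List.mem_map.2 ⟨_, ha, rfl⟩⟩
    · rw [map_list_prod, List.map_map, List.map_map]
      congr 1
      apply List.map_congr_left
      intro g _
      exact baseChange_gen φ g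
  · simp
  · intro x y _ _ hx hy
    simpa using add_mem hx hy
  · intro c x _ hx
    simpa using Submodule.smul_mem _ c hx

end Tens
end Tensor

section Graphs

variable {S V E : Type}

/-- A graph with external vertices `S`, internal vertices `V` and edges `E`: each edge has two
ends, indexed by `Bool`. Multiple edges and tadpoles are allowed. A total order of the edges and
internal vertices, and the direction of the edges, provide an orientation: for `n` even, it is
given by the order of the edges, and for `n` odd by the order of the half-edges and internal
vertices, where the half-edges `(i, false)`, `(i, true)` come in consecutive pairs. -/
abbrev Graph (S V E : Type) : Type := E → Bool → S ⊕ V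

/-- Two edges are linked if they can be joined by a path through internal vertices. -/
def Linked (G : Graph S V E) : E → E → Prop :=
  Relation.EqvGen fun i j => ∃ (w : V) (b c : Bool), G i b = .inr w ∧ G j c = .inr w

/-- The valence of a vertex. -/
def valence (G : Graph S V E) (a : S ⊕ V) : ℕ := Nat.card {p : E × Bool // G p.1 p.2 = a}

/-- Primitive graphs: there is at least one external vertex, all external vertices have valence
one, all internal vertices have valence at least three, and the graph is internally connected. -/
structure IsPrimitive (G : Graph S V E) : Prop where
  nonempty : Nonempty S
  ext_valence : ∀ s : S, valence G (.inl s) = 1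
  int_valence : ∀ w : V, 3 ≤ valence G (.inr w)
  linked : ∀ i j : E, Linked G i j

/-- Unitrivalent trees. -/
structure IsUnitrivalentTree (G : Graph S V E) : Prop where
  isPrimitive : IsPrimitive G
  int_valence : ∀ w : V, valence G (.inr w) = 3
  tree : Nat.card E + 1 = Nat.card S + Nat.card V

/-- Change of the numbering of the vertices and edges, and of the direction of the edges. -/
def Graph.relabel (G : Graph S V E) (π : Equiv.Perm S) (τ : Equiv.Perm V) (σ : Equiv.Perm E)
    (f : E → Bool) : Graph S V E :=
  fun i b => (G (σ i) (xor b (f i))).map π τ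

/-- The effect of a change of numbering on the orientation. -/
def relabelSign (n : ℕ) [Fintype V] [DecidableEq V] [Fintype E] [DecidableEq E]
    (τ : Equiv.Perm V) (σ : Equiv.Perm E) (f : E → Bool) : ℤ :=
  if Even n then (Equiv.Perm.sign σ : ℤ)
  else (Equiv.Perm.sign τ : ℤ) * ∏ i, if f i then -1 else 1

open scoped Classical in
/-- The least edge in the internally connected component of an edge. -/
def rep [Fintype E] [LinearOrder E] (G : Graph S V E) (i : E) : E :=
  (Finset.univ.filter fun j => Linked G i j).min'
    ⟨i, Finset.mem_filter.2 ⟨Finset.mem_univ i, Relation.EqvGen.refl i⟩⟩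

section Components

variable [Fintype E] [LinearOrder E] (G : Graph S V E) (c : E)

/-- The edges of the internally connected component with least edge `c`. -/
abbrev CompE : Type := {i : E // rep G i = c}

/-- The internal vertices of this component. -/
abbrev CompV : Type := {w : V // ∃ i b, rep G i = c ∧ G i b = .inr w}

/-- The half-edges of this component which are incident to external vertices. -/
abbrev CompS : Type := {p : CompE G c × Bool // (G p.1 p.2).isLeft}

/-- The component, where each external vertex is split into univalent ones. -/
def component : Graph (CompS G c) (CompV G c) (CompE G c) := fun i b =>
  if h : (G i b).isLeft then .inl ⟨(i, b), h⟩
  else .inr ⟨(G i b).getRight (Sum.not_isLeft.1 h), i, b, i.2, by simp⟩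

/-- The external vertex to which a half-edge is incident. -/
def leg (p : CompS G c) : S := (G p.1.1 p.1.2).getLeft p.2

open scoped Classical in
/-- The sign that relates the orientation of a graph to the product of the orientations of its
internally connected components, in the order of their least edges. -/
def shuffleSign (n : ℕ) [Fintype V] [LinearOrder V] : ℤ :=
  if Even n then
    (-1) ^ (Finset.univ.filter fun p : E × E => p.1 < p.2 ∧ rep G p.2 < rep G p.1).card
  else
    (-1) ^ (Finset.univ.filter fun p : V × V => p.1 < p.2 ∧ ∃ i j b c,
      G i b = .inr p.1 ∧ G j c = .inr p.2 ∧ rep G j < rep G i).card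

end Components

section Contraction

open scoped Classical in
/-- Contraction of the edge `i` with ends `w` and `a`; the vertex `w` disappears. -/
def contract (G : Graph S V E) (i : E) (w : V) (a : S ⊕ {u : V // u ≠ w}) :
    Graph S {u : V // u ≠ w} {j : E // j ≠ i} := fun j b =>
  match G j b with
  | .inl s => .inl s
  | .inr u => if h : u ≠ w then .inr ⟨u, h⟩ else a

/-- The orientation sign for the contraction of the edge `i` with `(i, true)` incident to the
vertex `w` that disappears. -/
def contractSign (n : ℕ) [Fintype V] [LinearOrder V] [Fintype E] [LinearOrder E]
    (i : E) (w : V) : ℤ :=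
  if Even n then (-1) ^ (Finset.univ.filter fun j => j < i).card
  else (-1) ^ (Finset.univ.filter fun u => u < w).card

end Contraction
end Graphs

section HGC

variable {R : Type} [Ring R] [Algebra ℚ R] (K : CoeffAlgebra R)
variable {A : Type u} [NonUnitalRing A] [Module ℚ A] (D : DGCommAlgebra A)

/-- Functions on numbered graphs with values in `R ⊗ A_*^{⊗ k}`. -/
abbrev Series : Type u :=
  ∀ k v e : ℕ, Graph (Fin k) (Fin v) (Fin e) → Tens K D (Fin k)

/-- The degree `m` part of the completed tensor product of `R` and of the hairy graph complex: the
equivariant maps of degree `-m` (cohomologically) from oriented primitive graphs to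
`R ⊗ A^{⊗ k}`. For `R = ℚ` this is the degree `m` part of the hairy graph complex. -/
def HGC (n : ℕ) (m : ℤ) : Submodule ℚ (Series K D) where
  carrier := {x | ∀ (k v e : ℕ) (G : Graph (Fin k) (Fin v) (Fin e)),
    x k v e G ∈ Tens.part K D (Fin k) (((n : ℤ) - 1) * e - n * v - m) ∧
    (¬ IsPrimitive G → x k v e G = 0) ∧
    ∀ (π : Equiv.Perm (Fin k)) (τ : Equiv.Perm (Fin v)) (σ : Equiv.Perm (Fin e))
      (f : Fin e → Bool),
      x k v e (G.relabel π τ σ f) = relabelSign n τ σ f • Tens.rename π (x k v e G)}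
  add_mem' := by
    intro x y hx hy k v e G
    refine ⟨add_mem (hx k v e G).1 (hy k v e G).1, fun h => ?_, fun π τ σ f => ?_⟩
    · simp [(hx k v e G).2.1 h, (hy k v e G).2.1 h]
    · simp only [Pi.add_apply, (hx k v e G).2.2, (hy k v e G).2.2, map_add, smul_add]
  zero_mem' := by
    intro k v e G
    exact ⟨zero_mem _, fun _ => rfl, fun _ _ _ _ => by simp⟩
  smul_mem' := by
    intro c x hx k v e G
    refine ⟨Submodule.smul_mem _ c (hx k v e G).1, fun h => ?_, fun π τ σ f => ?_⟩
    · simp [(hx k v e G).2.1 h]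
    · simp only [Pi.smul_apply, (hx k v e G).2.2, map_smul, smul_comm c]

variable {K D}

/-- The value of an equivariant map on a graph with arbitrary sets of vertices and edges. -/
def evalOn {S V E : Type} [Fintype S] [Fintype V] [LinearOrder V] [Fintype E] [LinearOrder E]
    (G : Graph S V E) : Series K D →ₗ[ℚ] Tens K D S where
  toFun x := Tens.rename (Fintype.equivFin S).symm
    (x (Fintype.card S) (Fintype.card V) (Fintype.card E) fun i b =>
      (G (monoEquivOfFin E rfl i) b).map (Fintype.equivFin S) (monoEquivOfFin V rfl).symm)
  map_add' x y := by simp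
  map_smul' c x := by simp

open scoped Classical in
/-- The extension of a degree zero element to a morphism on all graphs without isolated external
vertices which is compatible with products of graphs and with fusion of external vertices. -/
def extend (n : ℕ) (x : Series K D) {S V E : Type} [Fintype V] [LinearOrder V]
    [Fintype E] [LinearOrder E] (G : Graph S V E) : Tens K D S :=
  shuffleSign G n • (((Finset.univ.image (rep G)).sort (· ≤ ·)).map fun c =>
    Tens.rename (leg G c) (evalOn (component G c) x)).prod

open scoped Classical in
/-- The summand of `F (d G)` given by the contraction of the edge `i`, where `F` is the extension
of `x`. Tadpoles and edges between external vertices are not contracted. -/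
def contractTerm (n : ℕ) (x : Series K D) {S V E : Type} [Fintype V] [LinearOrder V]
    [Fintype E] [LinearOrder E] (G : Graph S V E) (i : E) : Tens K D S :=
  match G i false, G i true with
  | .inl _, .inl _ => 0
  | .inl s, .inr w => contractSign n i w • extend n x (contract G i w (.inl s))
  | .inr w, .inl s =>
      (if Even n then 1 else -1 : ℤ) • contractSign n i w •
        extend n x (contract G i w (.inl s))
  | .inr u, .inr w =>
      if h : u ≠ w then contractSign n i w • extend n x (contract G i w (.inr ⟨u, h⟩)) else 0

/-- The curvature `∑ ℓ_k(x, …, x) / k!` of an element `x` of degree zero, evaluated on a graph: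
this is `d (F G) - F (d G)`, where `F` is the extension of `x`. -/
def curvature (n : ℕ) (x : Series K D) (k v e : ℕ) (G : Graph (Fin k) (Fin v) (Fin e)) :
    Tens K D (Fin k) :=
  Tens.d (x k v e G) - ∑ i, contractTerm n x G i

open scoped Classical in
/-- The value of the vertex splitting differential of `y` on a graph (up to a global sign): the sum
of the values of `y` on the graphs obtained by contracting an edge between internal vertices. -/
def splitting (n : ℕ) (k v e : ℕ) (G : Graph (Fin k) (Fin v) (Fin e)) :
    Series K D →ₗ[ℚ] Tens K D (Fin k) :=
  ∑ i, match G i false, G i true with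
    | .inr u, .inr w =>
        if h : u ≠ w then contractSign n i w • evalOn (contract G i w (.inr ⟨u, h⟩)) else 0
    | _, _ => 0


/-- The subspace of degree `m` by which one divides to obtain unitrivalent trees: it is spanned by
the graphs which are not unitrivalent trees, and by the `IHX` relations, i.e. the images under the
splitting differential of trees whose internal vertices are trivalent, except for one of valence
four. (If `G` is a unitrivalent tree, then `splitting` only evaluates `y` on such trees.) -/
def ihx (K : CoeffAlgebra R) (D : DGCommAlgebra A) (n : ℕ) (m : ℤ) : Submodule ℚ (Series K D) where
  carrier := {x | ∃ y ∈ HGC K D n (m + 1), ∀ (k v e : ℕ) (G : Graph (Fin k) (Fin v) (Fin e)),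
    IsUnitrivalentTree G → x k v e G = splitting n k v e G y}
  add_mem' := by
    rintro x x' ⟨y, hy, h⟩ ⟨y', hy', h'⟩
    refine ⟨y + y', add_mem hy hy', fun k v e G hG => ?_⟩
    simp [h k v e G hG, h' k v e G hG]
  zero_mem' := ⟨0, zero_mem _, fun k v e G _ => by simp⟩
  smul_mem' := by
    rintro c x ⟨y, hy, h⟩
    refine ⟨c • y, Submodule.smul_mem _ c hy, fun k v e G hG => ?_⟩
    simp [h k v e G hG]

variable (K D)

/-- The degree `m` part of the completed tensor product of `R` and of the space of unitrivalent
trees modulo `IHX`. -/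
abbrev UTT (n : ℕ) (m : ℤ) : Type u := HGC K D n m ⧸ (ihx K D n m).submoduleOf (HGC K D n m)

/-- The Maurer--Cartan elements of `R ⊗ HGC`. -/
def MCHGC (n : ℕ) : Set (HGC K D n 0) :=
  {x | ∀ (k v e : ℕ) (G : Graph (Fin k) (Fin v) (Fin e)), IsPrimitive G →
    curvature n x.1 k v e G = 0}

/-- The Maurer--Cartan elements of `R ⊗ UTT`, with respect to the structure inherited from
`R ⊗ HGC`: the curvature of the class of `x` is the class of the curvature of `x`, which does not
depend on the choice of `x`. -/
def MCUTT (n : ℕ) : Set (UTT K D n 0) :=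
  {ξ | ∃ x : HGC K D n 0, Submodule.Quotient.mk x = ξ ∧ curvature n x.1 ∈ ihx K D n (-1)}

variable {K D}

/-- The quotient map on Maurer--Cartan elements. -/
def MCHGC.toUTT {n : ℕ} (x : MCHGC K D n) : MCUTT K D n :=
  ⟨Submodule.Quotient.mk x.1, x.1, rfl, 0, zero_mem _, fun k v e G hG => by
    simpa using x.2 k v e G hG.isPrimitive⟩

variable {R' : Type} [Ring R'] [Algebra ℚ R'] {K' : CoeffAlgebra R'} (φ : CoeffHom K K')

/-- Extension of scalars for functions on graphs. -/
def Series.map : Series K D →ₗ[ℚ] Series K' D where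
  toFun x k v e G := Tens.baseChange φ (x k v e G)
  map_add' x y := by ext; simp
  map_smul' c x := by ext; simp

theorem map_mem_HGC {n : ℕ} {m : ℤ} {x : Series K D} (hx : x ∈ HGC K D n m) :
    Series.map φ x ∈ HGC K' D n m := by
  intro k v e G
  refine ⟨Tens.baseChange_mem_part φ (hx k v e G).1, fun h => ?_, fun π τ σ f => ?_⟩
  · simp [Series.map, (hx k v e G).2.1 h]
  · simp only [Series.map, LinearMap.coe_mk, AddHom.coe_mk, (hx k v e G).2.2, map_zsmul,
      Tens.baseChange_rename]

theorem evalOn_map {S V E : Type} [Fintype S] [Fintype V] [LinearOrder V] [Fintype E]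
    [LinearOrder E] (G : Graph S V E) (x : Series K D) :
    evalOn G (Series.map φ x) = Tens.baseChange φ (evalOn G x) := by
  simp [evalOn, Series.map, Tens.baseChange_rename]

theorem splitting_map (n k v e : ℕ) (G : Graph (Fin k) (Fin v) (Fin e)) (x : Series K D) :
    splitting n k v e G (Series.map φ x) = Tens.baseChange φ (splitting n k v e G x) := by
  simp only [splitting, LinearMap.sum_apply, map_sum]
  refine Finset.sum_congr rfl fun i _ => ?_
  split
  · split_ifs
    · simp only [LinearMap.smul_apply, evalOn_map, map_zsmul]
    · simp
  · simp

theorem map_mem_ihx {n : ℕ} {m : ℤ} {x : Series K D} (hx : x ∈ ihx K D n m) :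
    Series.map φ x ∈ ihx K' D n m := by
  obtain ⟨y, hy, h⟩ := hx
  refine ⟨Series.map φ y, map_mem_HGC φ hy, fun k v e G hG => ?_⟩
  rw [splitting_map, ← h k v e G hG]
  rfl

/-- Extension of scalars for hairy graphs. -/
def HGC.map (n : ℕ) (m : ℤ) : HGC K D n m →ₗ[ℚ] HGC K' D n m :=
  (Series.map φ).restrict fun _ h => map_mem_HGC φ h

/-- Extension of scalars for unitrivalent trees. -/
def UTT.map (n : ℕ) (m : ℤ) : UTT K D n m →ₗ[ℚ] UTT K' D n m :=
  Submodule.mapQ _ _ (HGC.map φ n m) fun _ h => map_mem_ihx φ h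

end HGC

section Simplices

theorem isInternal_of_isCompl {M : Type*} [AddCommGroup M] [Module ℚ M] {P Q : Submodule ℚ M}
    (h : IsCompl P Q) :
    DirectSum.IsInternal fun i : ℤ => if i = 0 then P else if i = 1 then Q else ⊥ := by
  rw [DirectSum.isInternal_submodule_iff_iSupIndep_and_iSup_eq_top]
  constructor
  · intro i
    by_cases h0 : i = 0
    · subst h0
      refine h.disjoint.mono (by simp) (iSup₂_le fun j hj => ?_)
      simp only [if_neg hj]
      split_ifs <;> simp
    · by_cases h1 : i = 1
      · subst h1
        refine h.disjoint.symm.mono (by simp) (iSup₂_le fun j hj => ?_)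
        simp only [if_neg hj]
        split_ifs <;> simp
      · simp [h0, h1]
  · rw [eq_top_iff, ← h.sup_eq_top]
    refine sup_le ?_ ?_
    · exact le_iSup_of_le 0 (by simp)
    · exact le_iSup_of_le 1 (by simp)

/-- The base field as a coefficient algebra. -/
def ratCoeff : CoeffAlgebra ℚ where
  gr i := if i = 0 then ⊤ else ⊥
  isInternal := by
    simpa using isInternal_of_isCompl (isCompl_top_bot (α := Submodule ℚ ℚ))
  mul_mem := by
    intro i j a b ha hb
    by_cases hi : i = 0 <;> by_cases hj : j = 0 <;> simp_all
  graded_comm := by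
    intro i j a b ha hb
    by_cases hi : i = 0 <;> by_cases hj : j = 0 <;> simp_all [mul_comm]
  d := 0
  d_mem := by simp
  leibniz := by simp
  d_d := by simp
  one_mem := by simp

open Polynomial

/-- The algebra `Ω^*(Δ^1) = ℚ[t] ⊕ ℚ[t] dt` of polynomial differential forms on the interval; the
pair `(p, q)` stands for `p + q dt`. -/
abbrev Forms : Type := TrivSqZeroExt ℚ[X] ℚ[X]

/-- The form `p + q dt` has degree zero if `q = 0` and degree one if `p = 0`. -/
def formsGr (i : ℤ) : Submodule ℚ Forms :=
  if i = 0 then LinearMap.ker ((TrivSqZeroExt.sndHom ℚ[X] ℚ[X]).restrictScalars ℚ)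
    else if i = 1 then LinearMap.ker (TrivSqZeroExt.fstHom ℚ ℚ[X] ℚ[X]).toLinearMap
    else ⊥

theorem mem_formsGr {i : ℤ} {a : Forms} :
    a ∈ formsGr i ↔ (i = 0 ∧ a.snd = 0) ∨ (i = 1 ∧ a.fst = 0) ∨ a = 0 := by
  unfold formsGr
  split_ifs with h0 h1
  · subst h0; simp 
    rintro rfl; simp
  · subst h1; simp
    rintro rfl; simp
  · simp [h0, h1]

/-- The differential `p + q dt ↦ p' dt`. -/
def formsD : Forms →ₗ[ℚ] Forms where
  toFun a := TrivSqZeroExt.inr (derivative a.fst)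
  map_add' a b := by simp [add_smul]
  map_smul' c a := by ext <;> simp

/-- The differential graded algebra structure of the polynomial differential forms. -/
def intervalCoeff : CoeffAlgebra Forms where
  gr := formsGr
  isInternal := by
    refine isInternal_of_isCompl ⟨?_, ?_⟩
    · rw [Submodule.disjoint_def]
      intro x hx hy
      exact TrivSqZeroExt.ext (by simpa using hy) (by simpa using hx)
    · rw [codisjoint_iff, eq_top_iff]
      intro x _
      rw [← TrivSqZeroExt.inl_fst_add_inr_snd_eq x]
      exact Submodule.add_mem_sup (by simp) (by simp)
  mul_mem := by
    intro i j a b ha hb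
    rw [mem_formsGr] at *
    rcases ha with ⟨rfl, ha⟩ | ⟨rfl, ha⟩ | rfl
    · rcases hb with ⟨rfl, hb⟩ | ⟨rfl, hb⟩ | rfl
      · exact .inl ⟨rfl, by simp [ha, hb]⟩
      · exact .inr (.inl ⟨rfl, by simp [hb]⟩)
      · simp
    · rcases hb with ⟨rfl, hb⟩ | ⟨rfl, hb⟩ | rfl
      · exact .inr (.inl ⟨rfl, by simp [ha]⟩)
      · exact .inr (.inr (by ext <;> simp [ha, hb]))
      · simp
    · simp
  graded_comm := by
    intro i j a b ha hb
    rw [mem_formsGr] at *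
    rcases ha with ⟨rfl, ha⟩ | ⟨rfl, ha⟩ | rfl
    · simp [mul_comm]
    · rcases hb with ⟨rfl, hb⟩ | ⟨rfl, hb⟩ | rfl
      · simp [mul_comm]
      · ext <;> simp [ha, hb]
      · simp
    · simp
  d := formsD
  d_mem := by
    intro i a ha
    rw [mem_formsGr] at *
    rcases ha with ⟨rfl, ha⟩ | ⟨rfl, ha⟩ | rfl
    · exact .inr (.inl ⟨rfl, by simp [formsD]⟩)
    · exact .inr (.inr (by simp [formsD, ha]))
    · simp
  leibniz := by
    intro i a b ha
    rw [mem_formsGr] at *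
    rcases ha with ⟨rfl, ha⟩ | ⟨rfl, ha⟩ | rfl
    · ext
      · simp [formsD]
      · simp [formsD, derivative_mul, mul_comm, add_comm]
    · ext
      · simp [formsD]
      · simp [formsD, ha]
    · simp
  d_d := by simp [formsD]
  one_mem := mem_formsGr.2 (.inl ⟨rfl, TrivSqZeroExt.snd_one⟩)

/-- Evaluation of forms at the point `t` of the interval. -/
def evalForms (t : ℚ) : CoeffHom intervalCoeff ratCoeff where
  toAlgHom := (Polynomial.aeval t).comp (TrivSqZeroExt.fstHom ℚ ℚ[X] ℚ[X])
  map_mem := by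
    intro i r hr
    rcases mem_formsGr.1 hr with ⟨rfl, h⟩ | ⟨rfl, h⟩ | rfl
    · simp [ratCoeff]
    · simp [ratCoeff, h]
    · simp
  map_d := by
    intro r
    simp [intervalCoeff, ratCoeff, formsD]

variable {A : Type u} [NonUnitalRing A] [Module ℚ A] (D : DGCommAlgebra A) (n : ℕ)

/-- Two Maurer--Cartan elements of the hairy graph complex are joined by a `1`-simplex, that is, by
a Maurer--Cartan element with coefficients in the forms on the interval. -/
def gaugeHGC (x y : MCHGC ratCoeff D n) : Prop :=
  ∃ z ∈ MCHGC intervalCoeff D n,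
    HGC.map (evalForms 0) n 0 z = x ∧ HGC.map (evalForms 1) n 0 z = y

/-- Two Maurer--Cartan elements of the complex of unitrivalent trees are joined by a `1`-simplex. -/
def gaugeUTT (x y : MCUTT ratCoeff D n) : Prop :=
  ∃ z ∈ MCUTT intervalCoeff D n,
    UTT.map (evalForms 0) n 0 z = x ∧ UTT.map (evalForms 1) n 0 z = y

/-- Gauge equivalence classes of Maurer--Cartan elements of the hairy graph complex. -/
def GaugeClassesHGC : Type u := Quot (gaugeHGC D n)

/-- Gauge equivalence classes of Maurer--Cartan elements of the complex of unitrivalent trees. -/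
def GaugeClassesUTT : Type u := Quot (gaugeUTT D n)

/-- The map on gauge equivalence classes induced by the quotient map. -/
def gaugeClassesMap : GaugeClassesHGC D n → GaugeClassesUTT D n :=
  Quot.map MCHGC.toUTT (by
    rintro x y ⟨z, hz, hx, hy⟩
    exact ⟨_, (MCHGC.toUTT ⟨z, hz⟩).2, congrArg Submodule.Quotient.mk hx,
      congrArg Submodule.Quotient.mk hy⟩)

end Simplices
end HairyGraphs

end

noncomputable section
namespace HairyGraphs
universe u
set_option linter.unusedSectionVars false

namespace Tens

variable {R : Type} [Ring R] [Algebra ℚ R] {K : CoeffAlgebra R}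
variable {A : Type u} [NonUnitalRing A] [Module ℚ A] {D : DGCommAlgebra A}
variable {S T : Type}

theorem induction {p : Tens K D S → Prop} (hg : ∀ g, p (gen g)) (h1 : ∀ c : ℚ, p (algebraMap ℚ _ c))
    (hadd : ∀ x y, p x → p y → p (x + y)) (hmul : ∀ x y, p x → p y → p (x * y)) (x : Tens K D S) :
    p x := by
  obtain ⟨y, rfl⟩ : ∃ y, mk K D S y = x := RingQuot.mkAlgHom_surjective ℚ (Rel K D S) x
  induction y using FreeAlgebra.induction with
  | grade0 r => simpa using h1 r
  | grade1 x => exact hg x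
  | mul a b ha hb => simpa using hmul _ _ ha hb
  | add a b ha hb => simpa using hadd _ _ ha hb

theorem gen_base (i : ℤ) (r : K.gr i) : (gen (.base i r) : Tens K D S) = base K D S i r := rfl

theorem gen_lab (s : S) (i : ℤ) (a : D.gr i) : (gen (.lab s i a) : Tens K D S) = lab K D s i a := rfl

/-- The parity automorphism. -/
def theta : Tens K D S →ₐ[ℚ] Tens K D S :=
  lift (fun i => (-1 : ℚ) ^ i • base K D S i) (fun s i => (-1 : ℚ) ^ i • lab K D s i)
    (by simp [base_one])
    (by intro i j r r'; simp [base_mul, smul_smul, sign_mul, mul_comm])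
    (by intro s i j r r'; simp [lab_mul, smul_smul, sign_mul, mul_comm])
    (by intro s i j r a; simp [base_lab, smul_smul]; congr 1; ring)
    (by intro s t i j r a; simp [lab_lab s t r a, smul_smul]; congr 1; ring)

theorem theta_gen (g : Gen K D S) : theta (gen g) = (-1 : ℚ) ^ (g.deg K D) • gen g := by
  cases g <;> simp only [theta, lift_gen, Gen.deg] <;> rfl

theorem dHom_gen_base (i : ℤ) (r : K.gr i) : (dHom (gen (.base i r) : Tens K D S)) =
    triang i (base K D S i) (base K D S (i + 1) ∘ₗ K.dGr i) r := by
  simp only [dHom, lift_gen]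

theorem dHom_gen_lab (s : S) (i : ℤ) (r : D.gr i) : (dHom (gen (.lab s i r) : Tens K D S)) =
    triang i (lab K D s i) (lab K D s (i + 1) ∘ₗ D.dGr i) r := by
  simp only [dHom, lift_gen]

theorem dHom_apply (x : Tens K D S) : dHom x = !![theta x, d x; 0, x] := by
  suffices h : dHom x 0 0 = theta x ∧ dHom x 1 0 = 0 ∧ dHom x 1 1 = x by
    ext p q
    fin_cases p <;> fin_cases q
    · exact h.1
    · simp [d]
    · exact h.2.1
    · exact h.2.2
  induction x using induction with
  | hg g =>
    cases g with
    | base i r => rw [dHom_gen_base, theta_gen]; simp [triang, Gen.deg, gen_base]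
    | lab s i r => rw [dHom_gen_lab, theta_gen]; simp [triang, Gen.deg, gen_lab]
  | h1 c =>
    rw [AlgHom.commutes, AlgHom.commutes, Matrix.algebraMap_eq_diagonal]
    simp
  | hadd x y hx hy => simp [hx, hy]
  | hmul x y hx hy => simp [Matrix.mul_apply, hx, hy]

theorem d_mul (x y : Tens K D S) : d (x * y) = theta x * d y + d x * y := by
  have h : dHom (x * y) 0 1 = (dHom x * dHom y) 0 1 := by rw [map_mul]
  rw [dHom_apply, dHom_apply, dHom_apply] at h
  simpa [Matrix.mul_apply] using h

theorem d_gen_base (i : ℤ) (r : K.gr i) :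
    d (gen (.base i r) : Tens K D S) = base K D S (i + 1) (K.dGr i r) := by
  simp [d, dHom_gen_base, triang]

theorem d_gen_lab (s : S) (i : ℤ) (r : D.gr i) :
    d (gen (.lab s i r) : Tens K D S) = lab K D s (i + 1) (D.dGr i r) := by
  simp [d, dHom_gen_lab, triang]

theorem d_algebraMap (c : ℚ) : d (algebraMap ℚ (Tens K D S) c) = 0 := by
  have h : dHom (algebraMap ℚ (Tens K D S) c) 0 1 = 0 := by
    rw [AlgHom.commutes, Matrix.algebraMap_eq_diagonal]; simp
  exact h

theorem d_one : d (1 : Tens K D S) = 0 := by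
  simpa using d_algebraMap (K := K) (D := D) (S := S) 1

theorem theta_theta (x : Tens K D S) : theta (theta x) = x := by
  have : (theta.comp theta : Tens K D S →ₐ[ℚ] Tens K D S) = AlgHom.id ℚ _ := by
    refine hom_ext fun g => ?_
    simp [theta_gen, smul_smul, sign_sq]
  exact DFunLike.congr_fun this x

theorem theta_d (x : Tens K D S) : theta (d x) = - d (theta x) := by
  induction x using induction with
  | hg g =>
    cases g with
    | base i r =>
      rw [theta_gen, map_smul, d_gen_base, ← gen_base, theta_gen]
      simp [Gen.deg, sign_mul]
    | lab s i r =>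
      rw [theta_gen, map_smul, d_gen_lab, ← gen_lab, theta_gen]
      simp [Gen.deg, sign_mul]
  | h1 c => simp [d_algebraMap]
  | hadd x y hx hy => simp [hx, hy]; abel
  | hmul x y hx hy => simp [d_mul, hx, hy]; abel

theorem d_d (x : Tens K D S) : d (d x) = 0 := by
  induction x using induction with
  | hg g =>
    cases g with
    | base i r =>
      rw [d_gen_base, ← gen_base, d_gen_base]
      have : K.dGr (i + 1) (K.dGr i r) = 0 := Subtype.ext (K.d_d _)
      rw [this, map_zero]
    | lab s i r =>
      rw [d_gen_lab, ← gen_lab, d_gen_lab]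
      have : D.dGr (i + 1) (D.dGr i r) = 0 := Subtype.ext (D.d_d _)
      rw [this, map_zero]
  | h1 c => simp [d_algebraMap]
  | hadd x y hx hy => simp [hx, hy]
  | hmul x y hx hy => simp [d_mul, hx, hy, theta_d, theta_theta]

theorem theta_rename (f : S → T) (x : Tens K D S) : theta (rename f x) = rename f (theta x) := by
  have : theta.comp (rename f) = (rename f).comp (theta : Tens K D S →ₐ[ℚ] Tens K D S) := by
    refine hom_ext fun g => ?_
    cases g <;> simp [theta_gen, rename_gen_base, rename_gen_lab, Gen.deg]
  exact DFunLike.congr_fun this x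

theorem d_rename (f : S → T) (x : Tens K D S) : d (rename f x) = rename f (d x) := by
  induction x using induction with
  | hg g =>
    cases g with
    | base i r => rw [rename_gen_base, d_gen_base, d_gen_base, ← gen_base, ← gen_base, rename_gen_base]
    | lab s i r => rw [rename_gen_lab, d_gen_lab, d_gen_lab, ← gen_lab, ← gen_lab, rename_gen_lab]
  | h1 c => simp [d_algebraMap]
  | hadd x y hx hy => simp [hx, hy]
  | hmul x y hx hy => simp [d_mul, hx, hy, theta_rename]

theorem rename_rename {U : Type} (f : S → T) (g : T → U) (x : Tens K D S) :
    rename g (rename f x) = rename (g ∘ f) x := by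
  have : (rename g).comp (rename f) = (rename (g ∘ f) : Tens K D S →ₐ[ℚ] Tens K D U) := by
    refine hom_ext fun x => ?_
    cases x <;> simp [rename_gen_base, rename_gen_lab]
  exact DFunLike.congr_fun this x

theorem rename_id (x : Tens K D S) : rename id x = x := by
  have : rename id = AlgHom.id ℚ (Tens K D S) := by
    refine hom_ext fun x => ?_
    cases x <;> simp [rename_gen_base, rename_gen_lab]
  exact DFunLike.congr_fun this x

section

variable {R' : Type} [Ring R'] [Algebra ℚ R'] {K' : CoeffAlgebra R'} (φ : CoeffHom K K')

theorem theta_baseChange (x : Tens K D S) : theta (baseChange φ x) = baseChange φ (theta x) := by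
  have : theta.comp (baseChange φ) = (baseChange φ).comp (theta : Tens K D S →ₐ[ℚ] Tens K D S) := by
    refine hom_ext fun g => ?_
    cases g <;> simp [theta_gen, baseChange_gen, Gen.deg, Gen.map]
  exact DFunLike.congr_fun this x

theorem d_baseChange (x : Tens K D S) : d (baseChange φ x) = baseChange φ (d x) := by
  induction x using induction with
  | hg g =>
    cases g with
    | base i r =>
      rw [baseChange_gen, d_gen_base, ← gen_base, baseChange_gen, Gen.map, Gen.map, d_gen_base, ← gen_base]
      congr 2
      exact Subtype.ext (φ.map_d r).symm
    | lab s i r =>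
      rw [baseChange_gen, d_gen_lab, ← gen_lab, baseChange_gen, Gen.map, Gen.map, d_gen_lab, ← gen_lab]
  | h1 c => simp [d_algebraMap]
  | hadd x y hx hy => simp [hx, hy]
  | hmul x y hx hy => simp [d_mul, hx, hy, theta_baseChange]

end

variable (K D) in
/-- The span of the products of homogeneous generators of total degree `m` in which each tensor
factor with index in `U` occurs. -/
def hd (m : ℤ) (U : Set S) : Submodule ℚ (Tens K D S) :=
  Submodule.span ℚ {b | ∃ w : List (Gen K D S), (w.map (Gen.deg K D)).sum = m ∧
    (∀ s ∈ U, ∃ i a, Gen.lab s i a ∈ w) ∧ b = (w.map gen).prod}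

theorem part_eq_hd (m : ℤ) : part K D S m = hd K D m Set.univ := by
  simp [part, hd]

theorem hd_mono {m : ℤ} {U U' : Set S} (h : U ⊆ U') : hd K D m U' ≤ hd K D m U :=
  Submodule.span_mono fun _ ⟨w, h1, h2, h3⟩ => ⟨w, h1, fun s hs => h2 s (h hs), h3⟩

theorem one_mem_hd : (1 : Tens K D S) ∈ hd K D 0 ∅ :=
  Submodule.subset_span ⟨[], by simp⟩

theorem gen_mem_hd (g : Gen K D S) : gen g ∈ hd K D (g.deg K D) (∅ : Set S) :=
  Submodule.subset_span ⟨[g], by simp⟩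

theorem hd_mul {m m' : ℤ} {U U' : Set S} {x y : Tens K D S} (hx : x ∈ hd K D m U)
    (hy : y ∈ hd K D m' U') : x * y ∈ hd K D (m + m') (U ∪ U') := by
  have := Submodule.mul_mem_mul hx hy
  rw [hd, hd, Submodule.span_mul_span] at this
  refine Submodule.span_mono ?_ this
  rintro _ ⟨_, ⟨w, h1, h2, rfl⟩, _, ⟨w', h1', h2', rfl⟩, rfl⟩
  refine ⟨w ++ w', by simp [h1, h1'], ?_, by simp⟩
  rintro s (hs | hs)
  · obtain ⟨i, a, h⟩ := h2 s hs
    exact ⟨i, a, by simp [h]⟩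
  · obtain ⟨i, a, h⟩ := h2' s hs
    exact ⟨i, a, by simp [h]⟩

theorem rename_gen (f : S → T) (g : Gen K D S) : ∃ g' : Gen K D T, rename f (gen g) = gen g' ∧
    g'.deg K D = g.deg K D ∧ ∀ s i a, g = .lab s i a → g' = .lab (f s) i a := by
  cases g with
  | base i r => exact ⟨.base i r, rename_gen_base .., rfl, by simp⟩
  | lab s i a =>
    refine ⟨.lab (f s) i a, rename_gen_lab .., rfl, ?_⟩
    rintro s' i' a' h
    cases h
    rfl

theorem rename_mem_hd (f : S → T) {m : ℤ} {U : Set S} {x : Tens K D S} (hx : x ∈ hd K D m U) :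
    rename f x ∈ hd K D m (f '' U) := by
  refine Submodule.span_induction (p := fun b _ => rename f b ∈ hd K D m (f '' U)) ?_ (by simp)
    (fun x y _ _ hx hy => by simpa using add_mem hx hy)
    (fun c x _ hx => by simpa using Submodule.smul_mem _ c hx) hx
  rintro _ ⟨w, h1, h2, rfl⟩
  choose g' hg hd' hl using rename_gen (K := K) (D := D) f
  refine Submodule.subset_span ⟨w.map g', ?_, ?_, ?_⟩
  · rw [← h1, List.map_map]
    congr 1
    exact List.map_congr_left fun g _ => hd' g
  · rintro _ ⟨s, hs, rfl⟩
    obtain ⟨i, a, h⟩ := h2 s hs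
    exact ⟨i, a, List.mem_map.2 ⟨_, h, hl _ _ _ _ rfl⟩⟩
  · rw [map_list_prod, List.map_map, List.map_map]
    congr 1
    exact List.map_congr_left fun g _ => hg g

theorem theta_of_mem {m : ℤ} {U : Set S} {x : Tens K D S} (hx : x ∈ hd K D m U) :
    theta x = (-1 : ℚ) ^ m • x := by
  refine Submodule.span_induction (p := fun b _ => theta b = (-1 : ℚ) ^ m • b) ?_ (by simp)
    (fun x y _ _ hx hy => by simp [hx, hy])
    (fun c x _ hx => by rw [map_smul, hx, smul_comm]) hx
  rintro _ ⟨w, rfl, -, rfl⟩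
  clear hx
  induction w with
  | nil => simp
  | cons g w ih => simp [theta_gen, ih, smul_smul, sign_mul, mul_comm]

theorem gen_comm (g g' : Gen K D S) :
    gen g * gen g' = (-1 : ℚ) ^ (g.deg K D * g'.deg K D) • (gen g' * gen g) := by
  cases g with
  | base i r =>
    cases g' with
    | base j r' =>
      simp only [gen_base, Gen.deg]
      rw [← base_mul, ← base_mul]
      have h2 : (r' * r : R) ∈ K.gr (i + j) := by
        rw [add_comm]; exact K.mul_mem r'.2 r.2
      have : (⟨r * r', K.mul_mem r.2 r'.2⟩ : K.gr (i + j)) = (-1 : ℚ) ^ (i * j) • ⟨r' * r, h2⟩ :=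
        Subtype.ext (K.graded_comm r.2 r'.2)
      rw [this, map_smul]
      congr 1
      exact base_cast (add_comm _ _) _ _ rfl
    | lab t j a => exact base_lab t r a
  | lab s i a =>
    cases g' with
    | base j r' =>
      simp only [gen_base, gen_lab, Gen.deg]
      rw [base_lab, smul_smul, mul_comm j i, sign_sq, one_smul]
    | lab t j a' => exact lab_lab s t a a'

theorem hd_comm {m m' : ℤ} {U U' : Set S} {x y : Tens K D S} (hx : x ∈ hd K D m U)
    (hy : y ∈ hd K D m' U') : x * y = (-1 : ℚ) ^ (m * m') • (y * x) := by
  have key (g : Gen K D S) (w : List (Gen K D S)) : gen g * (w.map gen).prod =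
      (-1 : ℚ) ^ (g.deg K D * (w.map (Gen.deg K D)).sum) • ((w.map gen).prod * gen g) := by
    induction w with
    | nil => simp
    | cons g' w ih =>
      simp only [List.map_cons, List.prod_cons, List.sum_cons]
      rw [← mul_assoc, gen_comm g g', smul_mul_assoc, mul_assoc, ih, mul_smul_comm, smul_smul,
        ← sign_mul, mul_add, mul_assoc]
  refine Submodule.span_induction (p := fun x _ => x * y = (-1 : ℚ) ^ (m * m') • (y * x)) ?_ (by simp)
    (fun x y _ _ hx hy => by simp [add_mul, mul_add, hx, hy])
    (fun c x _ hx => by simp [hx, smul_comm c]) hx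
  rintro _ ⟨w, rfl, -, rfl⟩
  refine Submodule.span_induction (p := fun y _ => _ * y = (-1 : ℚ) ^ (_ * m') • (y * _)) ?_ (by simp)
    (fun x y _ _ hx hy => by simp [add_mul, mul_add, hx, hy])
    (fun c x _ hx => by simp [hx, smul_comm c]) hy
  rintro _ ⟨w', rfl, -, rfl⟩
  clear hx
  induction w with
  | nil => simp
  | cons g w ih =>
    simp only [List.map_cons, List.prod_cons, List.sum_cons]
    rw [mul_assoc, ih, mul_smul_comm, ← mul_assoc, key, smul_mul_assoc, smul_smul, ← sign_mul,
      mul_assoc]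
    congr 2
    ring

theorem base_mem_hd (i : ℤ) (r : K.gr i) : base K D S i r ∈ hd K D i (∅ : Set S) :=
  gen_mem_hd (.base i r)

theorem lab_mem_hd (s : S) (i : ℤ) (a : D.gr i) : lab K D s i a ∈ hd K D i ({s} : Set S) :=
  Submodule.subset_span ⟨[.lab s i a], by simp [Gen.deg], by simp, by simp [gen_lab]⟩

theorem gen_mem_hd' (g : Gen K D S) :
    gen g ∈ hd K D (g.deg K D) {s : S | ∃ i a, Gen.lab s i a = g} := by
  cases g with
  | base i r => exact hd_mono (by simp) (base_mem_hd i r)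
  | lab s i a =>
    refine hd_mono ?_ (lab_mem_hd s i a)
    rintro t ⟨j, b, h⟩
    cases h
    rfl

theorem d_mem_hd {m : ℤ} {U : Set S} {x : Tens K D S} (hx : x ∈ hd K D m U) :
    d x ∈ hd K D (m + 1) U := by
  refine Submodule.span_induction (p := fun b _ => d b ∈ hd K D (m + 1) U) ?_ (by simp)
    (fun x y _ _ hx hy => by simpa using add_mem hx hy)
    (fun c x _ hx => by simpa using Submodule.smul_mem _ c hx) hx
  rintro _ ⟨w, rfl, h2, rfl⟩
  have key : ∀ w : List (Gen K D S), d (w.map gen).prod ∈ hd K D ((w.map (Gen.deg K D)).sum + 1)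
      {s | ∃ i a, Gen.lab s i a ∈ w} := by
    intro w
    induction w with
    | nil => simp [d_one]
    | cons g w ih =>
      simp only [List.map_cons, List.prod_cons, List.sum_cons, d_mul]
      have e : {s | ∃ i a, Gen.lab s i a ∈ g :: w} ⊆
          {s | ∃ i a, Gen.lab s i a = g} ∪ {s | ∃ i a, Gen.lab s i a ∈ w} := by
        rintro s ⟨i, a, h⟩
        rcases List.mem_cons.1 h with h | h
        · exact .inl ⟨i, a, h⟩
        · exact .inr ⟨i, a, h⟩
      refine hd_mono e (add_mem ?_ ?_)
      · rw [theta_gen, add_assoc]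
        rw [smul_mul_assoc]
        exact Submodule.smul_mem _ _ (hd_mul (gen_mem_hd' g) ih)
      · have h1 : d (gen g) ∈ hd K D (g.deg K D + 1) {s | ∃ i a, Gen.lab s i a = g} := by
          cases g with
          | base i r =>
            rw [d_gen_base]
            exact hd_mono (by simp) (base_mem_hd _ _)
          | lab s i a =>
            rw [d_gen_lab]
            refine hd_mono ?_ (lab_mem_hd _ _ _)
            rintro t ⟨j, b, h⟩
            cases h
            rfl
        have h2 : (w.map gen).prod ∈ hd K D (w.map (Gen.deg K D)).sum
            {s | ∃ i a, Gen.lab s i a ∈ w} :=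
          Submodule.subset_span ⟨w, rfl, fun s hs => hs, rfl⟩
        have := hd_mul h1 h2
        rwa [add_right_comm] at this
  exact hd_mono (fun s hs => h2 s hs) (key w)

theorem d_mul_of_mem {m : ℤ} {U : Set S} {x : Tens K D S} (hx : x ∈ hd K D m U) (y : Tens K D S) :
    d (x * y) = (-1 : ℚ) ^ m • (x * d y) + d x * y := by
  rw [d_mul, theta_of_mem hx, smul_mul_assoc]

/-- Products of one coefficient and one homogeneous element for each label in a list. -/
def normalForms (m : ℤ) (l : List S) : Submodule ℚ (Tens K D S) :=
  Submodule.span ℚ {b | ∃ (i : ℤ) (r : K.gr i) (w : List (Σ (_ : S) (j : ℤ), D.gr j)),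
    w.map (·.1) = l ∧ i + (w.map (·.2.1)).sum = m ∧
    b = base K D S i r * (w.map fun p => lab K D p.1 p.2.1 p.2.2).prod}

theorem gen_mul_labs (s : S) (j : ℤ) (a : D.gr j) (w : List (Σ (_ : S) (j : ℤ), D.gr j))
    (hs : s ∈ w.map (·.1)) : ∃ (c : ℚ) (w' : List (Σ (_ : S) (j : ℤ), D.gr j)),
      w'.map (·.1) = w.map (·.1) ∧ (w'.map (·.2.1)).sum = j + (w.map (·.2.1)).sum ∧
      lab K D s j a * (w.map fun p => lab K D p.1 p.2.1 p.2.2).prod =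
        c • (w'.map fun p => lab K D p.1 p.2.1 p.2.2).prod := by
  induction w with
  | nil => simp at hs
  | cons p w ih =>
    obtain ⟨t, i, b⟩ := p
    by_cases h : s = t
    · subst h
      refine ⟨1, ⟨s, j + i, ⟨_, D.mul_mem a.2 b.2⟩⟩ :: w, by simp, by simp [add_assoc], ?_⟩
      simp only [List.map_cons, List.prod_cons, one_smul]
      rw [lab_mul, mul_assoc]
    · obtain ⟨c, w', h1, h2, h3⟩ := ih (by simpa [h] using hs)
      refine ⟨(-1) ^ (j * i) * c, ⟨t, i, b⟩ :: w', by simp [h1], by simp [h2]; ring, ?_⟩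
      simp only [List.map_cons, List.prod_cons]
      rw [← mul_assoc, lab_lab, smul_mul_assoc, mul_assoc, h3, mul_smul_comm, smul_smul]

theorem word_mem_normalForms (w : List (Gen K D S)) : ∃ l : List S, l.Nodup ∧
    (∀ s i a, Gen.lab s i a ∈ w → s ∈ l) ∧
    (w.map gen).prod ∈ normalForms (K := K) (D := D) (w.map (Gen.deg K D)).sum l := by
  induction w with
  | nil =>
    refine ⟨[], by simp, by simp, Submodule.subset_span ⟨0, ⟨1, K.one_mem⟩, [], by simp [base_one]⟩⟩
  | cons g w ih =>
    obtain ⟨l, hl, h2, h3⟩ := ih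
    cases g with
    | base i r =>
      refine ⟨l, hl, fun s i a h => h2 s i a (by simpa using h), ?_⟩
      simp only [List.map_cons, List.prod_cons, List.sum_cons, Gen.deg]
      refine Submodule.span_induction (p := fun b _ => gen (.base i r) * b ∈ normalForms _ l) ?_
        (by simp) (fun x y _ _ hx hy => by simpa [mul_add] using add_mem hx hy)
        (fun c x _ hx => by simpa using Submodule.smul_mem _ c hx) h3
      rintro _ ⟨j, r', v, hv, hj, rfl⟩
      refine Submodule.subset_span ⟨i + j, ⟨_, K.mul_mem r.2 r'.2⟩, v, hv, ?_, ?_⟩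
      · rw [add_assoc, hj]
      · rw [base_mul, gen_base, mul_assoc]
    | lab s i a =>
      simp only [List.map_cons, List.prod_cons, List.sum_cons, Gen.deg]
      by_cases hs : s ∈ l
      · refine ⟨l, hl, ?_, ?_⟩
        · intro t j b h
          rcases List.mem_cons.1 h with h | h
          · cases h; exact hs
          · exact h2 t j b h
        · refine Submodule.span_induction (p := fun b _ => gen (.lab s i a) * b ∈ normalForms _ l) ?_
            (by simp) (fun x y _ _ hx hy => by simpa [mul_add] using add_mem hx hy)
            (fun c x _ hx => by simpa using Submodule.smul_mem _ c hx) h3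
          rintro _ ⟨j, r', v, hv, hj, rfl⟩
          obtain ⟨c, v', k1, k2, k3⟩ := gen_mul_labs (K := K) s i a v (by rwa [hv])
          rw [gen_lab, ← mul_assoc]
          have := gen_comm (Gen.lab s i a) (Gen.base j r' : Gen K D S)
          rw [gen_lab, gen_base] at this
          rw [this, smul_mul_assoc, mul_assoc, k3, mul_smul_comm]
          refine Submodule.smul_mem _ _ (Submodule.smul_mem _ _ (Submodule.subset_span ?_))
          exact ⟨j, r', v', k1.trans hv, by rw [k2, ← hj]; ring, rfl⟩
      · refine ⟨s :: l, by simp [hs, hl], ?_, ?_⟩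
        · intro t j b h
          rcases List.mem_cons.1 h with h | h
          · cases h; simp
          · exact List.mem_cons_of_mem _ (h2 t j b h)
        · refine Submodule.span_induction
            (p := fun b _ => gen (.lab s i a) * b ∈ normalForms _ (s :: l)) ?_
            (by simp) (fun x y _ _ hx hy => by simpa [mul_add] using add_mem hx hy)
            (fun c x _ hx => by simpa using Submodule.smul_mem _ c hx) h3
          rintro _ ⟨j, r', v, hv, hj, rfl⟩
          rw [gen_lab, ← mul_assoc]
          have := gen_comm (Gen.lab s i a) (Gen.base j r' : Gen K D S)
          rw [gen_lab, gen_base] at this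
          rw [this, smul_mul_assoc, mul_assoc]
          refine Submodule.smul_mem _ _ (Submodule.subset_span ?_)
          exact ⟨j, r', ⟨s, i, a⟩ :: v, by simp [hv], by simp [← hj]; ring, by simp⟩

/-- If `R` and `A` are bounded above, then the tensor product is bounded above. -/
theorem part_eq_bot [Fintype S] {B N : ℤ} (hK : ∀ i, K.gr i ≠ ⊥ → i ≤ B) (hD : ∀ i, D.gr i ≠ ⊥ → i ≤ N)
    {m : ℤ} (hm : B + Fintype.card S * N < m) : part K D S m = ⊥ := by
  rw [eq_bot_iff, part, Submodule.span_le]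
  rintro _ ⟨w, rfl, h2, rfl⟩
  obtain ⟨l, hl, k2, k3⟩ := word_mem_normalForms w
  have hlen : l.length = Fintype.card S := by
    classical
    rw [← List.toFinset_card_of_nodup hl, ← Finset.card_univ]
    congr 1
    ext s
    obtain ⟨i, a, h⟩ := h2 s
    simpa using k2 s i a h
  suffices h : normalForms (K := K) (D := D) (w.map (Gen.deg K D)).sum l ≤ ⊥ from h k3
  rw [normalForms, Submodule.span_le]
  rintro _ ⟨i, r, v, hv, hj, rfl⟩
  have hvl : v.length = Fintype.card S := by rw [← hlen, ← hv]; simp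
  by_contra hne
  have hne' : base K D S i r * (v.map fun p => lab K D p.1 p.2.1 p.2.2).prod ≠ 0 := hne
  have h1 : i ≤ B := by
    refine hK i fun h => hne' ?_
    have : r = 0 := Subtype.ext ((Submodule.eq_bot_iff _).1 h _ r.2)
    simp [this]
  have h3 : ∀ p ∈ v, p.2.1 ≤ N := by
    intro p hp
    refine hD _ fun h => hne' ?_
    have : p.2.2 = 0 := Subtype.ext ((Submodule.eq_bot_iff _).1 h _ p.2.2.2)
    obtain ⟨v1, v2, rfl⟩ := List.append_of_mem hp
    simp [this]
  have h4 : (v.map (·.2.1)).sum ≤ v.length * N := by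
    have := List.sum_le_card_nsmul (v.map (·.2.1)) N (by
      intro x hx
      obtain ⟨p, hp, rfl⟩ := List.mem_map.1 hx
      exact h3 p hp)
    simpa using this
  rw [hvl] at h4
  linarith

end Tens

section Signs

variable {X Y Z : Type} [LinearOrder X] [LinearOrder Y] [LinearOrder Z]

/-- The sign `-1` if `φ` reverses the order of `p` and `q`. -/
def disSign (φ : X → Y) (p q : X) : ℤ := if (p < q ↔ φ p < φ q) then 1 else -1

/-- The sign of the order of two elements. -/
def ltSign (p q : X) : ℤ := if q < p then -1 else 1

/-- The parity of the number of inversions of a map on a finite set. -/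
def invSign (φ : X → Y) (U : Finset X) : ℤ :=
  ∏ x ∈ U.offDiag with x.1 < x.2, disSign φ x.1 x.2

theorem ltSign_mul_self (p q : X) : ltSign p q * ltSign p q = 1 := by
  unfold ltSign; split_ifs <;> simp

theorem ltSign_swap {p q : X} (h : p ≠ q) : ltSign p q * ltSign q p = -1 := by
  unfold ltSign
  rcases lt_or_gt_of_ne h with h | h
  · simp [h, h.asymm]
  · simp [h, h.asymm]

theorem disSign_mul_self (φ : X → Y) (p q : X) : disSign φ p q * disSign φ p q = 1 := by
  unfold disSign; split_ifs <;> simp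

theorem disSign_eq {φ : X → Y} {p q : X} (h : p ≠ q) (h' : φ p ≠ φ q) :
    disSign φ p q = ltSign p q * ltSign (φ p) (φ q) := by
  unfold ltSign disSign
  rcases lt_or_gt_of_ne h with h | h <;> rcases lt_or_gt_of_ne h' with h' | h' <;>
    simp [h, h', h.asymm, h'.asymm]

theorem disSign_comm {φ : X → Y} {p q : X} (h : p ≠ q) (h' : φ p ≠ φ q) :
    disSign φ p q = disSign φ q p := by
  unfold disSign
  rcases lt_or_gt_of_ne h with h | h <;> rcases lt_or_gt_of_ne h' with h' | h' <;>
    simp [h, h', h.asymm, h'.asymm]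

theorem disSign_comp {φ : X → Y} {ψ : Y → Z} {p q : X} (h : p ≠ q) (h' : φ p ≠ φ q)
    (h'' : ψ (φ p) ≠ ψ (φ q)) :
    disSign (ψ ∘ φ) p q = disSign ψ (φ p) (φ q) * disSign φ p q := by
  rw [disSign_eq h' h'', disSign_eq h h', disSign_eq h h'']
  rw [show ∀ a b c : ℤ, a * b * (c * a) = c * b * (a * a) by intros; ring, ltSign_mul_self, mul_one]
  rfl

theorem invSign_empty (φ : X → Y) : invSign φ ∅ = 1 := by simp [invSign]

theorem invSign_insert {φ : X → Y} {U : Finset X} {a : X} (ha : a ∉ U)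
    (hφ : Set.InjOn φ (insert a U : Finset X)) :
    invSign φ (insert a U) = (∏ q ∈ U, disSign φ a q) * invSign φ U := by
  classical
  have hne : ∀ q ∈ U, a ≠ q := fun q hq h => ha (h ▸ hq)
  have hne' : ∀ q ∈ U, φ a ≠ φ q := fun q hq h =>
    hne q hq (hφ (by simp) (by simp [hq]) h)
  have e1 : ∏ x ∈ {a} ×ˢ U with x.1 < x.2, disSign φ x.1 x.2 =
      ∏ q ∈ U with a < q, disSign φ a q := by
    refine Finset.prod_nbij' (·.2) (fun q => (a, q)) ?_ ?_ ?_ ?_ ?_ <;> aesop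
  have e2 : ∏ x ∈ U ×ˢ {a} with x.1 < x.2, disSign φ x.1 x.2 =
      ∏ q ∈ U with ¬ a < q, disSign φ a q := by
    refine Finset.prod_nbij' (·.1) (fun q => (q, a)) ?_ ?_ ?_ ?_ ?_
    · rintro ⟨p, q⟩; simp; rintro h rfl h'; exact ⟨h, h'.le⟩
    · intro q; simp; intro h h'; exact ⟨h, lt_of_le_of_ne h' (hne q h).symm⟩
    · rintro ⟨p, q⟩; simp; rintro h rfl h'; rfl
    · intro q; simp
    · rintro ⟨p, q⟩; simp; rintro h rfl h'; exact (disSign_comm (hne p h) (hne' p h)).symm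
  have e3 : ∏ x ∈ (insert a U).offDiag with x.1 < x.2, disSign φ x.1 x.2 =
      (∏ x ∈ U.offDiag with x.1 < x.2, disSign φ x.1 x.2) *
      (∏ x ∈ {a} ×ˢ U with x.1 < x.2, disSign φ x.1 x.2) *
      ∏ x ∈ U ×ˢ {a} with x.1 < x.2, disSign φ x.1 x.2 := by
    rw [Finset.offDiag_insert ha, Finset.filter_union, Finset.filter_union,
      Finset.prod_union, Finset.prod_union]
    · rw [Finset.disjoint_left]
      rintro ⟨p, q⟩ h h'
      simp only [Finset.mem_filter, Finset.mem_offDiag, Finset.mem_product,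
        Finset.mem_singleton] at h h'
      exact ha (h'.1.1 ▸ h.1.1)
    · rw [Finset.disjoint_left]
      rintro ⟨p, q⟩ h h'
      simp only [Finset.mem_filter, Finset.mem_offDiag, Finset.mem_product,
        Finset.mem_singleton, Finset.mem_union] at h h'
      rcases h with h | h
      · exact ha (h'.1.2 ▸ h.1.2.1)
      · exact ha (h.1.1 ▸ h'.1.1)
  rw [invSign, e3, e1, e2, mul_assoc, Finset.prod_filter_mul_prod_filter_not, mul_comm]
  rfl

theorem invSign_mul_self (φ : X → Y) (U : Finset X) : invSign φ U * invSign φ U = 1 := by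
  unfold invSign
  rw [← Finset.prod_mul_distrib]
  exact Finset.prod_eq_one fun x _ => disSign_mul_self _ _ _

theorem invSign_congr {φ ψ : X → Y} {U : Finset X} (h : ∀ i ∈ U, φ i = ψ i) :
    invSign φ U = invSign ψ U := by
  unfold invSign
  refine Finset.prod_congr rfl fun x hx => ?_
  simp only [Finset.mem_filter, Finset.mem_offDiag] at hx
  simp only [disSign, h _ hx.1.1, h _ hx.1.2.1]

theorem invSign_comp {φ : X → Y} {ψ : Y → Z} {U : Finset X} (hφ : Set.InjOn φ U)
    (hψ : Set.InjOn ψ (U.image φ)) :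
    invSign (ψ ∘ φ) U = invSign ψ (U.image φ) * invSign φ U := by
  induction U using Finset.induction_on with
  | empty => simp [invSign_empty]
  | insert a U ha ih =>
    have hc : Set.InjOn (ψ ∘ φ) (insert a U : Finset X) := by
      refine Set.InjOn.comp hψ hφ ?_
      exact fun x hx => Finset.mem_coe.2 (Finset.mem_image_of_mem φ hx)
    have hne : ∀ q ∈ U, a ≠ q := fun q hq h => ha (h ▸ hq)
    have ha' : φ a ∉ U.image φ := by
      simp only [Finset.mem_image, not_exists, not_and]
      intro q hq h
      exact hne q hq (hφ (by simp) (by simp [hq]) h.symm)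
    rw [Finset.image_insert] at hψ ⊢
    rw [invSign_insert ha hc, invSign_insert ha hφ, invSign_insert ha' hψ,
      ih (hφ.mono (by simp)) (hψ.mono (by simp)), Finset.prod_image]
    · rw [mul_mul_mul_comm, ← Finset.prod_mul_distrib]
      congr 1
      refine Finset.prod_congr rfl fun q hq => ?_
      refine disSign_comp (hne q hq) ?_ ?_
      · exact fun h => hne q hq (hφ (by simp) (by simp [hq]) h)
      · exact fun h => hne q hq (hc (by simp) (by simp [hq]) h)
    · exact hφ.mono (by simp)

theorem invSign_of_strictMonoOn {φ : X → Y} {U : Finset X} (h : StrictMonoOn φ U) :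
    invSign φ U = 1 := by
  refine Finset.prod_eq_one fun x hx => ?_
  simp only [Finset.mem_filter, Finset.mem_offDiag] at hx
  simp [disSign, hx.2, h hx.1.1 hx.1.2.1 hx.2]

theorem invSign_perm {m : ℕ} (σ : Equiv.Perm (Fin m)) :
    invSign σ Finset.univ = (Equiv.Perm.sign σ : ℤ) := by
  rw [Equiv.Perm.sign_eq_prod_prod_Ioi]
  push_cast
  rw [invSign, Finset.prod_sigma']
  refine Finset.prod_nbij' (fun x => ⟨x.1, x.2⟩) (fun x => (x.1, x.2)) ?_ ?_ ?_ ?_ ?_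
  · rintro ⟨p, q⟩; simp
  · rintro ⟨p, q⟩; simp; intro h; exact ⟨h.ne, h⟩
  · rintro ⟨p, q⟩; simp
  · rintro ⟨p, q⟩; simp
  · rintro ⟨p, q⟩; simp; intro h h'
    simp only [disSign, h', true_iff]
    split_ifs <;> simp

/-- The sign of the shuffle that separates two finite sets. -/
def kappa (P Q : Finset X) : ℤ := ∏ p ∈ P, ∏ q ∈ Q, ltSign p q

theorem kappa_mul_self (P Q : Finset X) : kappa P Q * kappa P Q = 1 := by
  unfold kappa
  rw [← Finset.prod_mul_distrib]
  refine Finset.prod_eq_one fun p _ => ?_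
  rw [← Finset.prod_mul_distrib]
  exact Finset.prod_eq_one fun q _ => ltSign_mul_self _ _

theorem kappa_swap {P Q : Finset X} (h : Disjoint P Q) :
    kappa P Q * kappa Q P = (-1) ^ (P.card * Q.card) := by
  unfold kappa
  rw [Finset.prod_comm (s := Q), ← Finset.prod_mul_distrib]
  have : ∀ p ∈ P, (∏ q ∈ Q, ltSign p q) * ∏ q ∈ Q, ltSign q p = (-1) ^ Q.card := by
    intro p hp
    rw [← Finset.prod_mul_distrib, ← Finset.prod_const]
    refine Finset.prod_congr rfl fun q hq => ltSign_swap ?_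
    rintro rfl
    exact Finset.disjoint_left.1 h hp hq
  rw [Finset.prod_congr rfl this, Finset.prod_const, ← pow_mul, mul_comm]

theorem kappa_union_left {P P' Q : Finset X} (h : Disjoint P P') :
    kappa (P ∪ P') Q = kappa P Q * kappa P' Q := Finset.prod_union h

theorem kappa_union_right {P Q Q' : Finset X} (h : Disjoint Q Q') :
    kappa P (Q ∪ Q') = kappa P Q * kappa P Q' := by
  unfold kappa
  rw [← Finset.prod_mul_distrib]
  exact Finset.prod_congr rfl fun p _ => Finset.prod_union h

theorem kappa_empty_right (P : Finset X) : kappa P ∅ = 1 := by simp [kappa]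

theorem kappa_empty_left (P : Finset X) : kappa ∅ P = 1 := by simp [kappa]

theorem invSign_union {φ : X → Y} {P Q : Finset X} (h : Disjoint P Q)
    (hφ : Set.InjOn φ (P ∪ Q : Finset X)) :
    invSign φ (P ∪ Q) = invSign φ P * invSign φ Q * ∏ p ∈ P, ∏ q ∈ Q, disSign φ p q := by
  induction P using Finset.induction_on with
  | empty => simp [invSign_empty]
  | insert a P ha ih =>
    have h' : Disjoint P Q := h.mono_left (by simp)
    have haQ : a ∉ Q := Finset.disjoint_left.1 h (by simp)
    rw [Finset.insert_union] at hφ ⊢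
    rw [invSign_insert (by simp [ha, haQ]) hφ, ih h' (hφ.mono (by intro x; simp; tauto)),
      invSign_insert ha (hφ.mono (by intro x; simp; tauto)), Finset.prod_union h',
      Finset.prod_insert ha]
    ring

theorem kappa_image {φ : X → Y} {P Q : Finset X} (h : Disjoint P Q)
    (hφ : Set.InjOn φ (P ∪ Q : Finset X)) :
    kappa (P.image φ) (Q.image φ) = kappa P Q * ∏ p ∈ P, ∏ q ∈ Q, disSign φ p q := by
  unfold kappa
  rw [Finset.prod_image (hφ.mono (by simp)), ← Finset.prod_mul_distrib]
  refine Finset.prod_congr rfl fun p hp => ?_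
  rw [Finset.prod_image (hφ.mono (by simp)), ← Finset.prod_mul_distrib]
  refine Finset.prod_congr rfl fun q hq => ?_
  have hne : p ≠ q := by rintro rfl; exact Finset.disjoint_left.1 h hp hq
  rw [disSign_eq hne fun h => hne (hφ (by simp [hp]) (by simp [hq]) h), ← mul_assoc,
    ltSign_mul_self, one_mul]

end Signs

section KoszulProducts

variable {Ω Ω' ι : Type} [LinearOrder Ω] [LinearOrder Ω'] {B B' : Type u} [Ring B] [Ring B']

/-- The product of elements `y i` over a list, with the sign of the shuffle that separates the
sets `P i` in which the orientation elements of `y i` are contained. -/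
def koszulProd (P : ι → Finset Ω) (y : ι → B) : List ι → B
  | [] => 1
  | i :: l => (l.map fun j => kappa (P i) (P j)).prod • (y i * koszulProd P y l)

theorem koszulProd_perm {P : ι → Finset Ω} {y : ι → B} {l l' : List ι} (h : l.Perm l')
    (hc : ∀ i ∈ l, ∀ j ∈ l, i ≠ j → y i * y j = (kappa (P i) (P j) * kappa (P j) (P i)) • (y j * y i)) :
    koszulProd P y l = koszulProd P y l' := by
  induction h with
  | nil => rfl
  | cons i h ih =>
    simp only [koszulProd]
    rw [ih fun i hi j hj => hc i (by simp [hi]) j (by simp [hj]), (h.map _).prod_eq]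
  | swap i j l =>
    by_cases hij : i = j
    · rw [hij]
    · simp only [koszulProd, List.map_cons, List.prod_cons, mul_smul_comm, smul_smul, ← mul_assoc]
      rw [hc j (by simp) i (by simp) (Ne.symm hij), smul_mul_assoc, smul_smul]
      congr 1
      rw [show ∀ a b c d : ℤ, a * b * c * (a * d) = d * b * c * (a * a) by intros; ring,
        kappa_mul_self]
      ring
  | trans h h' ih ih' =>
    rw [ih hc, ih' fun i hi j hj => hc i (h.mem_iff.2 hi) j (h.mem_iff.2 hj)]

theorem prod_map_kappa [DecidableEq ι] {P : ι → Finset Ω} (Q : Finset Ω) {l : List ι} (hl : l.Nodup)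
    (hd : ∀ i ∈ l, ∀ j ∈ l, i ≠ j → Disjoint (P i) (P j)) :
    (l.map fun j => kappa Q (P j)).prod = kappa Q (l.toFinset.biUnion P) := by
  induction l with
  | nil => simp [kappa_empty_right]
  | cons i l ih =>
    rw [List.nodup_cons] at hl
    rw [List.map_cons, List.prod_cons, List.toFinset_cons, Finset.biUnion_insert, kappa_union_right,
      ih hl.2 fun i hi j hj => hd i (by simp [hi]) j (by simp [hj])]
    rw [Finset.disjoint_biUnion_right]
    intro j hj
    refine hd i (by simp) j (by simp [List.mem_toFinset.1 hj]) ?_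
    rintro rfl
    exact hl.1 (List.mem_toFinset.1 hj)

theorem koszulProd_append [DecidableEq ι] {P : ι → Finset Ω} {y : ι → B} {l l' : List ι}
    (hl : (l ++ l').Nodup)
    (hd : ∀ i ∈ l ++ l', ∀ j ∈ l ++ l', i ≠ j → Disjoint (P i) (P j)) :
    koszulProd P y (l ++ l') = kappa (l.toFinset.biUnion P) (l'.toFinset.biUnion P) •
      (koszulProd P y l * koszulProd P y l') := by
  induction l with
  | nil => simp [kappa_empty_left, koszulProd]
  | cons i l ih =>
    rw [List.cons_append] at hl hd ⊢
    have hl' := hl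
    rw [List.nodup_cons] at hl'
    have hd' : ∀ i ∈ l ++ l', ∀ j ∈ l ++ l', i ≠ j → Disjoint (P i) (P j) :=
      fun i hi j hj => hd i (List.mem_cons_of_mem _ hi) j (List.mem_cons_of_mem _ hj)
    rw [koszulProd, ih hl'.2 hd', List.map_append, List.prod_append, koszulProd, List.toFinset_cons,
      Finset.biUnion_insert, kappa_union_left, prod_map_kappa (l := l') _ (List.nodup_append.1 hl'.2).2.1]
    · simp only [mul_smul_comm, smul_mul_assoc, smul_smul, ← mul_assoc]
      congr 1
      ring
    · exact fun i hi j hj => hd' i (by simp [hi]) j (by simp [hj])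
    · rw [Finset.disjoint_biUnion_right]
      intro j hj
      refine hd i (by simp) j (by simp [List.mem_toFinset.1 hj]) ?_
      rintro rfl
      exact hl'.1 (by simp [List.mem_toFinset.1 hj])

theorem koszulProd_congr {P P' : ι → Finset Ω} {y y' : ι → B} {l : List ι}
    (hP : ∀ i ∈ l, P i = P' i) (hy : ∀ i ∈ l, y i = y' i) :
    koszulProd P y l = koszulProd P' y' l := by
  induction l with
  | nil => rfl
  | cons i l ih =>
    rw [koszulProd, koszulProd, ih (fun i hi => hP i (by simp [hi])) fun i hi => hy i (by simp [hi]),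
      hy i (by simp), hP i (by simp)]
    congr 2
    exact List.map_congr_left fun j hj => by rw [hP j (by simp [hj])]

theorem koszulProd_list_map {ι' : Type} (P : ι' → Finset Ω) (y : ι' → B) (f : ι → ι') (l : List ι) :
    koszulProd P y (l.map f) = koszulProd (P ∘ f) (y ∘ f) l := by
  induction l with
  | nil => rfl
  | cons i l ih =>
    rw [List.map_cons, koszulProd, koszulProd, ih, List.map_map]
    rfl

theorem koszulProd_map [DecidableEq ι] (ρ : B →+* B') {φ : Ω → Ω'} {P : ι → Finset Ω} {y : ι → B}
    {c : ι → ℤ} {l : List ι} (hl : l.Nodup)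
    (hd : ∀ i ∈ l, ∀ j ∈ l, i ≠ j → Disjoint (P i) (P j))
    (hφ : Set.InjOn φ (l.toFinset.biUnion P : Finset Ω)) :
    koszulProd (fun i => (P i).image φ) (fun i => (invSign φ (P i) * c i) • ρ (y i)) l =
      (invSign φ (l.toFinset.biUnion P) * (l.map c).prod) • ρ (koszulProd P y l) := by
  induction l with
  | nil => simp [koszulProd, invSign_empty]
  | cons i l ih =>
    have hl' := List.nodup_cons.1 hl
    have hd' : ∀ i ∈ l, ∀ j ∈ l, i ≠ j → Disjoint (P i) (P j) :=
      fun i hi j hj => hd i (List.mem_cons_of_mem _ hi) j (List.mem_cons_of_mem _ hj)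
    rw [List.toFinset_cons, Finset.biUnion_insert] at hφ ⊢
    have hdi : Disjoint (P i) (l.toFinset.biUnion P) := by
      rw [Finset.disjoint_biUnion_right]
      intro j hj
      refine hd i (by simp) j (by simp [List.mem_toFinset.1 hj]) ?_
      rintro rfl
      exact hl'.1 (List.mem_toFinset.1 hj)
    have hφ' : Set.InjOn φ (l.toFinset.biUnion P : Finset Ω) := hφ.mono (by
      rw [Finset.coe_subset]; exact Finset.subset_union_right)
    have hP : ∀ j ∈ l, P j ⊆ l.toFinset.biUnion P := fun j hj =>
      Finset.subset_biUnion_of_mem P (List.mem_toFinset.2 hj)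
    have hdd : ∀ a ∈ l, ∀ b ∈ l, a ≠ b → Disjoint ((P a).image φ) ((P b).image φ) := by
      intro a ha b hb hab
      rw [Finset.disjoint_left]
      intro z hz hz'
      obtain ⟨x, hx, rfl⟩ := Finset.mem_image.1 hz
      obtain ⟨y, hy, hxy⟩ := Finset.mem_image.1 hz'
      have := hφ' (hP b hb hy) (hP a ha hx) hxy
      subst this
      exact Finset.disjoint_left.1 (hd' a ha b hb hab) hx hy
    rw [koszulProd, ih hl'.2 hd' hφ', koszulProd, invSign_union hdi hφ, prod_map_kappa _ hl'.2 hdd,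
      prod_map_kappa _ hl'.2 hd', List.map_cons, List.prod_cons]
    rw [show (l.toFinset.biUnion fun j => (P j).image φ) = (l.toFinset.biUnion P).image φ from
      (Finset.biUnion_image ..).symm, kappa_image hdi hφ]
    simp only [map_zsmul, map_mul, mul_smul_comm, smul_mul_assoc, smul_smul]
    congr 1
    ring

end KoszulProducts

section Evaluation

variable {R : Type} [Ring R] [Algebra ℚ R] {K : CoeffAlgebra R}
variable {A : Type u} [NonUnitalRing A] [Module ℚ A] {D : DGCommAlgebra A}
variable {S V E : Type}

theorem map_map_sum {S V S' V' S'' V'' : Type} (x : S ⊕ V) (h : S → S') (k : V → V')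
    (h' : S' → S'') (k' : V' → V'') : (x.map h k).map h' k' = x.map (h' ∘ h) (k' ∘ k) := by
  cases x <;> rfl

theorem evalOn_eq {n : ℕ} {m : ℤ} {x : Series K D} (hx : x ∈ HGC K D n m) [Fintype S] [Fintype V]
    [LinearOrder V] [Fintype E] [LinearOrder E] (G : Graph S V E) {k v e : ℕ} (s : S ≃ Fin k)
    (ov : Fin v ≃o V) (oe : Fin e ≃o E) :
    evalOn G x = Tens.rename s.symm (x k v e fun i b => (G (oe i) b).map s ov.symm) := by
  obtain rfl : k = Fintype.card S := by simpa using (Fintype.card_congr s).symm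
  obtain rfl : v = Fintype.card V := by simpa using Fintype.card_congr ov.toEquiv
  obtain rfl : e = Fintype.card E := by simpa using Fintype.card_congr oe.toEquiv
  obtain rfl : ov = monoEquivOfFin V rfl := Subsingleton.elim _ _
  obtain rfl : oe = monoEquivOfFin E rfl := Subsingleton.elim _ _
  set π : Equiv.Perm (Fin (Fintype.card S)) := (Fintype.equivFin S).symm.trans s
  set H : Graph (Fin (Fintype.card S)) (Fin (Fintype.card V)) (Fin (Fintype.card E)) := fun i b =>
    (G (monoEquivOfFin E rfl i) b).map (Fintype.equivFin S) (monoEquivOfFin V rfl).symm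
  have h := (hx _ _ _ H).2.2 π 1 1 (fun _ => false)
  have h1 : relabelSign n (1 : Equiv.Perm (Fin (Fintype.card V)))
      (1 : Equiv.Perm (Fin (Fintype.card E))) (fun _ => false) = 1 := by
    simp [relabelSign]
  have h2 : H.relabel π 1 1 (fun _ => false) = fun i b =>
      (G (monoEquivOfFin E rfl i) b).map s (monoEquivOfFin V rfl).symm := by
    funext i b
    simp only [Graph.relabel, H, map_map_sum]
    congr 1
    · ext a; simp [π]
    · simp
  rw [h1, one_smul, h2] at h
  rw [h, Tens.rename_rename]
  change Tens.rename _ _ = _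
  congr 2
  funext a
  simp [π]

/-- The sign of a reversed edge. -/
def flipSign (b : Bool) : ℤ := if b then -1 else 1

theorem flipSign_mul_self (b : Bool) : flipSign b * flipSign b = 1 := by cases b <;> simp [flipSign]

theorem flipSign_xor (b c : Bool) : flipSign (xor b c) = flipSign b * flipSign c := by
  cases b <;> cases c <;> simp [flipSign]

theorem evalOn_iso {n : ℕ} {m : ℤ} {x : Series K D} (hx : x ∈ HGC K D n m)
    {S' V' E' : Type} [Fintype S] [Fintype V] [LinearOrder V] [Fintype E] [LinearOrder E]
    [Fintype S'] [Fintype V'] [LinearOrder V'] [Fintype E'] [LinearOrder E']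
    (G : Graph S V E) (G' : Graph S' V' E') (s : S ≃ S') (b : V ≃ V') (a : E ≃ E') (f : E → Bool)
    (h : ∀ i c, G' (a i) c = (G i (xor c (f i))).map s b) :
    evalOn G' x = (if Even n then invSign a Finset.univ
      else invSign b Finset.univ * ∏ i, flipSign (f i)) • Tens.rename s (evalOn G x) := by
  set s1 := Fintype.equivFin S
  set v1 := monoEquivOfFin V rfl
  set e1 := monoEquivOfFin E rfl
  set v2 := monoEquivOfFin V' (Fintype.card_congr b).symm
  set e2 := monoEquivOfFin E' (Fintype.card_congr a).symm
  rw [evalOn_eq hx G s1 v1 e1, evalOn_eq hx G' (s.symm.trans s1) v2 e2]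
  set σ : Equiv.Perm (Fin (Fintype.card E)) := (e1.toEquiv.trans (a.trans e2.symm.toEquiv)).symm
  set τ : Equiv.Perm (Fin (Fintype.card V)) := v1.toEquiv.trans (b.trans v2.symm.toEquiv)
  set H : Graph (Fin (Fintype.card S)) (Fin (Fintype.card V)) (Fin (Fintype.card E)) := fun i b =>
    (G (e1 i) b).map s1 v1.symm
  have h2 : (fun i c => (G' (e2 i) c).map (s.symm.trans s1) v2.symm) =
      H.relabel 1 τ σ (fun i => f (e1 (σ i))) := by
    funext i c
    obtain ⟨j, rfl⟩ : ∃ j, i = e2.symm (a (e1 j)) := ⟨σ i, by simp [σ]⟩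
    have hj : σ (e2.symm (a (e1 j))) = j := by simp [σ]
    simp only [Graph.relabel, hj, H, OrderIso.apply_symm_apply, h, map_map_sum]
    congr 1
    · ext y; simp
    · ext y; simp [τ]
  have h3 := (hx _ _ _ H).2.2 1 τ σ (fun i => f (e1 (σ i)))
  rw [h2, h3, map_zsmul, Tens.rename_rename, Tens.rename_rename]
  congr 1
  · unfold relabelSign
    have hσ : (Equiv.Perm.sign σ : ℤ) = invSign a Finset.univ := by
      rw [Equiv.Perm.sign_symm, ← invSign_perm]
      have : (⇑(e1.toEquiv.trans (a.trans e2.symm.toEquiv)) : Fin _ → Fin _) = e2.symm ∘ (a ∘ e1) := rfl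
      rw [this, invSign_comp (by intro x _ y _; simp) (by intro x _ y _; simp),
        invSign_comp (by intro x _ y _; simp) (by intro x _ y _; simp),
        invSign_of_strictMonoOn (e2.symm.strictMono.strictMonoOn _),
        invSign_of_strictMonoOn (e1.strictMono.strictMonoOn _),
        Finset.image_univ_of_surjective e1.surjective]
      simp
    have hτ : (Equiv.Perm.sign τ : ℤ) = invSign b Finset.univ := by
      rw [← invSign_perm]
      have : (⇑τ : Fin _ → Fin _) = v2.symm ∘ (b ∘ v1) := rfl
      rw [this, invSign_comp (by intro x _ y _; simp) (by intro x _ y _; simp),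
        invSign_comp (by intro x _ y _; simp) (by intro x _ y _; simp),
        invSign_of_strictMonoOn (v2.symm.strictMono.strictMonoOn _),
        invSign_of_strictMonoOn (v1.strictMono.strictMonoOn _),
        Finset.image_univ_of_surjective v1.surjective]
      simp
    rw [hσ, hτ]
    congr 2
    rw [← (σ.trans e1.toEquiv).prod_comp]
    rfl

end Evaluation

section Ambient

variable {S V E : Type} [LinearOrder E] [LinearOrder V] [Fintype V]
variable {S' V' E' : Type} [LinearOrder E'] [LinearOrder V'] [Fintype V']

open scoped Classical in
/-- The internal vertices incident to a set of edges. -/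
def verts (g : Graph S V E) (P : Finset E) : Finset V :=
  Finset.univ.filter fun w => ∃ i ∈ P, ∃ b, g i b = .inr w

theorem mem_verts {g : Graph S V E} {P : Finset E} {w : V} :
    w ∈ verts g P ↔ ∃ i ∈ P, ∃ b, g i b = .inr w := by simp [verts]

/-- The half-edges in a set of edges which are incident to external vertices. -/
abbrev Legs (g : Graph S V E) (P : Finset E) : Type :=
  {p : {i // i ∈ P} × Bool // (g p.1 p.2).isLeft}

/-- The external vertex of a half-edge. -/
def legVertex (g : Graph S V E) (P : Finset E) (p : Legs g P) : S := (g p.1.1 p.1.2).getLeft p.2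

/-- The subgraph given by a set of edges, with external vertices split into univalent ones. -/
def restr (g : Graph S V E) (P : Finset E) : Graph (Legs g P) {w // w ∈ verts g P} {i // i ∈ P} :=
  fun i b => if h : (g i b).isLeft then .inl ⟨(i, b), h⟩
    else .inr ⟨(g i b).getRight (Sum.not_isLeft.1 h), mem_verts.2 ⟨i, i.2, b, by simp⟩⟩

theorem restr_inl {g : Graph S V E} {P : Finset E} {i : {i // i ∈ P}} {b : Bool}
    (h : (g i b).isLeft) : restr g P i b = .inl ⟨(i, b), h⟩ := by simp [restr, h]

theorem restr_inr {g : Graph S V E} {P : Finset E} {i : {i // i ∈ P}} {b : Bool} {w : V}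
    (h : g i b = .inr w) : restr g P i b = .inr ⟨w, mem_verts.2 ⟨i, i.2, b, h⟩⟩ := by
  have h' : ¬ (g i b).isLeft := by simp [h]
  simp [restr, h]

theorem restr_map (g : Graph S V E) (P : Finset E) (i : {i // i ∈ P}) (b : Bool) :
    (restr g P i b).map (legVertex g P) Subtype.val = g i b := by
  rcases h : g i b with s | w
  · have h' : (g i b).isLeft := by simp [h]
    rw [restr_inl h']
    simp [legVertex, h]
  · rw [restr_inr h]
    rfl

/-- A map of graphs which is injective on a set of edges and on their internal vertices. -/
structure GMap (h : S → S') (a : E → E') (b : V → V') (f : E → Bool) (g : Graph S V E) (P : Finset E)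
    (g' : Graph S' V' E') : Prop where
  injE : Set.InjOn a P
  injV : Set.InjOn b (verts g P)
  map : ∀ i ∈ P, ∀ c, g' (a i) c = (g i (xor c (f i))).map h b

/-- The effect of a map of graphs on the orientation. -/
def gsign (n : ℕ) (a : E → E') (b : V → V') (f : E → Bool) (g : Graph S V E) (P : Finset E) : ℤ :=
  if Even n then invSign a P else invSign b (verts g P) * ∏ i ∈ P, flipSign (f i)

theorem gsign_mul_self (n : ℕ) (a : E → E') (b : V → V') (f : E → Bool) (g : Graph S V E)
    (P : Finset E) : gsign n a b f g P * gsign n a b f g P = 1 := by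
  unfold gsign
  split_ifs
  · exact invSign_mul_self _ _
  · rw [mul_mul_mul_comm, invSign_mul_self, ← Finset.prod_mul_distrib, one_mul]
    exact Finset.prod_eq_one fun i _ => flipSign_mul_self _

variable {h : S → S'} {a : E → E'} {b : V → V'} {f : E → Bool} {g : Graph S V E} {P : Finset E}
  {g' : Graph S' V' E'}

namespace GMap

theorem mono (M : GMap h a b f g P g') {Q : Finset E} (hQ : Q ⊆ P) : GMap h a b f g Q g' where
  injE := M.injE.mono (by simpa using hQ)
  injV := M.injV.mono fun w hw => by
    simp only [Finset.mem_coe, mem_verts] at hw ⊢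
    obtain ⟨i, hi, c⟩ := hw
    exact ⟨i, hQ hi, c⟩
  map i hi := M.map i (hQ hi)

theorem verts_image (M : GMap h a b f g P g') : verts g' (P.image a) = (verts g P).image b := by
  ext w
  simp only [mem_verts, Finset.mem_image]
  constructor
  · rintro ⟨_, ⟨i, hi, rfl⟩, c, hc⟩
    rw [M.map i hi] at hc
    rcases hv : g i (xor c (f i)) with s | w'
    · simp [hv] at hc
    · rw [hv] at hc
      exact ⟨w', ⟨i, hi, _, hv⟩, by simpa using hc⟩
  · rintro ⟨w', ⟨i, hi, c, hc⟩, rfl⟩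
    refine ⟨a i, ⟨i, hi, rfl⟩, xor c (f i), ?_⟩
    rw [M.map i hi, Bool.xor_assoc, Bool.xor_self, Bool.xor_false, hc]
    rfl

theorem isLeft_iff (M : GMap h a b f g P g') {i : E} (hi : i ∈ P) (c : Bool) :
    (g' (a i) c).isLeft = (g i (xor c (f i))).isLeft := by
  rw [M.map i hi]; cases g i (xor c (f i)) <;> rfl

/-- The bijection of edges. -/
def equivE (M : GMap h a b f g P g') : {i // i ∈ P} ≃ {i // i ∈ P.image a} :=
  Equiv.ofBijective (fun i => ⟨a i, Finset.mem_image_of_mem a i.2⟩) (by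
    constructor
    · intro i j hij
      exact Subtype.ext (M.injE i.2 j.2 (congrArg Subtype.val hij))
    · rintro ⟨_, hj⟩
      obtain ⟨i, hi, rfl⟩ := Finset.mem_image.1 hj
      exact ⟨⟨i, hi⟩, rfl⟩)

/-- The bijection of internal vertices. -/
def equivV (M : GMap h a b f g P g') : {w // w ∈ verts g P} ≃ {w // w ∈ verts g' (P.image a)} :=
  Equiv.ofBijective (fun w => ⟨b w, by
    rw [M.verts_image]; exact Finset.mem_image_of_mem b w.2⟩) (by
    constructor
    · intro i j hij
      exact Subtype.ext (M.injV i.2 j.2 (congrArg Subtype.val hij))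
    · rintro ⟨w', hw'⟩
      have hw := hw'
      rw [M.verts_image] at hw
      obtain ⟨i, hi, rfl⟩ := Finset.mem_image.1 hw
      exact ⟨⟨i, hi⟩, rfl⟩)

/-- The bijection of legs. -/
def equivS (M : GMap h a b f g P g') : Legs g P ≃ Legs g' (P.image a) :=
  Equiv.ofBijective (fun p => ⟨(⟨a p.1.1, Finset.mem_image_of_mem a p.1.1.2⟩, xor p.1.2 (f p.1.1)), by
      have := p.2
      simp only [M.isLeft_iff p.1.1.2, Bool.xor_assoc, Bool.xor_self, Bool.xor_false, this]⟩) (by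
    constructor
    · rintro ⟨⟨⟨i, hi⟩, c⟩, hp⟩ ⟨⟨⟨j, hj⟩, c'⟩, hp'⟩ hpp
      simp only [Subtype.mk.injEq, Prod.mk.injEq] at hpp
      obtain ⟨h1, h2⟩ := hpp
      have := M.injE hi hj h1
      subst this
      simpa using h2
    · rintro ⟨⟨⟨i', hi'⟩, c⟩, hp⟩
      obtain ⟨i, hi, rfl⟩ := Finset.mem_image.1 hi'
      refine ⟨⟨(⟨i, hi⟩, xor c (f i)), ?_⟩, ?_⟩
      · rw [M.isLeft_iff hi] at hp
        exact hp
      · simp)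

theorem legVertex_equivS (M : GMap h a b f g P g') (p : Legs g P) :
    legVertex g' (P.image a) (M.equivS p) = h (legVertex g P p) := by
  obtain ⟨⟨⟨i, hi⟩, c⟩, hp⟩ := p
  have h1 : Sum.inl (legVertex g' (P.image a) (M.equivS ⟨⟨⟨i, hi⟩, c⟩, hp⟩)) =
      g' (a i) (xor c (f i)) := by
    rw [legVertex, Sum.inl_getLeft]
    rfl
  have h2 : Sum.inl (legVertex g P ⟨⟨⟨i, hi⟩, c⟩, hp⟩) = g i c := by simp [legVertex]
  rw [M.map i hi, Bool.xor_assoc, Bool.xor_self, Bool.xor_false, ← h2] at h1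
  simpa using h1

theorem restr_equiv (M : GMap h a b f g P g') (i : {i // i ∈ P}) (c : Bool) :
    restr g' (P.image a) (M.equivE i) c = (restr g P i (xor c (f i))).map M.equivS M.equivV := by
  have hm := M.map i i.2 c
  rcases hv : g i (xor c (f i)) with s | w
  · have hl : (g i (xor c (f i))).isLeft := by simp [hv]
    have hl' : (g' (M.equivE i) c).isLeft := by
      rw [show ((M.equivE i : {i // i ∈ P.image a}) : E') = a i from rfl, M.isLeft_iff i.2, hl]
    rw [restr_inl hl, restr_inl hl', Sum.map_inl]
    refine congrArg Sum.inl (Subtype.ext (Prod.ext rfl ?_))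
    change c = xor (xor c (f i)) (f i)
    simp
  · rw [restr_inr hv, restr_inr (w := b w) (by
      rw [show ((M.equivE i : {i // i ∈ P.image a}) : E') = a i from rfl, hm, hv]; rfl)]
    rfl

end GMap

variable {R : Type} [Ring R] [Algebra ℚ R] {K : CoeffAlgebra R}
variable {A : Type u} [NonUnitalRing A] [Module ℚ A] {D : DGCommAlgebra A}

/-- The value of a series on the subgraph given by a set of edges. -/
def atom (x : Series K D) (g : Graph S V E) (P : Finset E) : Tens K D S :=
  Tens.rename (legVertex g P) (evalOn (restr g P) x)

theorem invSign_univ_subtype {X Y : Type} [LinearOrder X] [LinearOrder Y] {U : Finset X} {U' : Finset Y}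
    (φ : X → Y) (e : {x // x ∈ U} ≃ {y // y ∈ U'}) (he : ∀ x, (e x : Y) = φ x) :
    invSign e Finset.univ = invSign φ U := by
  have h1 : invSign (Subtype.val ∘ e) Finset.univ = invSign e Finset.univ := by
    rw [invSign_comp (by intro x _ y _; simp) (by intro x _ y _; exact Subtype.ext),
      invSign_of_strictMonoOn (φ := Subtype.val) (fun x _ y _ hxy => hxy), one_mul]
  have h2 : invSign (φ ∘ Subtype.val) (Finset.univ : Finset {x // x ∈ U}) = invSign φ U := by
    rw [invSign_comp (by intro x _ y _; exact Subtype.ext),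
      invSign_of_strictMonoOn (φ := Subtype.val) (fun x _ y _ hxy => hxy), mul_one]
    · congr 1
      ext x; simp
    · intro x hx y hy hxy
      simp at hx hy
      have h3 : (e ⟨x, hx⟩ : Y) = e ⟨y, hy⟩ := by rw [he, he]; exact hxy
      have h4 := e.injective (Subtype.ext h3)
      simpa using h4
  rw [← h1, ← h2]
  congr 1
  funext x
  exact he x

theorem atom_nat {n : ℕ} {m : ℤ} {x : Series K D} (hx : x ∈ HGC K D n m)
    (M : GMap h a b f g P g') :
    atom x g' (P.image a) = gsign n a b f g P • Tens.rename h (atom x g P) := by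
  unfold atom
  rw [evalOn_iso hx (restr g P) _ M.equivS M.equivV M.equivE (fun i => f i) M.restr_equiv]
  rw [map_zsmul, Tens.rename_rename, Tens.rename_rename]
  congr 1
  · rw [gsign, invSign_univ_subtype a M.equivE (fun _ => rfl),
      invSign_univ_subtype b M.equivV (fun _ => rfl)]
    congr 2
    exact Finset.prod_coe_sort P fun i => flipSign (f i)
  · congr 2
    funext p
    exact M.legVertex_equivS p

end Ambient

section Components

variable {S V E : Type} [LinearOrder E] [LinearOrder V] [Fintype V]
variable {S' V' E' : Type} [LinearOrder E'] [LinearOrder V'] [Fintype V']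

/-- Two edges in a set of edges are linked if they can be joined by a path through edges in this set
and internal vertices. -/
def LinkedIn (g : Graph S V E) (P : Finset E) : E → E → Prop :=
  Relation.EqvGen fun i j => i ∈ P ∧ j ∈ P ∧ ∃ (w : V) (b c : Bool), g i b = .inr w ∧ g j c = .inr w

/-- The component of an edge. -/
def cls (g : Graph S V E) (P : Finset E) (i : E) : Finset E :=
  haveI := Classical.decPred (LinkedIn g P i)
  P.filter (LinkedIn g P i)

/-- The internally connected components. -/
def comps (g : Graph S V E) (P : Finset E) : Finset (Finset E) := P.image (cls g P)

variable {h : S → S'} {a : E → E'} {b : V → V'} {f : E → Bool} {g : Graph S V E} {P : Finset E}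
  {g' : Graph S' V' E'}

theorem LinkedIn.refl (i : E) : LinkedIn g P i i := Relation.EqvGen.refl i

theorem LinkedIn.symm {i j : E} (h : LinkedIn g P i j) : LinkedIn g P j i := Relation.EqvGen.symm _ _ h

theorem LinkedIn.trans {i j k : E} (h : LinkedIn g P i j) (h' : LinkedIn g P j k) : LinkedIn g P i k :=
  Relation.EqvGen.trans _ _ _ h h'

theorem LinkedIn.of_mem {i j : E} (hi : i ∈ P) (hj : j ∈ P) {w : V} {b c : Bool} (hb : g i b = .inr w)
    (hc : g j c = .inr w) : LinkedIn g P i j := Relation.EqvGen.rel _ _ ⟨hi, hj, w, b, c, hb, hc⟩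

theorem mem_cls {i j : E} : j ∈ cls g P i ↔ j ∈ P ∧ LinkedIn g P i j := by simp [cls]

theorem cls_subset (i : E) : cls g P i ⊆ P := fun _ hj => (mem_cls.1 hj).1

theorem self_mem_cls {i : E} (hi : i ∈ P) : i ∈ cls g P i := mem_cls.2 ⟨hi, .refl i⟩

theorem cls_eq {i j : E} (h : LinkedIn g P i j) : cls g P i = cls g P j := by
  ext k
  simp only [mem_cls]
  exact and_congr_right fun _ => ⟨fun h' => h.symm.trans h', fun h' => h.trans h'⟩

theorem mem_comps {c : Finset E} : c ∈ comps g P ↔ ∃ i ∈ P, cls g P i = c := by simp [comps]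

theorem subset_of_mem_comps {c : Finset E} (hc : c ∈ comps g P) : c ⊆ P := by
  obtain ⟨i, -, rfl⟩ := mem_comps.1 hc
  exact cls_subset i

theorem eq_cls_of_mem {c : Finset E} (hc : c ∈ comps g P) {i : E} (hi : i ∈ c) : c = cls g P i := by
  obtain ⟨j, -, rfl⟩ := mem_comps.1 hc
  exact cls_eq (mem_cls.1 hi).2

theorem nonempty_of_mem_comps {c : Finset E} (hc : c ∈ comps g P) : c.Nonempty := by
  obtain ⟨i, hi, rfl⟩ := mem_comps.1 hc
  exact ⟨i, self_mem_cls hi⟩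

theorem comps_disjoint {c c' : Finset E} (hc : c ∈ comps g P) (hc' : c' ∈ comps g P) (hne : c ≠ c') :
    Disjoint c c' := by
  rw [Finset.disjoint_left]
  intro i hi hi'
  exact hne ((eq_cls_of_mem hc hi).trans (eq_cls_of_mem hc' hi').symm)

theorem biUnion_comps : (comps g P).biUnion id = P := by
  ext i
  simp only [Finset.mem_biUnion, id]
  constructor
  · rintro ⟨c, hc, hi⟩
    exact subset_of_mem_comps hc hi
  · intro hi
    exact ⟨_, mem_comps.2 ⟨i, hi, rfl⟩, self_mem_cls hi⟩

theorem verts_mono {Q : Finset E} (h : Q ⊆ P) : verts g Q ⊆ verts g P := by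
  intro w hw
  obtain ⟨i, hi, c⟩ := mem_verts.1 hw
  exact mem_verts.2 ⟨i, h hi, c⟩

theorem verts_disjoint {c c' : Finset E} (hc : c ∈ comps g P) (hc' : c' ∈ comps g P) (hne : c ≠ c') :
    Disjoint (verts g c) (verts g c') := by
  rw [Finset.disjoint_left]
  intro w hw hw'
  obtain ⟨i, hi, b, hb⟩ := mem_verts.1 hw
  obtain ⟨j, hj, b', hb'⟩ := mem_verts.1 hw'
  refine hne ?_
  rw [eq_cls_of_mem hc hi, eq_cls_of_mem hc' hj]
  exact cls_eq (.of_mem (subset_of_mem_comps hc hi) (subset_of_mem_comps hc' hj) hb hb')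

theorem biUnion_verts_comps : (comps g P).biUnion (verts g) = verts g P := by
  ext w
  simp only [Finset.mem_biUnion]
  constructor
  · rintro ⟨c, hc, hw⟩
    exact verts_mono (subset_of_mem_comps hc) hw
  · intro hw
    obtain ⟨i, hi, b, hb⟩ := mem_verts.1 hw
    exact ⟨_, mem_comps.2 ⟨i, hi, rfl⟩, mem_verts.2 ⟨i, self_mem_cls hi, b, hb⟩⟩

theorem GMap.linkedIn_iff (M : GMap h a b f g P g') {i j : E} (hi : i ∈ P) (hj : j ∈ P) :
    LinkedIn g' (P.image a) (a i) (a j) ↔ LinkedIn g P i j := by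
  constructor
  · intro hl
    have key : ∀ x y, LinkedIn g' (P.image a) x y → x = y ∨
        ∃ i ∈ P, ∃ j ∈ P, x = a i ∧ y = a j ∧ LinkedIn g P i j := by
      intro x y hxy
      induction hxy with
      | rel x y hxy =>
        obtain ⟨hx, hy, w, c, c', hc, hc'⟩ := hxy
        obtain ⟨i, hi, rfl⟩ := Finset.mem_image.1 hx
        obtain ⟨j, hj, rfl⟩ := Finset.mem_image.1 hy
        rw [M.map _ hi] at hc
        rw [M.map _ hj] at hc'
        rcases hv : g i (xor c (f i)) with s | v
        · simp [hv] at hc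
        · rcases hv' : g j (xor c' (f j)) with s | v'
          · simp [hv'] at hc'
          · rw [hv] at hc
            rw [hv'] at hc'
            have : v = v' := M.injV (mem_verts.2 ⟨i, hi, _, hv⟩) (mem_verts.2 ⟨j, hj, _, hv'⟩) (by
              simp only [Sum.map_inr, Sum.inr.injEq] at hc hc'
              rw [hc, hc'])
            subst this
            exact .inr ⟨i, hi, j, hj, rfl, rfl, .of_mem hi hj hv hv'⟩
      | refl x => exact .inl rfl
      | symm x y _ ih =>
        rcases ih with rfl | ⟨i, hi, j, hj, rfl, rfl, hl⟩
        · exact .inl rfl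
        · exact .inr ⟨j, hj, i, hi, rfl, rfl, hl.symm⟩
      | trans x y z _ _ ih ih' =>
        rcases ih with rfl | ⟨i, hi, j, hj, rfl, rfl, hl⟩
        · exact ih'
        · rcases ih' with rfl | ⟨i', hi', j', hj', h1, rfl, hl'⟩
          · exact .inr ⟨i, hi, j, hj, rfl, rfl, hl⟩
          · have := M.injE hj hi' h1
            subst this
            exact .inr ⟨i, hi, j', hj', rfl, rfl, hl.trans hl'⟩
    rcases key _ _ hl with h1 | ⟨i', hi', j', hj', h1, h2, hl⟩
    · rw [M.injE hi hj h1]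
      exact .refl _
    · rwa [M.injE hi hi' h1, M.injE hj hj' h2]
  · intro hl
    induction hl with
    | rel i j hij =>
      obtain ⟨hi, hj, w, c, c', hc, hc'⟩ := hij
      refine .of_mem (w := b w) (b := xor c (f i)) (c := xor c' (f j)) (Finset.mem_image_of_mem a hi) (Finset.mem_image_of_mem a hj) ?_ ?_
      · rw [M.map _ hi]; simp [hc]
      · rw [M.map _ hj]; simp [hc']
    | refl i => exact .refl _
    | symm i j h ih => exact (ih hj hi).symm
    | trans i j k h h' ih ih' =>
      by_cases hjP : j ∈ P
      · exact (ih hi hjP).trans (ih' hjP hj)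
      · have : ∀ x y, LinkedIn g P x y → (x ∈ P ↔ y ∈ P) := by
          intro x y hxy
          induction hxy with
          | rel x y hxy => simp [hxy.1, hxy.2.1]
          | refl x => rfl
          | symm x y _ ih => exact ih.symm
          | trans x y z _ _ ih ih' => exact ih.trans ih'
        exact absurd ((this _ _ h).1 hi) hjP

theorem GMap.cls_image (M : GMap h a b f g P g') {i : E} (hi : i ∈ P) :
    cls g' (P.image a) (a i) = (cls g P i).image a := by
  ext x
  simp only [mem_cls, Finset.mem_image]
  constructor
  · rintro ⟨⟨j, hj, rfl⟩, hl⟩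
    exact ⟨j, ⟨hj, (M.linkedIn_iff hi hj).1 hl⟩, rfl⟩
  · rintro ⟨j, ⟨hj, hl⟩, rfl⟩
    exact ⟨⟨j, hj, rfl⟩, (M.linkedIn_iff hi hj).2 hl⟩

theorem GMap.comps_image (M : GMap h a b f g P g') :
    comps g' (P.image a) = (comps g P).image (Finset.image a) := by
  rw [comps, comps, Finset.image_image, Finset.image_image]
  exact Finset.image_congr fun i hi => M.cls_image hi

/-- There is no internal vertex which is incident to edges in both sets. -/
def Unlinked (g : Graph S V E) (P Q : Finset E) : Prop :=
  ∀ i ∈ P, ∀ j ∈ Q, ∀ b c w, g i b = .inr w → g j c ≠ .inr w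

theorem Unlinked.symm {Q : Finset E} (h : Unlinked g P Q) : Unlinked g Q P :=
  fun i hi j hj b c w hb hc => h j hj i hi c b w hc hb

theorem Unlinked.linkedIn {Q : Finset E} (hu : Unlinked g P Q) {i j : E}
    (hl : LinkedIn g (P ∪ Q) i j) : (i ∈ P → j ∈ P ∧ LinkedIn g P i j) ∧
      (j ∈ P → i ∈ P ∧ LinkedIn g P i j) := by
  induction hl with
  | rel i j hij =>
    obtain ⟨hi, hj, w, b, c, hb, hc⟩ := hij
    rw [Finset.mem_union] at hi hj
    constructor
    · intro hi
      have hj : j ∈ P := hj.resolve_right fun hj => hu i hi j hj b c w hb hc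
      exact ⟨hj, .of_mem hi hj hb hc⟩
    · intro hj
      have hi : i ∈ P := hi.resolve_right fun hi => hu j hj i hi c b w hc hb
      exact ⟨hi, .of_mem hi hj hb hc⟩
  | refl i => exact ⟨fun h => ⟨h, .refl _⟩, fun h => ⟨h, .refl _⟩⟩
  | symm i j _ ih => exact ⟨fun h => ⟨(ih.2 h).1, (ih.2 h).2.symm⟩, fun h => ⟨(ih.1 h).1, (ih.1 h).2.symm⟩⟩
  | trans i j k _ _ ih ih' =>
    constructor
    · intro h
      have h1 := ih.1 h
      have h2 := ih'.1 h1.1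
      exact ⟨h2.1, h1.2.trans h2.2⟩
    · intro h
      have h1 := ih'.2 h
      have h2 := ih.2 h1.1
      exact ⟨h2.1, h2.2.trans h1.2⟩

theorem LinkedIn.mono {Q : Finset E} (hQ : P ⊆ Q) {i j : E} (hl : LinkedIn g P i j) : LinkedIn g Q i j :=
  Relation.EqvGen.mono (fun _ _ ⟨h1, h2, h3⟩ => ⟨hQ h1, hQ h2, h3⟩) _ _ hl

theorem Unlinked.cls_union {Q : Finset E} (hu : Unlinked g P Q) {i : E} (hi : i ∈ P) :
    cls g (P ∪ Q) i = cls g P i := by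
  ext j
  simp only [mem_cls]
  constructor
  · rintro ⟨-, hl⟩
    exact (hu.linkedIn hl).1 hi
  · rintro ⟨hj, hl⟩
    exact ⟨Finset.mem_union_left _ hj, hl.mono Finset.subset_union_left⟩

theorem Unlinked.comps_union {Q : Finset E} (hu : Unlinked g P Q) :
    comps g (P ∪ Q) = comps g P ∪ comps g Q := by
  rw [comps, Finset.image_union]
  congr 1
  · exact Finset.image_congr fun i hi => hu.cls_union hi
  · rw [Finset.union_comm]
    exact Finset.image_congr fun i hi => hu.symm.cls_union hi

theorem unlinked_cls (i : E) : Unlinked g (cls g P i) (P \ cls g P i) := by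
  intro j hj k hk b c w hb hc
  rw [Finset.mem_sdiff, mem_cls, not_and] at hk
  rw [mem_cls] at hj
  exact hk.2 hk.1 (hj.2.trans (.of_mem hj.1 hk.1 hb hc))

theorem linkedIn_cls {i j k : E} (hj : j ∈ cls g P i) (hk : k ∈ cls g P i) :
    LinkedIn g (cls g P i) j k := by
  have hl : LinkedIn g (cls g P i ∪ P \ cls g P i) j k := by
    rw [Finset.union_sdiff_of_subset (cls_subset i)]
    exact (mem_cls.1 hj).2.symm.trans (mem_cls.1 hk).2
  exact (((unlinked_cls i).linkedIn hl).1 hj).2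

theorem comps_of_linked (hP : P.Nonempty) (hl : ∀ i ∈ P, ∀ j ∈ P, LinkedIn g P i j) :
    comps g P = {P} := by
  have : ∀ i ∈ P, cls g P i = P := fun i hi =>
    (cls_subset i).antisymm fun j hj => mem_cls.2 ⟨hj, hl i hi j hj⟩
  rw [comps, Finset.image_congr (g := fun _ => P) fun i hi => this i hi, Finset.image_const hP]

/-- The elements that may contribute to an orientation: edges and internal vertices. -/
def OriElt (E V : Type) : Type := E ⊕ₗ V

instance : LinearOrder (OriElt E V) := inferInstanceAs (LinearOrder (E ⊕ₗ V))

/-- An edge as an orientation element. -/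
def OriElt.edge (i : E) : OriElt E V := toLex (Sum.inl i)

/-- An internal vertex as an orientation element. -/
def OriElt.vert (w : V) : OriElt E V := toLex (Sum.inr w)

/-- The map of orientation elements induced by maps of edges and vertices. -/
def oriMap (a : E → E') (b : V → V') (o : OriElt E V) : OriElt E' V' :=
  toLex ((ofLex (show E ⊕ₗ V from o)).map a b)

theorem edge_injective : Function.Injective (OriElt.edge : E → OriElt E V) :=
  fun _ _ h => Sum.inl_injective (toLex.injective h)

theorem vert_injective : Function.Injective (OriElt.vert : V → OriElt E V) :=
  fun _ _ h => Sum.inr_injective (toLex.injective h)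

theorem edge_strictMono : StrictMono (OriElt.edge : E → OriElt E V) :=
  fun _ _ h => Sum.Lex.inl_lt_inl_iff.2 h

theorem vert_strictMono : StrictMono (OriElt.vert : V → OriElt E V) :=
  fun _ _ h => Sum.Lex.inr_lt_inr_iff.2 h

/-- The set of elements that provide the orientation. -/
def ori (n : ℕ) (g : Graph S V E) (P : Finset E) : Finset (OriElt E V) :=
  if Even n then P.image .edge else (verts g P).image .vert

theorem GMap.ori_image (n : ℕ) (M : GMap h a b f g P g') :
    ori n g' (P.image a) = (ori n g P).image (oriMap a b) := by
  unfold ori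
  split_ifs
  · rw [Finset.image_image, Finset.image_image]; rfl
  · rw [Finset.image_image, M.verts_image, Finset.image_image]; rfl

theorem GMap.injOn_oriMap (n : ℕ) (M : GMap h a b f g P g') : Set.InjOn (oriMap a b) (ori n g P) := by
  unfold ori
  split_ifs
  · intro x hx y hy hxy
    simp only [Finset.coe_image, Set.mem_image, Finset.mem_coe] at hx hy
    obtain ⟨i, hi, rfl⟩ := hx
    obtain ⟨j, hj, rfl⟩ := hy
    rw [M.injE hi hj (edge_injective (V := V') hxy)]
  · intro x hx y hy hxy
    simp only [Finset.coe_image, Set.mem_image, Finset.mem_coe] at hx hy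
    obtain ⟨i, hi, rfl⟩ := hx
    obtain ⟨j, hj, rfl⟩ := hy
    rw [M.injV hi hj (vert_injective (E := E') hxy)]

theorem GMap.invSign_oriMap (n : ℕ) (M : GMap h a b f g P g') : invSign (oriMap a b) (ori n g P) =
    if Even n then invSign a P else invSign b (verts g P) := by
  have hinj := M.injOn_oriMap n
  unfold ori at hinj ⊢
  split_ifs at hinj ⊢ with hn
  · have h1 := invSign_comp (φ := (OriElt.edge : E → OriElt E V)) (ψ := oriMap a b) (U := P)
      edge_injective.injOn hinj
    rw [invSign_of_strictMonoOn (φ := (OriElt.edge : E → OriElt E V)) (edge_strictMono.strictMonoOn _),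
      mul_one] at h1
    rw [← h1]
    have h2 := invSign_comp (φ := a) (ψ := (OriElt.edge : E' → OriElt E' V')) (U := P)
      M.injE edge_injective.injOn
    rw [invSign_of_strictMonoOn (φ := (OriElt.edge : E' → OriElt E' V'))
      (edge_strictMono.strictMonoOn _), one_mul] at h2
    exact h2
  · have h1 := invSign_comp (φ := (OriElt.vert : V → OriElt E V)) (ψ := oriMap a b)
      (U := verts g P) vert_injective.injOn hinj
    rw [invSign_of_strictMonoOn (φ := (OriElt.vert : V → OriElt E V)) (vert_strictMono.strictMonoOn _),
      mul_one] at h1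
    rw [← h1]
    have h2 := invSign_comp (φ := b) (ψ := (OriElt.vert : V' → OriElt E' V'))
      (U := verts g P) M.injV vert_injective.injOn
    rw [invSign_of_strictMonoOn (φ := (OriElt.vert : V' → OriElt E' V'))
      (vert_strictMono.strictMonoOn _), one_mul] at h2
    exact h2

theorem ori_disjoint (n : ℕ) {c c' : Finset E} (hc : c ∈ comps g P) (hc' : c' ∈ comps g P)
    (hne : c ≠ c') : Disjoint (ori n g c) (ori n g c') := by
  unfold ori
  split_ifs
  · exact (Finset.disjoint_image edge_injective).2 (comps_disjoint hc hc' hne)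
  · exact (Finset.disjoint_image vert_injective).2 (verts_disjoint hc hc' hne)

theorem biUnion_ori_comps (n : ℕ) : (comps g P).biUnion (ori n g) = ori n g P := by
  unfold ori
  split_ifs
  · rw [← Finset.biUnion_image]
    exact congrArg _ biUnion_comps
  · rw [← Finset.biUnion_image, biUnion_verts_comps]

theorem card_ori (n : ℕ) : (ori n g P).card = if Even n then P.card else (verts g P).card := by
  unfold ori
  split_ifs
  · exact Finset.card_image_of_injective _ edge_injective
  · exact Finset.card_image_of_injective _ vert_injective

end Components

section Extension

variable {R : Type} [Ring R] [Algebra ℚ R] {K : CoeffAlgebra R}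
variable {A : Type u} [NonUnitalRing A] [Module ℚ A] {D : DGCommAlgebra A}
variable {S V E : Type} [LinearOrder E] [LinearOrder V] [Fintype V]
variable {S' V' E' : Type} [LinearOrder E'] [LinearOrder V'] [Fintype V']
variable {h : S → S'} {a : E → E'} {b : V → V'} {f : E → Bool} {g : Graph S V E} {P : Finset E}
  {g' : Graph S' V' E'}

/-- The degree of the value of a degree zero series on a graph. -/
def graphDeg (n : ℕ) (g : Graph S V E) (P : Finset E) : ℤ := ((n : ℤ) - 1) * P.card - n * (verts g P).card

theorem evalOn_mem {n : ℕ} {m : ℤ} {x : Series K D} (hx : x ∈ HGC K D n m) {S V E : Type} [Fintype S]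
    [Fintype V] [LinearOrder V] [Fintype E] [LinearOrder E] (G : Graph S V E) :
    evalOn G x ∈ Tens.hd K D (((n : ℤ) - 1) * Fintype.card E - n * Fintype.card V - m) Set.univ := by
  have h1 := (hx _ _ _ fun i b => (G (monoEquivOfFin E rfl i) b).map (Fintype.equivFin S)
    (monoEquivOfFin V rfl).symm).1
  rw [Tens.part_eq_hd] at h1
  exact Tens.hd_mono (by simp) (Tens.rename_mem_hd (Fintype.equivFin S).symm h1)

/-- The external vertices incident to a set of edges. -/
def exts (g : Graph S V E) (P : Finset E) : Set S := {s | ∃ i ∈ P, ∃ b, g i b = .inl s}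

theorem range_legVertex : Set.range (legVertex g P) = exts g P := by
  ext s
  constructor
  · rintro ⟨p, rfl⟩
    exact ⟨p.1.1, p.1.1.2, p.1.2, by simp [legVertex]⟩
  · rintro ⟨i, hi, b, hb⟩
    exact ⟨⟨(⟨i, hi⟩, b), by simp [hb]⟩, by simp [legVertex, hb]⟩

theorem atom_mem {n : ℕ} {m : ℤ} {x : Series K D} (hx : x ∈ HGC K D n m) (g : Graph S V E)
    (P : Finset E) : atom x g P ∈ Tens.hd K D (graphDeg n g P - m) (exts g P) := by
  have := Tens.rename_mem_hd (legVertex g P) (evalOn_mem hx (restr g P))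
  rw [Set.image_univ, range_legVertex] at this
  simpa [graphDeg, atom] using this

theorem zpow_smul_eq {M : Type*} [AddCommGroup M] [Module ℚ M] {k : ℤ} {N : ℕ} (hk : Even (k - N)) (z : M) :
    (-1 : ℚ) ^ k • z = ((-1 : ℤ) ^ N) • z := by
  rcases Nat.even_or_odd N with hN | hN
  · have : Even k := by
      rw [Int.even_sub] at hk
      exact hk.2 (by exact_mod_cast hN)
    rw [this.neg_one_zpow, hN.neg_one_pow, one_smul, one_smul]
  · have : Odd k := by
      rw [Int.even_sub] at hk
      rw [← Int.not_even_iff_odd, hk, Int.not_even_iff_odd]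
      exact_mod_cast hN
    rw [this.neg_one_zpow, hN.neg_one_pow, neg_smul, neg_smul, one_smul, one_smul]

theorem even_graphDeg_sub (n : ℕ) (g : Graph S V E) (P : Finset E) :
    Even (graphDeg n g P - (ori n g P).card) := by
  unfold graphDeg
  rw [card_ori]
  split_ifs with hn
  · obtain ⟨k, rfl⟩ := hn
    exact ⟨k * P.card - k * (verts g P).card - P.card, by push_cast; ring⟩
  · obtain ⟨k, rfl⟩ := Nat.not_even_iff_odd.1 hn
    exact ⟨k * P.card - k * (verts g P).card - (verts g P).card, by push_cast; ring⟩

theorem hd_comm_of_even {m m' : ℤ} {N N' : ℕ} {U U' : Set S} {x y : Tens K D S}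
    (hx : x ∈ Tens.hd K D m U) (hy : y ∈ Tens.hd K D m' U') (h : Even (m - N)) (h' : Even (m' - N')) :
    x * y = ((-1 : ℤ) ^ (N * N')) • (y * x) := by
  rw [Tens.hd_comm hx hy, zpow_smul_eq]
  obtain ⟨k, hk⟩ := h
  obtain ⟨k', hk'⟩ := h'
  refine ⟨k * k' + k' * N + N' * k + k * k', ?_⟩
  have e1 : m = k + k + N := by linarith
  have e2 : m' = k' + k' + N' := by linarith
  rw [e1, e2]
  push_cast
  ring

theorem atom_comm {n : ℕ} {x : Series K D} (hx : x ∈ HGC K D n 0) {c c' : Finset E}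
    (hd : Disjoint (ori n g c) (ori n g c')) :
    atom x g c * atom x g c' =
      (kappa (ori n g c) (ori n g c') * kappa (ori n g c') (ori n g c)) • (atom x g c' * atom x g c) := by
  rw [kappa_swap hd]
  exact hd_comm_of_even (atom_mem hx g c) (atom_mem hx g c') (by simpa using even_graphDeg_sub n g c)
    (by simpa using even_graphDeg_sub n g c')

/-- The extension of a series to a multiplicative function on graphs. -/
def Fa (n : ℕ) (x : Series K D) (g : Graph S V E) (P : Finset E) : Tens K D S :=
  koszulProd (ori n g) (atom x g) (comps g P).toList

theorem Fa_eq_of_list {n : ℕ} {x : Series K D} (hx : x ∈ HGC K D n 0) {l : List (Finset E)}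
    (hl : l.Nodup) (h : ∀ c, c ∈ l ↔ c ∈ comps g P) : Fa n x g P = koszulProd (ori n g) (atom x g) l := by
  refine koszulProd_perm ?_ ?_
  · rw [List.perm_ext_iff_of_nodup (Finset.nodup_toList _) hl]
    intro c
    rw [Finset.mem_toList, h]
  · intro c hc c' hc' hne
    rw [Finset.mem_toList] at hc hc'
    exact atom_comm hx (ori_disjoint n hc hc' hne)

theorem Fa_empty (n : ℕ) (x : Series K D) (g : Graph S V E) : Fa n x g ∅ = 1 := by
  simp [Fa, comps, koszulProd]

theorem Fa_of_linked (n : ℕ) (x : Series K D) (hP : P.Nonempty)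
    (hl : ∀ i ∈ P, ∀ j ∈ P, LinkedIn g P i j) : Fa n x g P = atom x g P := by
  rw [Fa, comps_of_linked hP hl, Finset.toList_singleton]
  simp [koszulProd]

theorem Fa_union {n : ℕ} {x : Series K D} (hx : x ∈ HGC K D n 0) {Q : Finset E} (hu : Unlinked g P Q)
    (hd : Disjoint P Q) :
    Fa n x g (P ∪ Q) = kappa (ori n g P) (ori n g Q) • (Fa n x g P * Fa n x g Q) := by
  have hdc : Disjoint (comps g P) (comps g Q) := by
    rw [Finset.disjoint_left]
    intro c hc hc'
    obtain ⟨i, hi⟩ := nonempty_of_mem_comps hc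
    exact Finset.disjoint_left.1 hd (subset_of_mem_comps hc hi) (subset_of_mem_comps hc' hi)
  have hnd : ((comps g P).toList ++ (comps g Q).toList).Nodup := by
    rw [List.nodup_append']
    refine ⟨Finset.nodup_toList _, Finset.nodup_toList _, ?_⟩
    rw [List.disjoint_left]
    intro c hc hc'
    exact Finset.disjoint_left.1 hdc (Finset.mem_toList.1 hc) (Finset.mem_toList.1 hc')
  have hm : ∀ c, c ∈ (comps g P).toList ++ (comps g Q).toList ↔ c ∈ comps g (P ∪ Q) := by
    intro c; simp [hu.comps_union]
  rw [Fa_eq_of_list hx hnd hm, koszulProd_append hnd, Finset.toList_toFinset, Finset.toList_toFinset,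
    biUnion_ori_comps, biUnion_ori_comps]
  · rfl
  · intro c hc c' hc' hne
    exact ori_disjoint n ((hm c).1 hc) ((hm c').1 hc') hne

theorem Fa_nat {n : ℕ} {x : Series K D} (hx : x ∈ HGC K D n 0) (M : GMap h a b f g P g') :
    Fa n x g' (P.image a) = gsign n a b f g P • Tens.rename h (Fa n x g P) := by
  have hinj : Set.InjOn (Finset.image a) (comps g P : Set (Finset E)) := by
    intro c hc c' hc' hcc
    obtain ⟨i, hi⟩ := nonempty_of_mem_comps hc
    have : a i ∈ c'.image a := by
      have := Finset.mem_image_of_mem a hi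
      exact (show c.image a = c'.image a from hcc) ▸ this
    obtain ⟨j, hj, hji⟩ := Finset.mem_image.1 this
    have := M.injE (subset_of_mem_comps hc' hj) (subset_of_mem_comps hc hi) hji
    subst this
    exact (eq_cls_of_mem hc hi).trans (eq_cls_of_mem hc' hj).symm
  have hnd : ((comps g P).toList.map (Finset.image a)).Nodup := by
    refine (Finset.nodup_toList _).map_on ?_
    intro c hc c' hc' hcc
    exact hinj (Finset.mem_toList.1 hc) (Finset.mem_toList.1 hc') hcc
  rw [Fa_eq_of_list hx hnd (by intro c; simp [M.comps_image]), koszulProd_list_map]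
  set cs : Finset E → ℤ := fun c => if Even n then 1 else ∏ i ∈ c, flipSign (f i)
  have e1 : koszulProd (ori n g' ∘ Finset.image a) (atom x g' ∘ Finset.image a) (comps g P).toList =
      koszulProd (fun c => (ori n g c).image (oriMap a b))
        (fun c => (invSign (oriMap a b) (ori n g c) * cs c) •
          ((Tens.rename h : Tens K D S →ₐ[ℚ] Tens K D S') : Tens K D S →+* Tens K D S') (atom x g c))
        (comps g P).toList := by
    refine koszulProd_congr ?_ ?_
    · intro c hc
      exact (M.mono (subset_of_mem_comps (Finset.mem_toList.1 hc))).ori_image n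
    · intro c hc
      have Mc := M.mono (subset_of_mem_comps (Finset.mem_toList.1 hc))
      rw [Function.comp_apply, atom_nat hx Mc, Mc.invSign_oriMap]
      congr 1
      simp only [gsign, cs]
      split_ifs <;> simp
  rw [e1, koszulProd_map (B' := Tens K D S') (ι := Finset E) _ (Finset.nodup_toList _), Finset.toList_toFinset, biUnion_ori_comps,
    M.invSign_oriMap]
  · congr 1
    simp only [gsign, cs]
    split_ifs with hn
    · simp
    · congr 1
      rw [Finset.prod_map_toList]
      conv_rhs => rw [← biUnion_comps (g := g) (P := P)]
      rw [Finset.prod_biUnion]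
      · rfl
      · intro c hc c' hc' hne
        exact comps_disjoint hc hc' hne
  · intro c hc c' hc' hne
    exact ori_disjoint n (Finset.mem_toList.1 hc) (Finset.mem_toList.1 hc') hne
  · rw [Finset.toList_toFinset, biUnion_ori_comps]
    exact M.injOn_oriMap n

theorem koszulProd_mem {n : ℕ} {x : Series K D} (hx : x ∈ HGC K D n 0) (l : List (Finset E)) :
    koszulProd (ori n g) (atom x g) l ∈
      Tens.hd K D (l.map (graphDeg n g)).sum {s | ∃ c ∈ l, s ∈ exts g c} := by
  induction l with
  | nil => exact Tens.hd_mono (by simp) Tens.one_mem_hd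
  | cons c l ih =>
    refine zsmul_mem ?_ _
    have h1 := atom_mem hx g c
    rw [sub_zero] at h1
    refine Tens.hd_mono ?_ (Tens.hd_mul h1 ih)
    rintro s ⟨c', hc', hs⟩
    rcases List.mem_cons.1 hc' with rfl | hc'
    · exact .inl hs
    · exact .inr ⟨c', hc', hs⟩

theorem Fa_mem {n : ℕ} {x : Series K D} (hx : x ∈ HGC K D n 0) (g : Graph S V E) (P : Finset E) :
    Fa n x g P ∈ Tens.hd K D (graphDeg n g P) (exts g P) := by
  have h1 := koszulProd_mem (g := g) hx (comps g P).toList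
  have h2 : ((comps g P).toList.map (graphDeg n g)).sum = graphDeg n g P := by
    rw [Finset.sum_map_toList]
    unfold graphDeg
    rw [Finset.sum_sub_distrib, ← Finset.mul_sum, ← Finset.mul_sum, ← Nat.cast_sum, ← Nat.cast_sum,
      ← Finset.card_biUnion (fun c hc c' hc' hne => verts_disjoint hc hc' hne), biUnion_verts_comps]
    congr 3
    have := Finset.card_biUnion (s := comps g P) (t := id)
      (fun c hc c' hc' hne => comps_disjoint hc hc' hne)
    rw [biUnion_comps] at this
    exact this.symm
  rw [h2] at h1
  refine Tens.hd_mono ?_ h1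
  rintro s ⟨i, hi, c, hs⟩
  exact ⟨cls g P i, Finset.mem_toList.2 (mem_comps.2 ⟨i, hi, rfl⟩), i, self_mem_cls hi, c, hs⟩

/-- The extension only depends on the values on the components. -/
theorem Fa_congr {n : ℕ} {x y : Series K D} (h : ∀ c ∈ comps g P, atom x g c = atom y g c) :
    Fa n x g P = Fa n y g P :=
  koszulProd_congr (fun _ _ => rfl) fun c hc => h c (Finset.mem_toList.1 hc)

end Extension

section Contraction

variable {R : Type} [Ring R] [Algebra ℚ R] {K : CoeffAlgebra R}
variable {A : Type u} [NonUnitalRing A] [Module ℚ A] {D : DGCommAlgebra A}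
variable {S V E : Type} [LinearOrder E] [LinearOrder V] [Fintype V]
variable {S' V' E' : Type} [LinearOrder E'] [LinearOrder V'] [Fintype V']
variable {h : S → S'} {a : E → E'} {b : V → V'} {f : E → Bool} {g : Graph S V E} {P : Finset E}
  {g' : Graph S' V' E'} {i : E} {w : V} {z : S ⊕ V}

open scoped Classical in
/-- The graph obtained by moving all half-edges at the internal vertex `w` to `z`. -/
def cg (g : Graph S V E) (w : V) (z : S ⊕ V) : Graph S V E := fun i b =>
  if g i b = .inr w then z else g i b

theorem cg_of_eq {c : Bool} (h : g i c = .inr w) : cg g w z i c = z := by simp [cg, h]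

theorem cg_of_ne {c : Bool} (h : g i c ≠ .inr w) : cg g w z i c = g i c := by simp [cg, h]

/-- The edge `i` joins the internal vertex `w` to `z ≠ w`. -/
def Ends (g : Graph S V E) (i : E) (w : V) (z : S ⊕ V) : Prop :=
  z ≠ .inr w ∧ ∃ c, g i c = .inr w ∧ g i (!c) = z

/-- Internal vertices are not univalent. -/
def NoUniv (g : Graph S V E) (P : Finset E) : Prop :=
  ∀ i ∈ P, ∀ c w, g i c = .inr w → ∃ j ∈ P, ∃ c', (j, c') ≠ (i, c) ∧ g j c' = .inr w

theorem Ends.mem_verts (he : Ends g i w z) (hi : i ∈ P) : w ∈ verts g P := by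
  obtain ⟨-, c, hc, -⟩ := he
  exact HairyGraphs.mem_verts.2 ⟨i, hi, c, hc⟩

theorem Ends.eq_of_ne (he : Ends g i w z) {c : Bool} (hc : g i c ≠ .inr w) : g i c = z ∧ g i (!c) = .inr w := by
  obtain ⟨-, c', h1, h2⟩ := he
  cases c <;> cases c' <;> simp_all

theorem verts_cg (he : Ends g i w z) (hi : i ∈ P) (hP : NoUniv g P) :
    verts (cg g w z) (P.erase i) = (verts g P).erase w := by
  ext v
  simp only [mem_verts, Finset.mem_erase]
  constructor
  · rintro ⟨j, ⟨hji, hj⟩, c, hc⟩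
    by_cases hw : g j c = .inr w
    · rw [cg_of_eq hw] at hc
      subst hc
      obtain ⟨h1, c', h2, h3⟩ := he
      exact ⟨fun h => h1 (by rw [h]), i, hi, _, h3⟩
    · rw [cg_of_ne hw] at hc
      refine ⟨?_, j, hj, c, hc⟩
      rintro rfl
      exact hw hc
  · rintro ⟨hv, j, hj, c, hc⟩
    have key : ∀ j ∈ P, ∀ c, g j c = .inr v → j ≠ i →
        ∃ i_1, (i_1 ≠ i ∧ i_1 ∈ P) ∧ ∃ b, cg g w z i_1 b = .inr v := by
      intro j hj c hc hji
      refine ⟨j, ⟨hji, hj⟩, c, ?_⟩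
      rw [cg_of_ne (by rw [hc]; simpa using hv), hc]
    by_cases hji : j = i
    · subst hji
      obtain ⟨j', hj', c', hne, hc'⟩ := hP j hj c v hc
      refine key j' hj' c' hc' ?_
      rintro rfl
      have : c' = !c := by
        have : c' ≠ c := fun h => hne (by rw [h])
        cases c <;> cases c' <;> simp_all
      subst this
      have := (he.eq_of_ne (c := c) (by rw [hc]; simpa using hv)).2
      rw [hc'] at this
      exact hv (by simpa using this)
    · exact key j hj c hc hji

theorem NoUniv.cg (hP : NoUniv g P) (he : Ends g i w z) (hi : i ∈ P) :
    NoUniv (cg g w z) (P.erase i) := by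
  intro j hj c v hc
  rw [Finset.mem_erase] at hj
  have key : ∀ j' ∈ P, ∀ c', (j', c') ≠ (j, c) → j' ≠ i → HairyGraphs.cg g w z j' c' = .inr v →
      ∃ j' ∈ P.erase i, ∃ c', (j', c') ≠ (j, c) ∧ HairyGraphs.cg g w z j' c' = .inr v :=
    fun j' hj' c' h1 h2 h3 => ⟨j', Finset.mem_erase.2 ⟨h2, hj'⟩, c', h1, h3⟩
  obtain ⟨hz, ci, hci, hci'⟩ := he
  -- a half-edge at an end of `i` other than the half-edge of `i` itself
  by_cases hw : g j c = .inr w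
  · rw [cg_of_eq hw] at hc
    subst hc
    obtain ⟨j', hj', c', hne, hc'⟩ := hP i hi (!ci) v hci'
    have hj'i : j' ≠ i := by
      rintro rfl
      have : c' = ci := by
        have : c' ≠ !ci := fun h => hne (by rw [h])
        cases ci <;> cases c' <;> simp_all
      subst this
      rw [hci] at hc'
      exact hz hc'.symm
    refine key j' hj' c' ?_ hj'i ?_
    · rintro h
      simp only [Prod.mk.injEq] at h
      rw [h.1, h.2, hw] at hc'
      exact hz hc'.symm
    · rw [cg_of_ne (by rw [hc']; exact hz), hc']
  · rw [cg_of_ne hw] at hc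
    obtain ⟨j', hj', c', hne, hc'⟩ := hP j hj.2 c v hc
    by_cases hj'i : j' = i
    · subst hj'i
      have hvw : (Sum.inr v : S ⊕ V) ≠ .inr w := by rw [← hc]; exact hw
      have hc'' : c' = !ci := by
        by_contra h
        have : c' = ci := by cases ci <;> cases c' <;> simp_all
        rw [this, hci] at hc'
        exact hvw hc'.symm
      subst hc''
      have hzv : z = .inr v := by rw [← hci', hc']
      obtain ⟨k, hk, d, hne', hd⟩ := hP j' hj' ci w hci
      have hkj : k ≠ j' := by
        rintro rfl
        have : d = !ci := by
          have : d ≠ ci := fun h => hne' (by rw [h])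
          cases ci <;> cases d <;> simp_all
        rw [this, hci', hzv] at hd
        exact hvw hd
      refine key k hk d ?_ hkj ?_
      · rintro h
        simp only [Prod.mk.injEq] at h
        rw [h.1, h.2, hc] at hd
        exact hvw hd
      · rw [cg_of_eq hd, hzv]
    · refine key j' hj' c' hne hj'i ?_
      rw [cg_of_ne (by rw [hc', ← hc]; exact hw), hc']

/-- The orientation element that is removed by a contraction. -/
def remElt (n : ℕ) (i : E) (w : V) : OriElt E V := if Even n then .edge i else .vert w

theorem remElt_mem (n : ℕ) (he : Ends g i w z) (hi : i ∈ P) : remElt n i w ∈ ori n g P := by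
  unfold remElt ori
  split_ifs
  · exact Finset.mem_image_of_mem _ hi
  · exact Finset.mem_image_of_mem _ (he.mem_verts hi)

theorem ori_cg (n : ℕ) (he : Ends g i w z) (hi : i ∈ P) (hP : NoUniv g P) :
    ori n (cg g w z) (P.erase i) = (ori n g P).erase (remElt n i w) := by
  unfold remElt ori
  split_ifs
  · rw [Finset.image_erase edge_injective]
  · rw [verts_cg he hi hP, Finset.image_erase vert_injective]

theorem oriMap_remElt (n : ℕ) : oriMap a b (remElt n i w) = remElt n (a i) (b w) := by
  unfold remElt
  split_ifs <;> rfl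

/-- The sign given by the position of the removed orientation element. -/
def csgn (n : ℕ) (g : Graph S V E) (P : Finset E) (i : E) (w : V) : ℤ :=
  kappa {remElt n i w} (ori n g P)

/-- The sign given by the direction of a contracted edge. -/
def dirSign (n : ℕ) (g : Graph S V E) (i : E) (w : V) : ℤ :=
  open scoped Classical in if Even n then 1 else if g i true = .inr w then 1 else -1

theorem csgn_mul_self (n : ℕ) (g : Graph S V E) (P : Finset E) (i : E) (w : V) :
    csgn n g P i w * csgn n g P i w = 1 := kappa_mul_self _ _

/-- The sign of a contraction. -/
def conSign (n : ℕ) (g : Graph S V E) (P : Finset E) (i : E) (w : V) : ℤ :=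
  dirSign n g i w * csgn n g P i w

theorem GMap.ends (M : GMap h a b f g P g') (hi : i ∈ P) (he : Ends g i w z) :
    Ends g' (a i) (b w) (z.map h b) := by
  obtain ⟨hz, c, hc, hc'⟩ := he
  refine ⟨?_, xor c (f i), ?_, ?_⟩
  · rcases z with s | v
    · simp
    · intro hh
      refine hz ?_
      rw [M.injV (mem_verts.2 ⟨i, hi, _, hc'⟩) (mem_verts.2 ⟨i, hi, _, hc⟩) (by simpa using hh)]
  · rw [M.map i hi, Bool.xor_assoc, Bool.xor_self, Bool.xor_false, hc]; rfl
  · rw [M.map i hi, Bool.not_xor, Bool.xor_assoc, Bool.xor_self, Bool.xor_false, hc']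

theorem GMap.ends_iff (M : GMap h a b f g P g') (hi : i ∈ P) :
    (∃ w z, Ends g' (a i) w z) ↔ ∃ w z, Ends g i w z := by
  constructor
  · rintro ⟨w', z', hz, c, hc, hc'⟩
    rw [M.map i hi] at hc hc'
    rw [Bool.not_xor] at hc'
    rcases hv : g i (xor c (f i)) with s | w
    · simp [hv] at hc
    · refine ⟨w, _, ?_, _, hv, rfl⟩
      intro h
      rw [h] at hc'
      rw [hv] at hc
      exact hz (hc'.symm.trans hc)
  · rintro ⟨w, z, he⟩
    exact ⟨_, _, M.ends hi he⟩

theorem verts_cg_subset (he : Ends g i w z) (hi : i ∈ P) :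
    verts (cg g w z) (P.erase i) ⊆ verts g P := by
  intro v hv
  obtain ⟨j, hj, c, hc⟩ := mem_verts.1 hv
  by_cases hw : g j c = .inr w
  · rw [cg_of_eq hw] at hc
    obtain ⟨-, c', -, h3⟩ := he
    exact mem_verts.2 ⟨i, hi, _, h3.trans hc⟩
  · rw [cg_of_ne hw] at hc
    exact mem_verts.2 ⟨j, Finset.mem_of_mem_erase hj, c, hc⟩

theorem GMap.cg (M : GMap h a b f g P g') (hi : i ∈ P) (he : Ends g i w z) :
    GMap h a b f (cg g w z) (P.erase i) (cg g' (b w) (z.map h b)) where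
  injE := M.injE.mono (by simp)
  injV := M.injV.mono (by simpa using verts_cg_subset he hi)
  map j hj c := by
    have hj := Finset.mem_of_mem_erase hj
    by_cases hw : g j (xor c (f j)) = .inr w
    · rw [cg_of_eq hw, cg_of_eq]
      rw [M.map j hj, hw]; rfl
    · rw [cg_of_ne hw, cg_of_ne, M.map j hj]
      rw [M.map j hj]
      rcases hv : g j (xor c (f j)) with s | v
      · simp
      · intro hh
        refine hw ?_
        rw [hv, M.injV (mem_verts.2 ⟨j, hj, _, hv⟩) (he.mem_verts hi) (by simpa using hh)]

theorem GMap.image_erase (M : GMap h a b f g P g') (hi : i ∈ P) :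
    (P.image a).erase (a i) = (P.erase i).image a := by
  ext j
  simp only [Finset.mem_erase, Finset.mem_image]
  constructor
  · rintro ⟨hj, k, hk, rfl⟩
    exact ⟨k, ⟨fun h => hj (by rw [h]), hk⟩, rfl⟩
  · rintro ⟨k, ⟨hki, hk⟩, rfl⟩
    exact ⟨fun h => hki (M.injE hk hi h), k, hk, rfl⟩

theorem GMap.noUniv (M : GMap h a b f g P g') (hP : NoUniv g P) : NoUniv g' (P.image a) := by
  intro j hj c v hc
  obtain ⟨k, hk, rfl⟩ := Finset.mem_image.1 hj
  rw [M.map k hk] at hc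
  rcases hv : g k (xor c (f k)) with s | w
  · simp [hv] at hc
  · obtain ⟨l, hl, d, hne, hd⟩ := hP k hk _ w hv
    refine ⟨a l, Finset.mem_image_of_mem a hl, xor d (f l), ?_, ?_⟩
    · intro hh
      simp only [Prod.mk.injEq] at hh
      have := M.injE hl hk hh.1
      subst this
      refine hne ?_
      rw [← hh.2]
      simp
    · rw [M.map l hl, Bool.xor_assoc, Bool.xor_self, Bool.xor_false, hd, ← hc, hv]

theorem gsign_eq (n : ℕ) (M : GMap h a b f g P g') : gsign n a b f g P =
    invSign (oriMap a b) (ori n g P) * if Even n then 1 else ∏ i ∈ P, flipSign (f i) := by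
  rw [M.invSign_oriMap, gsign]
  split_ifs <;> simp

theorem GMap.dirSign (n : ℕ) (M : GMap h a b f g P g') (hi : i ∈ P) (he : Ends g i w z) :
    dirSign n g' (a i) (b w) = dirSign n g i w * if Even n then 1 else flipSign (f i) := by
  classical
  have h1 : ∀ c, g' (a i) c = .inr (b w) ↔ g i (xor c (f i)) = .inr w := by
    intro c
    rw [M.map i hi]
    rcases hv : g i (xor c (f i)) with s | v
    · simp
    · simp only [Sum.map_inr, Sum.inr.injEq]
      exact ⟨fun hh => M.injV (mem_verts.2 ⟨i, hi, _, hv⟩) (he.mem_verts hi) hh, fun hh => by rw [hh]⟩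
  have h2 : g i false = .inr w ↔ ¬ g i true = .inr w := by
    obtain ⟨hz, c, hc, hc'⟩ := he
    cases c
    · simp only [Bool.not_false] at hc'
      simp [hc, hc', hz]
    · simp only [Bool.not_true] at hc'
      simp [hc, hc', hz]
  unfold HairyGraphs.dirSign
  split_ifs with h3 h4 h5 h5
  · rfl
  all_goals
    rw [h1] at h4
    rcases hf : f i with _ | _
    · simp_all [flipSign]
    · simp_all [flipSign]

/-- The compatibility of signs of contractions with maps of graphs. -/
theorem GMap.conSign_mul (n : ℕ) (M : GMap h a b f g P g') (hi : i ∈ P) (he : Ends g i w z)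
    (hP : NoUniv g P) :
    conSign n g' (P.image a) (a i) (b w) * gsign n a b f (HairyGraphs.cg g w z) (P.erase i) =
      gsign n a b f g P * conSign n g P i w := by
  have hmem := remElt_mem n he hi
  have h1 : ori n g P = insert (remElt n i w) (ori n (HairyGraphs.cg g w z) (P.erase i)) := by
    rw [ori_cg n he hi hP, Finset.insert_erase hmem]
  have h2 : remElt n i w ∉ ori n (HairyGraphs.cg g w z) (P.erase i) := by
    rw [ori_cg n he hi hP]; simp
  have hinj := M.injOn_oriMap n
  have h3 : csgn n g' (P.image a) (a i) (b w) =
      ∏ q ∈ ori n (HairyGraphs.cg g w z) (P.erase i), ltSign (oriMap a b (remElt n i w)) (oriMap a b q) := by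
    rw [csgn, M.ori_image, ← oriMap_remElt, kappa, Finset.prod_singleton, Finset.prod_image hinj,
      h1, Finset.prod_insert h2]
    simp [ltSign]
  have h4 : csgn n g P i w = ∏ q ∈ ori n (HairyGraphs.cg g w z) (P.erase i), ltSign (remElt n i w) q := by
    rw [csgn, kappa, Finset.prod_singleton, h1, Finset.prod_insert h2]
    simp [ltSign]
  have h5 : invSign (oriMap a b) (ori n g P) = csgn n g P i w * csgn n g' (P.image a) (a i) (b w) *
      invSign (oriMap a b) (ori n (HairyGraphs.cg g w z) (P.erase i)) := by
    rw [h3, h4, ← Finset.prod_mul_distrib]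
    rw [h1] at hinj ⊢
    rw [invSign_insert h2 hinj]
    congr 1
    refine Finset.prod_congr rfl fun q hq => ?_
    have hne : remElt n i w ≠ q := by rintro rfl; exact h2 hq
    exact disSign_eq hne fun hh => hne (hinj (by simp) (by simp [hq]) hh)
  rw [gsign_eq n M, gsign_eq n (M.cg hi he), h5, conSign, conSign, M.dirSign n hi he]
  have h6 := csgn_mul_self n g P i w
  by_cases hn : Even n
  · simp only [if_pos hn]
    linear_combination (-HairyGraphs.dirSign n g i w * csgn n g' (P.image a) (a i) (b w) *
      invSign (oriMap a b) (ori n (HairyGraphs.cg g w z) (P.erase i))) * h6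
  · simp only [if_neg hn]
    rw [← Finset.mul_prod_erase P _ hi]
    linear_combination (-HairyGraphs.dirSign n g i w * csgn n g' (P.image a) (a i) (b w) *
      invSign (oriMap a b) (ori n (HairyGraphs.cg g w z) (P.erase i)) * flipSign (f i) *
      ∏ j ∈ P.erase i, flipSign (f j)) * h6

/-- The summand of the extension of a series to the boundary given by a contraction. -/
def cval (n : ℕ) (x : Series K D) (g : Graph S V E) (P : Finset E) (i : E) (w : V) (z : S ⊕ V) :
    Tens K D S := conSign n g P i w • Fa n x (cg g w z) (P.erase i)

/-- Either of the two ends of an edge may be removed by a contraction. -/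
theorem swapMap (g : Graph S V E) (P : Finset E) (i : E) {w u : V} (hne : u ≠ w) :
    GMap id id (Equiv.swap u w) (fun _ => false) (cg g w (.inr u)) (P.erase i) (cg g u (.inr w)) where
  injE := Function.injective_id.injOn
  injV := (Equiv.swap u w).injective.injOn
  map j hj c := by
    rw [Bool.xor_false, id]
    by_cases hw : g j c = .inr w
    · rw [cg_of_eq hw, cg_of_ne (by rw [hw]; simpa using hne.symm), hw]; simp
    · rw [cg_of_ne hw]
      by_cases hu : g j c = .inr u
      · rw [cg_of_eq hu, hu]; simp
      · rw [cg_of_ne hu]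
        rcases hv : g j c with s | v
        · rfl
        · rw [hv] at hu hw
          simp only [Sum.map_inr, Sum.inr.injEq] at hu hw ⊢
          rw [Equiv.swap_apply_of_ne_of_ne hu hw]

theorem conSign_swap (n : ℕ) {u : V} (he : Ends g i w (.inr u)) (hi : i ∈ P) (hP : NoUniv g P) :
    conSign n g P i u * gsign n id (Equiv.swap u w) (fun _ => false) (cg g w (.inr u)) (P.erase i) =
      conSign n g P i w := by
  classical
  have hne : u ≠ w := by
    rintro rfl
    exact he.1 rfl
  have he' : Ends g i u (.inr w) := by
    obtain ⟨hz, c, hc, hc'⟩ := he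
    exact ⟨by simpa using hne.symm, !c, hc', by simpa using hc⟩
  unfold conSign dirSign csgn remElt ori gsign
  by_cases hn : Even n
  · simp only [if_pos hn]
    rw [invSign_of_strictMonoOn (strictMono_id.strictMonoOn _)]
    ring
  · simp only [if_neg hn]
    rw [verts_cg he hi hP]
    have hu : u ∈ (verts g P).erase w := Finset.mem_erase.2 ⟨hne, he'.mem_verts hi⟩
    set U := ((verts g P).erase w).erase u
    have hU : ∀ q ∈ U, q ≠ u ∧ q ≠ w := by
      intro q hq
      simp only [U, Finset.mem_erase] at hq
      exact ⟨hq.1, hq.2.1⟩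
    have h1 : verts g P = insert w (insert u U) := by
      rw [Finset.insert_erase hu, Finset.insert_erase (he.mem_verts hi)]
    have hw : w ∉ insert u U := by simp [U, hne.symm]
    have huU : u ∉ U := by simp [U]
    have h2 : (verts g P).erase w = insert u U := (Finset.insert_erase hu).symm
    rw [h2, invSign_insert huU (Equiv.injective _).injOn, kappa, kappa, Finset.prod_singleton,
      Finset.prod_singleton, Finset.prod_image vert_injective.injOn,
      Finset.prod_image vert_injective.injOn, h1]
    rw [Finset.prod_insert hw, Finset.prod_insert huU, Finset.prod_insert hw, Finset.prod_insert huU]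
    have e0 : invSign (Equiv.swap u w) U = 1 := by
      have : invSign (Equiv.swap u w) U = invSign id U :=
        invSign_congr fun q hq => Equiv.swap_apply_of_ne_of_ne (hU q hq).1 (hU q hq).2
      rw [this]
      exact invSign_of_strictMonoOn (strictMono_id.strictMonoOn _)
    have lt_vert : ∀ p q : V, ltSign (OriElt.vert p : OriElt E V) (.vert q) = ltSign p q := by
      intro p q; simp [ltSign, vert_strictMono.lt_iff_lt]
    simp only [lt_vert]
    have e1 : ∏ q ∈ U, disSign (Equiv.swap u w) u q = (∏ q ∈ U, ltSign u q) * ∏ q ∈ U, ltSign w q := by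
      rw [← Finset.prod_mul_distrib]
      refine Finset.prod_congr rfl fun q hq => ?_
      rw [disSign_eq (hU q hq).1.symm fun hh => (hU q hq).1.symm ((Equiv.swap u w).injective hh),
        Equiv.swap_apply_left, Equiv.swap_apply_of_ne_of_ne (hU q hq).1 (hU q hq).2]
    have e2 : (∏ q ∈ U, ltSign u q) * ∏ q ∈ U, ltSign u q = 1 := by
      rw [← Finset.prod_mul_distrib]
      exact Finset.prod_eq_one fun q _ => ltSign_mul_self _ _
    have e3 : ltSign u u = 1 := by simp [ltSign]
    have e4 : ltSign w w = 1 := by simp [ltSign]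
    have e5 : ltSign w u = - ltSign u w := by
      have h3 := ltSign_swap hne
      have h4 := ltSign_mul_self u w
      linear_combination ltSign u w * h3 - ltSign w u * h4
    have e6 : (if g i true = Sum.inr u then (1 : ℤ) else -1) =
        - (if g i true = Sum.inr w then 1 else -1) := by
      obtain ⟨hz, c, hc, hc'⟩ := he
      cases c
      · simp only [Bool.not_false] at hc'
        simp [hc', hne]
      · simp only [Bool.not_true] at hc'
        simp [hc, hne.symm]
    rw [e0, e1, e3, e4, e5, e6]
    simp only [flipSign, Bool.false_eq_true, if_false, Finset.prod_const_one]
    linear_combination ((if g i true = Sum.inr w then 1 else -1) * (-ltSign u w) *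
      (∏ q ∈ U, ltSign w q)) * e2

theorem cval_swap {n : ℕ} {x : Series K D} (hx : x ∈ HGC K D n 0) {u : V} (he : Ends g i w (.inr u))
    (hi : i ∈ P) (hP : NoUniv g P) : cval n x g P i u (.inr w) = cval n x g P i w (.inr u) := by
  have hne : u ≠ w := by
    rintro rfl
    exact he.1 rfl
  have h1 := Fa_nat hx (swapMap g P i hne)
  rw [Finset.image_id, Tens.rename_id] at h1
  rw [cval, cval, h1, smul_smul, conSign_swap n he hi hP]

theorem Ends.eq_or {w' : V} {z' : S ⊕ V} (he : Ends g i w z) (he' : Ends g i w' z') :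
    (w = w' ∧ z = z') ∨ (z = .inr w' ∧ z' = .inr w) := by
  obtain ⟨hz, c, hc, hc'⟩ := he
  obtain ⟨hz', d, hd, hd'⟩ := he'
  by_cases hcd : d = c
  · subst hcd
    left
    rw [hc] at hd
    exact ⟨by simpa using hd, hc'.symm.trans hd'⟩
  · have : d = !c := by cases c <;> cases d <;> simp_all
    subst this
    right
    rw [Bool.not_not] at hd'
    exact ⟨hc'.symm.trans hd, hd'.symm.trans hc⟩

open scoped Classical in
/-- The summand of the extension of a series to the boundary given by an edge. -/
def cterm (n : ℕ) (x : Series K D) (g : Graph S V E) (P : Finset E) (i : E) : Tens K D S :=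
  if h : ∃ w z, Ends g i w z then cval n x g P i h.choose h.choose_spec.choose else 0

theorem cterm_eq {n : ℕ} {x : Series K D} (hx : x ∈ HGC K D n 0) (he : Ends g i w z)
    (hi : i ∈ P) (hP : NoUniv g P) : cterm n x g P i = cval n x g P i w z := by
  have h : ∃ w z, Ends g i w z := ⟨w, z, he⟩
  have key : ∀ w' z', Ends g i w' z' → cval n x g P i w' z' = cval n x g P i w z := by
    intro w' z' he'
    rcases he.eq_or he' with ⟨rfl, rfl⟩ | ⟨rfl, rfl⟩
    · rfl
    · exact cval_swap hx he hi hP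
  rw [cterm, dif_pos h]
  exact key _ _ h.choose_spec.choose_spec

theorem cterm_of_not {n : ℕ} {x : Series K D} (h : ¬ ∃ w z, Ends g i w z) : cterm n x g P i = 0 :=
  dif_neg h

theorem cval_nat {n : ℕ} {x : Series K D} (hx : x ∈ HGC K D n 0) (M : GMap h a b f g P g')
    (he : Ends g i w z) (hi : i ∈ P) (hP : NoUniv g P) :
    cval n x g' (P.image a) (a i) (b w) (z.map h b) =
      gsign n a b f g P • Tens.rename h (cval n x g P i w z) := by
  rw [cval, M.image_erase hi, Fa_nat hx (M.cg hi he), smul_smul, M.conSign_mul n hi he hP, cval,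
    map_zsmul, smul_smul]

theorem cterm_nat {n : ℕ} {x : Series K D} (hx : x ∈ HGC K D n 0) (M : GMap h a b f g P g')
    (hi : i ∈ P) (hP : NoUniv g P) :
    cterm n x g' (P.image a) (a i) = gsign n a b f g P • Tens.rename h (cterm n x g P i) := by
  by_cases hex : ∃ w z, Ends g i w z
  · obtain ⟨w, z, he⟩ := hex
    rw [cterm_eq hx (M.ends hi he) (Finset.mem_image_of_mem a hi) (M.noUniv hP), cterm_eq hx he hi hP,
      cval_nat hx M he hi hP]
  · rw [cterm_of_not hex, cterm_of_not (by rwa [M.ends_iff hi]), map_zero, smul_zero]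

/-- The curvature, for the extension of a series. -/
def curvA (n : ℕ) (x : Series K D) (g : Graph S V E) (P : Finset E) : Tens K D S :=
  Tens.d (Fa n x g P) - ∑ i ∈ P, cterm n x g P i

theorem curvA_nat {n : ℕ} {x : Series K D} (hx : x ∈ HGC K D n 0) (M : GMap h a b f g P g')
    (hP : NoUniv g P) :
    curvA n x g' (P.image a) = gsign n a b f g P • Tens.rename h (curvA n x g P) := by
  rw [curvA, curvA, Fa_nat hx M, Finset.sum_image M.injE, map_zsmul, Tens.d_rename, map_sub, smul_sub,
    map_sum, Finset.smul_sum]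
  congr 1
  exact Finset.sum_congr rfl fun i hi => cterm_nat hx M hi hP

end Contraction

section Comparison

variable {R : Type} [Ring R] [Algebra ℚ R] {K : CoeffAlgebra R}
variable {A : Type u} [NonUnitalRing A] [Module ℚ A] {D : DGCommAlgebra A}
variable {S V E : Type} [LinearOrder E] [LinearOrder V] [Fintype V]

theorem koszulProd_eq_prod {Ω ι : Type} [LinearOrder Ω] [LinearOrder ι] {B : Type u} [Ring B]
    (P : ι → Finset Ω) (y : ι → B) {l : List ι} (hl : l.Pairwise (· < ·)) :
    koszulProd P y l =
      (∏ i ∈ l.toFinset, ∏ j ∈ l.toFinset, if i < j then kappa (P i) (P j) else 1) • (l.map y).prod := by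
  induction l with
  | nil => simp [koszulProd]
  | cons i l ih =>
    rw [List.pairwise_cons] at hl
    have hi : i ∉ l.toFinset := fun h => lt_irrefl _ (hl.1 i (by simpa using h))
    have hnd : l.Nodup := hl.2.imp fun h => h.ne
    rw [koszulProd, ih hl.2, List.toFinset_cons, Finset.prod_insert hi, Finset.prod_insert hi,
      if_neg (lt_irrefl i), one_mul, List.map_cons, List.prod_cons, mul_smul_comm, smul_smul]
    congr 2
    · rw [← List.prod_toFinset _ hnd]
      exact Finset.prod_congr rfl fun j hj => by rw [if_pos (hl.1 j (by simpa using hj))]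
    · refine Finset.prod_congr rfl fun j hj => ?_
      rw [Finset.prod_insert hi, if_neg (hl.1 j (by simpa using hj)).not_gt, one_mul]

theorem kappa_vert {P Q : Finset V} :
    kappa (P.image OriElt.vert : Finset (OriElt E V)) (Q.image .vert) = kappa P Q := by
  unfold kappa
  rw [Finset.prod_image vert_injective.injOn]
  refine Finset.prod_congr rfl fun p _ => ?_
  rw [Finset.prod_image vert_injective.injOn]
  refine Finset.prod_congr rfl fun q _ => ?_
  simp [ltSign, vert_strictMono.lt_iff_lt]

theorem kappa_edge {P Q : Finset E} :
    kappa (P.image OriElt.edge : Finset (OriElt E V)) (Q.image .edge) = kappa P Q := by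
  unfold kappa
  rw [Finset.prod_image edge_injective.injOn]
  refine Finset.prod_congr rfl fun p _ => ?_
  rw [Finset.prod_image edge_injective.injOn]
  refine Finset.prod_congr rfl fun q _ => ?_
  simp [ltSign, edge_strictMono.lt_iff_lt]

/-- The sign of a shuffle counts the inversions. -/
theorem prod_kappa_fiber {X ι : Type} [LinearOrder X] [LinearOrder ι] (T : Finset X) (ρ : X → ι)
    (I : Finset ι) (hI : ∀ p ∈ T, ρ p ∈ I) :
    (∏ i ∈ I, ∏ j ∈ I, if i < j then kappa (T.filter (ρ · = i)) (T.filter (ρ · = j)) else 1) =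
      (-1) ^ ((T ×ˢ T).filter fun p => p.1 < p.2 ∧ ρ p.2 < ρ p.1).card := by
  have h1 : ∀ i ∈ I, ∀ j ∈ I, (if i < j then kappa (T.filter (ρ · = i)) (T.filter (ρ · = j)) else 1) =
      ∏ p ∈ T.filter (ρ · = i), ∏ q ∈ T.filter (ρ · = j), if q < p ∧ ρ p < ρ q then (-1 : ℤ) else 1 := by
    intro i _ j _
    have : ∀ p ∈ T.filter (ρ · = i), ∀ q ∈ T.filter (ρ · = j),
        (if q < p ∧ ρ p < ρ q then (-1 : ℤ) else 1) = if i < j then ltSign p q else 1 := by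
      intro p hp q hq
      rw [(Finset.mem_filter.1 hp).2, (Finset.mem_filter.1 hq).2]
      unfold ltSign
      by_cases hij : i < j <;> simp [hij]
    rw [Finset.prod_congr rfl fun p hp => Finset.prod_congr rfl fun q hq => this p hp q hq]
    split_ifs
    · rfl
    · simp
  rw [Finset.prod_congr rfl fun i hi => Finset.prod_congr rfl fun j hj => h1 i hi j hj]
  have h2 : ∀ i ∈ I, (∏ j ∈ I, ∏ p ∈ T.filter (ρ · = i), ∏ q ∈ T.filter (ρ · = j),
      if q < p ∧ ρ p < ρ q then (-1 : ℤ) else 1) = ∏ p ∈ T.filter (ρ · = i), ∏ q ∈ T,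
      if q < p ∧ ρ p < ρ q then (-1 : ℤ) else 1 := by
    intro i _
    rw [Finset.prod_comm]
    refine Finset.prod_congr rfl fun p _ => ?_
    exact Finset.prod_fiberwise_of_maps_to hI _
  rw [Finset.prod_congr rfl h2, Finset.prod_fiberwise_of_maps_to hI, Finset.prod_comm,
    ← Finset.prod_product', Finset.prod_ite]
  simp

theorem linked_iff [Fintype E] {G : Graph S V E} {i j : E} :
    Linked G i j ↔ LinkedIn G Finset.univ i j := by
  unfold Linked LinkedIn
  simp

theorem rep_eq_iff [Fintype E] {G : Graph S V E} {i j : E} : rep G i = rep G j ↔ Linked G i j := by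
  classical
  have hself : ∀ i, Linked G i (rep G i) := fun i =>
    (Finset.mem_filter.1 (Finset.min'_mem (Finset.univ.filter fun j => Linked G i j) _)).2
  constructor
  · intro h
    have h2 := hself j
    rw [← h] at h2
    exact (hself i).trans _ _ _ (h2.symm)
  · intro h
    unfold rep
    congr 1
    ext k
    simp only [Finset.mem_filter, Finset.mem_univ, true_and]
    exact ⟨fun hk => (h.symm).trans _ _ _ hk, fun hk => h.trans _ _ _ hk⟩

/-- The set of edges of the component with least edge `c`. -/
def compFinset [Fintype E] (G : Graph S V E) (c : E) : Finset E := Finset.univ.filter (rep G · = c)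

theorem compFinset_rep [Fintype E] (G : Graph S V E) (i : E) :
    compFinset G (rep G i) = cls G Finset.univ i := by
  ext j
  rw [compFinset, Finset.mem_filter, mem_cls, rep_eq_iff, linked_iff]
  exact and_congr Iff.rfl ⟨LinkedIn.symm, LinkedIn.symm⟩

theorem evalOn_component [Fintype E] {n : ℕ} {m : ℤ} {x : Series K D} (hx : x ∈ HGC K D n m)
    (G : Graph S V E) (c : E) [Fintype (CompS G c)] [Fintype (CompV G c)] [Fintype (CompE G c)] :
    Tens.rename (leg G c) (evalOn (component G c) x) = atom x G (compFinset G c) := by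
  have hE : ∀ i, rep G i = c ↔ i ∈ compFinset G c := by simp [compFinset]
  have hV : ∀ w, (∃ i b, rep G i = c ∧ G i b = .inr w) ↔ w ∈ verts G (compFinset G c) := by
    simp [mem_verts, compFinset]
  let eE : CompE G c ≃ {i // i ∈ compFinset G c} := Equiv.subtypeEquivRight hE
  let eV : CompV G c ≃ {i // i ∈ verts G (compFinset G c)} := Equiv.subtypeEquivRight hV
  let eS : CompS G c ≃ Legs G (compFinset G c) :=
    (eE.prodCongr (Equiv.refl Bool)).subtypeEquiv fun p => Iff.rfl
  have h := evalOn_iso hx (component G c) (restr G (compFinset G c)) eS eV eE (fun _ => false) (by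
    intro i b
    rw [Bool.xor_false]
    rcases hv : G i b with s | w
    · have h1 : (G i b).isLeft := by simp [hv]
      rw [restr_inl (i := eE i) h1]
      simp only [component, h1, dite_true]
      rfl
    · have h1 : (G (eE i) b) = .inr w := hv
      rw [restr_inr (i := eE i) h1]
      have h2 : component G c i b = .inr ⟨w, i, b, i.2, hv⟩ := by simp [component, hv]
      rw [h2]
      rfl)
  rw [atom, h]
  have s1 : invSign eE (Finset.univ : Finset (CompE G c)) = 1 := invSign_of_strictMonoOn fun _ _ _ _ h => h
  have s2 : invSign eV (Finset.univ : Finset (CompV G c)) = 1 := invSign_of_strictMonoOn fun _ _ _ _ h => h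
  simp only [s1, s2, flipSign]
  simp only [Bool.false_eq_true, if_false, Finset.prod_const_one, mul_one, ite_self, one_smul]
  rw [Tens.rename_rename]
  rfl

theorem extend_eq [Fintype E] {n : ℕ} {x : Series K D} (hx : x ∈ HGC K D n 0) (G : Graph S V E) :
    extend n x G = Fa n x G Finset.univ := by
  classical
  set I := Finset.univ.image (rep G)
  have hsort : (I.sort (· ≤ ·)).Pairwise (· < ·) := Finset.sortedLT_sort I |>.pairwise
  have hcomp : ∀ c ∈ I, ∃ i, rep G i = c ∧ compFinset G c = cls G Finset.univ i := by
    intro c hc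
    obtain ⟨i, -, rfl⟩ := Finset.mem_image.1 hc
    exact ⟨i, rfl, compFinset_rep G i⟩
  have hnd : ((I.sort (· ≤ ·)).map (compFinset G)).Nodup := by
    refine (Finset.sort_nodup I _).map_on ?_
    intro c hc c' hc' hcc
    rw [Finset.mem_sort] at hc hc'
    obtain ⟨i, hi, -⟩ := hcomp c hc
    have : i ∈ compFinset G c' := by rw [← hcc]; simp [compFinset, hi]
    rw [← hi]
    exact (Finset.mem_filter.1 this).2
  have hm : ∀ c, c ∈ (I.sort (· ≤ ·)).map (compFinset G) ↔ c ∈ comps G Finset.univ := by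
    intro c
    rw [List.mem_map, mem_comps]
    constructor
    · rintro ⟨c', hc', rfl⟩
      rw [Finset.mem_sort] at hc'
      obtain ⟨i, hi, h⟩ := hcomp c' hc'
      exact ⟨i, Finset.mem_univ i, h.symm⟩
    · rintro ⟨i, -, rfl⟩
      exact ⟨rep G i, by simp [I], compFinset_rep G i⟩
  rw [Fa_eq_of_list hx hnd hm, koszulProd_list_map, koszulProd_eq_prod _ _ hsort, extend]
  have hmap : (I.sort (· ≤ ·)).map (fun c => Tens.rename (leg G c) (evalOn (component G c) x)) =
      (I.sort (· ≤ ·)).map (atom x G ∘ compFinset G) := by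
    refine List.map_congr_left fun c _ => ?_
    exact evalOn_component hx G c
  rw [hmap]
  congr 1
  rw [Finset.sort_toFinset, shuffleSign]
  split_ifs with hn
  · have h1 : ∀ c, (ori n G ∘ compFinset G) c = (compFinset G c).image .edge := by
      intro c; simp [ori, hn]
    simp only [h1, kappa_edge]
    rw [show compFinset G = fun c => Finset.univ.filter (rep G · = c) from rfl,
      prod_kappa_fiber Finset.univ (rep G) I (by simp [I])]
    simp
  · have h1 : ∀ c, (ori n G ∘ compFinset G) c = (verts G (compFinset G c)).image .vert := by
      intro c; simp [ori, hn]
    simp only [h1, kappa_vert]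
    by_cases hE : IsEmpty E
    · simp [I]
    have hE' : Nonempty E := not_isEmpty_iff.1 hE
    let ρ : V → E := fun w => if h : ∃ i b, G i b = .inr w then rep G h.choose else hE'.some
    have hρ : ∀ i b w, G i b = .inr w → ρ w = rep G i := by
      intro i b w h
      have h' : ∃ i b, G i b = .inr w := ⟨i, b, h⟩
      simp only [ρ, dif_pos h']
      rw [rep_eq_iff]
      obtain ⟨c, hc⟩ := h'.choose_spec
      exact .rel _ _ ⟨w, c, b, hc, h⟩
    have h2 : ∀ c, verts G (compFinset G c) = (verts G Finset.univ).filter (ρ · = c) := by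
      intro c
      ext w
      simp only [mem_verts, Finset.mem_filter, compFinset, Finset.mem_univ, true_and]
      constructor
      · rintro ⟨i, rfl, b, hb⟩
        exact ⟨⟨i, b, hb⟩, hρ i b w hb⟩
      · rintro ⟨⟨i, b, hb⟩, h⟩
        exact ⟨i, by rw [← h, hρ i b w hb], b, hb⟩
    simp only [h2]
    rw [prod_kappa_fiber _ ρ I]
    · congr 2
      ext ⟨p, q⟩
      simp only [Finset.mem_filter, Finset.mem_univ, true_and, Finset.mem_product, mem_verts]
      constructor
      · rintro ⟨hpq, i, j, b, c, hb, hc, hlt⟩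
        exact ⟨⟨⟨i, b, hb⟩, j, c, hc⟩, hpq, by rwa [hρ i b p hb, hρ j c q hc]⟩
      · rintro ⟨⟨⟨i, b, hb⟩, j, c, hc⟩, hpq, hlt⟩
        exact ⟨hpq, i, j, b, c, hb, hc, by rwa [hρ i b p hb, hρ j c q hc] at hlt⟩
    · intro p hp
      obtain ⟨i, -, b, hb⟩ := mem_verts.1 hp
      rw [hρ i b p hb]
      simp [I]

end Comparison

section Splitting

variable {R : Type} [Ring R] [Algebra ℚ R] {K : CoeffAlgebra R}
variable {A : Type u} [NonUnitalRing A] [Module ℚ A] {D : DGCommAlgebra A}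
variable {S V E : Type} [LinearOrder E] [LinearOrder V] [Fintype V]
variable {S' V' E' : Type} [LinearOrder E'] [LinearOrder V'] [Fintype V']
variable {h : S → S'} {a : E → E'} {b : V → V'} {f : E → Bool} {g : Graph S V E} {P : Finset E}
  {g' : Graph S' V' E'} {i : E} {w : V} {z : S ⊕ V}

theorem atom_sub (x y : Series K D) (g : Graph S V E) (P : Finset E) :
    atom (x - y) g P = atom x g P - atom y g P := by simp [atom]

/-- A contraction of an edge between internal vertices. -/
def sval (n : ℕ) (y : Series K D) (g : Graph S V E) (P : Finset E) (i : E) (w : V) (z : S ⊕ V) :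
    Tens K D S := conSign n g P i w • atom y (cg g w z) (P.erase i)

theorem sval_swap {n : ℕ} {m : ℤ} {y : Series K D} (hy : y ∈ HGC K D n m) {u : V}
    (he : Ends g i w (.inr u)) (hi : i ∈ P) (hP : NoUniv g P) :
    sval n y g P i u (.inr w) = sval n y g P i w (.inr u) := by
  have hne : u ≠ w := by
    rintro rfl
    exact he.1 rfl
  have h1 := atom_nat hy (swapMap g P i hne)
  rw [Finset.image_id, Tens.rename_id] at h1
  rw [sval, sval, h1, smul_smul, conSign_swap n he hi hP]

open scoped Classical in
/-- The summand of the vertex splitting differential given by an edge. -/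
def sterm (n : ℕ) (y : Series K D) (g : Graph S V E) (P : Finset E) (i : E) : Tens K D S :=
  if h : ∃ w u, Ends g i w (.inr u) then sval n y g P i h.choose (.inr h.choose_spec.choose) else 0

theorem sterm_eq {n : ℕ} {m : ℤ} {y : Series K D} (hy : y ∈ HGC K D n m) {u : V}
    (he : Ends g i w (.inr u)) (hi : i ∈ P) (hP : NoUniv g P) :
    sterm n y g P i = sval n y g P i w (.inr u) := by
  have h : ∃ w u, Ends g i w (.inr u) := ⟨w, u, he⟩
  have key : ∀ w' u', Ends g i w' (.inr u') → sval n y g P i w' (.inr u') = sval n y g P i w (.inr u) := by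
    intro w' u' he'
    rcases he.eq_or he' with ⟨h1, h2⟩ | ⟨h1, h2⟩
    · rw [h1, h2]
    · rw [h2, ← Sum.inr_injective h1]
      exact sval_swap hy he hi hP
  rw [sterm, dif_pos h]
  exact key _ _ h.choose_spec.choose_spec

theorem sterm_of_not {n : ℕ} {y : Series K D} (h : ¬ ∃ w u, Ends g i w (.inr u)) :
    sterm n y g P i = 0 := dif_neg h

theorem GMap.ends_inr_iff (M : GMap h a b f g P g') (hi : i ∈ P) :
    (∃ w u, Ends g' (a i) w (.inr u)) ↔ ∃ w u, Ends g i w (.inr u) := by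
  constructor
  · rintro ⟨w', u', he'⟩
    obtain ⟨w, z, he⟩ := (M.ends_iff hi).1 ⟨w', _, he'⟩
    rcases z with s | u
    · rcases he'.eq_or (M.ends hi he) with ⟨-, h2⟩ | ⟨h1, h2⟩
      · simp at h2
      · simp at h2
    · exact ⟨w, u, he⟩
  · rintro ⟨w, u, he⟩
    exact ⟨_, _, M.ends hi he⟩

theorem sval_nat {n : ℕ} {m : ℤ} {y : Series K D} (hy : y ∈ HGC K D n m) (M : GMap h a b f g P g')
    (he : Ends g i w z) (hi : i ∈ P) (hP : NoUniv g P) :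
    sval n y g' (P.image a) (a i) (b w) (z.map h b) =
      gsign n a b f g P • Tens.rename h (sval n y g P i w z) := by
  rw [sval, M.image_erase hi, atom_nat hy (M.cg hi he), smul_smul, M.conSign_mul n hi he hP, sval,
    map_zsmul, smul_smul]

theorem sterm_nat {n : ℕ} {m : ℤ} {y : Series K D} (hy : y ∈ HGC K D n m) (M : GMap h a b f g P g')
    (hi : i ∈ P) (hP : NoUniv g P) :
    sterm n y g' (P.image a) (a i) = gsign n a b f g P • Tens.rename h (sterm n y g P i) := by
  by_cases hex : ∃ w u, Ends g i w (.inr u)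
  · obtain ⟨w, u, he⟩ := hex
    rw [sterm_eq hy (M.ends hi he) (Finset.mem_image_of_mem a hi) (M.noUniv hP), sterm_eq hy he hi hP]
    exact sval_nat hy M he hi hP
  · rw [sterm_of_not hex, sterm_of_not (by rwa [M.ends_inr_iff hi]), map_zero, smul_zero]

/-- The vertex splitting differential. -/
def splitA (n : ℕ) (y : Series K D) (g : Graph S V E) (P : Finset E) : Tens K D S :=
  ∑ i ∈ P, sterm n y g P i

theorem splitA_nat {n : ℕ} {m : ℤ} {y : Series K D} (hy : y ∈ HGC K D n m) (M : GMap h a b f g P g')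
    (hP : NoUniv g P) :
    splitA n y g' (P.image a) = gsign n a b f g P • Tens.rename h (splitA n y g P) := by
  rw [splitA, splitA, Finset.sum_image M.injE, map_sum, Finset.smul_sum]
  exact Finset.sum_congr rfl fun i hi => sterm_nat hy M hi hP

end Splitting

section Primitive

variable {R : Type} [Ring R] [Algebra ℚ R] {K : CoeffAlgebra R}
variable {A : Type u} [NonUnitalRing A] [Module ℚ A] {D : DGCommAlgebra A}
variable {S V E : Type} [LinearOrder E] [LinearOrder V] [Fintype V]

/-- External vertices are univalent. -/
def UnivExt (g : Graph S V E) (P : Finset E) : Prop :=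
  ∀ s, ∃! p : E × Bool, p.1 ∈ P ∧ g p.1 p.2 = .inl s

theorem UnivExt.bijective {g : Graph S V E} {P : Finset E} (h : UnivExt g P) :
    Function.Bijective (legVertex g P) := by
  constructor
  · intro p q hpq
    have hp : g p.1.1 p.1.2 = .inl (legVertex g P p) := by simp [legVertex]
    have hq : g q.1.1 q.1.2 = .inl (legVertex g P p) := by rw [hpq]; simp [legVertex]
    have := (h (legVertex g P p)).unique (y₁ := (p.1.1.1, p.1.2)) (y₂ := (q.1.1.1, q.1.2))
      ⟨p.1.1.2, hp⟩ ⟨q.1.1.2, hq⟩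
    simp only [Prod.mk.injEq] at this
    exact Subtype.ext (Prod.ext (Subtype.ext this.1) this.2)
  · intro s
    obtain ⟨⟨i, b⟩, ⟨hi, hb⟩, -⟩ := h s
    simp only at hi hb
    exact ⟨⟨(⟨i, hi⟩, b), by simp [hb]⟩, by simp [legVertex, hb]⟩

theorem atom_univ [Fintype S] [Fintype E] {n : ℕ} {m : ℤ} {x : Series K D} (hx : x ∈ HGC K D n m)
    {G : Graph S V E} (hs : UnivExt G Finset.univ) (hv : verts G Finset.univ = Finset.univ) :
    atom x G Finset.univ = evalOn G x := by
  let eE : {i // i ∈ (Finset.univ : Finset E)} ≃ E := Equiv.subtypeUnivEquiv fun i => Finset.mem_univ i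
  let eV : {w // w ∈ verts G Finset.univ} ≃ V := Equiv.subtypeUnivEquiv fun w => by simp [hv]
  have h := evalOn_iso hx (restr G Finset.univ) G (Equiv.ofBijective _ hs.bijective) eV eE (fun _ => false) (by
    intro i c
    rw [Bool.xor_false]
    exact (restr_map G Finset.univ i c).symm)
  have s1 : invSign eE Finset.univ = 1 := invSign_of_strictMonoOn fun _ _ _ _ h => h
  have s2 : invSign eV Finset.univ = 1 := invSign_of_strictMonoOn fun _ _ _ _ h => h
  simp only [s1, s2, flipSign] at h
  simp only [Bool.false_eq_true, if_false, Finset.prod_const_one, mul_one, ite_self, one_smul] at h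
  rw [h, atom]
  rfl

theorem evalOn_fin {n : ℕ} {m : ℤ} {x : Series K D} (hx : x ∈ HGC K D n m) {k v e : ℕ}
    (G : Graph (Fin k) (Fin v) (Fin e)) : evalOn G x = x k v e G := by
  rw [evalOn_eq hx G (Equiv.refl _) (OrderIso.refl _) (OrderIso.refl _)]
  have : (fun i b => (G ((OrderIso.refl (Fin e)) i) b).map (Equiv.refl _) (OrderIso.refl (Fin v)).symm) = G := by
    funext i b
    exact Sum.map_id_id_apply
  rw [this]
  exact Tens.rename_id _
where
  Sum.map_id_id_apply {α β : Type} {x : α ⊕ β} : x.map id id = x := by simp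

variable [Fintype E] {G : Graph S V E}

theorem IsPrimitive.univExt (hG : IsPrimitive G) : UnivExt G Finset.univ := by
  intro s
  have h := hG.ext_valence s
  rw [valence, Nat.card_eq_one_iff_unique] at h
  obtain ⟨⟨h1⟩, ⟨p, hp⟩⟩ := h
  exact ⟨p, ⟨Finset.mem_univ _, hp⟩, fun q hq => congrArg Subtype.val (h1 ⟨q, hq.2⟩ ⟨p, hp⟩)⟩

theorem exists_of_valence {w : V} (h : 2 ≤ valence G (.inr w)) (p : E × Bool) :
    ∃ q : E × Bool, q ≠ p ∧ G q.1 q.2 = .inr w := by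
  classical
  rw [valence, Nat.card_eq_fintype_card] at h
  obtain ⟨⟨q, hq⟩, ⟨q', hq'⟩, hne⟩ := Fintype.one_lt_card_iff.1 h
  have hne : q ≠ q' := fun h => hne (Subtype.ext h)
  by_cases hqp : q = p
  · exact ⟨q', fun h => hne (hqp.trans h.symm), hq'⟩
  · exact ⟨q, hqp, hq⟩

theorem IsPrimitive.noUniv (hG : IsPrimitive G) : NoUniv G Finset.univ := by
  intro i _ c w _
  obtain ⟨q, h1, h2⟩ := exists_of_valence (G := G) (w := w) (by have := hG.int_valence w; omega) (i, c)
  exact ⟨q.1, Finset.mem_univ _, q.2, h1, h2⟩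

theorem IsPrimitive.verts (hG : IsPrimitive G) : verts G Finset.univ = Finset.univ := by
  ext w
  simp only [mem_verts, Finset.mem_univ, true_and, iff_true]
  have h := hG.int_valence w
  rw [valence] at h
  have : 0 < Nat.card {p : E × Bool // G p.1 p.2 = .inr w} := by omega
  obtain ⟨⟨⟨p, hp⟩⟩, -⟩ := Nat.card_pos_iff.1 this
  exact ⟨p.1, p.2, hp⟩

theorem contractMap (G : Graph S V E) (i : E) (w : V) (a : S ⊕ {u : V // u ≠ w}) :
    GMap id Subtype.val Subtype.val (fun _ => false) (contract G i w a) Finset.univ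
      (cg G w (a.map id Subtype.val)) where
  injE := Subtype.val_injective.injOn
  injV := Subtype.val_injective.injOn
  map j _ c := by
    rw [Bool.xor_false]
    rcases h : G j c with s | u
    · rw [cg_of_ne (by simp [h]), h]
      simp [contract, h]
    · by_cases hu : u = w
      · subst hu
        rw [cg_of_eq h]
        simp [contract, h]
      · rw [cg_of_ne (by simp [h, hu]), h]
        simp [contract, h, hu]

theorem contract_image (i : E) : (Finset.univ : Finset {j : E // j ≠ i}).image Subtype.val =
    Finset.univ.erase i := by
  ext j
  simp

theorem gsign_contract (n : ℕ) (i : E) (w : V) (a : S ⊕ {u : V // u ≠ w}) :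
    gsign n Subtype.val Subtype.val (fun _ => false) (contract G i w a) Finset.univ = 1 := by
  rw [gsign, invSign_of_strictMonoOn (φ := Subtype.val) (fun _ _ _ _ h => h),
    invSign_of_strictMonoOn (φ := Subtype.val) (fun _ _ _ _ h => h)]
  simp [flipSign]

theorem extend_contract {n : ℕ} {x : Series K D} (hx : x ∈ HGC K D n 0) (i : E) (w : V)
    (a : S ⊕ {u : V // u ≠ w}) :
    extend n x (contract G i w a) = Fa n x (cg G w (a.map id Subtype.val)) (Finset.univ.erase i) := by
  have h := Fa_nat hx (contractMap G i w a)
  rw [contract_image, gsign_contract, one_smul, Tens.rename_id] at h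
  rw [extend_eq hx, h]

theorem evalOn_contract [Fintype S] {n : ℕ} {m : ℤ} {y : Series K D} (hy : y ∈ HGC K D n m)
    (hs : UnivExt G Finset.univ) (hG : NoUniv G Finset.univ) (hv : verts G Finset.univ = Finset.univ)
    {i : E} {w u : V} (h : u ≠ w) (he : Ends G i w (.inr u)) :
    evalOn (contract G i w (.inr ⟨u, h⟩)) y = atom y (cg G w (.inr u)) (Finset.univ.erase i) := by
  have M := contractMap G i w (.inr ⟨u, h⟩)
  have h1 := atom_nat hy M
  rw [contract_image, gsign_contract, one_smul, Tens.rename_id] at h1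
  rw [show (Sum.inr u : S ⊕ V) = (Sum.inr (⟨u, h⟩ : {u : V // u ≠ w})).map id Subtype.val from rfl, h1,
    atom_univ hy]
  · intro s
    obtain ⟨⟨j, c⟩, ⟨-, hc⟩, huniq⟩ := hs s
    simp only at hc
    have key : ∀ j c, (∃ hj : j ≠ i, contract G i w (.inr ⟨u, h⟩) ⟨j, hj⟩ c = .inl s) ↔ G j c = .inl s := by
      intro j c
      constructor
      · rintro ⟨hj, hh⟩
        rcases hv : G j c with s' | u'
        · simpa [contract, hv] using hh
        · by_cases hu : u' = w <;> simp [contract, hv, hu] at hh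
      · intro hh
        refine ⟨?_, by simp [contract, hh]⟩
        rintro rfl
        obtain ⟨-, d, hd, hd'⟩ := he
        cases c <;> cases d <;> simp_all
    obtain ⟨hj, hh⟩ := (key j c).2 hc
    refine ⟨(⟨j, hj⟩, c), ⟨Finset.mem_univ _, hh⟩, ?_⟩
    rintro ⟨⟨j', hj'⟩, c'⟩ ⟨-, hh'⟩
    have := huniq (j', c') ⟨Finset.mem_univ _, (key j' c').1 ⟨hj', hh'⟩⟩
    simp only [Prod.mk.injEq] at this
    exact Prod.ext (Subtype.ext this.1) this.2
  · have h2 := M.verts_image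
    rw [contract_image, show (Sum.inr (⟨u, h⟩ : {u : V // u ≠ w}) : S ⊕ _).map id Subtype.val = .inr u from rfl,
      verts_cg he (Finset.mem_univ i) hG, hv] at h2
    ext ⟨v, hv'⟩
    have : v ∈ Finset.univ.erase w := by simp [hv']
    rw [h2] at this
    obtain ⟨v', hv1, hv2⟩ := Finset.mem_image.1 this
    have : v' = ⟨v, hv'⟩ := Subtype.ext hv2
    rw [← this]
    simp [hv1]

theorem contractSign_eq (n : ℕ) (hv : verts G Finset.univ = Finset.univ) (i : E) (w : V) :
    contractSign n i w = csgn n G Finset.univ i w := by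
  have key : ∀ {X : Type} [LinearOrder X] [Fintype X] (p : X),
      kappa {p} (Finset.univ : Finset X) = (-1) ^ (Finset.univ.filter fun q => q < p).card := by
    intro X _ _ p
    rw [kappa, Finset.prod_singleton]
    simp [ltSign, Finset.prod_ite]
  unfold contractSign csgn remElt ori
  split_ifs
  · rw [← Finset.image_singleton, kappa_edge, key]
  · rw [← Finset.image_singleton, kappa_vert, hv, key]

theorem contractTerm_eq {n : ℕ} {x : Series K D} (hx : x ∈ HGC K D n 0)
    (hG : NoUniv G Finset.univ) (hv : verts G Finset.univ = Finset.univ) (i : E) :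
    contractTerm n x G i = cterm n x G Finset.univ i := by
  unfold contractTerm
  rcases hf : G i false with s | u <;> rcases ht : G i true with t | w
  · rw [cterm_of_not]
    rintro ⟨w, z, -, c, hc, -⟩
    cases c <;> simp_all
  · have he : Ends G i w (.inl s) := ⟨by simp, true, ht, hf⟩
    simp only
    rw [cterm_eq hx he (Finset.mem_univ i) hG, extend_contract hx, contractSign_eq n hv, cval, conSign,
      dirSign]
    simp [ht]
  · have he : Ends G i u (.inl t) := ⟨by simp, false, hf, ht⟩
    simp only
    rw [cterm_eq hx he (Finset.mem_univ i) hG, extend_contract hx, contractSign_eq n hv, cval, conSign,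
      dirSign, smul_smul]
    simp [ht]
  · simp only
    split_ifs with huw
    · have he : Ends G i w (.inr u) := ⟨by simpa using huw, true, ht, hf⟩
      rw [cterm_eq hx he (Finset.mem_univ i) hG, extend_contract hx, contractSign_eq n hv, cval, conSign,
        dirSign]
      simp [ht]
    · rw [cterm_of_not]
      rintro ⟨v, z, hz, c, hc, hc'⟩
      rw [not_not] at huw
      subst huw
      cases c <;> simp_all

theorem atom_fin {n : ℕ} {m : ℤ} {x : Series K D} (hx : x ∈ HGC K D n m) {k v e : ℕ}
    {G : Graph (Fin k) (Fin v) (Fin e)} (hG : IsPrimitive G) :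
    atom x G Finset.univ = x k v e G := by
  rw [atom_univ hx hG.univExt hG.verts, evalOn_fin hx]

theorem linked_univ {G : Graph S V E} (hG : IsPrimitive G) : ∀ i ∈ (Finset.univ : Finset E), ∀ j ∈ (Finset.univ : Finset E),
    LinkedIn G Finset.univ i j := fun i _ j _ => linked_iff.1 (hG.linked i j)

theorem IsPrimitive.edge_nonempty (hG : IsPrimitive G) : (Finset.univ : Finset E).Nonempty := by
  obtain ⟨s⟩ := hG.nonempty
  obtain ⟨p, -⟩ := hG.univExt s
  exact ⟨p.1, Finset.mem_univ _⟩

theorem curvature_eq {n : ℕ} {x : Series K D} (hx : x ∈ HGC K D n 0) {k v e : ℕ}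
    {G : Graph (Fin k) (Fin v) (Fin e)} (hG : IsPrimitive G) :
    curvature n x k v e G = curvA n x G Finset.univ := by
  rw [curvature, curvA, Fa_of_linked n x hG.edge_nonempty (linked_univ hG), atom_fin hx hG]
  congr 1
  exact Finset.sum_congr rfl fun i _ => contractTerm_eq hx hG.noUniv hG.verts i

theorem splitting_eq {n : ℕ} {m : ℤ} {y : Series K D} (hy : y ∈ HGC K D n m) {k v e : ℕ}
    {G : Graph (Fin k) (Fin v) (Fin e)} (hG : IsPrimitive G) :
    splitting n k v e G y = splitA n y G Finset.univ := by
  rw [splitting, LinearMap.sum_apply, splitA]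
  refine Finset.sum_congr rfl fun i _ => ?_
  have hno : (∀ w u, G i false = .inr u → G i true = .inr w → u = w) → ¬ ∃ w u, Ends G i w (.inr u) := by
    rintro h ⟨w, u, hz, c, hc, hc'⟩
    cases c
    · have := h _ _ hc hc'; subst this; exact hz rfl
    · have := h _ _ hc' hc; subst this; exact hz rfl
  split
  · rename_i u w hf ht
    split_ifs with huw
    · have he : Ends G i w (.inr u) := ⟨by simpa using huw, true, ht, hf⟩
      rw [sterm_eq hy he (Finset.mem_univ i) hG.noUniv, LinearMap.smul_apply,
        evalOn_contract hy hG.univExt hG.noUniv hG.verts huw he, contractSign_eq n hG.verts, sval, conSign,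
        dirSign]
      simp [ht]
    · rw [sterm_of_not, LinearMap.zero_apply]
      refine hno fun w' u' h1 h2 => ?_
      rw [hf] at h1
      rw [ht] at h2
      rw [← Sum.inr_injective h1, ← Sum.inr_injective h2]
      exact not_not.1 huw
  · rename_i hh
    rw [sterm_of_not, LinearMap.zero_apply]
    exact hno fun w u h1 h2 => (hh u w h1 h2).elim

end Primitive

section Derivation

variable {R : Type} [Ring R] [Algebra ℚ R] {K : CoeffAlgebra R}
variable {A : Type u} [NonUnitalRing A] [Module ℚ A] {D : DGCommAlgebra A}
variable {S V E : Type} [LinearOrder E] [LinearOrder V] [Fintype V]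
variable {g : Graph S V E} {P Q : Finset E} {i j : E} {w : V} {z : S ⊕ V}

theorem NoUniv.of_unlinked (h : NoUniv g (P ∪ Q)) (hu : Unlinked g P Q) : NoUniv g P := by
  intro i hi c w hc
  obtain ⟨j, hj, c', hne, hc'⟩ := h i (Finset.mem_union_left _ hi) c w hc
  rcases Finset.mem_union.1 hj with hj | hj
  · exact ⟨j, hj, c', hne, hc'⟩
  · exact (hu i hi j hj c c' w hc hc').elim

theorem Ends.cg_unlinked (he : Ends g i w z) (hi : i ∈ P) (hu : Unlinked g P Q) :
    ∀ j ∈ Q, ∀ c, cg g w z j c = g j c := by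
  intro j hj c
  obtain ⟨-, c', hc', -⟩ := he
  exact cg_of_ne fun h => hu i hi j hj c' c w hc' h

theorem Unlinked.cg (hu : Unlinked g P Q) (he : Ends g i w z) (hi : i ∈ P) :
    Unlinked (cg g w z) (P.erase i) Q := by
  intro j hj k hk c c' v hc hc'
  rw [he.cg_unlinked hi hu k hk] at hc'
  by_cases hw : g j c = .inr w
  · rw [cg_of_eq hw] at hc
    obtain ⟨-, d, -, hd⟩ := he
    exact hu i hi k hk (!d) c' v (hd.trans hc) hc'
  · rw [cg_of_ne hw] at hc
    exact hu j (Finset.mem_of_mem_erase hj) k hk c c' v hc hc'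

theorem idMap {g g' : Graph S V E} (h : ∀ j ∈ Q, ∀ c, g' j c = g j c) :
    GMap id id id (fun _ => false) g Q g' where
  injE := Function.injective_id.injOn
  injV := Function.injective_id.injOn
  map j hj c := by rw [Bool.xor_false, id, h j hj]; cases g j c <;> rfl

theorem gsign_id (n : ℕ) (g : Graph S V E) (P : Finset E) : gsign n id id (fun _ => false) g P = 1 := by
  rw [gsign, invSign_of_strictMonoOn (φ := id) (fun _ _ _ _ h => h),
    invSign_of_strictMonoOn (φ := id) (fun _ _ _ _ h => h)]
  simp [flipSign]

theorem Fa_of_eqOn {n : ℕ} {x : Series K D} (hx : x ∈ HGC K D n 0) {g g' : Graph S V E}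
    (h : ∀ j ∈ Q, ∀ c, g' j c = g j c) : Fa n x g' Q = Fa n x g Q := by
  have := Fa_nat hx (idMap h)
  rwa [Finset.image_id, gsign_id, one_smul, Tens.rename_id] at this

theorem atom_of_eqOn {n : ℕ} {m : ℤ} {x : Series K D} (hx : x ∈ HGC K D n m) {g g' : Graph S V E}
    (h : ∀ j ∈ Q, ∀ c, g' j c = g j c) : atom x g' Q = atom x g Q := by
  have := atom_nat hx (idMap h)
  rwa [Finset.image_id, gsign_id, one_smul, Tens.rename_id] at this

theorem ori_of_eqOn (n : ℕ) {g g' : Graph S V E} (h : ∀ j ∈ Q, ∀ c, g' j c = g j c) :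
    ori n g' Q = ori n g Q := by
  have := (idMap h).ori_image n
  rw [Finset.image_id] at this
  rw [this, show (oriMap id id : OriElt E V → OriElt E V) = id from ?_, Finset.image_id]
  funext o
  rcases o with o | o <;> rfl

theorem Unlinked.verts_disjoint (hu : Unlinked g P Q) : Disjoint (verts g P) (verts g Q) := by
  rw [Finset.disjoint_left]
  intro w hw hw'
  obtain ⟨i, hi, c, hc⟩ := mem_verts.1 hw
  obtain ⟨j, hj, c', hc'⟩ := mem_verts.1 hw'
  exact hu i hi j hj c c' w hc hc'

theorem Unlinked.ori_disjoint (n : ℕ) (hu : Unlinked g P Q) (hd : Disjoint P Q) :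
    Disjoint (ori n g P) (ori n g Q) := by
  unfold ori
  split_ifs
  · exact (Finset.disjoint_image edge_injective).2 hd
  · exact (Finset.disjoint_image vert_injective).2 hu.verts_disjoint

theorem ori_union (n : ℕ) (g : Graph S V E) (P Q : Finset E) :
    ori n g (P ∪ Q) = ori n g P ∪ ori n g Q := by
  unfold ori
  split_ifs
  · rw [Finset.image_union]
  · rw [← Finset.image_union]
    congr 1
    ext w
    simp only [mem_verts, Finset.mem_union]
    constructor
    · rintro ⟨i, hi | hi, h⟩
      exacts [.inl ⟨i, hi, h⟩, .inr ⟨i, hi, h⟩]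
    · rintro (⟨i, hi, h⟩ | ⟨i, hi, h⟩)
      exacts [⟨i, .inl hi, h⟩, ⟨i, .inr hi, h⟩]

theorem cterm_union {n : ℕ} {x : Series K D} (hx : x ∈ HGC K D n 0) (hu : Unlinked g P Q)
    (hd : Disjoint P Q) (hP : NoUniv g (P ∪ Q)) (hi : i ∈ P) :
    cterm n x g (P ∪ Q) i = kappa (ori n g P) (ori n g Q) • (cterm n x g P i * Fa n x g Q) := by
  by_cases h : ∃ w z, Ends g i w z
  swap
  · rw [cterm_of_not h, cterm_of_not h, zero_mul, smul_zero]
  obtain ⟨w, z, he⟩ := h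
  have hP1 := hP.of_unlinked hu
  have heq := he.cg_unlinked hi hu
  have hiQ : i ∉ Q := fun h => Finset.disjoint_left.1 hd hi h
  have hr := remElt_mem n he hi
  rw [cterm_eq hx he (Finset.mem_union_left _ hi) hP, cterm_eq hx he hi hP1, cval, cval,
    Finset.erase_union_distrib, Finset.erase_eq_of_notMem hiQ,
    Fa_union hx (hu.cg he hi) (hd.mono_left (Finset.erase_subset _ _)), Fa_of_eqOn hx heq,
    ori_of_eqOn n heq, ori_cg n he hi hP1, conSign, conSign, csgn, csgn, ori_union,
    kappa_union_right (hu.ori_disjoint n hd), smul_mul_assoc, smul_smul, smul_smul]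
  congr 1
  conv_rhs => rw [← Finset.insert_erase hr, Finset.insert_eq,
    kappa_union_left (Finset.disjoint_singleton_left.2 (Finset.notMem_erase _ _))]
  rw [← Finset.insert_eq, Finset.insert_erase hr]
  ring

theorem exts_cg (he : Ends g i w z) (hi : i ∈ P) (hP : NoUniv g P) :
    exts g P ⊆ exts (cg g w z) (P.erase i) := by
  rintro s ⟨j, hj, c, hc⟩
  by_cases hji : j = i
  · subst hji
    have hz := he.eq_of_ne (c := c) (by simp [hc])
    obtain ⟨k, hk, c', hne, hc'⟩ := hP j hj (!c) w hz.2
    refine ⟨k, Finset.mem_erase.2 ⟨?_, hk⟩, c', ?_⟩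
    · rintro rfl
      have : c' = c := by
        have : c' ≠ !c := fun h => hne (by rw [h])
        cases c <;> cases c' <;> simp_all
      subst this
      simp [hc] at hc'
    · rw [cg_of_eq hc', ← hz.1, hc]
  · exact ⟨j, Finset.mem_erase.2 ⟨hji, hj⟩, c, by rw [cg_of_ne (by simp [hc]), hc]⟩

theorem graphDeg_cg (n : ℕ) (he : Ends g i w z) (hi : i ∈ P) (hP : NoUniv g P) :
    graphDeg n (cg g w z) (P.erase i) = graphDeg n g P + 1 := by
  have h1 := Finset.card_erase_add_one hi
  have h2 := Finset.card_erase_add_one (he.mem_verts hi)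
  rw [graphDeg, graphDeg, verts_cg he hi hP, ← h1, ← h2]
  push_cast
  ring

theorem cterm_mem {n : ℕ} {x : Series K D} (hx : x ∈ HGC K D n 0) (hP : NoUniv g P) (hi : i ∈ P) :
    cterm n x g P i ∈ Tens.hd K D (graphDeg n g P + 1) (exts g P) := by
  by_cases h : ∃ w z, Ends g i w z
  · obtain ⟨w, z, he⟩ := h
    rw [cterm_eq hx he hi hP, cval, ← graphDeg_cg n he hi hP]
    exact zsmul_mem (Tens.hd_mono (exts_cg he hi hP) (Fa_mem hx _ _)) _
  · rw [cterm_of_not h]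
    exact zero_mem _

theorem curvA_mem {n : ℕ} {x : Series K D} (hx : x ∈ HGC K D n 0) (hP : NoUniv g P) :
    curvA n x g P ∈ Tens.hd K D (graphDeg n g P + 1) (exts g P) :=
  sub_mem (Tens.d_mem_hd (Fa_mem hx g P)) (sum_mem fun _ hi => cterm_mem hx hP hi)

/-- The curvature is a derivation with respect to products of graphs. -/
theorem curvA_union {n : ℕ} {x : Series K D} (hx : x ∈ HGC K D n 0) (hu : Unlinked g P Q)
    (hd : Disjoint P Q) (hP : NoUniv g (P ∪ Q)) :
    curvA n x g (P ∪ Q) = kappa (ori n g P) (ori n g Q) • (curvA n x g P * Fa n x g Q +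
      ((-1 : ℤ) ^ (ori n g P).card) • (Fa n x g P * curvA n x g Q)) := by
  have hQ : NoUniv g Q := NoUniv.of_unlinked (Q := P) (by rwa [Finset.union_comm]) hu.symm
  have h2 : ∀ i ∈ Q, cterm n x g (P ∪ Q) i = kappa (ori n g P) (ori n g Q) •
      (((-1 : ℤ) ^ (ori n g P).card) • (Fa n x g P * cterm n x g Q i)) := by
    intro i hi
    rw [Finset.union_comm, cterm_union hx hu.symm hd.symm (by rwa [Finset.union_comm]) hi,
      hd_comm_of_even (N := (ori n g Q).card + 1) (cterm_mem hx hQ hi) (Fa_mem hx g P)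
        (by simpa using even_graphDeg_sub n g Q) (even_graphDeg_sub n g P), smul_smul, smul_smul]
    congr 1
    have h1 := kappa_swap (hu.ori_disjoint n hd)
    have h3 := kappa_mul_self (ori n g P) (ori n g Q)
    have h4 : ((-1 : ℤ) ^ (((ori n g Q).card + 1) * (ori n g P).card)) =
        (-1) ^ ((ori n g P).card * (ori n g Q).card) * (-1) ^ (ori n g P).card := by
      rw [← pow_add]; ring_nf
    rw [h4, ← h1]
    have h5 := kappa_mul_self (ori n g Q) (ori n g P)
    linear_combination (kappa (ori n g P) (ori n g Q) * (-1) ^ (ori n g P).card) * h5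
  rw [curvA, Finset.sum_union hd, Finset.sum_congr rfl fun i hi => cterm_union hx hu hd hP hi,
    Finset.sum_congr rfl h2, Fa_union hx hu hd, map_zsmul, Tens.d_mul_of_mem (Fa_mem hx g P),
    zpow_smul_eq (even_graphDeg_sub n g P), curvA, curvA, ← Finset.smul_sum, ← Finset.smul_sum,
    ← Finset.smul_sum, ← Finset.sum_mul, ← Finset.mul_sum, sub_mul, mul_sub]
  simp only [smul_add, smul_sub]
  abel

theorem curvA_empty (n : ℕ) (x : Series K D) (g : Graph S V E) : curvA n x g ∅ = 0 := by
  simp [curvA, Fa_empty, Tens.d_one]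

theorem curvA_mem_of_comps {n : ℕ} {x : Series K D} (hx : x ∈ HGC K D n 0)
    (N : Subalgebra ℚ (Tens K D S)) (I : Submodule ℚ (Tens K D S)) (hl : ∀ a ∈ N, ∀ b ∈ I, a * b ∈ I)
    (hr : ∀ a ∈ N, ∀ b ∈ I, b * a ∈ I) (P : Finset E) (hP : NoUniv g P)
    (hc : ∀ c ∈ comps g P, Fa n x g c ∈ N ∧ curvA n x g c ∈ I) :
    Fa n x g P ∈ N ∧ curvA n x g P ∈ I := by
  induction P using Finset.strongInduction with
  | H P ih =>
    rcases P.eq_empty_or_nonempty with rfl | ⟨i, hi⟩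
    · rw [Fa_empty, curvA_empty]
      exact ⟨one_mem _, zero_mem _⟩
    · have hu := unlinked_cls (g := g) (P := P) i
      have hun : cls g P i ∪ P \ cls g P i = P := Finset.union_sdiff_of_subset (cls_subset i)
      have hd : Disjoint (cls g P i) (P \ cls g P i) := Finset.disjoint_sdiff
      have h1 := hc _ (mem_comps.2 ⟨i, hi, rfl⟩)
      have hcu := hu.comps_union
      rw [hun] at hcu
      have hP' : NoUniv g (cls g P i ∪ P \ cls g P i) := by rwa [hun]
      have h2 := ih (P \ cls g P i) (by
        refine Finset.ssubset_iff_subset_ne.2 ⟨Finset.sdiff_subset, fun h => ?_⟩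
        have : i ∈ P \ cls g P i := by rw [h]; exact hi
        exact (Finset.mem_sdiff.1 this).2 (self_mem_cls hi))
        (NoUniv.of_unlinked (by rwa [Finset.union_comm]) hu.symm)
        (fun c h => hc c (by rw [hcu]; exact Finset.mem_union_right _ h))
      have e1 := Fa_union hx hu hd
      have e2 := curvA_union hx hu hd hP'
      rw [hun] at e1 e2
      rw [e1, e2]
      exact ⟨zsmul_mem (mul_mem h1.1 h2.1) _,
        zsmul_mem (add_mem (hr _ h2.1 _ h1.2) (zsmul_mem (hl _ h1.1 _ h2.2) _)) _⟩

theorem curvA_eq_zero_of_comps {n : ℕ} {x : Series K D} (hx : x ∈ HGC K D n 0) (hP : NoUniv g P)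
    (hc : ∀ c ∈ comps g P, curvA n x g c = 0) : curvA n x g P = 0 := by
  have := (curvA_mem_of_comps hx ⊤ ⊥ (by simp) (by simp) P hP fun c h =>
    ⟨trivial, by simpa using hc c h⟩).2
  simpa using this

/-- The contraction of two edges at different vertices. -/
theorem cg_cg {wi wj : V} {zi zj : S ⊕ V} (hij : Ends g i wi zi) (hji : Ends g j wj zj) (hne : wi ≠ wj)
    (hz : ¬ (zi = .inr wj ∧ zj = .inr wi)) :
    ∃ zi' zj', Ends (cg g wi zi) j wj zj' ∧ Ends (cg g wj zj) i wi zi' ∧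
      cg (cg g wi zi) wj zj' = cg (cg g wj zj) wi zi' := by
  classical
  have key : ∀ {i j : E} {wi wj : V} {zi zj : S ⊕ V}, Ends g i wi zi → Ends g j wj zj → wi ≠ wj →
      ¬ (zi = .inr wj ∧ zj = .inr wi) → Ends (cg g wi zi) j wj (if zj = .inr wi then zi else zj) := by
    intro i j wi wj zi zj hij hji hne hz
    obtain ⟨h1, c, h2, h3⟩ := hji
    refine ⟨?_, c, ?_, ?_⟩
    · split_ifs with h
      · exact fun h' => hz ⟨h', h⟩
      · exact h1
    · rw [cg_of_ne (by rw [h2]; simpa using hne.symm), h2]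
    · rw [cg, h3]
  refine ⟨_, _, key hij hji hne hz, key hji hij hne.symm (fun h => hz ⟨h.2, h.1⟩), ?_⟩
  funext k c
  obtain ⟨hz1, -⟩ := hij
  obtain ⟨hz2, -⟩ := hji
  have hne' : (Sum.inr wi : S ⊕ V) ≠ .inr wj := by simpa using hne
  unfold cg
  split_ifs <;> simp_all

theorem dirSign_cg (n : ℕ) {z' : S ⊕ V} {wj : V} (hne : w ≠ wj) (he' : Ends (cg g w z) j wj z') {zj : S ⊕ V}
    (hj : Ends g j wj zj) : dirSign n (cg g w z) j wj = dirSign n g j wj := by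
  have : cg g w z j true = .inr wj ↔ g j true = .inr wj := by
    constructor
    · intro h
      by_contra h'
      have h1 := (hj.eq_of_ne h').2
      have h2 : cg g w z j (!true) = .inr wj := by
        rw [cg_of_ne (by rw [h1]; simpa using hne.symm), h1]
      obtain ⟨hz', c, hc, hc'⟩ := he'
      cases c
      · exact hz' (hc'.symm.trans h)
      · exact hz' (hc'.symm.trans h2)
    · intro h
      rw [cg_of_ne (by rw [h]; simpa using hne.symm), h]
  unfold dirSign
  by_cases h : g j true = .inr wj
  · rw [if_pos (this.2 h), if_pos h]
  · rw [if_neg fun h' => h (this.1 h'), if_neg h]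

theorem conSign_conSign (n : ℕ) {wi wj : V} {zi zj zi' zj' : S ⊕ V} (hij : Ends g i wi zi) (hji : Ends g j wj zj)
    (hne : wi ≠ wj) (hi' : Ends (cg g wj zj) i wi zi') (hj' : Ends (cg g wi zi) j wj zj')
    (hi : i ∈ P) (hj : j ∈ P) (hne' : i ≠ j) (hP : NoUniv g P) :
    conSign n g P i wi * conSign n (cg g wi zi) (P.erase i) j wj =
      - (conSign n g P j wj * conSign n (cg g wj zj) (P.erase j) i wi) := by
  have hr : remElt n i wi ≠ remElt n j wj := by
    unfold remElt
    split_ifs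
    · exact fun h => hne' (edge_injective h)
    · exact fun h => hne (vert_injective h)
  have key : ∀ {r s : OriElt E V} {O : Finset (OriElt E V)}, r ∈ O →
      kappa {s} O = ltSign s r * kappa {s} (O.erase r) := by
    intro r s O hr
    rw [kappa, kappa, Finset.prod_singleton, Finset.prod_singleton, Finset.mul_prod_erase _ _ hr]
  have hri := remElt_mem n hij hi
  have hrj := remElt_mem n hji hj
  rw [conSign, conSign, conSign, conSign, dirSign_cg n hne hj' hji, dirSign_cg n hne.symm hi' hij,
    csgn, csgn, csgn, csgn, ori_cg n hij hi hP, ori_cg n hji hj hP]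
  rw [key hrj (s := remElt n i wi), key hri (s := remElt n j wj)]
  have h1 := ltSign_swap hr
  have h2 := ltSign_mul_self (remElt n i wi) (remElt n j wj)
  have h3 := kappa_mul_self {remElt n i wi} ((ori n g P).erase (remElt n j wj))
  linear_combination (dirSign n g i wi * dirSign n g j wj *
    kappa {remElt n i wi} ((ori n g P).erase (remElt n j wj)) *
    kappa {remElt n j wj} ((ori n g P).erase (remElt n i wi))) *
      (ltSign (remElt n i wi) (remElt n j wj) * h1 - ltSign (remElt n j wj) (remElt n i wi) * h2)

open scoped Classical in
/-- The summand of the boundary of the curvature given by an edge. -/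
def bterm (n : ℕ) (x : Series K D) (g : Graph S V E) (P : Finset E) (i : E) : Tens K D S :=
  if h : ∃ w z, Ends g i w z then
    conSign n g P i h.choose • curvA n x (cg g h.choose h.choose_spec.choose) (P.erase i) else 0

open scoped Classical in
/-- The contraction of two edges. -/
def ccterm (n : ℕ) (x : Series K D) (g : Graph S V E) (P : Finset E) (i j : E) : Tens K D S :=
  if h : ∃ w z, Ends g i w z then
    conSign n g P i h.choose • cterm n x (cg g h.choose h.choose_spec.choose) (P.erase i) j else 0

theorem Ends.swap {u : V} (he : Ends g i w (.inr u)) : Ends g i u (.inr w) := by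
  have hne : u ≠ w := by
    rintro rfl
    exact he.1 rfl
  obtain ⟨hz, c, hc, hc'⟩ := he
  exact ⟨by simpa using hne.symm, !c, hc', by simpa using hc⟩

theorem bterm_eq {n : ℕ} {x : Series K D} (hx : x ∈ HGC K D n 0) (he : Ends g i w z)
    (hi : i ∈ P) (hP : NoUniv g P) :
    bterm n x g P i = conSign n g P i w • curvA n x (cg g w z) (P.erase i) := by
  have h : ∃ w z, Ends g i w z := ⟨w, z, he⟩
  have key : ∀ w' z', Ends g i w' z' → conSign n g P i w' • curvA n x (cg g w' z') (P.erase i) =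
      conSign n g P i w • curvA n x (cg g w z) (P.erase i) := by
    intro w' z' he'
    rcases he.eq_or he' with ⟨rfl, rfl⟩ | ⟨rfl, rfl⟩
    · rfl
    · have hne : w' ≠ w := by rintro rfl; exact he.1 rfl
      have h1 := curvA_nat hx (swapMap g P i hne) (hP.cg he hi)
      rw [Finset.image_id, Tens.rename_id] at h1
      rw [h1, smul_smul, conSign_swap n he hi hP]
  rw [bterm, dif_pos h]
  exact key _ _ h.choose_spec.choose_spec

theorem ccterm_eq {n : ℕ} {x : Series K D} (hx : x ∈ HGC K D n 0) (he : Ends g i w z)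
    (hi : i ∈ P) (hj : j ∈ P.erase i) (hP : NoUniv g P) :
    ccterm n x g P i j = conSign n g P i w • cterm n x (cg g w z) (P.erase i) j := by
  have h : ∃ w z, Ends g i w z := ⟨w, z, he⟩
  have key : ∀ w' z', Ends g i w' z' → conSign n g P i w' • cterm n x (cg g w' z') (P.erase i) j =
      conSign n g P i w • cterm n x (cg g w z) (P.erase i) j := by
    intro w' z' he'
    rcases he.eq_or he' with ⟨rfl, rfl⟩ | ⟨rfl, rfl⟩
    · rfl
    · have hne : w' ≠ w := by rintro rfl; exact he.1 rfl
      have h1 := cterm_nat hx (swapMap g P i hne) hj (hP.cg he hi)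
      rw [Finset.image_id, Tens.rename_id, id] at h1
      rw [h1, smul_smul, conSign_swap n he hi hP]
  rw [ccterm, dif_pos h]
  exact key _ _ h.choose_spec.choose_spec

/-- Two edges can be contracted one after the other. -/
def Contractible (g : Graph S V E) (i j : E) : Prop :=
  ∃ wi zi wj zj, Ends g i wi zi ∧ Ends g j wj zj ∧ wi ≠ wj ∧ ¬ (zi = .inr wj ∧ zj = .inr wi)

theorem Contractible.symm (h : Contractible g i j) : Contractible g j i := by
  obtain ⟨wi, zi, wj, zj, h1, h2, h3, h4⟩ := h
  exact ⟨wj, zj, wi, zi, h2, h1, h3.symm, fun h => h4 ⟨h.2, h.1⟩⟩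

theorem contractible_of_ends {w' : V} {z' : S ⊕ V} (he : Ends g i w z) (he' : Ends (cg g w z) j w' z') :
    Contractible g i j := by
  obtain ⟨hz', c, hc, hc'⟩ := he'
  have hw' : w ≠ w' := by
    rintro rfl
    by_cases h : g j c = .inr w
    · rw [cg_of_eq h] at hc
      exact he.1 hc
    · rw [cg_of_ne h] at hc
      exact h hc
  by_cases h : g j c = .inr w
  · rw [cg_of_eq h] at hc
    subst hc
    have h2 : g j (!c) ≠ .inr w := by
      intro h2
      rw [cg_of_eq h2] at hc'
      exact hz' hc'.symm
    rw [cg_of_ne h2] at hc'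
    exact ⟨w', .inr w, w, z', he.swap, ⟨by rwa [← hc'], c, h, hc'⟩, hw'.symm, fun h => hz' h.2⟩
  · rw [cg_of_ne h] at hc
    refine ⟨w, z, w', g j (!c), he, ⟨?_, c, hc, rfl⟩, hw', ?_⟩
    · intro h2
      rw [cg_of_ne (by rw [h2]; simpa using hw'.symm), h2] at hc'
      exact hz' hc'.symm
    · rintro ⟨rfl, h2⟩
      rw [cg_of_eq h2] at hc'
      exact hz' hc'.symm

theorem ccterm_of_not {n : ℕ} {x : Series K D} (hx : x ∈ HGC K D n 0)
    (hi : i ∈ P) (hj : j ∈ P.erase i) (hP : NoUniv g P) (h : ¬ Contractible g i j) :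
    ccterm n x g P i j = 0 := by
  by_cases hex : ∃ w z, Ends g i w z
  · obtain ⟨w, z, he⟩ := hex
    rw [ccterm_eq hx he hi hj hP, cterm_of_not, smul_zero]
    rintro ⟨w', z', he'⟩
    exact h (contractible_of_ends he he')
  · exact dif_neg hex

theorem ccterm_antisymm {n : ℕ} {x : Series K D} (hx : x ∈ HGC K D n 0)
    (hi : i ∈ P) (hj : j ∈ P) (hij : i ≠ j) (hP : NoUniv g P) :
    ccterm n x g P i j = - ccterm n x g P j i := by
  have hj' : j ∈ P.erase i := Finset.mem_erase.2 ⟨hij.symm, hj⟩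
  have hi' : i ∈ P.erase j := Finset.mem_erase.2 ⟨hij, hi⟩
  by_cases h : Contractible g i j
  · obtain ⟨wi, zi, wj, zj, h1, h2, h3, h4⟩ := h
    obtain ⟨zi', zj', h5, h6, h7⟩ := cg_cg h1 h2 h3 h4
    rw [ccterm_eq hx h1 hi hj' hP, ccterm_eq hx h2 hj hi' hP, cterm_eq hx h5 hj' (hP.cg h1 hi),
      cterm_eq hx h6 hi' (hP.cg h2 hj), cval, cval, smul_smul, smul_smul, h7, Finset.erase_right_comm,
      conSign_conSign n h1 h2 h3 h6 h5 hi hj hij hP, neg_smul]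
  · rw [ccterm_of_not hx hi hj' hP h, ccterm_of_not hx hj hi' hP fun h' => h h'.symm, neg_zero]

/-- The Bianchi identity. -/
theorem d_curvA {n : ℕ} {x : Series K D} (hx : x ∈ HGC K D n 0) (hP : NoUniv g P) :
    Tens.d (curvA n x g P) = - ∑ i ∈ P, bterm n x g P i := by
  have h1 : ∀ i ∈ P, Tens.d (cterm n x g P i) = bterm n x g P i + ∑ j ∈ P.erase i, ccterm n x g P i j := by
    intro i hi
    by_cases hex : ∃ w z, Ends g i w z
    · obtain ⟨w, z, he⟩ := hex
      rw [cterm_eq hx he hi hP, bterm_eq hx he hi hP, cval, map_zsmul,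
        Finset.sum_congr rfl fun j hj => ccterm_eq hx he hi hj hP, curvA, smul_sub, Finset.smul_sum]
      abel
    · rw [cterm_of_not hex, bterm, dif_neg hex, map_zero, zero_add, Finset.sum_eq_zero]
      intro j _
      exact dif_neg hex
  have h2 : ∑ i ∈ P, ∑ j ∈ P.erase i, ccterm n x g P i j = 0 := by
    have h3 : ∑ i ∈ P, ∑ j ∈ P.erase i, ccterm n x g P i j =
        ∑ i ∈ P, ∑ j ∈ P.erase i, ccterm n x g P j i := by
      refine Finset.sum_comm' ?_
      intro i j
      simp only [Finset.mem_erase]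
      tauto
    have h4 : ∑ i ∈ P, ∑ j ∈ P.erase i, ccterm n x g P i j =
        - ∑ i ∈ P, ∑ j ∈ P.erase i, ccterm n x g P j i := by
      rw [← Finset.sum_neg_distrib]
      refine Finset.sum_congr rfl fun i hi => ?_
      rw [← Finset.sum_neg_distrib]
      refine Finset.sum_congr rfl fun j hj => ?_
      rw [Finset.mem_erase] at hj
      exact ccterm_antisymm hx hi hj.2 hj.1.symm hP
    rw [← h3] at h4
    have h5 : (2 : ℚ) • ∑ i ∈ P, ∑ j ∈ P.erase i, ccterm n x g P i j = 0 := by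
      rw [two_smul]
      nth_rw 2 [h4]
      exact add_neg_cancel _
    exact (smul_eq_zero.1 h5).resolve_left two_ne_zero
  rw [curvA, map_sub, Tens.d_d, map_sum, Finset.sum_congr rfl h1, Finset.sum_add_distrib, h2]
  simp

end Derivation

section Valences

variable {S V E : Type} [LinearOrder E] [LinearOrder V] [Fintype V]
variable {S' V' E' : Type} [LinearOrder E'] [LinearOrder V'] [Fintype V']
variable {h : S → S'} {a : E → E'} {b : V → V'} {f : E → Bool} {g' : Graph S' V' E'}
variable {g : Graph S V E} {P Q : Finset E} {i j : E} {w : V} {z : S ⊕ V}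

open scoped Classical in
/-- The half-edges at an internal vertex. -/
def halves (g : Graph S V E) (P : Finset E) (v : V) : Finset (E × Bool) :=
  (P ×ˢ Finset.univ).filter fun p => g p.1 p.2 = .inr v

/-- The half-edges at external vertices. -/
def extHalves (g : Graph S V E) (P : Finset E) : Finset (E × Bool) :=
  (P ×ˢ Finset.univ).filter fun p => (g p.1 p.2).isLeft

theorem mem_halves {v : V} {p : E × Bool} : p ∈ halves g P v ↔ p.1 ∈ P ∧ g p.1 p.2 = .inr v := by
  simp [halves]

theorem mem_extHalves {p : E × Bool} : p ∈ extHalves g P ↔ p.1 ∈ P ∧ ∃ s, g p.1 p.2 = .inl s := by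
  simp [extHalves, Sum.isLeft_iff]

/-- The defect of a graph from having trivalent internal vertices. -/
def defect (g : Graph S V E) (P : Finset E) : ℤ :=
  2 * P.card - (extHalves g P).card - 3 * (verts g P).card

theorem two_mul_card (g : Graph S V E) (P : Finset E) :
    2 * P.card = (extHalves g P).card + ∑ v ∈ verts g P, (halves g P v).card := by
  classical
  have h1 : (P ×ˢ (Finset.univ : Finset Bool)).card = 2 * P.card := by
    rw [Finset.card_product]; simp [mul_comm]
  have h2 : P ×ˢ (Finset.univ : Finset Bool) = extHalves g P ∪ (verts g P).biUnion (halves g P) := by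
    ext ⟨i, c⟩
    simp only [Finset.mem_product, Finset.mem_univ, and_true, Finset.mem_union, mem_extHalves,
      Finset.mem_biUnion, mem_halves]
    constructor
    · intro hi
      rcases hv : g i c with s | v
      · exact .inl ⟨hi, s, rfl⟩
      · exact .inr ⟨v, mem_verts.2 ⟨i, hi, c, hv⟩, hi, rfl⟩
    · rintro (⟨hi, -⟩ | ⟨-, -, hi, -⟩) <;> exact hi
  rw [← h1, h2, Finset.card_union_of_disjoint, Finset.card_biUnion]
  · intro v _ v' _ hne
    rw [Function.onFun, Finset.disjoint_left]
    intro p hp hp'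
    rw [mem_halves] at hp hp'
    exact hne (Sum.inr_injective (hp.2.symm.trans hp'.2))
  · rw [Finset.disjoint_left]
    intro p hp hp'
    obtain ⟨-, s, hs⟩ := mem_extHalves.1 hp
    obtain ⟨v, -, hv⟩ := Finset.mem_biUnion.1 hp'
    rw [mem_halves, hs] at hv
    simp at hv

theorem defect_eq_sum (g : Graph S V E) (P : Finset E) :
    defect g P = ∑ v ∈ verts g P, ((halves g P v).card - 3 : ℤ) := by
  have := two_mul_card g P
  rw [defect, Finset.sum_sub_distrib, Finset.sum_const, nsmul_eq_mul]
  push_cast [← @Nat.cast_inj ℤ] at this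
  linarith

/-- The internal vertices are at least trivalent. -/
def Trivalent (g : Graph S V E) (P : Finset E) : Prop := ∀ v ∈ verts g P, 3 ≤ (halves g P v).card

theorem Trivalent.defect_nonneg (h : Trivalent g P) : 0 ≤ defect g P := by
  rw [defect_eq_sum]
  exact Finset.sum_nonneg fun v hv => by have := h v hv; omega

theorem Trivalent.card_halves_of_defect (h : Trivalent g P) (hd : defect g P = 0) :
    ∀ v ∈ verts g P, (halves g P v).card = 3 := by
  rw [defect_eq_sum, Finset.sum_eq_zero_iff_of_nonneg fun v hv => by have := h v hv; omega] at hd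
  intro v hv
  have := hd v hv
  omega

theorem Trivalent.noUniv (h : Trivalent g P) : NoUniv g P := by
  intro i hi c w hc
  have h1 := h w (mem_verts.2 ⟨i, hi, c, hc⟩)
  obtain ⟨p, hp, hne⟩ := Finset.exists_mem_ne (s := halves g P w) (by omega) (i, c)
  rw [mem_halves] at hp
  exact ⟨p.1, hp.1, p.2, hne, hp.2⟩

theorem Ends.halves_mem (he : Ends g i w z) (hi : i ∈ P) : ∃ c, (i, c) ∈ halves g P w ∧ g i (!c) = z := by
  obtain ⟨-, c, hc, hc'⟩ := he
  exact ⟨c, mem_halves.2 ⟨hi, hc⟩, hc'⟩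

theorem halves_cg_of_ne (he : Ends g i w z) {v : V} (hv : v ≠ w) (hz : z ≠ .inr v) :
    halves (cg g w z) (P.erase i) v = halves g P v := by
  obtain ⟨-, c, hc, hc'⟩ := he
  ext ⟨j, d⟩
  simp only [mem_halves, Finset.mem_erase]
  constructor
  · rintro ⟨⟨hji, hj⟩, hd⟩
    refine ⟨hj, ?_⟩
    by_cases hw : g j d = .inr w
    · rw [cg_of_eq hw] at hd; exact (hz hd).elim
    · rwa [cg_of_ne hw] at hd
  · rintro ⟨hj, hd⟩
    refine ⟨⟨?_, hj⟩, ?_⟩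
    · rintro rfl
      have : d = c ∨ d = !c := by cases c <;> cases d <;> simp
      rcases this with rfl | rfl
      · exact hv (Sum.inr_injective (hd.symm.trans hc))
      · exact hz (hc'.symm.trans hd)
    · rw [cg_of_ne (by rw [hd]; simpa using hv), hd]

theorem card_union_erase {α : Type} [DecidableEq α] {X Y : Finset α} (hd : Disjoint X Y) {p q : α}
    (hp : p ∈ X ∪ Y) (hq : q ∈ X ∪ Y) (hpq : p ≠ q) :
    (((X ∪ Y).erase p).erase q).card + 2 = X.card + Y.card := by
  rw [← Finset.card_union_of_disjoint hd, ← Finset.card_erase_add_one hp,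
    ← Finset.card_erase_add_one (s := (X ∪ Y).erase p) (Finset.mem_erase.2 ⟨hpq.symm, hq⟩)]

theorem card_halves_cg {u : V} (he : Ends g i w (.inr u)) (hi : i ∈ P) :
    (halves (cg g w (.inr u)) (P.erase i) u).card + 2 = (halves g P w).card + (halves g P u).card := by
  obtain ⟨hz, c, hc, hc'⟩ := he
  have hne : u ≠ w := fun h => hz (by rw [h])
  rw [← card_union_erase (p := (i, c)) (q := (i, !c))]
  · congr 2
    ext ⟨j, d⟩
    simp only [mem_halves, Finset.mem_erase, Finset.mem_union, Prod.mk.injEq, ne_eq, Prod.mk.injEq]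
    have h1 : cg g w (.inr u) j d = .inr u ↔ g j d = .inr w ∨ g j d = .inr u := by
      by_cases hw : g j d = .inr w
      · simp [cg_of_eq hw, hw]
      · simp [cg_of_ne hw, hw]
    rw [h1]
    have h2 : d = c ∨ d = !c := by cases c <;> cases d <;> simp
    constructor
    · rintro ⟨⟨hji, hj⟩, hd⟩
      exact ⟨fun h => hji h.1, fun h => hji h.1, hd.imp (⟨hj, ·⟩) (⟨hj, ·⟩)⟩
    · rintro ⟨h3, h4, h5⟩
      refine ⟨⟨fun hji => h2.elim (fun h => h4 ⟨hji, h⟩) fun h => h3 ⟨hji, h⟩, h5.elim (·.1) (·.1)⟩,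
        h5.imp (·.2) (·.2)⟩
  · rw [Finset.disjoint_left]
    intro p hp hp'
    rw [mem_halves] at hp hp'
    exact hne (Sum.inr_injective (hp'.2.symm.trans hp.2))
  · exact Finset.mem_union_left _ (mem_halves.2 ⟨hi, hc⟩)
  · exact Finset.mem_union_right _ (mem_halves.2 ⟨hi, hc'⟩)
  · simp

theorem extHalves_cg_inr {u : V} (he : Ends g i w (.inr u)) :
    extHalves (cg g w (.inr u)) (P.erase i) = extHalves g P := by
  obtain ⟨hz, c, hc, hc'⟩ := he
  ext ⟨j, d⟩
  simp only [mem_extHalves, Finset.mem_erase]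
  constructor
  · rintro ⟨⟨hji, hj⟩, s, hd⟩
    refine ⟨hj, s, ?_⟩
    by_cases hw : g j d = .inr w
    · rw [cg_of_eq hw] at hd; simp at hd
    · rwa [cg_of_ne hw] at hd
  · rintro ⟨hj, s, hd⟩
    refine ⟨⟨?_, hj⟩, s, ?_⟩
    · rintro rfl
      have : d = c ∨ d = !c := by cases c <;> cases d <;> simp
      rcases this with rfl | rfl <;> simp_all
    · rw [cg_of_ne (by simp [hd]), hd]

theorem card_extHalves_cg_inl {s : S} (he : Ends g i w (.inl s)) (hi : i ∈ P) :
    (extHalves (cg g w (.inl s)) (P.erase i)).card + 2 = (halves g P w).card + (extHalves g P).card := by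
  obtain ⟨hz, c, hc, hc'⟩ := he
  rw [← card_union_erase (p := (i, c)) (q := (i, !c))]
  · congr 2
    ext ⟨j, d⟩
    simp only [mem_halves, mem_extHalves, Finset.mem_erase, Finset.mem_union, Prod.mk.injEq, ne_eq, Prod.mk.injEq]
    have h1 : (∃ t, cg g w (.inl s) j d = .inl t) ↔ g j d = .inr w ∨ ∃ t, g j d = .inl t := by
      by_cases hw : g j d = .inr w
      · simp [cg_of_eq hw, hw]
      · simp [cg_of_ne hw, hw]
    rw [h1]
    have h2 : d = c ∨ d = !c := by cases c <;> cases d <;> simp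
    constructor
    · rintro ⟨⟨hji, hj⟩, hd⟩
      exact ⟨fun h => hji h.1, fun h => hji h.1, hd.imp (⟨hj, ·⟩) (⟨hj, ·⟩)⟩
    · rintro ⟨h3, h4, h5⟩
      refine ⟨⟨fun hji => h2.elim (fun h => h4 ⟨hji, h⟩) fun h => h3 ⟨hji, h⟩, h5.elim (·.1) (·.1)⟩,
        h5.imp (·.2) (·.2)⟩
  · rw [Finset.disjoint_left]
    intro p hp hp'
    rw [mem_halves] at hp
    rw [mem_extHalves, hp.2] at hp'
    simp at hp'
  · exact Finset.mem_union_left _ (mem_halves.2 ⟨hi, hc⟩)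
  · exact Finset.mem_union_right _ (mem_extHalves.2 ⟨hi, s, hc'⟩)
  · simp

theorem Trivalent.cg (h : Trivalent g P) (he : Ends g i w z) (hi : i ∈ P) :
    Trivalent (cg g w z) (P.erase i) := by
  intro v hv
  rw [verts_cg he hi h.noUniv, Finset.mem_erase] at hv
  by_cases hz : z = .inr v
  · subst hz
    have h1 := card_halves_cg he hi
    have h2 := h v hv.2
    have h3 := h w (he.mem_verts hi)
    omega
  · rw [halves_cg_of_ne he hv.1 hz]
    exact h v hv.2

theorem defect_cg_inr {u : V} (he : Ends g i w (.inr u)) (hi : i ∈ P) (hP : NoUniv g P) :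
    defect (cg g w (.inr u)) (P.erase i) = defect g P + 1 := by
  have h1 := Finset.card_erase_add_one hi
  have h2 := Finset.card_erase_add_one (he.mem_verts hi)
  rw [defect, defect, verts_cg he hi hP, extHalves_cg_inr he, ← h1, ← h2]
  push_cast
  ring

theorem defect_cg_inl {s : S} (he : Ends g i w (.inl s)) (hi : i ∈ P) (hP : Trivalent g P) :
    defect (cg g w (.inl s)) (P.erase i) ≤ defect g P := by
  have h1 := Finset.card_erase_add_one hi
  have h2 := Finset.card_erase_add_one (he.mem_verts hi)
  have h3 := card_extHalves_cg_inl he hi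
  have h4 := hP w (he.mem_verts hi)
  rw [defect, defect, verts_cg he hi hP.noUniv, ← h1, ← h2]
  push_cast
  omega

theorem halves_cls {v : V} {c : Finset E} (hc : c ∈ comps g P) (hv : v ∈ verts g c) :
    halves g c v = halves g P v := by
  obtain ⟨j, hj, d, hd⟩ := mem_verts.1 hv
  have h1 := eq_cls_of_mem hc hj
  ext ⟨k, d'⟩
  simp only [mem_halves]
  refine and_congr_left fun hd' => ⟨fun hk => subset_of_mem_comps hc hk, fun hk => ?_⟩
  rw [h1]
  exact mem_cls.2 ⟨hk, .of_mem (subset_of_mem_comps hc hj) hk hd hd'⟩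

theorem Trivalent.comps (h : Trivalent g P) {c : Finset E} (hc : c ∈ comps g P) : Trivalent g c := by
  intro v hv
  rw [halves_cls hc hv]
  exact h v (verts_mono (subset_of_mem_comps hc) hv)

theorem defect_eq_sum_comps (g : Graph S V E) (P : Finset E) :
    defect g P = ∑ c ∈ comps g P, defect g c := by
  rw [defect_eq_sum, ← biUnion_verts_comps, Finset.sum_biUnion]
  · refine Finset.sum_congr rfl fun c hc => ?_
    rw [defect_eq_sum]
    exact Finset.sum_congr rfl fun v hv => by rw [halves_cls hc hv]
  · intro c hc c' hc' hne
    exact verts_disjoint hc hc' hne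

theorem Trivalent.defect_le (h : Trivalent g P) {c : Finset E} (hc : c ∈ HairyGraphs.comps g P) :
    defect g c ≤ defect g P := by
  rw [defect_eq_sum_comps g P]
  exact Finset.single_le_sum (f := defect g) (fun c hc => (h.comps hc).defect_nonneg) hc

/-- The edges are linked with each other. -/
def IsLinked (g : Graph S V E) (P : Finset E) : Prop := ∀ i ∈ P, ∀ j ∈ P, LinkedIn g P i j

theorem isLinked_iff : IsLinked g P ↔ ∀ Q ⊆ P, Q.Nonempty → Unlinked g Q (P \ Q) → Q = P := by
  constructor
  · intro h Q hQ ⟨i, hi⟩ hu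
    refine hQ.antisymm fun j hj => ?_
    have := h i (hQ hi) j hj
    rw [← Finset.union_sdiff_of_subset hQ] at this
    exact ((hu.linkedIn this).1 hi).1
  · intro h i hi j hj
    have := h (cls g P i) (cls_subset i) ⟨i, self_mem_cls hi⟩ (unlinked_cls i)
    rw [← this] at hj
    exact (mem_cls.1 hj).2

theorem isLinked_of_mem_comps {c : Finset E} (hc : c ∈ comps g P) : IsLinked g c := by
  obtain ⟨i, -, rfl⟩ := mem_comps.1 hc
  exact fun j hj k hk => linkedIn_cls hj hk

theorem IsLinked.cg {u : V} (h : IsLinked g P) (he : Ends g i w (.inr u)) (hi : i ∈ P) :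
    IsLinked (cg g w (.inr u)) (P.erase i) := by
  rw [isLinked_iff] at h ⊢
  intro Q hQ hne hu
  have hiQ : i ∉ Q := fun hh => Finset.notMem_erase i P (hQ hh)
  obtain ⟨-, ci, hci, hci'⟩ := he
  have hci2 : ∀ d v, g i d = .inr v → v = w ∨ v = u := by
    intro d v hd
    have : d = ci ∨ d = !ci := by cases ci <;> cases d <;> simp
    rcases this with rfl | rfl
    · exact .inl (Sum.inr_injective (hd.symm.trans hci))
    · exact .inr (Sum.inr_injective (hd.symm.trans hci'))
  have key : ∀ j c v, g j c = .inr v → HairyGraphs.cg g w (.inr u) j c = .inr (if v = w then u else v) := by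
    intro j c v hv
    split_ifs with hvw
    · rw [cg_of_eq (by rw [hv, hvw])]
    · rw [cg_of_ne (by rw [hv]; simpa using hvw), hv]
  have key2 : ∀ j c v, g j c = .inr v → (v = w ∨ v = u) → HairyGraphs.cg g w (.inr u) j c = .inr u := by
    intro j c v hv hvw
    rw [key j c v hv]
    split_ifs with hvw'
    · rfl
    · rw [hvw.resolve_left hvw']
  by_cases hR : ∃ j ∈ P.erase i \ Q, ∃ c v, g j c = .inr v ∧ (v = w ∨ v = u)
  · exfalso
    obtain ⟨j, hj, c, v, hv, hvw⟩ := hR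
    have := h Q (hQ.trans (Finset.erase_subset _ _)) hne (by
      intro k hk l hl d d' v' hd hd'
      rw [Finset.mem_sdiff] at hl
      by_cases hli : l = i
      · subst hli
        exact hu k hk j hj d c u (key2 k d v' hd (hci2 d' v' hd')) (key2 j c v hv hvw)
      · exact hu k hk l (Finset.mem_sdiff.2 ⟨Finset.mem_erase.2 ⟨hli, hl.1⟩, hl.2⟩) d d' _
          (key k d v' hd) (key l d' v' hd'))
    rw [this] at hiQ
    exact hiQ hi
  · have := h (insert i Q) (Finset.insert_subset hi (hQ.trans (Finset.erase_subset _ _)))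
      (Finset.insert_nonempty _ _) (by
      intro k hk l hl d d' v' hd hd'
      rw [Finset.mem_sdiff, Finset.mem_insert, not_or] at hl
      have hl' : l ∈ P.erase i \ Q := Finset.mem_sdiff.2 ⟨Finset.mem_erase.2 ⟨hl.2.1, hl.1⟩, hl.2.2⟩
      rcases Finset.mem_insert.1 hk with rfl | hk
      · exact hR ⟨l, hl', d', v', hd', hci2 d v' hd⟩
      · exact hu k hk l hl' d d' _ (key k d v' hd) (key l d' v' hd'))
    rw [← this, Finset.erase_insert hiQ]

theorem extHalves_nonempty_of_comps {s : S} (h : IsLinked g P) (he : Ends g i w (.inl s)) (hi : i ∈ P)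
    {c : Finset E} (hc : c ∈ comps (cg g w (.inl s)) (P.erase i)) :
    (extHalves (cg g w (.inl s)) c).Nonempty := by
  by_contra hemp
  rw [Finset.not_nonempty_iff_eq_empty] at hemp
  have hno : ∀ j ∈ c, ∀ d t, cg g w (.inl s) j d ≠ .inl t := by
    intro j hj d t ht
    have : (j, d) ∈ extHalves (cg g w (.inl s)) c := mem_extHalves.2 ⟨hj, t, ht⟩
    rw [hemp] at this
    simp at this
  have hcP := subset_of_mem_comps hc
  rw [isLinked_iff] at h
  have := h c (hcP.trans (Finset.erase_subset _ _)) (nonempty_of_mem_comps hc) (by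
    intro k hk l hl d d' v hd hd'
    have hkw : g k d ≠ .inr w := fun hw => hno k hk d s (cg_of_eq hw)
    rw [Finset.mem_sdiff] at hl
    have hli : l ≠ i := by
      rintro rfl
      have := (he.eq_of_ne (c := d') (by rw [hd', ← hd]; exact hkw)).1
      rw [hd'] at this
      simp at this
    refine hl.2 ?_
    rw [eq_cls_of_mem hc hk]
    exact mem_cls.2 ⟨Finset.mem_erase.2 ⟨hli, hl.1⟩, .of_mem (hcP hk) (Finset.mem_erase.2 ⟨hli, hl.1⟩)
      ((cg_of_ne hkw).trans hd) ((cg_of_ne (by rw [hd', ← hd]; exact hkw)).trans hd')⟩)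
  have hi' : i ∈ c := by rw [this]; exact hi
  exact Finset.notMem_erase i P (hcP hi')

theorem card_le_of_isLinked (P : Finset E) : ∀ (g : Graph S V E), P.Nonempty → IsLinked g P → Trivalent g P →
    (extHalves g P).card + (verts g P).card ≤ P.card + 1 := by
  induction P using Finset.strongInduction with
  | H P ih =>
    intro g hne h ht
    by_cases hex : ∃ i ∈ P, ∃ w u, Ends g i w (.inr u)
    · obtain ⟨i, hi, w, u, he⟩ := hex
      have h2 := Finset.card_erase_add_one (he.mem_verts hi)
      have h3 := Finset.card_erase_add_one hi
      have hne' : (P.erase i).Nonempty := by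
        obtain ⟨c, hc, -⟩ := he.halves_mem hi
        obtain ⟨p, hp, hpc⟩ := Finset.exists_mem_ne (s := halves g P w)
          (by have := ht w (he.mem_verts hi); omega) (i, c)
        refine ⟨p.1, Finset.mem_erase.2 ⟨fun hpi => ?_, (mem_halves.1 hp).1⟩⟩
        have hp2 : p.2 ≠ c := fun h => hpc (Prod.ext hpi h)
        have hpe := (mem_halves.1 hp).2
        have hce := (mem_halves.1 hc).2
        rw [hpi] at hpe
        obtain ⟨hz, d, hd, hd'⟩ := he
        have : p.2 = !d ∨ c = !d := by
          cases hp2' : p.2 <;> cases c <;> cases d <;> simp_all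
        rcases this with h | h
        · rw [h] at hpe; exact hz (hd'.symm.trans hpe)
        · simp only at hce; rw [h] at hce; exact hz (hd'.symm.trans hce)
      have h1 := ih (P.erase i) (Finset.erase_ssubset hi) (cg g w (.inr u)) hne' (h.cg he hi) (ht.cg he hi)
      rw [extHalves_cg_inr he, verts_cg he hi ht.noUniv] at h1
      omega
    · have hE : ∀ i ∈ P, ∀ w u, g i false = .inr w → g i true = .inr u → w = u := by
        intro i hi w u hw hu
        by_contra hwu
        exact hex ⟨i, hi, w, u, by simpa using Ne.symm hwu, false, hw, hu⟩
      have hE' : ∀ i ∈ P, ∀ c d w u, g i c = .inr w → g i d = .inr u → w = u := by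
        intro i hi c d w u hw hu
        cases c <;> cases d
        · exact Sum.inr_injective (hw.symm.trans hu)
        · exact hE i hi w u hw hu
        · exact (hE i hi u w hu hw).symm
        · exact Sum.inr_injective (hw.symm.trans hu)
      rcases (verts g P).eq_empty_or_nonempty with hv | ⟨v, hv⟩
      · obtain ⟨i, hi⟩ := hne
        rw [isLinked_iff] at h
        have hP := h {i} (by simpa using hi) (by simp) (by
          intro k hk l hl d d' v hd hd'
          rw [Finset.mem_singleton] at hk
          subst hk
          have : v ∈ verts g P := mem_verts.2 ⟨k, hi, d, hd⟩
          rw [hv] at this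
          simp at this)
        have h2 := two_mul_card g P
        rw [hv, Finset.sum_empty] at h2
        rw [hv, ← hP] at *
        simp at h2 ⊢
        omega
      · have hall : ∀ i ∈ P, ∃ c, g i c = .inr v := by
          have hP := isLinked_iff.1 h ((halves g P v).image Prod.fst) (by
              intro i hi
              obtain ⟨p, hp, rfl⟩ := Finset.mem_image.1 hi
              exact (mem_halves.1 hp).1) (by
              rw [Finset.image_nonempty, ← Finset.card_pos]
              have := ht v hv
              omega) (by
              intro k hk l hl d d' v' hd hd'
              obtain ⟨p, hp, rfl⟩ := Finset.mem_image.1 hk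
              rw [mem_halves] at hp
              have := hE' p.1 hp.1 _ _ _ _ hd hp.2
              subst this
              rw [Finset.mem_sdiff] at hl
              exact hl.2 (Finset.mem_image.2 ⟨(l, d'), mem_halves.2 ⟨hl.1, hd'⟩, rfl⟩))
          intro i hi
          rw [← hP] at hi
          obtain ⟨p, hp, rfl⟩ := Finset.mem_image.1 hi
          exact ⟨p.2, (mem_halves.1 hp).2⟩
        have hv1 : verts g P = {v} := by
          ext v'
          rw [Finset.mem_singleton]
          constructor
          · intro hv'
            obtain ⟨i, hi, c, hc⟩ := mem_verts.1 hv'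
            obtain ⟨d, hd⟩ := hall i hi
            exact hE' i hi _ _ _ _ hc hd
          · rintro rfl; exact hv
        have h2 : (extHalves g P).card ≤ P.card := by
          refine Finset.card_le_card_of_injOn Prod.fst (fun p hp => (mem_extHalves.1 hp).1) ?_
          rintro ⟨i, c⟩ hp ⟨j, d⟩ hq hij
          simp only at hij
          subst hij
          obtain ⟨hi, s, hs⟩ := mem_extHalves.1 hp
          obtain ⟨-, t, ht⟩ := mem_extHalves.1 hq
          obtain ⟨c', hc'⟩ := hall i hi
          simp only at hs ht
          have : c ≠ c' := by rintro rfl; rw [hs] at hc'; simp at hc'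
          have : d ≠ c' := by rintro rfl; rw [ht] at hc'; simp at hc'
          cases c <;> cases d <;> cases c' <;> simp_all
        rw [hv1, Finset.card_singleton]
        omega

end Valences

section Primitivity

variable {S V E : Type} [LinearOrder E] [LinearOrder V] [Fintype V]
variable {S' V' E' : Type} [LinearOrder E'] [LinearOrder V'] [Fintype V']
variable {h : S → S'} {a : E → E'} {b : V → V'} {f : E → Bool} {g' : Graph S' V' E'}
variable {g : Graph S V E} {P Q : Finset E} {i j : E} {w : V} {z : S ⊕ V}

/-- The subgraph given by a set of edges is primitive if one splits its external vertices. -/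
structure Prim (g : Graph S V E) (P : Finset E) : Prop where
  linked : IsLinked g P
  trivalent : Trivalent g P
  ext : (extHalves g P).Nonempty

theorem Prim.nonempty (h : Prim g P) : P.Nonempty := by
  obtain ⟨p, hp⟩ := h.ext
  exact ⟨p.1, (mem_extHalves.1 hp).1⟩

theorem Prim.noUniv (h : Prim g P) : NoUniv g P := h.trivalent.noUniv

theorem Prim.card_le (h : Prim g P) : (extHalves g P).card + (verts g P).card ≤ P.card + 1 :=
  card_le_of_isLinked P g h.nonempty h.linked h.trivalent

theorem Prim.cg {u : V} (h : Prim g P) (he : Ends g i w (.inr u)) (hi : i ∈ P) :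
    Prim (cg g w (.inr u)) (P.erase i) :=
  ⟨h.linked.cg he hi, h.trivalent.cg he hi, by rw [extHalves_cg_inr he]; exact h.ext⟩

theorem Prim.comps_cg {s : S} (h : Prim g P) (he : Ends g i w (.inl s)) (hi : i ∈ P) {c : Finset E}
    (hc : c ∈ comps (HairyGraphs.cg g w (.inl s)) (P.erase i)) : Prim (HairyGraphs.cg g w (.inl s)) c ∧
      defect (HairyGraphs.cg g w (.inl s)) c ≤ defect g P :=
  ⟨⟨isLinked_of_mem_comps hc, (h.trivalent.cg he hi).comps hc,
    extHalves_nonempty_of_comps h.linked he hi hc⟩,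
    ((h.trivalent.cg he hi).defect_le hc).trans (defect_cg_inl he hi h.trivalent)⟩

theorem GMap.card_halves (M : GMap h a b f g P g') {v : V} (hv : v ∈ verts g P) :
    (halves g' (P.image a) (b v)).card = (halves g P v).card := by
  symm
  refine Finset.card_bij (fun p _ => (a p.1, xor p.2 (f p.1))) ?_ ?_ ?_
  · intro p hp
    rw [mem_halves] at hp ⊢
    refine ⟨Finset.mem_image_of_mem a hp.1, ?_⟩
    rw [M.map p.1 hp.1, Bool.xor_assoc, Bool.xor_self, Bool.xor_false, hp.2]
    rfl
  · intro p hp q hq hpq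
    rw [mem_halves] at hp hq
    simp only [Prod.mk.injEq] at hpq
    have h1 := M.injE hp.1 hq.1 hpq.1
    rw [h1] at hpq
    exact Prod.ext h1 (by simpa using hpq.2)
  · rintro ⟨i', c⟩ hp
    rw [mem_halves] at hp
    obtain ⟨i, hi, rfl⟩ := Finset.mem_image.1 hp.1
    have h1 := hp.2
    simp only at h1
    rw [M.map i hi] at h1
    rcases hu : g i (xor c (f i)) with s | u
    · simp [hu] at h1
    · rw [hu] at h1
      have h2 := M.injV (mem_verts.2 ⟨i, hi, _, hu⟩) hv (Sum.inr_injective h1)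
      exact ⟨(i, xor c (f i)), mem_halves.2 ⟨hi, by rw [← h2]; exact hu⟩, by simp⟩

theorem GMap.card_extHalves (M : GMap h a b f g P g') :
    (extHalves g' (P.image a)).card = (extHalves g P).card := by
  symm
  refine Finset.card_bij (fun p _ => (a p.1, xor p.2 (f p.1))) ?_ ?_ ?_
  · intro p hp
    rw [mem_extHalves] at hp ⊢
    obtain ⟨hi, s, hs⟩ := hp
    refine ⟨Finset.mem_image_of_mem a hi, h s, ?_⟩
    rw [M.map p.1 hi, Bool.xor_assoc, Bool.xor_self, Bool.xor_false, hs]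
    rfl
  · intro p hp q hq hpq
    rw [mem_extHalves] at hp hq
    simp only [Prod.mk.injEq] at hpq
    have h1 := M.injE hp.1 hq.1 hpq.1
    rw [h1] at hpq
    exact Prod.ext h1 (by simpa using hpq.2)
  · rintro ⟨i', c⟩ hp
    rw [mem_extHalves] at hp
    obtain ⟨i, hi, rfl⟩ := Finset.mem_image.1 hp.1
    obtain ⟨s', h1⟩ := hp.2
    simp only at h1
    rw [M.map i hi] at h1
    rcases hu : g i (xor c (f i)) with s | u
    · exact ⟨(i, xor c (f i)), mem_extHalves.2 ⟨hi, s, hu⟩, by simp⟩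
    · simp [hu] at h1

theorem GMap.card_verts (M : GMap h a b f g P g') : (verts g' (P.image a)).card = (verts g P).card := by
  rw [M.verts_image, Finset.card_image_of_injOn M.injV]

theorem GMap.card_edges (M : GMap h a b f g P g') : (P.image a).card = P.card :=
  Finset.card_image_of_injOn M.injE

theorem GMap.prim_iff (M : GMap h a b f g P g') : Prim g' (P.image a) ↔ Prim g P := by
  have h1 : IsLinked g' (P.image a) ↔ IsLinked g P := by
    unfold IsLinked
    simp only [Finset.forall_mem_image]
    exact forall₂_congr fun i hi => forall₂_congr fun j hj => M.linkedIn_iff hi hj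
  have h2 : Trivalent g' (P.image a) ↔ Trivalent g P := by
    unfold Trivalent
    rw [M.verts_image]
    simp only [Finset.forall_mem_image]
    exact forall₂_congr fun v hv => by rw [M.card_halves hv]
  have h3 : (extHalves g' (P.image a)).Nonempty ↔ (extHalves g P).Nonempty := by
    rw [← Finset.card_pos, ← Finset.card_pos, M.card_extHalves]
  exact ⟨fun h => ⟨h1.1 h.1, h2.1 h.2, h3.1 h.3⟩, fun h => ⟨h1.2 h.1, h2.2 h.2, h3.2 h.3⟩⟩

theorem GMap.defect_eq (M : GMap h a b f g P g') : defect g' (P.image a) = defect g P := by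
  rw [defect, defect, M.card_verts, M.card_edges, M.card_extHalves]

theorem valence_eq [Fintype E] (G : Graph S V E) (w : V) :
    valence G (.inr w) = (halves G Finset.univ w).card := by
  classical
  rw [valence, Nat.card_eq_fintype_card, Fintype.card_subtype, halves]
  congr 1

theorem IsPrimitive.prim [Fintype E] {G : Graph S V E} (hG : IsPrimitive G) : Prim G Finset.univ where
  linked := linked_univ hG
  trivalent v _ := by rw [← valence_eq]; exact hG.int_valence v
  ext := by
    obtain ⟨s⟩ := hG.nonempty
    obtain ⟨p, ⟨-, hp⟩, -⟩ := hG.univExt s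
    exact ⟨p, mem_extHalves.2 ⟨Finset.mem_univ _, s, hp⟩⟩

theorem Prim.isPrimitive [Fintype E] {G : Graph S V E} (h : Prim G Finset.univ)
    (hs : UnivExt G Finset.univ) (hv : verts G Finset.univ = Finset.univ) : IsPrimitive G where
  nonempty := by
    obtain ⟨p, hp⟩ := h.ext
    obtain ⟨-, s, -⟩ := mem_extHalves.1 hp
    exact ⟨s⟩
  ext_valence s := by
    rw [valence, Nat.card_eq_one_iff_unique]
    obtain ⟨p, ⟨-, hp⟩, hu⟩ := hs s
    refine ⟨⟨?_⟩, ⟨p, hp⟩⟩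
    rintro ⟨q, hq⟩ ⟨q', hq'⟩
    exact Subtype.ext ((hu q ⟨Finset.mem_univ _, hq⟩).trans (hu q' ⟨Finset.mem_univ _, hq'⟩).symm)
  int_valence w := by
    rw [valence_eq]
    exact h.trivalent w (by rw [hv]; exact Finset.mem_univ w)
  linked i j := linked_iff.2 (h.linked i (Finset.mem_univ i) j (Finset.mem_univ j))

theorem UnivExt.card [Fintype S] (h : UnivExt g P) : (extHalves g P).card = Fintype.card S := by
  rw [← Finset.card_univ]
  have key : ∀ p ∈ extHalves g P, ∃ s, g p.1 p.2 = .inl s := fun p hp => (mem_extHalves.1 hp).2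
  refine Finset.card_bij (fun p hp => (key p hp).choose) (fun _ _ => Finset.mem_univ _) ?_ ?_
  · intro p hp q hq hpq
    have h1 := (key p hp).choose_spec
    have h2 := (key q hq).choose_spec
    rw [← hpq] at h2
    exact (h _).unique ⟨(mem_extHalves.1 hp).1, h1⟩ ⟨(mem_extHalves.1 hq).1, h2⟩
  · intro s _
    obtain ⟨p, ⟨hp, hs⟩, -⟩ := h s
    have hp' : p ∈ extHalves g P := mem_extHalves.2 ⟨hp, s, hs⟩
    exact ⟨p, hp', Sum.inl_injective ((key p hp').choose_spec.symm.trans hs)⟩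

/-- Primitive subgraphs are isomorphic to numbered graphs. -/
theorem Prim.exists_model (hP : Prim g P) :
    ∃ (G : Graph (Fin (extHalves g P).card) (Fin (verts g P).card) (Fin P.card)) (h : Fin _ → S)
      (a : Fin _ → E) (b : Fin _ → V), GMap h a b (fun _ => false) G Finset.univ g ∧
        Finset.univ.image a = P ∧ IsPrimitive G := by
  let oe := P.orderIsoOfFin rfl
  let ov := (verts g P).orderIsoOfFin rfl
  let es : Legs g P ≃ Fin (extHalves g P).card := (Equiv.ofBijective
    (fun p : Legs g P => (⟨(p.1.1.1, p.1.2), mem_extHalves.2 ⟨p.1.1.2, Sum.isLeft_iff.1 p.2⟩⟩ :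
      {p // p ∈ extHalves g P})) (by
      constructor
      · intro p q hpq
        simp only [Subtype.mk.injEq, Prod.mk.injEq] at hpq
        exact Subtype.ext (Prod.ext (Subtype.ext hpq.1) hpq.2)
      · rintro ⟨⟨i, c⟩, hp⟩
        have hp' := mem_extHalves.1 hp
        exact ⟨⟨(⟨i, hp'.1⟩, c), Sum.isLeft_iff.2 hp'.2⟩, rfl⟩)).trans (Finset.equivFin _)
  let G : Graph (Fin (extHalves g P).card) (Fin (verts g P).card) (Fin P.card) :=
    fun i c => (restr g P (oe i) c).map es ov.symm
  have M : GMap (fun s => legVertex g P (es.symm s)) (fun i => (oe i : E)) (fun v => (ov v : V))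
      (fun _ => false) G Finset.univ g :=
    { injE := fun i _ j _ hij => oe.injective (Subtype.ext hij)
      injV := fun i _ j _ hij => ov.injective (Subtype.ext hij)
      map := by
        intro i _ c
        rw [Bool.xor_false, ← restr_map g P (oe i) c]
        simp only [G, map_map_sum]
        congr 1
        · funext p; simp
        · funext v; simp }
  have him : Finset.univ.image (fun i => (oe i : E)) = P := by
    ext i
    simp only [Finset.mem_image, Finset.mem_univ, true_and]
    exact ⟨fun ⟨j, hj⟩ => hj ▸ (oe j).2, fun hi => ⟨oe.symm ⟨i, hi⟩, by simp⟩⟩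
  refine ⟨G, _, _, _, M, him, ?_⟩
  refine ((M.prim_iff).1 (by rwa [him])).isPrimitive ?_ ?_
  · intro s
    have h1 : ∀ i c, G i c = .inl s ↔ restr g P (oe i) c = .inl (es.symm s) := by
      intro i c
      simp only [G]
      rcases restr g P (oe i) c with t | v
      · simp [Equiv.eq_symm_apply]
      · simp
    set p := es.symm s with hp
    have h2 : ∀ i c, restr g P (oe i) c = .inl p ↔ (oe i, c) = p.1 := by
      intro i c
      constructor
      · intro hh
        have h3 : (g (oe i) c).isLeft := by
          by_contra h4
          simp [restr, h4] at hh
        rw [restr_inl h3] at hh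
        rw [← Sum.inl_injective hh]
      · intro hh
        have h3 : (g (oe i) c).isLeft := by
          have := p.2
          rw [← hh] at this
          exact this
        rw [restr_inl h3]
        exact congrArg _ (Subtype.ext hh)
    refine ⟨(oe.symm p.1.1, p.1.2), ⟨Finset.mem_univ _, ?_⟩, ?_⟩
    · rw [h1, h2]; simp
    · rintro ⟨i, c⟩ ⟨-, hic⟩
      rw [h1, h2] at hic
      rw [← hic]
      simp
  · have h1 := M.card_verts
    rw [him] at h1
    exact Finset.eq_univ_of_card _ (by rw [← h1]; simp)

end Primitivity

section CurvatureSeries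

variable {R : Type} [Ring R] [Algebra ℚ R] {K : CoeffAlgebra R}
variable {A : Type u} [NonUnitalRing A] [Module ℚ A] {D : DGCommAlgebra A}
variable {S V E : Type} [LinearOrder E] [LinearOrder V] [Fintype V]
variable {g : Graph S V E} {P : Finset E} {i : E} {w : V} {z : S ⊕ V}

theorem relabelMap {k v e : ℕ} (G : Graph (Fin k) (Fin v) (Fin e)) (π : Equiv.Perm (Fin k))
    (τ : Equiv.Perm (Fin v)) (σ : Equiv.Perm (Fin e)) (f : Fin e → Bool) :
    GMap π σ.symm τ (fun i => f (σ.symm i)) G Finset.univ (G.relabel π τ σ f) where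
  injE := σ.symm.injective.injOn
  injV := τ.injective.injOn
  map i _ c := by simp [Graph.relabel]

theorem gsign_relabel (n : ℕ) {k v e : ℕ} {G : Graph (Fin k) (Fin v) (Fin e)}
    (hv : verts G Finset.univ = Finset.univ) (τ : Equiv.Perm (Fin v)) (σ : Equiv.Perm (Fin e))
    (f : Fin e → Bool) :
    gsign n σ.symm τ (fun i => f (σ.symm i)) G Finset.univ = relabelSign n τ σ f := by
  rw [gsign, relabelSign, hv, invSign_perm, invSign_perm]
  rw [Equiv.prod_comp σ.symm fun i => flipSign (f i)]
  simp [flipSign]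

theorem image_univ_perm {e : ℕ} (σ : Equiv.Perm (Fin e)) : Finset.univ.image σ = Finset.univ := by
  ext i; simp

theorem relabel_relabel {k v e : ℕ} (G : Graph (Fin k) (Fin v) (Fin e)) (π : Equiv.Perm (Fin k))
    (τ : Equiv.Perm (Fin v)) (σ : Equiv.Perm (Fin e)) (f : Fin e → Bool) :
    (G.relabel π τ σ f).relabel π⁻¹ τ⁻¹ σ⁻¹ (fun i => f (σ⁻¹ i)) = G := by
  funext i c
  simp [Graph.relabel]

theorem isPrimitive_relabel {k v e : ℕ} (G : Graph (Fin k) (Fin v) (Fin e)) (π : Equiv.Perm (Fin k))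
    (τ : Equiv.Perm (Fin v)) (σ : Equiv.Perm (Fin e)) (f : Fin e → Bool) :
    IsPrimitive (G.relabel π τ σ f) ↔ IsPrimitive G := by
  have key : ∀ (G : Graph (Fin k) (Fin v) (Fin e)) (π : Equiv.Perm (Fin k))
    (τ : Equiv.Perm (Fin v)) (σ : Equiv.Perm (Fin e)) (f : Fin e → Bool), IsPrimitive G →
      IsPrimitive (G.relabel π τ σ f) := by
    intro G π τ σ f hG
    have M := relabelMap G π τ σ f
    have h1 := M.prim_iff.2 hG.prim
    rw [image_univ_perm] at h1
    refine h1.isPrimitive ?_ ?_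
    · intro s
      obtain ⟨p, ⟨-, hp⟩, hu⟩ := hG.univExt (π.symm s)
      have h2 : ∀ i c, G.relabel π τ σ f i c = .inl s ↔ G (σ i) (xor c (f i)) = .inl (π.symm s) := by
        intro i c
        simp only [Graph.relabel]
        rcases G (σ i) (xor c (f i)) with t | v
        · simp [Equiv.eq_symm_apply]
        · simp
      refine ⟨(σ.symm p.1, xor p.2 (f (σ.symm p.1))), ⟨Finset.mem_univ _, ?_⟩, ?_⟩
      · rw [h2]; simpa using hp
      · rintro ⟨i, c⟩ ⟨-, hic⟩
        rw [h2] at hic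
        rw [← hu (σ i, xor c (f i)) ⟨Finset.mem_univ _, hic⟩]
        simp
    · have h3 := M.verts_image
      rw [image_univ_perm] at h3
      rw [h3, hG.verts, image_univ_perm]
  exact ⟨fun h => by have := key _ π⁻¹ τ⁻¹ σ⁻¹ (fun i => f (σ⁻¹ i)) h; rwa [relabel_relabel] at this, key G π τ σ f⟩

theorem exts_univ [Fintype E] {G : Graph S V E} (h : UnivExt G Finset.univ) :
    exts G Finset.univ = Set.univ := by
  ext s
  obtain ⟨p, ⟨hp, hs⟩, -⟩ := h s
  simp only [Set.mem_univ, iff_true]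
  exact ⟨p.1, hp, p.2, hs⟩

theorem graphDeg_univ (n : ℕ) {k v e : ℕ} {G : Graph (Fin k) (Fin v) (Fin e)} (hv : verts G Finset.univ = Finset.univ) :
    graphDeg n G Finset.univ = ((n : ℤ) - 1) * e - n * v := by
  simp [graphDeg, hv]

open scoped Classical in
/-- A function on primitive subgraphs which is compatible with maps of graphs defines a series. -/
def seriesOf (F : ∀ k v e : ℕ, Graph (Fin k) (Fin v) (Fin e) → Tens K D (Fin k)) : Series K D :=
  fun k v e G => if IsPrimitive G then F k v e G else 0

theorem seriesOf_mem {n : ℕ} {m : ℤ} {F : ∀ k v e : ℕ, Graph (Fin k) (Fin v) (Fin e) → Tens K D (Fin k)}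
    (h1 : ∀ (k v e : ℕ) G, IsPrimitive G → F k v e G ∈ Tens.part K D (Fin k) (((n : ℤ) - 1) * e - n * v - m))
    (h2 : ∀ (k v e : ℕ) G (π : Equiv.Perm (Fin k)) (τ : Equiv.Perm (Fin v)) (σ : Equiv.Perm (Fin e)) f,
      IsPrimitive G → F k v e (G.relabel π τ σ f) = relabelSign n τ σ f • Tens.rename π (F k v e G)) :
    seriesOf F ∈ HGC K D n m := by
  intro k v e G
  refine ⟨?_, fun h => if_neg h, fun π τ σ f => ?_⟩
  · unfold seriesOf
    split_ifs with h
    · exact h1 _ _ _ _ h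
    · exact zero_mem _
  · unfold seriesOf
    by_cases h : IsPrimitive G
    · rw [if_pos h, if_pos ((isPrimitive_relabel ..).2 h), h2 _ _ _ _ _ _ _ _ h]
    · rw [if_neg h, if_neg fun h' => h ((isPrimitive_relabel ..).1 h'), map_zero, smul_zero]

/-- The curvature as a series. -/
def curv (n : ℕ) (x : Series K D) : Series K D := seriesOf (curvature n x)

theorem curv_mem {n : ℕ} {x : Series K D} (hx : x ∈ HGC K D n 0) : curv n x ∈ HGC K D n (-1) := by
  refine seriesOf_mem ?_ ?_
  · intro k v e G hG
    have := curvA_mem hx hG.noUniv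
    rwa [exts_univ hG.univExt, ← Tens.part_eq_hd, graphDeg_univ n hG.verts, ← curvature_eq hx hG,
      ← sub_neg_eq_add] at this
  · intro k v e G π τ σ f hG
    rw [curvature_eq hx hG, curvature_eq hx ((isPrimitive_relabel ..).2 hG)]
    have := curvA_nat hx (relabelMap G π τ σ f) hG.noUniv
    rwa [image_univ_perm, gsign_relabel n hG.verts] at this

theorem curv_apply {n : ℕ} {x : Series K D} {k v e : ℕ} {G : Graph (Fin k) (Fin v) (Fin e)}
    (hG : IsPrimitive G) : curv n x k v e G = curvature n x k v e G := if_pos hG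

/-- The value of a series on a primitive subgraph. -/
theorem Prim.atom_model {n : ℕ} (hP : Prim g P) :
    ∃ (G : Graph (Fin (extHalves g P).card) (Fin (verts g P).card) (Fin P.card)) (h : Fin _ → S) (ε : ℤ),
      IsPrimitive G ∧ (∀ (m : ℤ) (y : Series K D), y ∈ HGC K D n m → atom y g P = ε • Tens.rename h (y _ _ _ G)) ∧
      (∀ x : Series K D, x ∈ HGC K D n 0 → curvA n x g P = ε • Tens.rename h (curvature n x _ _ _ G)) := by
  obtain ⟨G, h, a, b, M, him, hG⟩ := hP.exists_model
  refine ⟨G, h, gsign n a b (fun _ => false) G Finset.univ, hG, ?_, ?_⟩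
  · intro m y hy
    rw [← atom_fin hy hG, ← atom_nat hy M, him]
  · intro x hx
    rw [curvature_eq hx hG, ← curvA_nat hx M hG.noUniv, him]

theorem Prim.atom_curv {n : ℕ} {x : Series K D} (hx : x ∈ HGC K D n 0) (hP : Prim g P) :
    atom (curv n x) g P = curvA n x g P := by
  obtain ⟨G, h, ε, hG, h1, h2⟩ := hP.atom_model (K := K) (D := D) (n := n)
  rw [h1 _ _ (curv_mem hx), h2 x hx, curv_apply hG]

/-- The numerical defect. -/
def dfct (k v e : ℕ) : ℤ := 2 * e - k - 3 * v

theorem Prim.atom_congr {n : ℕ} {m : ℤ} {x y : Series K D} (hx : x ∈ HGC K D n m) (hy : y ∈ HGC K D n m)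
    (hP : Prim g P) (h : ∀ k v e G, IsPrimitive G → dfct k v e = defect g P → x k v e G = y k v e G) :
    atom x g P = atom y g P := by
  obtain ⟨G, h', ε, hG, h1, -⟩ := hP.atom_model (K := K) (D := D) (n := n)
  rw [h1 _ _ hx, h1 _ _ hy, h _ _ _ G hG rfl]

theorem IsPrimitive.defect_eq {k v e : ℕ} {G : Graph (Fin k) (Fin v) (Fin e)} (hG : IsPrimitive G) :
    defect G Finset.univ = dfct k v e := by
  rw [defect, hG.univExt.card, hG.verts, dfct]
  simp

theorem IsPrimitive.dfct_nonneg {k v e : ℕ} {G : Graph (Fin k) (Fin v) (Fin e)} (hG : IsPrimitive G) :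
    0 ≤ dfct k v e := by
  rw [← hG.defect_eq]
  exact hG.prim.trivalent.defect_nonneg

theorem IsPrimitive.card_le {k v e : ℕ} {G : Graph (Fin k) (Fin v) (Fin e)} (hG : IsPrimitive G) :
    k + v ≤ e + 1 := by
  have := hG.prim.card_le
  rw [hG.univExt.card, hG.verts] at this
  simpa using this

theorem Ends.not_inr {s : S} (he : Ends g i w (.inl s)) : ¬ ∃ w u, Ends g i w (.inr u) := by
  rintro ⟨w', u, he'⟩
  rcases he.eq_or he' with ⟨-, h⟩ | ⟨h, -⟩ <;> simp at h

/-- The Bianchi identity, if the curvature vanishes on graphs of at most the same defect. -/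
theorem Prim.d_curvA {n : ℕ} {x : Series K D} (hx : x ∈ HGC K D n 0) (hP : Prim g P)
    (N : Submodule ℚ (Tens K D S))
    (h : ∀ i ∈ P, ∀ w s, Ends g i w (.inl s) → curvA n x (HairyGraphs.cg g w (.inl s)) (P.erase i) ∈ N) :
    Tens.d (curvA n x g P) + splitA n (curv n x) g P ∈ N := by
  rw [HairyGraphs.d_curvA hx hP.noUniv, splitA, neg_add_eq_sub, ← Finset.sum_sub_distrib]
  refine sum_mem fun i hi => ?_
  by_cases hex : ∃ w z, Ends g i w z
  · obtain ⟨w, s | u, he⟩ := hex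
    · rw [sterm_of_not he.not_inr, bterm_eq hx he hi hP.noUniv, zero_sub]
      exact neg_mem (zsmul_mem (h i hi w s he) _)
    · rw [sterm_eq (curv_mem hx) he hi hP.noUniv, bterm_eq hx he hi hP.noUniv, sval,
        (hP.cg he hi).atom_curv hx, sub_self]
      exact zero_mem _
  · have h1 : bterm n x g P i = 0 := dif_neg hex
    rw [h1, sterm_of_not (fun ⟨w, u, he⟩ => hex ⟨w, _, he⟩), sub_zero]
    exact zero_mem _

/-- The difference of the curvatures of two series which agree up to some defect. -/
theorem Prim.curvA_sub {n : ℕ} {x y : Series K D} (hx : x ∈ HGC K D n 0) (hy : y ∈ HGC K D n 0)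
    (hP : Prim g P) (h : ∀ k v e G, IsPrimitive G → dfct k v e ≤ defect g P → x k v e G = y k v e G) :
    curvA n x g P - curvA n y g P = - splitA n (x - y) g P := by
  have h1 : Fa n x g P = Fa n y g P := by
    rw [Fa_of_linked n x hP.nonempty hP.linked, Fa_of_linked n y hP.nonempty hP.linked]
    exact hP.atom_congr hx hy fun k v e G hG hd => h k v e G hG hd.le
  rw [curvA, curvA, h1, sub_sub_sub_cancel_left, splitA, ← Finset.sum_sub_distrib,
    ← Finset.sum_neg_distrib]
  refine Finset.sum_congr rfl fun i hi => ?_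
  by_cases hex : ∃ w z, Ends g i w z
  · obtain ⟨w, s | u, he⟩ := hex
    · rw [sterm_of_not he.not_inr, cterm_eq hx he hi hP.noUniv, cterm_eq hy he hi hP.noUniv, cval, cval,
        Fa_congr (x := x) (y := y), sub_self, neg_zero]
      intro c hc
      obtain ⟨h2, h3⟩ := hP.comps_cg he hi hc
      exact h2.atom_congr hx hy fun k v e G hG hd => h k v e G hG (hd.le.trans h3)
    · have h2 := hP.cg he hi
      rw [sterm_eq (sub_mem hx hy) he hi hP.noUniv, cterm_eq hx he hi hP.noUniv,
        cterm_eq hy he hi hP.noUniv, cval, cval, sval, atom_sub,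
        Fa_of_linked n x h2.nonempty h2.linked, Fa_of_linked n y h2.nonempty h2.linked, ← smul_sub,
        ← smul_neg, neg_sub]
  · rw [cterm_of_not hex, cterm_of_not hex, sterm_of_not (fun ⟨w, u, he⟩ => hex ⟨w, _, he⟩)]
    simp

end CurvatureSeries

section Simplicial

variable {X : Type} [LinearOrder X] {M : Type u} [AddCommGroup M]

/-- The sign of the position of an element in a finite set. -/
def eps (c : X) (L : Finset X) : ℤ := ∏ q ∈ L, ltSign c q

theorem eps_mul_self (c : X) (L : Finset X) : eps c L * eps c L = 1 := by
  rw [eps, ← Finset.prod_mul_distrib]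
  exact Finset.prod_eq_one fun q _ => ltSign_mul_self _ _

theorem ltSign_self (c : X) : ltSign c c = 1 := by simp [ltSign]

theorem eps_insert {c d : X} {L : Finset X} (hd : d ∉ L) : eps c (insert d L) = ltSign c d * eps c L := by
  rw [eps, Finset.prod_insert hd, eps]

theorem eps_insert_self (c : X) (L : Finset X) : eps c (insert c L) = eps c L := by
  by_cases h : c ∈ L
  · rw [Finset.insert_eq_of_mem h]
  · rw [eps_insert h, ltSign_self, one_mul]

theorem eps_erase {c d : X} {L : Finset X} (hd : d ∈ L) : eps c L = ltSign c d * eps c (L.erase d) := by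
  rw [← eps_insert (Finset.notMem_erase d L), Finset.insert_erase hd]

theorem eps_erase_self {c : X} {L : Finset X} (hc : c ∈ L) : eps c (L.erase c) = eps c L := by
  rw [eps_erase hc, ltSign_self, one_mul]

/-- The simplicial coboundary operator. -/
def cob (ψ : Finset X → M) (L : Finset X) : M := ∑ c ∈ L, eps c L • ψ (L.erase c)

theorem cob_sub (ψ χ : Finset X → M) (L : Finset X) : cob (ψ - χ) L = cob ψ L - cob χ L := by
  simp [cob, smul_sub, Finset.sum_sub_distrib]

theorem cob_add (ψ χ : Finset X → M) (L : Finset X) : cob (ψ + χ) L = cob ψ L + cob χ L := by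
  simp [cob, smul_add, Finset.sum_add_distrib]

theorem eps_mul_eps {c d : X} {L : Finset X} (hc : c ∈ L) (hd : d ∈ L) (hne : c ≠ d) :
    eps c L * eps d (L.erase c) = - (eps d L * eps c (L.erase d)) := by
  rw [eps_erase (c := c) hd, eps_erase (c := d) hc]
  have h1 := ltSign_swap hne
  have h2 := ltSign_mul_self c d
  linear_combination (eps c (L.erase d) * eps d (L.erase c)) *
    (ltSign c d * h1 - ltSign d c * h2)

theorem cob_cob [IsAddTorsionFree M] (ψ : Finset X → M) (L : Finset X) : cob (cob ψ) L = 0 := by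
  have h1 : cob (cob ψ) L = ∑ c ∈ L, ∑ d ∈ L.erase c,
      (eps c L * eps d (L.erase c)) • ψ ((L.erase c).erase d) := by
    unfold cob
    refine Finset.sum_congr rfl fun c _ => ?_
    rw [Finset.smul_sum]
    exact Finset.sum_congr rfl fun d _ => by rw [smul_smul]
  have h2 : cob (cob ψ) L = - cob (cob ψ) L := by
    calc _ = ∑ d ∈ L, ∑ c ∈ L.erase d, (eps c L * eps d (L.erase c)) • ψ ((L.erase c).erase d) := by
          rw [h1]
          exact Finset.sum_comm' (by intro c d; simp only [Finset.mem_erase]; tauto)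
      _ = - cob (cob ψ) L := by
          rw [h1, ← Finset.sum_neg_distrib]
          refine Finset.sum_congr rfl fun c hc => ?_
          rw [← Finset.sum_neg_distrib]
          refine Finset.sum_congr rfl fun d hd => ?_
          rw [Finset.mem_erase] at hd
          rw [eps_mul_eps hd.2 hc hd.1, neg_smul, Finset.erase_right_comm]
  exact self_eq_neg.1 h2

/-- Families with a toggle that depends on the members with some property have no cohomology. -/
theorem exists_cob_of_toggle [IsAddTorsionFree M] (F : Set (Finset X)) (q : X → Prop) [DecidablePred q]
    (t : Finset X → X) (hdown : ∀ L ∈ F, ∀ c, L.erase c ∈ F) (hq : ∀ L ∈ F, ¬ q (t (L.filter q)))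
    (hins : ∀ L ∈ F, insert (t (L.filter q)) L ∈ F) (p : ℕ) (φ : Finset X → M)
    (hφ : ∀ L ∈ F, L.card = p + 1 → cob φ L = 0) :
    ∃ ψ : Finset X → M, ∀ L ∈ F, L.card = p → cob ψ L = φ L := by
  have key : ∀ j : ℕ, ∃ ψ : Finset X → M, ∀ L ∈ F, L.card = p → (L.filter q).card < j → cob ψ L = φ L := by
    intro j
    induction j with
    | zero => exact ⟨0, by simp⟩
    | succ j ih =>
      obtain ⟨ψ, hψ⟩ := ih
      set χ := φ - cob ψ with hχ
      have hχ0 : ∀ L ∈ F, L.card = p → (L.filter q).card < j → χ L = 0 := by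
        intro L hL hp hj
        simp [hχ, hψ L hL hp hj]
      have hχ1 : ∀ L ∈ F, L.card = p + 1 → cob χ L = 0 := by
        intro L hL hp
        rw [hχ, cob_sub, cob_cob, hφ L hL hp, sub_zero]
      let θ : Finset X → M := fun L => if t (L.filter q) ∉ L ∧ (L.filter q).card = j then
        eps (t (L.filter q)) L • χ (insert (t (L.filter q)) L) else 0
      suffices h : ∀ L ∈ F, L.card = p → (L.filter q).card < j + 1 → cob θ L = χ L by
        refine ⟨ψ + θ, fun L hL hp hj => ?_⟩
        rw [cob_add, h L hL hp hj, hχ, Pi.sub_apply]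
        abel
      have hfilter : ∀ L : Finset X, ∀ c, ¬ q c → (L.erase c).filter q = L.filter q := by
        intro L c hc
        rw [Finset.filter_erase, Finset.erase_eq_of_notMem]
        exact fun h => hc (Finset.mem_filter.1 h).2
      have hfilter' : ∀ L : Finset X, ∀ c, c ∈ L → q c → ((L.erase c).filter q).card < (L.filter q).card := by
        intro L c hc hqc
        rw [Finset.filter_erase]
        exact Finset.card_erase_lt_of_mem (Finset.mem_filter.2 ⟨hc, hqc⟩)
      intro L hL hp hj
      rcases Nat.lt_succ_iff_lt_or_eq.1 hj with hj | hj
      · rw [hχ0 L hL hp hj, cob, Finset.sum_eq_zero]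
        intro c hc
        simp only [θ]
        rw [if_neg, smul_zero]
        rintro ⟨-, h⟩
        have : ((L.erase c).filter q).card ≤ (L.filter q).card :=
          Finset.card_le_card (Finset.filter_subset_filter _ (Finset.erase_subset _ _))
        omega
      set τ := t (L.filter q) with hτ
      have hqτ : ¬ q τ := hq L hL
      have hθ : ∀ c ∈ L, q c → θ (L.erase c) = 0 := by
        intro c hc hqc
        simp only [θ]
        rw [if_neg]
        rintro ⟨-, h⟩
        have := hfilter' L c hc hqc
        omega
      have hθ' : ∀ c ∈ L, ¬ q c → θ (L.erase c) = if τ ∉ L.erase c then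
          eps τ (L.erase c) • χ (insert τ (L.erase c)) else 0 := by
        intro c hc hqc
        simp only [θ, hfilter L c hqc, hj, and_true]
        rfl
      by_cases hτL : τ ∈ L
      · rw [cob, Finset.sum_eq_single τ]
        · rw [hθ' τ hτL hqτ, if_pos (Finset.notMem_erase _ _), Finset.insert_erase hτL, smul_smul,
            eps_erase_self hτL, eps_mul_self, one_smul]
        · intro c hc hne
          by_cases hqc : q c
          · rw [hθ c hc hqc, smul_zero]
          · rw [hθ' c hc hqc, if_neg (not_not.2 (Finset.mem_erase.2 ⟨Ne.symm hne, hτL⟩)), smul_zero]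
        · exact fun h => (h hτL).elim
      · have h1 := hχ1 _ (hins L hL) (by rw [Finset.card_insert_of_notMem hτL, hp])
        rw [cob, Finset.sum_insert hτL, Finset.erase_insert hτL, eps_insert_self] at h1
        have h2 : cob θ L = - (eps τ L • ∑ c ∈ L, eps c (insert τ L) • χ ((insert τ L).erase c)) := by
          rw [cob, Finset.smul_sum, ← Finset.sum_neg_distrib]
          refine Finset.sum_congr rfl fun c hc => ?_
          have hcτ : c ≠ τ := fun h => hτL (h ▸ hc)
          have hτc : τ ∉ L.erase c := fun h => hτL (Finset.mem_of_mem_erase h)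
          rw [Finset.erase_insert_of_ne hcτ.symm]
          by_cases hqc : q c
          · rw [hθ c hc hqc, hχ0, smul_zero, smul_zero, smul_zero, neg_zero]
            · have := hdown _ (hins L hL) c
              rwa [Finset.erase_insert_of_ne hcτ.symm] at this
            · rw [Finset.card_insert_of_notMem hτc, Finset.card_erase_add_one hc, hp]
            · rw [Finset.filter_insert, if_neg hqτ, ← hj]
              exact hfilter' L c hc hqc
          · rw [hθ' c hc hqc, if_pos hτc, smul_smul, smul_smul, ← neg_smul]
            congr 1
            rw [eps_insert hτL, eps_erase (c := τ) hc]
            have h3 := ltSign_swap hcτ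
            have h4 := ltSign_mul_self c τ
            have h5 := ltSign_mul_self τ c
            linear_combination (eps c L * eps τ (L.erase c)) * h3
        rw [h2, eq_comm]
        have h3 : ∑ c ∈ L, eps c (insert τ L) • χ ((insert τ L).erase c) = - (eps τ L • χ L) :=
          (neg_eq_of_add_eq_zero_right h1).symm
        rw [h3, smul_neg, neg_neg, smul_smul, eps_mul_self, one_smul]
  obtain ⟨ψ, hψ⟩ := key (p + 1)
  exact ⟨ψ, fun L hL hp => hψ L hL hp (Nat.lt_succ_of_le (hp ▸ Finset.card_filter_le _ _))⟩

end Simplicial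

section Laminar

/-- Subsets of the labels; they index the edges and internal vertices of rooted trees. -/
@[ext] structure Cl (k : ℕ) : Type where
  s : Finset (Fin k)

/-- Larger subsets come first. -/
instance (k : ℕ) : LinearOrder (Cl k) :=
  LinearOrder.lift' (fun c => toLex (OrderDual.toDual c.s.card, toColex c.s)) (by
    intro c d h
    have := congrArg (fun p => (ofLex p).2) h
    exact Cl.ext (by simpa using this))

theorem Cl.lt_of_card_lt {k : ℕ} {c d : Cl k} (h : d.s.card < c.s.card) : c < d := by
  change toLex (OrderDual.toDual c.s.card, toColex c.s) < toLex (OrderDual.toDual d.s.card, toColex d.s)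
  rw [Prod.Lex.toLex_lt_toLex]
  exact .inl h

instance (k : ℕ) : Fintype (Cl k) := Fintype.ofInjective Cl.s fun _ _ h => Cl.ext h

variable {k : ℕ} {M : Type u} [AddCommGroup M] [IsAddTorsionFree M]

/-- Partitions. -/
structure IsPart (B : Finset (Finset (Fin k))) (U : Finset (Fin k)) : Prop where
  nonempty : ∀ x ∈ B, x.Nonempty
  disj : ∀ x ∈ B, ∀ y ∈ B, x ≠ y → Disjoint x y
  sub : ∀ x ∈ B, x ⊆ U
  cover : ∀ i ∈ U, ∃ x ∈ B, i ∈ x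

/-- Proper unions of at least two blocks of a partition. -/
structure IsCl (B : Finset (Finset (Fin k))) (U c : Finset (Fin k)) : Prop where
  sub : c ⊆ U
  nonempty : c.Nonempty
  notMem : c ∉ B
  ne : c ≠ U
  blocks : ∀ x ∈ B, x ⊆ c ∨ Disjoint x c

/-- Two sets are nested or disjoint. -/
def Nested (c d : Finset (Fin k)) : Prop := c ⊆ d ∨ d ⊆ c ∨ Disjoint c d

theorem Nested.symm {c d : Finset (Fin k)} (h : Nested c d) : Nested d c := by
  rcases h with h | h | h
  exacts [.inr (.inl h), .inl h, .inr (.inr h.symm)]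

/-- Laminar families of unions of blocks. -/
structure Adm (B : Finset (Finset (Fin k))) (U : Finset (Fin k)) (L : Finset (Cl k)) : Prop where
  cl : ∀ c ∈ L, IsCl B U c.s
  nested : ∀ c ∈ L, ∀ d ∈ L, Nested c.s d.s

variable {B : Finset (Finset (Fin k))} {U : Finset (Fin k)} {L : Finset (Cl k)}

theorem Adm.erase (h : Adm B U L) (c : Cl k) : Adm B U (L.erase c) :=
  ⟨fun d hd => h.cl d (Finset.mem_of_mem_erase hd), fun d hd e he =>
    h.nested d (Finset.mem_of_mem_erase hd) e (Finset.mem_of_mem_erase he)⟩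

theorem Adm.insert {c : Cl k} (h : Adm B U L) (hc : IsCl B U c.s) (hn : ∀ d ∈ L, Nested c.s d.s) :
    Adm B U (insert c L) := by
  refine ⟨fun d hd => ?_, fun d hd e he => ?_⟩
  · rcases Finset.mem_insert.1 hd with rfl | hd
    exacts [hc, h.cl d hd]
  · rcases Finset.mem_insert.1 hd with h1 | h1 <;> rcases Finset.mem_insert.1 he with h2 | h2
    · exact .inl (by rw [h1, h2])
    · exact h1 ▸ hn e h2
    · exact h2 ▸ (hn d h1).symm
    · exact h.nested d h1 e h2

theorem IsPart.eq_of_subset (hB : IsPart B U) {x y : Finset (Fin k)} (hx : x ∈ B) (hy : y ∈ B) (h : x ⊆ y) :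
    x = y := by
  by_contra hne
  obtain ⟨i, hi⟩ := hB.nonempty x hx
  exact Finset.disjoint_left.1 (hB.disj x hx y hy hne) hi (h hi)

/-- The members of a laminar family that contain a block have a least element. -/
theorem exists_least (hB : IsPart B U) {b : Finset (Fin k)} (hb : b ∈ B) (h : Adm B U L) :
    ∃ c : Finset (Fin k), (c = U ∨ ∃ d ∈ L, d.s = c) ∧ b ⊆ c ∧ c ⊆ U ∧ ∀ d ∈ L, b ⊆ d.s → c ⊆ d.s := by
  by_cases hex : (L.filter fun d => b ⊆ d.s).Nonempty
  · obtain ⟨c, hc, hmin⟩ := Finset.exists_min_image _ (fun d : Cl k => d.s.card) hex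
    rw [Finset.mem_filter] at hc
    refine ⟨c.s, .inr ⟨c, hc.1, rfl⟩, hc.2, (h.cl c hc.1).sub, fun d hd hbd => ?_⟩
    have h1 := hmin d (Finset.mem_filter.2 ⟨hd, hbd⟩)
    rcases h.nested c hc.1 d hd with h2 | h2 | h2
    · exact h2
    · exact (Finset.eq_of_subset_of_card_le h2 h1).ge
    · obtain ⟨i, hi⟩ := hB.nonempty b hb
      exact (Finset.disjoint_left.1 h2 (hc.2 hi) (hbd hi)).elim
  · refine ⟨U, .inl rfl, hB.sub b hb, subset_rfl, fun d hd hbd => ?_⟩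
    exact (hex ⟨d, Finset.mem_filter.2 ⟨hd, hbd⟩⟩).elim

/-- Merging two blocks. -/
def merge (B : Finset (Finset (Fin k))) (a b : Finset (Fin k)) : Finset (Finset (Fin k)) :=
  insert (a ∪ b) ((B.erase a).erase b)

theorem union_notMem (hB : IsPart B U) {a b : Finset (Fin k)} (ha : a ∈ B) (hb : b ∈ B) (hab : a ≠ b) :
    a ∪ b ∉ B := by
  intro h
  have h1 := hB.eq_of_subset ha h Finset.subset_union_left
  have h2 := hB.eq_of_subset hb h Finset.subset_union_right
  exact hab (h1.trans h2.symm)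

theorem card_merge (hB : IsPart B U) {a b : Finset (Fin k)} (ha : a ∈ B) (hb : b ∈ B) (hab : a ≠ b) :
    (merge B a b).card + 1 = B.card := by
  rw [merge, Finset.card_insert_of_notMem, Finset.card_erase_add_one, Finset.card_erase_add_one ha]
  · exact Finset.mem_erase.2 ⟨hab.symm, hb⟩
  · exact fun h => union_notMem hB ha hb hab (Finset.mem_of_mem_erase (Finset.mem_of_mem_erase h))

theorem IsPart.merge (hB : IsPart B U) {a b : Finset (Fin k)} (ha : a ∈ B) (hb : b ∈ B) :
    IsPart (merge B a b) U := by
  have hd : ∀ y ∈ (B.erase a).erase b, Disjoint (a ∪ b) y := by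
    intro y hy
    simp only [Finset.mem_erase] at hy
    rw [Finset.disjoint_union_left]
    exact ⟨hB.disj a ha y hy.2.2 (Ne.symm hy.2.1), hB.disj b hb y hy.2.2 (Ne.symm hy.1)⟩
  refine ⟨?_, ?_, ?_, ?_⟩
  · intro x hx
    rcases Finset.mem_insert.1 hx with rfl | hx
    · exact (hB.nonempty a ha).mono Finset.subset_union_left
    · exact hB.nonempty x (Finset.mem_of_mem_erase (Finset.mem_of_mem_erase hx))
  · intro x hx y hy hxy
    rcases Finset.mem_insert.1 hx with rfl | hx <;> rcases Finset.mem_insert.1 hy with rfl | hy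
    · exact (hxy rfl).elim
    · exact hd y hy
    · exact (hd x hx).symm
    · exact hB.disj x (Finset.mem_of_mem_erase (Finset.mem_of_mem_erase hx)) y
        (Finset.mem_of_mem_erase (Finset.mem_of_mem_erase hy)) hxy
  · intro x hx
    rcases Finset.mem_insert.1 hx with rfl | hx
    · exact Finset.union_subset (hB.sub a ha) (hB.sub b hb)
    · exact hB.sub x (Finset.mem_of_mem_erase (Finset.mem_of_mem_erase hx))
  · intro i hi
    obtain ⟨x, hx, hix⟩ := hB.cover i hi
    by_cases hxa : x = a
    · exact ⟨a ∪ b, Finset.mem_insert_self _ _, Finset.mem_union_left _ (hxa ▸ hix)⟩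
    by_cases hxb : x = b
    · exact ⟨a ∪ b, Finset.mem_insert_self _ _, Finset.mem_union_right _ (hxb ▸ hix)⟩
    · exact ⟨x, Finset.mem_insert_of_mem (Finset.mem_erase.2 ⟨hxb, Finset.mem_erase.2 ⟨hxa, hx⟩⟩), hix⟩

/-- A nonempty union of blocks that is contained in the union of two blocks. -/
theorem IsCl.eq_union {a b c : Finset (Fin k)} (ha : a ∈ B) (hb : b ∈ B) (hc : IsCl B U c)
    (h : c ⊆ a ∪ b) : c = a ∪ b := by
  have key : ∀ x ∈ B, (x ⊆ c ∨ c ⊆ U \ x) := by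
    intro x hx
    refine (hc.blocks x hx).imp id fun hd i hi => ?_
    exact Finset.mem_sdiff.2 ⟨hc.sub hi, fun hix => Finset.disjoint_left.1 hd hix hi⟩
  have hne : ∀ x ∈ B, ¬ c ⊆ x := by
    intro x hx hcx
    refine hc.notMem ?_
    rcases hc.blocks x hx with h1 | h1
    · rwa [hcx.antisymm h1]
    · obtain ⟨i, hi⟩ := hc.nonempty
      exact (Finset.disjoint_left.1 h1 (hcx hi) hi).elim
  refine h.antisymm (Finset.union_subset ?_ ?_)
  · refine (key a ha).resolve_right fun h1 => hne b hb fun i hi => ?_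
    rcases Finset.mem_union.1 (h hi) with h2 | h2
    · exact ((Finset.mem_sdiff.1 (h1 hi)).2 h2).elim
    · exact h2
  · refine (key b hb).resolve_right fun h1 => hne a ha fun i hi => ?_
    rcases Finset.mem_union.1 (h hi) with h2 | h2
    · exact h2
    · exact ((Finset.mem_sdiff.1 (h1 hi)).2 h2).elim

theorem isCl_union (hB : IsPart B U) {a b : Finset (Fin k)} (ha : a ∈ B) (hb : b ∈ B) (hab : a ≠ b)
    (hc : 3 ≤ B.card) : IsCl B U (a ∪ b) := by
  refine ⟨Finset.union_subset (hB.sub a ha) (hB.sub b hb), (hB.nonempty a ha).mono Finset.subset_union_left,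
    union_notMem hB ha hb hab, ?_, ?_⟩
  · intro h
    obtain ⟨x, hx, hxa, hxb⟩ : ∃ x ∈ B, x ≠ a ∧ x ≠ b := by
      by_contra hno
      push Not at hno
      have : B ⊆ {a, b} := fun x hx => by
        by_cases h : x = a
        · simp [h]
        · simp [hno x hx h]
      have := (Finset.card_le_card this).trans Finset.card_le_two
      omega
    obtain ⟨i, hi⟩ := hB.nonempty x hx
    have := hB.sub x hx hi
    rw [← h, Finset.mem_union] at this
    rcases this with h1 | h1
    · exact Finset.disjoint_left.1 (hB.disj x hx a ha hxa) hi h1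
    · exact Finset.disjoint_left.1 (hB.disj x hx b hb hxb) hi h1
  · intro x hx
    by_cases hxa : x = a
    · exact .inl (hxa ▸ Finset.subset_union_left)
    by_cases hxb : x = b
    · exact .inl (hxb ▸ Finset.subset_union_right)
    · rw [Finset.disjoint_union_right]
      exact .inr ⟨hB.disj x hx a ha hxa, hB.disj x hx b hb hxb⟩

theorem Adm.erase_union {a b : Finset (Fin k)} (ha : a ∈ B) (hb : b ∈ B)
    (h : Adm B U L) (hL : (⟨a ∪ b⟩ : Cl k) ∈ L) : Adm (merge B a b) U (L.erase ⟨a ∪ b⟩) := by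
  refine ⟨fun c hc => ?_, (h.erase _).nested⟩
  rw [Finset.mem_erase] at hc
  have h1 := h.cl c hc.2
  have hne : c.s ≠ a ∪ b := fun h => hc.1 (Cl.ext h)
  refine ⟨h1.sub, h1.nonempty, ?_, h1.ne, ?_⟩
  · intro hm
    rcases Finset.mem_insert.1 hm with hm | hm
    · exact hne hm
    · exact h1.notMem (Finset.mem_of_mem_erase (Finset.mem_of_mem_erase hm))
  · intro x hx
    rcases Finset.mem_insert.1 hx with rfl | hx
    · rcases h.nested _ hL c hc.2 with h2 | h2 | h2
      · exact .inl h2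
      · exact (hne (h1.eq_union ha hb h2)).elim
      · exact .inr h2
    · exact h1.blocks x (Finset.mem_of_mem_erase (Finset.mem_of_mem_erase hx))

theorem Adm.of_merge (hB : IsPart B U) {a b : Finset (Fin k)} (ha : a ∈ B) (hb : b ∈ B) (hab : a ≠ b)
    (h : Adm (merge B a b) U L) : Adm B U L := by
  refine ⟨fun c hc => ?_, h.nested⟩
  have h1 := h.cl c hc
  have h2 := h1.blocks _ (Finset.mem_insert_self _ _)
  have hmem : ∀ x ∈ B, x ≠ a → x ≠ b → x ∈ merge B a b := fun x hx h3 h4 =>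
    Finset.mem_insert_of_mem (Finset.mem_erase.2 ⟨h4, Finset.mem_erase.2 ⟨h3, hx⟩⟩)
  obtain ⟨ia, hia⟩ := hB.nonempty a ha
  obtain ⟨ib, hib⟩ := hB.nonempty b hb
  have hdab := Finset.disjoint_left.1 (hB.disj a ha b hb hab)
  have hca : c.s ≠ a := by
    intro h3
    rcases h2 with h2 | h2
    · have : ib ∈ c.s := h2 (Finset.mem_union_right _ hib)
      rw [h3] at this
      exact hdab this hib
    · exact Finset.disjoint_left.1 h2 (Finset.mem_union_left _ hia) (by rw [h3]; exact hia)
  have hcb : c.s ≠ b := by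
    intro h3
    rcases h2 with h2 | h2
    · have : ia ∈ c.s := h2 (Finset.mem_union_left _ hia)
      rw [h3] at this
      exact hdab hia this
    · exact Finset.disjoint_left.1 h2 (Finset.mem_union_right _ hib) (by rw [h3]; exact hib)
  refine ⟨h1.sub, h1.nonempty, fun h3 => h1.notMem (hmem _ h3 hca hcb), h1.ne, fun x hx => ?_⟩
  by_cases hxa : x = a
  · subst hxa
    exact h2.imp (fun h => Finset.subset_union_left.trans h) fun h => (Finset.disjoint_union_left.1 h).1
  by_cases hxb : x = b
  · subst hxb
    exact h2.imp (fun h => Finset.subset_union_right.trans h) fun h => (Finset.disjoint_union_left.1 h).2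
  · exact h1.blocks x (hmem x hx hxa hxb)

theorem Adm.union_notMem_of_merge (hB : IsPart B U) {a b a' : Finset (Fin k)} (ha : a ∈ B) (hb : b ∈ B)
    (hab : a ≠ b) (ha' : a' ∈ B) (h : Adm (merge B a b) U L) : (⟨a' ∪ b⟩ : Cl k) ∉ L := by
  intro hm
  have h1 := h.cl _ hm
  simp only at h1
  obtain ⟨ia, hia⟩ := hB.nonempty a ha
  obtain ⟨ib, hib⟩ := hB.nonempty b hb
  rcases h1.blocks _ (Finset.mem_insert_self _ _) with h2 | h2
  · have h3 := h2 (Finset.mem_union_left _ hia)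
    have h4 : ia ∈ a' := (Finset.mem_union.1 h3).resolve_right
      (Finset.disjoint_left.1 (hB.disj a ha b hb hab) hia)
    have : a = a' := by
      by_contra hne
      exact Finset.disjoint_left.1 (hB.disj a ha a' ha' hne) hia h4
    subst this
    exact h1.notMem (Finset.mem_insert_self _ _)
  · exact Finset.disjoint_left.1 h2 (Finset.mem_union_right _ hib) (Finset.mem_union_right _ hib)

/-- The complex of laminar families has cohomology only in the top degree. -/
theorem exists_cob (p : ℕ) : ∀ (B : Finset (Finset (Fin k))), IsPart B U → p + 2 < B.card →
    ∀ φ : Finset (Cl k) → M, (∀ L, Adm B U L → L.card = p + 1 → cob φ L = 0) →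
      ∃ ψ : Finset (Cl k) → M, ∀ L, Adm B U L → L.card = p → cob ψ L = φ L := by
  classical
  induction p with
  | zero => ?_
  | succ p ih => ?_
  all_goals
    intro B hB hcard φ hφ
    obtain ⟨b, hb⟩ : B.Nonempty := Finset.card_pos.1 (by omega)
    obtain ⟨ib, hib⟩ := hB.nonempty b hb
    let F : Set (Finset (Cl k)) := {L | Adm B U L ∧ ∀ a ∈ B, a ≠ b → (⟨a ∪ b⟩ : Cl k) ∉ L}
    let c1 : Finset (Cl k) → Finset (Fin k) := fun L =>
      if h : Adm B U L then (exists_least hB hb h).choose else ∅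
    have hfil : ∀ L, Adm B U L → Adm B U (L.filter fun d => b ⊆ d.s) := fun L h =>
      ⟨fun c hc => h.cl c (Finset.mem_filter.1 hc).1, fun c hc d hd =>
        h.nested c (Finset.mem_filter.1 hc).1 d (Finset.mem_filter.1 hd).1⟩
    have hc1 : ∀ L, Adm B U L → (c1 (L.filter fun d => b ⊆ d.s) = U ∨
        ∃ d ∈ L, d.s = c1 (L.filter fun d => b ⊆ d.s)) ∧ b ⊆ c1 (L.filter fun d => b ⊆ d.s) ∧
        c1 (L.filter fun d => b ⊆ d.s) ⊆ U ∧
        ∀ d ∈ L, b ⊆ d.s → c1 (L.filter fun d => b ⊆ d.s) ⊆ d.s := by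
      intro L h
      simp only [c1, dif_pos (hfil L h)]
      obtain ⟨h1, h2, h3, h4⟩ := (exists_least hB hb (hfil L h)).choose_spec
      exact ⟨h1.imp id fun ⟨d, hd, hd'⟩ => ⟨d, (Finset.mem_filter.1 hd).1, hd'⟩, h2, h3,
        fun d hd hbd => h4 d (Finset.mem_filter.2 ⟨hd, hbd⟩) hbd⟩
    obtain ⟨ψ₀, hψ₀⟩ := exists_cob_of_toggle F (fun d => b ⊆ d.s) (fun L => ⟨c1 L \ b⟩)
      (by
        rintro L ⟨h, h'⟩ c
        exact ⟨h.erase c, fun a ha hab hm => h' a ha hab (Finset.mem_of_mem_erase hm)⟩)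
      (by
        rintro L - h
        exact (Finset.mem_sdiff.1 (h hib)).2 hib)
      (by
        rintro L ⟨h, h'⟩
        obtain ⟨h1, h2, h3, h4⟩ := hc1 L h
        set c := c1 (L.filter fun d => b ⊆ d.s)
        have hcU : c ≠ U → IsCl B U c ∧ ∀ a ∈ B, a ≠ b → c ≠ a ∪ b := by
          intro hne
          obtain ⟨d, hd, hdc⟩ := h1.resolve_left hne
          rw [← hdc]
          exact ⟨h.cl d hd, fun a ha hab hda => h' a ha hab (by rw [← hda]; exact hd)⟩
        have hcb : ∀ x ∈ B, x ⊆ c ∨ Disjoint x c := by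
          by_cases hU : c = U
          · exact fun x hx => .inl (hU ▸ hB.sub x hx)
          · exact (hcU hU).1.blocks
        have hne2 : ∀ a ∈ B, a ≠ b → c ≠ a ∪ b := by
          by_cases hU : c = U
          · intro a ha hab h5
            exact (isCl_union hB ha hb hab (by omega)).ne (by rw [← h5, hU])
          · exact (hcU hU).2
        have hne3 : c ≠ b := by
          intro h5
          by_cases hU : c = U
          · have : B ⊆ {b} := by
              intro x hx
              rw [Finset.mem_singleton]
              exact hB.eq_of_subset hx hb (by rw [← h5, hU]; exact hB.sub x hx)
            have := Finset.card_le_card this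
            simp at this
            omega
          · exact (hcU hU).1.notMem (h5 ▸ hb)
        have hcl : IsCl B U (c \ b) := by
          refine ⟨Finset.sdiff_subset.trans h3, ?_, ?_, ?_, ?_⟩
          · rw [Finset.sdiff_nonempty]
            exact fun h5 => hne3 (h5.antisymm h2)
          · intro h5
            refine hne2 _ h5 ?_ ?_
            · intro h6
              rw [← h6] at hib
              have h7 := hib
              rw [h6] at h7
              exact (Finset.mem_sdiff.1 hib).2 h7
            · rw [Finset.sdiff_union_of_subset h2]
          · intro h5
            have : ib ∈ c \ b := by rw [h5]; exact hB.sub b hb hib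
            exact (Finset.mem_sdiff.1 this).2 hib
          · intro x hx
            by_cases hxb : x = b
            · subst hxb
              exact .inr Finset.disjoint_sdiff
            · have hd := hB.disj x hx b hb hxb
              exact (hcb x hx).imp (fun h5 => Finset.subset_sdiff.2 ⟨h5, hd⟩)
                fun h5 => h5.mono_right Finset.sdiff_subset
        refine ⟨h.insert hcl ?_, ?_⟩
        · intro d hd
          rcases (h.cl d hd).blocks b hb with h5 | h5
          · exact .inl (Finset.sdiff_subset.trans (h4 d hd h5))
          · have hn : Nested c d.s := by
              rcases h1 with h1 | ⟨e, he, hec⟩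
              · exact .inr (.inl (h1 ▸ (h.cl d hd).sub))
              · rw [← hec]; exact h.nested e he d hd
            rcases hn with h6 | h6 | h6
            · exact (Finset.disjoint_left.1 h5 hib (h6 (h2 hib))).elim
            · exact .inr (.inl (Finset.subset_sdiff.2 ⟨h6, h5.symm⟩))
            · exact .inr (.inr (h6.mono_left Finset.sdiff_subset))
        · intro a ha hab hm
          rcases Finset.mem_insert.1 hm with hm | hm
          · have : ib ∈ c \ b := by
              have h5 : a ∪ b = c \ b := congrArg Cl.s hm
              rw [← h5]
              exact Finset.mem_union_right _ hib
            exact (Finset.mem_sdiff.1 this).2 hib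
          · exact h' a ha hab hm)
      _ φ (fun L hL hp => hφ L hL.1 hp)
  · refine ⟨ψ₀, fun L hL hp => hψ₀ L ⟨hL, ?_⟩ hp⟩
    rw [Finset.card_eq_zero] at hp
    simp [hp]
  · set χ := φ - cob ψ₀ with hχ
    have hχ0 : ∀ L ∈ F, L.card = p + 1 → χ L = 0 := by
      intro L hL hp
      simp [hχ, hψ₀ L hL hp]
    have hχ1 : ∀ L, Adm B U L → L.card = p + 1 + 1 → cob χ L = 0 := by
      intro L hL hp
      rw [hχ, cob_sub, cob_cob, hφ L hL hp, sub_zero]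
    have hmF : ∀ a ∈ B, a ≠ b → ∀ L, Adm (merge B a b) U L → L ∈ F := fun a ha hab L hL =>
      ⟨hL.of_merge hB ha hb hab, fun a' ha' _ => hL.union_notMem_of_merge hB ha hb hab ha'⟩
    have hmI : ∀ a ∈ B, a ≠ b → ∀ L, Adm (merge B a b) U L → Adm B U (insert ⟨a ∪ b⟩ L) := by
      intro a ha hab L hL
      refine (hL.of_merge hB ha hb hab).insert (isCl_union hB ha hb hab (by omega)) ?_
      intro d hd
      exact ((hL.cl d hd).blocks _ (Finset.mem_insert_self _ _)).imp id .inr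
    have hex : ∀ a, a ∈ B ∧ a ≠ b → ∃ ψ : Finset (Cl k) → M, ∀ L, Adm (merge B a b) U L → L.card = p →
        cob ψ L = eps ⟨a ∪ b⟩ L • χ (insert ⟨a ∪ b⟩ L) := by
      rintro a ⟨ha, hab⟩
      have hc := card_merge hB ha hb hab
      refine ih _ (hB.merge ha hb) (by omega) (fun L => eps ⟨a ∪ b⟩ L • χ (insert ⟨a ∪ b⟩ L)) ?_
      intro L hL hp
      have hnm := hL.union_notMem_of_merge hB ha hb hab ha
      have h1 := hχ1 _ (hmI a ha hab L hL) (by rw [Finset.card_insert_of_notMem hnm, hp])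
      rw [cob, Finset.sum_insert hnm, Finset.erase_insert hnm, hχ0 L (hmF a ha hab L hL) hp, smul_zero,
        zero_add] at h1
      have h2 : cob (fun L => eps ⟨a ∪ b⟩ L • χ (insert ⟨a ∪ b⟩ L)) L = - (eps ⟨a ∪ b⟩ L •
          ∑ c ∈ L, eps c (insert ⟨a ∪ b⟩ L) • χ ((insert ⟨a ∪ b⟩ L).erase c)) := by
        rw [cob, Finset.smul_sum, ← Finset.sum_neg_distrib]
        refine Finset.sum_congr rfl fun c hc => ?_
        have hcne : c ≠ ⟨a ∪ b⟩ := fun h => hnm (h ▸ hc)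
        rw [Finset.erase_insert_of_ne hcne.symm, smul_smul, smul_smul, ← neg_smul]
        congr 1
        rw [eps_insert hnm, eps_erase (c := ⟨a ∪ b⟩) hc]
        have h3 := ltSign_swap hcne
        linear_combination (eps c L * eps ⟨a ∪ b⟩ (L.erase c)) * h3
      rw [h2, h1, smul_zero, neg_zero]
    choose! ψ hψ using hex
    let θ : Finset (Cl k) → M := fun L => if h : ∃ a, (a ∈ B ∧ a ≠ b) ∧ (⟨a ∪ b⟩ : Cl k) ∈ L then
      - (eps ⟨h.choose ∪ b⟩ L • ψ h.choose (L.erase ⟨h.choose ∪ b⟩)) else 0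
    have hθF : ∀ L ∈ F, θ L = 0 := by
      rintro L ⟨-, h⟩
      exact dif_neg fun ⟨a, ⟨ha, hab⟩, hm⟩ => h a ha hab hm
    have hθ : ∀ L, Adm B U L → ∀ a ∈ B, a ≠ b → (⟨a ∪ b⟩ : Cl k) ∈ L →
        θ L = - (eps ⟨a ∪ b⟩ L • ψ a (L.erase ⟨a ∪ b⟩)) := by
      intro L hL a ha hab hm
      have h : ∃ a, (a ∈ B ∧ a ≠ b) ∧ (⟨a ∪ b⟩ : Cl k) ∈ L := ⟨a, ⟨ha, hab⟩, hm⟩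
      have h1 : h.choose = a := by
        by_contra hne
        obtain ⟨⟨ha', hab'⟩, hm'⟩ := h.choose_spec
        refine (hL.erase_union ha hb hm).union_notMem_of_merge hB ha hb hab ha'
          (Finset.mem_erase.2 ⟨fun h2 => hne ?_, hm'⟩)
        have h3 : h.choose ∪ b = a ∪ b := congrArg Cl.s h2
        have h4 := hB.disj _ ha' b hb hab'
        have h5 := hB.disj _ ha b hb hab
        rw [← Finset.union_sdiff_cancel_right h4, h3, Finset.union_sdiff_cancel_right h5]
      simp only [θ, dif_pos h, h1]
    refine ⟨ψ₀ + θ, fun L hL hp => ?_⟩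
    suffices h : cob θ L = χ L by
      rw [cob_add, h, hχ, Pi.sub_apply]
      abel
    by_cases hLF : L ∈ F
    · rw [hχ0 L hLF hp, cob, Finset.sum_eq_zero]
      intro c _
      rw [hθF _ ⟨hL.erase c, fun a ha hab hm => hLF.2 a ha hab (Finset.mem_of_mem_erase hm)⟩, smul_zero]
    · obtain ⟨a, ha, hab, hm⟩ : ∃ a ∈ B, a ≠ b ∧ (⟨a ∪ b⟩ : Cl k) ∈ L := by
        by_contra hno
        push Not at hno
        exact hLF ⟨hL, hno⟩
      have hL' := hL.erase_union ha hb hm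
      have h1 := hψ a ⟨ha, hab⟩ _ hL' (by rw [Finset.card_erase_of_mem hm, hp]; rfl)
      rw [Finset.insert_erase hm, eps_erase_self hm] at h1
      rw [cob, ← Finset.add_sum_erase _ _ hm, hθF _ (hmF a ha hab _ hL'), smul_zero, zero_add]
      have h2 : ∑ c ∈ L.erase ⟨a ∪ b⟩, eps c L • θ (L.erase c) =
          eps ⟨a ∪ b⟩ L • cob (ψ a) (L.erase ⟨a ∪ b⟩) := by
        rw [cob, Finset.smul_sum]
        refine Finset.sum_congr rfl fun c hc => ?_
        rw [Finset.mem_erase] at hc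
        rw [hθ _ (hL.erase c) a ha hab (Finset.mem_erase.2 ⟨Ne.symm hc.1, hm⟩), smul_neg, smul_smul,
          ← neg_smul, smul_smul, Finset.erase_right_comm, eps_mul_eps hc.2 hm hc.1, neg_neg]
      rw [h2, h1, smul_smul, eps_mul_self, one_smul]

end Laminar

section ClusterTree

variable {k : ℕ}

/-- The set of all labels except for the root. -/
def top (r : Fin k) : Cl k := ⟨Finset.univ.erase r⟩

/-- A singleton. -/
def sing (s : Fin k) : Cl k := ⟨{s}⟩

theorem sing_injective : Function.Injective (sing : Fin k → Cl k) := fun _ _ h =>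
  Finset.singleton_injective (congrArg Cl.s h)

/-- The laminar families that correspond to trees with a given root. -/
abbrev LF (r : Fin k) (L : Finset (Cl k)) : Prop :=
  Adm ((Finset.univ.erase r).image singleton) (Finset.univ.erase r) L

/-- The least element of a laminar family above a set. -/
def par (r : Fin k) (L : Finset (Cl k)) (c : Cl k) : Cl k :=
  open scoped Classical in
  ⟨(Finset.univ.erase r).filter fun s => ∀ d ∈ L, c.s ⊂ d.s → s ∈ d.s⟩

/-- The edges of the tree of a laminar family. -/
def clEdges (r : Fin k) (L : Finset (Cl k)) : Finset (Cl k) :=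
  insert (top r) L ∪ (Finset.univ.erase r).image sing

/-- The tree of a laminar family. -/
def clGraph (r : Fin k) (L : Finset (Cl k)) : Graph (Fin k) (Cl k) (Cl k) := fun c b =>
  open scoped Classical in
  if b then (if h : ∃ s, c = sing s then .inl h.choose else .inr c)
  else if c = top r then .inl r else .inr (par r L c)

variable {r : Fin k} {L L' : Finset (Cl k)} {c d : Cl k}

theorem isPart_singletons (r : Fin k) :
    IsPart ((Finset.univ.erase r).image singleton) (Finset.univ.erase r) where
  nonempty := by simp
  disj := by
    intro x hx y hy hxy
    simp only [Finset.mem_image] at hx hy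
    obtain ⟨s, -, rfl⟩ := hx
    obtain ⟨t, -, rfl⟩ := hy
    simpa using hxy
  sub := by
    intro x hx
    simp only [Finset.mem_image] at hx
    obtain ⟨s, hs, rfl⟩ := hx
    simpa using hs
  cover i hi := ⟨{i}, Finset.mem_image_of_mem _ hi, Finset.mem_singleton_self i⟩

theorem card_singletons (r : Fin k) :
    ((Finset.univ.erase r).image (singleton : Fin k → Finset (Fin k))).card = k - 1 := by
  rw [Finset.card_image_of_injective _ Finset.singleton_injective,
    Finset.card_erase_of_mem (Finset.mem_univ r), Finset.card_univ, Fintype.card_fin]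

theorem mem_clEdges : c ∈ clEdges r L ↔ c ∈ insert (top r) L ∨ ∃ s, s ≠ r ∧ c = sing s := by
  simp [clEdges, eq_comm, or_assoc]

theorem mem_top {s : Fin k} : s ∈ (top r).s ↔ s ≠ r := by simp [top]

theorem top_ne_sing (hk : 3 ≤ k) (s : Fin k) : top r ≠ sing s := by
  intro h
  have h1 := congrArg (fun c : Cl k => c.s.card) h
  simp only [top, sing, Finset.card_singleton, Finset.card_erase_of_mem (Finset.mem_univ r),
    Finset.card_univ, Fintype.card_fin] at h1
  omega

theorem LF.sub (hL : LF r L) (hc : c ∈ L) : c.s ⊆ (top r).s := (hL.cl c hc).sub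

theorem LF.ne_top (hL : LF r L) (hc : c ∈ L) : c ≠ top r := fun h =>
  (hL.cl c hc).ne (congrArg Cl.s h)

theorem LF.ne_sing (hL : LF r L) (hc : c ∈ L) (s : Fin k) : c ≠ sing s := by
  rintro rfl
  refine (hL.cl _ hc).notMem (Finset.mem_image.2 ⟨s, ?_, rfl⟩)
  exact (hL.cl _ hc).sub (by simp [sing])

theorem LF.ssub (hL : LF r L) (hc : c ∈ L) : c.s ⊂ (top r).s :=
  (hL.sub hc).ssubset_of_ne fun h => hL.ne_top hc (Cl.ext h)

theorem LF.sub_insert (hL : LF r L) (hc : c ∈ insert (top r) L) : c.s ⊆ (top r).s := by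
  rcases Finset.mem_insert.1 hc with rfl | hc
  exacts [subset_rfl, hL.sub hc]

theorem LF.insert_ne_sing (hk : 3 ≤ k) (hL : LF r L) (hc : c ∈ insert (top r) L) (s : Fin k) : c ≠ sing s := by
  rcases Finset.mem_insert.1 hc with rfl | hc
  exacts [top_ne_sing hk s, hL.ne_sing hc s]

theorem LF.edge_sub (hL : LF r L) (hc : c ∈ clEdges r L) : c.s ⊆ (top r).s := by
  rcases mem_clEdges.1 hc with hc | ⟨s, hs, rfl⟩
  exacts [hL.sub_insert hc, by simpa [sing, mem_top] using hs]

theorem LF.edge_nonempty (hk : 3 ≤ k) (hL : LF r L) (hc : c ∈ clEdges r L) : c.s.Nonempty := by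
  rcases mem_clEdges.1 hc with hc | ⟨s, hs, rfl⟩
  · rcases Finset.mem_insert.1 hc with rfl | hc
    · refine Finset.card_pos.1 ?_
      simp only [top, Finset.card_erase_of_mem (Finset.mem_univ r), Finset.card_univ, Fintype.card_fin]
      omega
    · exact (hL.cl c hc).nonempty
  · exact Finset.singleton_nonempty s

theorem nested_sing (s : Fin k) (c : Cl k) : Nested (sing s).s c.s := by
  by_cases h : s ∈ c.s
  · exact .inl (by simpa [sing] using h)
  · exact .inr (.inr (by simpa [sing] using h))

theorem LF.nested_edges (hL : LF r L) (hc : c ∈ clEdges r L) (hd : d ∈ clEdges r L) : Nested c.s d.s := by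
  rcases mem_clEdges.1 hc with hc' | ⟨s, -, rfl⟩
  · rcases mem_clEdges.1 hd with hd' | ⟨s, -, rfl⟩
    · rcases Finset.mem_insert.1 hc' with rfl | hc'
      · exact .inr (.inl (hL.edge_sub hd))
      · rcases Finset.mem_insert.1 hd' with rfl | hd'
        · exact .inl (hL.edge_sub hc)
        · exact hL.nested c hc' d hd'
    · exact (nested_sing s c).symm
  · exact nested_sing s d

theorem mem_par {s : Fin k} : s ∈ (par r L c).s ↔ s ≠ r ∧ ∀ d ∈ L, c.s ⊂ d.s → s ∈ d.s := by
  simp [par]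

theorem par_sub (hd : d ∈ insert (top r) L) (h : c.s ⊂ d.s) : (par r L c).s ⊆ d.s := by
  intro s hs
  rw [mem_par] at hs
  rcases Finset.mem_insert.1 hd with rfl | hd
  exacts [mem_top.2 hs.1, hs.2 d hd h]

theorem LF.par_mem (hk : 3 ≤ k) (hL : LF r L) (hc : c ∈ clEdges r L) (hne : c ≠ top r) :
    par r L c ∈ insert (top r) L ∧ c.s ⊂ (par r L c).s := by
  classical
  have hT : top r ∈ (insert (top r) L).filter fun d => c.s ⊂ d.s :=
    Finset.mem_filter.2 ⟨Finset.mem_insert_self _ _, (hL.edge_sub hc).ssubset_of_ne fun h => hne (Cl.ext h)⟩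
  obtain ⟨m, hm, hmin⟩ := Finset.exists_min_image _ (fun d : Cl k => d.s.card) ⟨_, hT⟩
  obtain ⟨hm1, hm2⟩ := Finset.mem_filter.1 hm
  have h1 : par r L c = m := by
    refine Cl.ext ((par_sub hm1 hm2).antisymm fun s hs => ?_)
    refine mem_par.2 ⟨mem_top.1 (hL.sub_insert hm1 hs), fun d hd hcd => ?_⟩
    have h2 := hmin d (Finset.mem_filter.2 ⟨Finset.mem_insert_of_mem hd, hcd⟩)
    rcases hL.nested_edges (mem_clEdges.2 (.inl hm1)) (mem_clEdges.2 (.inl (Finset.mem_insert_of_mem hd)))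
      with h3 | h3 | h3
    · exact h3 hs
    · rwa [Finset.eq_of_subset_of_card_le h3 h2]
    · obtain ⟨x, hx⟩ := hL.edge_nonempty hk hc
      exact (Finset.disjoint_left.1 h3 (hm2.1 hx) (hcd.1 hx)).elim
  rw [h1]
  exact ⟨hm1, hm2⟩

theorem LF.exists_child (hk : 3 ≤ k) (hL : LF r L) (hd : d ∈ insert (top r) L) {s : Fin k} (hs : s ∈ d.s) :
    ∃ c ∈ clEdges r L, c ≠ top r ∧ par r L c = d ∧ s ∈ c.s := by
  classical
  have hS : sing s ∈ (clEdges r L).filter fun c => c.s ⊂ d.s ∧ s ∈ c.s := by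
    refine Finset.mem_filter.2 ⟨mem_clEdges.2 (.inr ⟨s, mem_top.1 (hL.sub_insert hd hs), rfl⟩),
      Finset.ssubset_iff_subset_ne.2 ⟨by simpa [sing] using hs, fun h => ?_⟩, Finset.mem_singleton_self s⟩
    exact hL.insert_ne_sing hk hd s (Cl.ext h).symm
  obtain ⟨c, hc, hmax⟩ := Finset.exists_max_image _ (fun c : Cl k => c.s.card) ⟨_, hS⟩
  obtain ⟨hc1, hc2, hc3⟩ := Finset.mem_filter.1 hc
  have hne : c ≠ top r := by
    rintro rfl
    exact hc2.2 (hL.sub_insert hd)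
  refine ⟨c, hc1, hne, ?_, hc3⟩
  by_contra hpd
  obtain ⟨h1, h2⟩ := hL.par_mem hk hc1 hne
  have h3 := hmax (par r L c) (Finset.mem_filter.2 ⟨mem_clEdges.2 (.inl h1),
    (par_sub hd hc2).ssubset_of_ne fun h => hpd (Cl.ext h), h2.1 hc3⟩)
  exact absurd (Finset.card_lt_card h2) (by omega)

theorem clGraph_true_sing (s : Fin k) : clGraph r L (sing s) true = .inl s := by
  have h : ∃ t, sing s = sing t := ⟨s, rfl⟩
  simp only [clGraph, if_true, dif_pos h]
  rw [← sing_injective h.choose_spec]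

theorem clGraph_true (h : ∀ s, c ≠ sing s) : clGraph r L c true = .inr c := by
  simp [clGraph, h]

theorem clGraph_false_top : clGraph r L (top r) false = .inl r := by simp [clGraph]

theorem clGraph_false (h : c ≠ top r) : clGraph r L c false = .inr (par r L c) := by
  simp [clGraph, h]

theorem LF.half_inl (hk : 3 ≤ k) (hL : LF r L) (hc : c ∈ clEdges r L) {b : Bool} {s : Fin k}
    (h : clGraph r L c b = .inl s) : (s = r ∧ c = top r ∧ b = false) ∨ (s ≠ r ∧ c = sing s ∧ b = true) := by
  cases b with
  | false =>
    by_cases hc : c = top r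
    · subst hc
      rw [clGraph_false_top] at h
      exact .inl ⟨(Sum.inl_injective h).symm, rfl, rfl⟩
    · rw [clGraph_false hc] at h
      cases h
  | true =>
    rcases mem_clEdges.1 hc with hc | ⟨t, ht, rfl⟩
    · rw [clGraph_true (hL.insert_ne_sing hk hc)] at h
      cases h
    · rw [clGraph_true_sing] at h
      cases h
      exact .inr ⟨ht, rfl, rfl⟩

theorem LF.half_inr (hk : 3 ≤ k) (hL : LF r L) (hc : c ∈ clEdges r L) {b : Bool}
    (h : clGraph r L c b = .inr d) : d ∈ insert (top r) L ∧
      ((b = true ∧ c = d) ∨ (b = false ∧ c ≠ top r ∧ par r L c = d)) := by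
  cases b with
  | false =>
    by_cases hct : c = top r
    · subst hct
      rw [clGraph_false_top] at h
      cases h
    · rw [clGraph_false hct] at h
      cases h
      exact ⟨(hL.par_mem hk hc hct).1, .inr ⟨rfl, hct, rfl⟩⟩
  | true =>
    rcases mem_clEdges.1 hc with hc | ⟨t, ht, rfl⟩
    · rw [clGraph_true (hL.insert_ne_sing hk hc)] at h
      cases h
      exact ⟨hc, .inl ⟨rfl, rfl⟩⟩
    · rw [clGraph_true_sing] at h
      cases h

theorem LF.univExt (hk : 3 ≤ k) (hL : LF r L) : UnivExt (clGraph r L) (clEdges r L) := by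
  intro s
  by_cases hs : s = r
  · subst hs
    refine ⟨(top s, false), ⟨mem_clEdges.2 (.inl (Finset.mem_insert_self _ _)), clGraph_false_top⟩, ?_⟩
    rintro ⟨c, b⟩ ⟨h1, h2⟩
    rcases hL.half_inl hk h1 h2 with ⟨-, rfl, rfl⟩ | ⟨h, -⟩
    exacts [rfl, (h rfl).elim]
  · refine ⟨(sing s, true), ⟨mem_clEdges.2 (.inr ⟨s, hs, rfl⟩), clGraph_true_sing s⟩, ?_⟩
    rintro ⟨c, b⟩ ⟨h1, h2⟩
    rcases hL.half_inl hk h1 h2 with ⟨h, -⟩ | ⟨-, rfl, rfl⟩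
    exacts [(hs h).elim, rfl]

theorem LF.verts (hk : 3 ≤ k) (hL : LF r L) : verts (clGraph r L) (clEdges r L) = insert (top r) L := by
  ext d
  rw [mem_verts]
  constructor
  · rintro ⟨c, hc, b, h⟩
    exact (hL.half_inr hk hc h).1
  · intro h
    exact ⟨d, mem_clEdges.2 (.inl h), true, clGraph_true (hL.insert_ne_sing hk h)⟩

theorem LF.prim (hk : 3 ≤ k) (hL : LF r L) : Prim (clGraph r L) (clEdges r L) where
  linked := by
    have key : ∀ m : ℕ, ∀ c ∈ clEdges r L, k - c.s.card ≤ m →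
        LinkedIn (clGraph r L) (clEdges r L) c (top r) := by
      intro m
      induction m with
      | zero =>
        intro c hc hm
        have h1 := Finset.card_le_card (hL.edge_sub hc)
        simp only [top, Finset.card_erase_of_mem (Finset.mem_univ r), Finset.card_univ,
          Fintype.card_fin] at h1
        omega
      | succ m ih =>
        intro c hc hm
        by_cases hne : c = top r
        · rw [hne]
          exact .refl _
        · obtain ⟨h1, h2⟩ := hL.par_mem hk hc hne
          have h3 := Finset.card_lt_card h2
          have h4 : (par r L c).s.card ≤ k := (Finset.card_le_univ _).trans (by simp)
          have hp := mem_clEdges.2 (.inl h1)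
          refine Relation.EqvGen.trans _ _ _ (.rel _ _ ⟨hc, hp, par r L c, false, true, clGraph_false hne,
            clGraph_true (hL.insert_ne_sing hk h1)⟩) (ih _ hp (by omega))
    exact fun i hi j hj => Relation.EqvGen.trans _ _ _ (key _ i hi le_rfl) (.symm _ _ (key _ j hj le_rfl))
  trivalent := by
    intro v hv
    rw [hL.verts hk] at hv
    have hve := mem_clEdges.2 (.inl hv)
    obtain ⟨s, hs⟩ := hL.edge_nonempty hk hve
    obtain ⟨c, hc, hct, hcv, hsc⟩ := hL.exists_child hk hv hs
    have h1 := (hL.par_mem hk hc hct).2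
    rw [hcv] at h1
    obtain ⟨t, ht, htc⟩ := Finset.exists_of_ssubset h1
    obtain ⟨d, hd, hdt, hdv, htd⟩ := hL.exists_child hk hv ht
    have hsub : {(v, true), (c, false), (d, false)} ⊆ halves (clGraph r L) (clEdges r L) v := by
      intro p hp
      simp only [Finset.mem_insert, Finset.mem_singleton] at hp
      rw [mem_halves]
      rcases hp with rfl | rfl | rfl
      · exact ⟨hve, clGraph_true (hL.insert_ne_sing hk hv)⟩
      · exact ⟨hc, by rw [clGraph_false hct, hcv]⟩
      · exact ⟨hd, by rw [clGraph_false hdt, hdv]⟩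
    have hcd : c ≠ d := by
      rintro rfl
      exact htc htd
    refine le_trans ?_ (Finset.card_le_card hsub)
    rw [Finset.card_insert_of_notMem (by simp), Finset.card_pair (by simpa using hcd)]
  ext := ⟨(top r, false), mem_extHalves.2 ⟨mem_clEdges.2 (.inl (Finset.mem_insert_self _ _)), r,
    clGraph_false_top⟩⟩

theorem LF.card_verts (hk : 3 ≤ k) (hL : LF r L) :
    (HairyGraphs.verts (clGraph r L) (clEdges r L)).card = L.card + 1 := by
  rw [hL.verts hk, Finset.card_insert_of_notMem fun h => hL.ne_top h rfl]

theorem LF.card_edges (hk : 3 ≤ k) (hL : LF r L) : (clEdges r L).card = L.card + k := by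
  have h : Disjoint (insert (top r) L) ((Finset.univ.erase r).image sing) := by
    rw [Finset.disjoint_left]
    intro c hc hc'
    obtain ⟨s, -, rfl⟩ := Finset.mem_image.1 hc'
    exact hL.insert_ne_sing hk hc s rfl
  rw [clEdges, Finset.card_union_of_disjoint h, Finset.card_insert_of_notMem fun h => hL.ne_top h rfl,
    Finset.card_image_of_injective _ sing_injective, Finset.card_erase_of_mem (Finset.mem_univ r),
    Finset.card_univ, Fintype.card_fin]
  omega

theorem LF.defect (hk : 3 ≤ k) (hL : LF r L) : defect (clGraph r L) (clEdges r L) = k - 3 - L.card := by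
  rw [HairyGraphs.defect, hL.card_verts hk, hL.card_edges hk, (hL.univExt hk).card, Fintype.card_fin]
  push_cast
  ring

theorem LF.clEdges_erase (hL : LF r L) (hc : c ∈ L) :
    clEdges r (L.erase c) = (clEdges r L).erase c := by
  ext d
  simp only [mem_clEdges, Finset.mem_insert, Finset.mem_erase]
  constructor
  · rintro ((rfl | h) | ⟨s, hs, rfl⟩)
    · exact ⟨(hL.ne_top hc).symm, .inl (.inl rfl)⟩
    · exact ⟨h.1, .inl (.inr h.2)⟩
    · exact ⟨(hL.ne_sing hc s).symm, .inr ⟨s, hs, rfl⟩⟩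
  · rintro ⟨h, (rfl | h') | h'⟩
    exacts [.inl (.inl rfl), .inl (.inr ⟨h, h'⟩), .inr h']

/-- Contraction of an edge of the tree of a laminar family removes a set from the family. -/
theorem LF.cg_clGraph (hk : 3 ≤ k) (hL : LF r L) (hc : c ∈ L) (hd : d ∈ clEdges r (L.erase c)) (b : Bool) :
    cg (clGraph r L) c (.inr (par r L c)) d b = clGraph r (L.erase c) d b := by
  have hL' : LF r (L.erase c) := hL.erase c
  have hd' : d ≠ c ∧ d ∈ clEdges r L := by rwa [hL.clEdges_erase hc, Finset.mem_erase] at hd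
  cases b with
  | true =>
    rw [cg_of_ne]
    · simp [clGraph]
    · by_cases hs : ∃ s, d = sing s
      · obtain ⟨s, rfl⟩ := hs
        rw [clGraph_true_sing]
        exact Sum.inl_ne_inr
      · push Not at hs
        rw [clGraph_true hs]
        exact fun h => hd'.1 (Sum.inr_injective h)
  | false =>
    by_cases hdt : d = top r
    · subst hdt
      rw [cg_of_ne, clGraph_false_top, clGraph_false_top]
      rw [clGraph_false_top]
      exact Sum.inl_ne_inr
    · obtain ⟨h1, h2⟩ := hL.par_mem hk hd'.2 hdt
      rw [clGraph_false hdt]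
      by_cases hpc : par r L d = c
      · rw [cg_of_eq (by rw [clGraph_false hdt, hpc])]
        congr 1
        ext s
        rw [hpc] at h2
        simp only [mem_par, Finset.mem_erase]
        refine and_congr_right fun _ => ⟨fun h e he hde => ?_, fun h e he hce => ?_⟩
        · refine h e he.2 (Finset.ssubset_iff_subset_ne.2 ⟨?_, fun h => he.1 (Cl.ext h.symm)⟩)
          rw [← hpc]
          exact par_sub (Finset.mem_insert_of_mem he.2) hde
        · exact h e ⟨fun h => hce.ne (h ▸ rfl), he⟩ (h2.trans hce)
      · rw [cg_of_ne (by rw [clGraph_false hdt]; exact fun h => hpc (Sum.inr_injective h)),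
          clGraph_false hdt]
        congr 1
        ext s
        simp only [mem_par, Finset.mem_erase]
        refine and_congr_right fun hs => ⟨fun h e he hde => h e he.2 hde, fun h e he hde => ?_⟩
        by_cases hec : e = c
        · subst hec
          refine par_sub (r := r) (Finset.mem_insert_of_mem he) hde ?_
          rcases Finset.mem_insert.1 h1 with h3 | h3
          · rw [h3]
            exact mem_top.2 hs
          · exact h _ ⟨hpc, h3⟩ h2
        · exact h e ⟨hec, he⟩ hde

theorem LF.ends (hk : 3 ≤ k) (hL : LF r L) (hc : c ∈ L) :
    Ends (clGraph r L) c c (.inr (par r L c)) := by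
  have h := (hL.par_mem hk (mem_clEdges.2 (.inl (Finset.mem_insert_of_mem hc))) (hL.ne_top hc)).2
  exact ⟨fun h' => h.ne (congrArg Cl.s (Sum.inr_injective h')).symm, true, clGraph_true (hL.ne_sing hc),
    clGraph_false (hL.ne_top hc)⟩

theorem mem_of_ends (hc : c ∈ clEdges r L) {v w : Cl k}
    (he : Ends (clGraph r L) c v (.inr w)) : c ∈ L := by
  have h1 : c ≠ top r := by
    rintro rfl
    obtain ⟨-, b, h2, h3⟩ := he
    cases b <;> simp [clGraph_false_top] at h2 h3
  have h2 : ∀ s, c ≠ sing s := by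
    rintro s rfl
    obtain ⟨-, b, h2, h3⟩ := he
    cases b <;> simp [clGraph_true_sing] at h2 h3
  rcases mem_clEdges.1 hc with hc | ⟨s, -, hs⟩
  · exact (Finset.mem_insert.1 hc).resolve_left h1
  · exact (h2 s hs).elim

theorem LF.ltSign_top (hL : LF r L) (hc : c ∈ L) : ltSign c (top r) = -1 := by
  have h : top r < c := Cl.lt_of_card_lt (Finset.card_lt_card (hL.ssub hc))
  simp [ltSign, h]

theorem LF.ltSign_sing (hL : LF r L) (hc : c ∈ L) (s : Fin k) : ltSign c (sing s) = 1 := by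
  have h : c < sing s := by
    refine Cl.lt_of_card_lt ?_
    have h1 := Finset.card_pos.2 (hL.cl c hc).nonempty
    rcases Nat.lt_or_ge 1 c.s.card with h2 | h2
    · simpa [sing] using h2
    · obtain ⟨t, ht⟩ := Finset.card_eq_one.1 (le_antisymm h2 h1)
      exact (hL.ne_sing hc t (Cl.ext ht)).elim
  simp [ltSign, h.not_gt]

theorem LF.conSign (n : ℕ) (hk : 3 ≤ k) (hL : LF r L) (hc : c ∈ L) :
    conSign n (clGraph r L) (clEdges r L) c c = - eps c L := by
  have hT : top r ∉ L := fun h => hL.ne_top h rfl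
  have h1 : eps c (insert (top r) L) = - eps c L := by
    rw [eps_insert hT, hL.ltSign_top hc, neg_one_mul]
  have h2 : ∀ U : Finset (Fin k), eps c (insert (top r) L ∪ U.image sing) = eps c (insert (top r) L) := by
    intro U
    refine (Finset.prod_subset Finset.subset_union_left fun d hd hd' => ?_).symm
    obtain ⟨s, -, rfl⟩ := Finset.mem_image.1 ((Finset.mem_union.1 hd).resolve_left hd')
    exact hL.ltSign_sing hc s
  have hdir : dirSign n (clGraph r L) c c = 1 := by
    simp [dirSign, clGraph_true (hL.ne_sing hc)]
  rw [HairyGraphs.conSign, hdir, one_mul, csgn, ori, remElt, hL.verts hk]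
  split_ifs with hn
  · rw [← Finset.image_singleton, kappa_edge, ← h1, ← h2 (Finset.univ.erase r)]
    simp [kappa, eps, clEdges]
  · rw [← Finset.image_singleton, kappa_vert, ← h1]
    simp [kappa, eps]

end ClusterTree

section Composition

variable {S V E : Type} [LinearOrder E] [LinearOrder V] [Fintype V]
variable {S' V' E' : Type} [LinearOrder E'] [LinearOrder V'] [Fintype V']
variable {S'' V'' E'' : Type} [LinearOrder E''] [LinearOrder V''] [Fintype V'']
variable {h : S → S'} {a : E → E'} {b : V → V'} {f : E → Bool} {g : Graph S V E} {P : Finset E}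
  {g' : Graph S' V' E'} {h' : S' → S''} {a' : E' → E''} {b' : V' → V''} {f' : E' → Bool}
  {g'' : Graph S'' V'' E''}

theorem GMap.comp (M : GMap h a b f g P g') (M' : GMap h' a' b' f' g' (P.image a) g'') :
    GMap (h' ∘ h) (a' ∘ a) (b' ∘ b) (fun i => xor (f i) (f' (a i))) g P g'' where
  injE := by
    refine M'.injE.comp M.injE fun i hi => ?_
    simpa using ⟨i, hi, rfl⟩
  injV := by
    refine M'.injV.comp M.injV fun w hw => ?_
    rw [M.verts_image]
    exact Finset.mem_coe.2 (Finset.mem_image_of_mem b hw)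
  map i hi c := by
    have h1 := M'.map (a i) (Finset.mem_image_of_mem a hi) c
    rw [M.map i hi] at h1
    rw [Function.comp_apply, h1, map_map_sum, Bool.xor_assoc, Bool.xor_comm (f' (a i))]

theorem gsign_comp (n : ℕ) (M : GMap h a b f g P g') (M' : GMap h' a' b' f' g' (P.image a) g'') :
    gsign n (a' ∘ a) (b' ∘ b) (fun i => xor (f i) (f' (a i))) g P =
      gsign n a' b' f' g' (P.image a) * gsign n a b f g P := by
  unfold gsign
  split_ifs
  · exact invSign_comp M.injE M'.injE
  · have h1 := M'.injV
    rw [M.verts_image] at h1 ⊢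
    rw [invSign_comp M.injV h1, Finset.prod_image M.injE]
    simp only [flipSign_xor, Finset.prod_mul_distrib]
    ring

end Composition

section ModelUniqueness

variable {S V E : Type} [LinearOrder E] [LinearOrder V] [Fintype V] {k : ℕ}

/-- An isomorphism of a graph with the tree of a laminar family. -/
structure Model (r : Fin k) (h : S → Fin k) (a : E → Cl k) (b : V → Cl k) (f : E → Bool) (g : Graph S V E)
    (P : Finset E) (L : Finset (Cl k)) : Prop where
  lf : LF r L
  map : GMap h a b f g P (clGraph r L)
  image : P.image a = clEdges r L

variable {r : Fin k} {h : S → Fin k} {a a' : E → Cl k} {b b' : V → Cl k} {f f' : E → Bool}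
  {g : Graph S V E} {P : Finset E} {L L' : Finset (Cl k)}

theorem Model.mem (M : Model r h a b f g P L) {i : E} (hi : i ∈ P) : a i ∈ clEdges r L :=
  M.image ▸ Finset.mem_image_of_mem a hi

theorem Model.half (M : Model r h a b f g P L) {i : E} (hi : i ∈ P) {x : Bool} {z : S ⊕ V} (hz : g i x = z) :
    clGraph r L (a i) (xor x (f i)) = z.map h b := by
  rw [M.map.map i hi, Bool.xor_assoc, Bool.xor_self, Bool.xor_false, hz]

theorem Model.exists_half (M : Model r h a b f g P L) {i : E} (hi : i ∈ P) {x : Bool} {w : V} (hw : w ∈ verts g P)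
    (hx : clGraph r L (a i) x = .inr (b w)) : g i (xor x (f i)) = .inr w := by
  rw [M.map.map i hi] at hx
  rcases hz : g i (xor x (f i)) with s | v
  · rw [hz] at hx; cases hx
  · rw [hz] at hx
    rw [M.map.injV (mem_verts.2 ⟨i, hi, _, hz⟩) hw (Sum.inr_injective hx)]

theorem Model.unique_aux (hk : 3 ≤ k) (M : Model r h a b f g P L) (M' : Model r h a' b' f' g P L') (m : ℕ) :
    ∀ i ∈ P, (a i).s.card < m → a' i = a i ∧ f' i = f i ∧
      ∀ w, g i (xor true (f i)) = .inr w → b' w = b w := by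
  induction m with
  | zero => intro i _ h; omega
  | succ m ih =>
    intro i hi hm
    rcases mem_clEdges.1 (M.mem hi) with hc | ⟨s, hs, hc⟩
    swap
    · have e1 := M.map.map i hi true
      rw [hc, clGraph_true_sing] at e1
      rcases hz : g i (xor true (f i)) with t | v
      swap
      · rw [hz] at e1; cases e1
      rw [hz] at e1
      have e2 := M'.half hi hz
      have e3 : s = h t := Sum.inl_injective e1
      rcases M'.lf.half_inl hk (M'.mem hi) e2 with ⟨h1, -⟩ | ⟨-, h1, h2⟩
      · exact (hs (e3.trans h1)).elim
      · refine ⟨by rw [h1, hc, e3], ?_, by simp⟩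
        revert h2
        cases f i <;> cases f' i <;> simp
    · have hns := M.lf.insert_ne_sing hk hc
      have e1 := M.map.map i hi true
      rw [clGraph_true hns] at e1
      rcases hz : g i (xor true (f i)) with t | w
      · rw [hz] at e1; cases e1
      rw [hz] at e1
      have e1 : a i = b w := Sum.inr_injective e1
      have hw : w ∈ verts g P := mem_verts.2 ⟨i, hi, _, hz⟩
      obtain ⟨hw', hdich⟩ := M'.lf.half_inr hk (M'.mem hi) (M'.half hi hz)
      have key : ∀ d ∈ clEdges r L, d ≠ top r → par r L d = a i →
          ∃ j ∈ P, a j = d ∧ a' j = d ∧ f' j = f j ∧ d ≠ top r ∧ par r L' d = b' w := by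
        intro d hd hdt hdp
        have hd' := hd
        rw [← M.image] at hd'
        obtain ⟨j, hj, rfl⟩ := Finset.mem_image.1 hd'
        have h1 := Finset.card_lt_card (M.lf.par_mem hk hd hdt).2
        rw [hdp] at h1
        obtain ⟨h2, h3, -⟩ := ih j hj (by omega)
        refine ⟨j, hj, rfl, h2, h3, hdt, ?_⟩
        have h4 := M.exists_half hj hw (x := false) (by rw [clGraph_false hdt, hdp, e1])
        obtain ⟨-, ⟨h5, -⟩ | ⟨-, -, h5⟩⟩ := M'.lf.half_inr hk (M'.mem hj) (M'.half hj h4)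
        · rw [h3] at h5; simp at h5
        · rwa [h2] at h5
      have conv : ∀ j ∈ P, ∀ y, g j y = .inr w → (j = i ∧ y = xor true (f i)) ∨
          (a j ≠ top r ∧ par r L (a j) = a i ∧ y = f j) := by
        intro j hj y hy
        obtain ⟨-, ⟨h5, h6⟩ | ⟨h5, h6, h7⟩⟩ := M.lf.half_inr hk (M.mem hj) (M.half hj hy)
        · have h7 : j = i := M.map.injE hj hi (h6.trans e1.symm)
          subst h7
          refine .inl ⟨rfl, ?_⟩
          revert h5
          cases y <;> cases f j <;> simp
        · refine .inr ⟨h6, h7.trans e1.symm, ?_⟩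
          revert h5
          cases y <;> cases f j <;> simp
      have hmain : f' i = f i ∧ a' i = b' w := by
        rcases hdich with ⟨h1, h2⟩ | ⟨h1, h2, h3⟩
        · refine ⟨?_, h2⟩
          revert h1
          cases f i <;> cases f' i <;> simp
        · have h4 : b' w ∈ P.image a' := by rw [M'.image]; exact mem_clEdges.2 (.inl hw')
          obtain ⟨j, hj, hjw⟩ := Finset.mem_image.1 h4
          have h5 := M'.exists_half hj hw (x := true)
            (by rw [hjw, clGraph_true (M'.lf.insert_ne_sing hk hw')])
          rcases conv j hj _ h5 with ⟨rfl, h6⟩ | ⟨h6, h7, h8⟩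
          · rw [← h6] at h1
            simp at h1
          · obtain ⟨j', hj', h9, h10, h11, -⟩ := key _ (M.mem hj) h6 h7
            rw [M.map.injE hj' hj h9] at h11
            rw [h11] at h8
            simp at h8
      have hset : b' w = a i := by
        ext s
        constructor
        · intro hs
          obtain ⟨d, hd, hdt, hdp, hsd⟩ := M'.lf.exists_child hk hw' hs
          have hd' := hd
          rw [← M'.image] at hd'
          obtain ⟨j, hj, rfl⟩ := Finset.mem_image.1 hd'
          have h4 := M'.exists_half hj hw (x := false) (by rw [clGraph_false hdt, hdp])
          rcases conv j hj _ h4 with ⟨rfl, -⟩ | ⟨h6, h7, -⟩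
          · have h5 := (M'.lf.par_mem hk hd hdt).2
            rw [hdp, hmain.2] at h5
            exact (h5.ne rfl).elim
          · obtain ⟨j', hj', h9, h10, -⟩ := key _ (M.mem hj) h6 h7
            rw [M.map.injE hj' hj h9] at h10
            rw [h10] at hsd
            have h5 := (M.lf.par_mem hk (M.mem hj) h6).2.1 hsd
            rwa [h7] at h5
        · intro hs
          obtain ⟨d, hd, hdt, hdp, hsd⟩ := M.lf.exists_child hk hc hs
          obtain ⟨j, hj, -, h2, -, -, h3⟩ := key d hd hdt hdp
          rw [← h3]
          exact (M'.lf.par_mem hk (h2 ▸ M'.mem hj) hdt).2.1 hsd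
      refine ⟨hmain.2.trans hset, hmain.1, fun w' hw' => ?_⟩
      cases hw'
      rw [hset, e1]

theorem LF.eq_filter (hL : LF r L) :
    L = open scoped Classical in (clEdges r L).filter fun c => c ≠ top r ∧ ∀ s, c ≠ sing s := by
  ext c
  simp only [Finset.mem_filter, mem_clEdges, Finset.mem_insert]
  constructor
  · exact fun h => ⟨.inl (.inr h), hL.ne_top h, hL.ne_sing h⟩
  · rintro ⟨(h | h) | ⟨s, -, h⟩, h1, h2⟩
    exacts [(h1 h).elim, h, (h2 s h).elim]

/-- Isomorphisms with trees of laminar families are determined by the labels. -/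
theorem Model.unique (hk : 3 ≤ k) (M : Model r h a b f g P L) (M' : Model r h a' b' f' g P L') :
    L' = L ∧ (∀ i ∈ P, a' i = a i) ∧ (∀ w ∈ verts g P, b' w = b w) ∧ ∀ i ∈ P, f' i = f i := by
  have key := fun i hi => M.unique_aux hk M' _ i hi (Nat.lt_succ_self _)
  refine ⟨?_, fun i hi => (key i hi).1, fun w hw => ?_, fun i hi => (key i hi).2.1⟩
  · rw [M.lf.eq_filter, M'.lf.eq_filter, ← M.image, ← M'.image,
      Finset.image_congr fun i hi => (key i hi).1]
  · have h1 : b w ∈ insert (top r) L := by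
      rw [← M.lf.verts hk, ← M.image, M.map.verts_image]
      exact Finset.mem_image_of_mem b hw
    have h2 := mem_clEdges.2 (.inl h1)
    rw [← M.image] at h2
    obtain ⟨i, hi, hiw⟩ := Finset.mem_image.1 h2
    exact (key i hi).2.2 w (M.exists_half hi hw (by rw [hiw, clGraph_true (M.lf.insert_ne_sing hk h1)]))

theorem Model.gsign_eq (n : ℕ) (hk : 3 ≤ k) (M : Model r h a b f g P L) (M' : Model r h a' b' f' g P L') :
    gsign n a' b' f' g P = gsign n a b f g P := by
  obtain ⟨-, h1, h2, h3⟩ := M.unique hk M'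
  unfold gsign
  rw [invSign_congr h1, invSign_congr h2, Finset.prod_congr rfl fun i hi => by rw [h3 i hi]]

end ModelUniqueness

section RootedTrees

variable {V E : Type} [LinearOrder E] [LinearOrder V] [Fintype V] {k : ℕ}
variable {r : Fin k} {g : Graph (Fin k) V E} {P : Finset E}

/-- The vertices of a graph. -/
def nodes (g : Graph (Fin k) V E) (P : Finset E) : Finset (Fin k ⊕ V) :=
  Finset.univ.image .inl ∪ (verts g P).image .inr

theorem inl_mem_nodes (s : Fin k) : .inl s ∈ nodes g P := by simp [nodes]

theorem inr_mem_nodes {w : V} : .inr w ∈ nodes g P ↔ w ∈ verts g P := by simp [nodes]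

theorem mem_nodes_of_half {i : E} (hi : i ∈ P) (c : Bool) : g i c ∈ nodes g P := by
  rcases h : g i c with s | w
  · exact inl_mem_nodes s
  · exact inr_mem_nodes.2 (mem_verts.2 ⟨i, hi, c, h⟩)

theorem card_nodes : (nodes g P).card = k + (verts g P).card := by
  rw [nodes, Finset.card_union_of_disjoint, Finset.card_image_of_injective _ Sum.inl_injective,
    Finset.card_image_of_injective _ Sum.inr_injective, Finset.card_univ, Fintype.card_fin]
  rw [Finset.disjoint_left]
  simp

/-- A proper set of nodes that contains the root is left by some edge. -/
theorem exists_crossing (hP : IsLinked g P) (hU : UnivExt g P) {X : Finset (Fin k ⊕ V)}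
    (hX : X ⊆ nodes g P) (hne : X ≠ nodes g P) (hr : .inl r ∈ X) :
    ∃ i ∈ P, ∃ c, g i c ∉ X ∧ g i (!c) ∈ X := by
  by_contra hno
  push Not at hno
  have hall : ∀ i ∈ P, ∀ c, g i c ∈ X → ∀ c', g i c' ∈ X := by
    intro i hi c hc c'
    by_contra h
    have h1 := hno i hi c' h
    cases c <;> cases c' <;> simp_all
  have hQ : P.filter (fun i => g i true ∈ X) = P := by
    refine isLinked_iff.1 hP _ (Finset.filter_subset _ _) ?_ ?_
    · obtain ⟨p, ⟨hp, hpr⟩, -⟩ := hU r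
      exact ⟨p.1, Finset.mem_filter.2 ⟨hp, hall p.1 hp p.2 (by rw [hpr]; exact hr) true⟩⟩
    · intro i hi j hj b c w hb hc
      rw [Finset.mem_filter] at hi
      rw [Finset.mem_sdiff, Finset.mem_filter] at hj
      refine hj.2 ⟨hj.1, hall j hj.1 c ?_ true⟩
      rw [hc, ← hb]
      exact hall i hi.1 true hi.2 b
  have hmem : ∀ i ∈ P, ∀ c, g i c ∈ X := by
    intro i hi c
    rw [← hQ] at hi
    exact hall i (Finset.mem_of_mem_filter i hi) true (Finset.mem_filter.1 hi).2 c
  refine hne (hX.antisymm fun x hx => ?_)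
  rcases x with s | w
  · obtain ⟨p, ⟨hp, hps⟩, -⟩ := hU s
    exact hps ▸ hmem p.1 hp p.2
  · obtain ⟨i, hi, c, hc⟩ := mem_verts.1 (inr_mem_nodes.1 hx)
    exact hc ▸ hmem i hi c

/-- A choice, for each node except for the root, of a half-edge that leads towards the root. -/
structure IsParent (r : Fin k) (g : Graph (Fin k) V E) (P : Finset E) (X : Finset (Fin k ⊕ V))
    (rank : Fin k ⊕ V → ℕ) (p : Fin k ⊕ V → E × Bool) : Prop where
  mem : ∀ x ∈ X, x ≠ .inl r → (p x).1 ∈ P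
  eq : ∀ x ∈ X, x ≠ .inl r → g (p x).1 (p x).2 = x
  up : ∀ x ∈ X, x ≠ .inl r → g (p x).1 (!(p x).2) ∈ X
  rank_lt : ∀ x ∈ X, x ≠ .inl r → rank (g (p x).1 (!(p x).2)) < rank x

theorem exists_isParent (hP : IsLinked g P) (hU : UnivExt g P) :
    ∃ rank p, IsParent r g P (nodes g P) rank p := by
  have key : ∀ m : ℕ, m < (nodes g P).card → ∃ X ⊆ nodes g P, X.card = m + 1 ∧ .inl r ∈ X ∧
      ∃ rank p, IsParent r g P X rank p := by
    intro m
    induction m with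
    | zero =>
      intro _
      obtain ⟨q, -⟩ := hU r
      refine ⟨{.inl r}, by simpa using inl_mem_nodes r, rfl, by simp, fun _ => 0, fun _ => q, ?_⟩
      constructor <;> simp
    | succ m ih =>
      intro hm
      obtain ⟨X, hX, hcard, hr, rank, p, hp⟩ := ih (by omega)
      obtain ⟨i, hi, c, hc, hc'⟩ := exists_crossing hP hU hX (by rintro rfl; omega) hr
      have hn : ∀ x ∈ X, x ≠ g i c := fun x hx h => hc (h ▸ hx)
      refine ⟨insert (g i c) X, Finset.insert_subset (mem_nodes_of_half hi c) hX, by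
        rw [Finset.card_insert_of_notMem hc, hcard], Finset.mem_insert_of_mem hr,
        Function.update rank (g i c) (rank (g i (!c)) + 1), Function.update p (g i c) (i, c), ?_⟩
      constructor
      all_goals
        intro x hx hxr
        rcases Finset.mem_insert.1 hx with rfl | hx
      · simpa using hi
      · rw [Function.update_of_ne (hn x hx)]
        exact hp.mem x hx hxr
      · simp
      · rw [Function.update_of_ne (hn x hx)]
        exact hp.eq x hx hxr
      · simpa using .inr hc'
      · rw [Function.update_of_ne (hn x hx)]
        exact Finset.mem_insert_of_mem (hp.up x hx hxr)
      · rw [Function.update_self, Function.update_self, Function.update_of_ne (hn _ hc')]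
        exact Nat.lt_succ_self _
      · rw [Function.update_of_ne (hn x hx), Function.update_of_ne (hn x hx),
          Function.update_of_ne (hn _ (hp.up x hx hxr))]
        exact hp.rank_lt x hx hxr
  have hpos : 0 < (nodes g P).card := Finset.card_pos.2 ⟨_, inl_mem_nodes r⟩
  obtain ⟨X, hX, hcard, -, h⟩ := key ((nodes g P).card - 1) (by omega)
  rwa [Finset.eq_of_subset_of_card_le hX (by omega)] at h

variable {rank : Fin k ⊕ V → ℕ} {p : Fin k ⊕ V → E × Bool}

/-- The next node on the way to the root. -/
def upNode (g : Graph (Fin k) V E) (p : Fin k ⊕ V → E × Bool) (x : Fin k ⊕ V) : Fin k ⊕ V :=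
  g (p x).1 (!(p x).2)

/-- The second node lies on the path from the first node to the root. -/
def Anc (r : Fin k) (g : Graph (Fin k) V E) (P : Finset E) (p : Fin k ⊕ V → E × Bool) :
    Fin k ⊕ V → Fin k ⊕ V → Prop :=
  Relation.ReflTransGen fun x y => x ∈ nodes g P ∧ x ≠ .inl r ∧ y = upNode g p x

theorem Anc.total {x y z : Fin k ⊕ V} (h : Anc r g P p x y) (h' : Anc r g P p x z) :
    Anc r g P p y z ∨ Anc r g P p z y :=
  Relation.ReflTransGen.total_of_right_unique (fun _ _ _ h1 h2 => h1.2.2.trans h2.2.2.symm) h h'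

theorem Anc.eq_root {x : Fin k ⊕ V} (h : Anc r g P p (.inl r) x) : x = .inl r := by
  rcases Relation.ReflTransGen.cases_head h with h | ⟨y, ⟨-, h1, -⟩, -⟩
  exacts [h.symm, (h1 rfl).elim]

/-- The labels of the leaves above a node. -/
def clu (r : Fin k) (g : Graph (Fin k) V E) (P : Finset E) (p : Fin k ⊕ V → E × Bool) (x : Fin k ⊕ V) : Cl k :=
  open scoped Classical in ⟨Finset.univ.filter fun s => Anc r g P p (.inl s) x⟩

theorem mem_clu {s : Fin k} {x : Fin k ⊕ V} : s ∈ (clu r g P p x).s ↔ Anc r g P p (.inl s) x := by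
  simp [clu]

theorem clu_mono {x y : Fin k ⊕ V} (h : Anc r g P p x y) : (clu r g P p x).s ⊆ (clu r g P p y).s :=
  fun _ hs => mem_clu.2 ((mem_clu.1 hs).trans h)

namespace IsParent

theorem anc_up (hp : IsParent r g P (nodes g P) rank p) {x : Fin k ⊕ V} (hx : x ∈ nodes g P)
    (hr : x ≠ .inl r) : Anc r g P p x (upNode g p x) ∧ rank (upNode g p x) < rank x ∧
      upNode g p x ∈ nodes g P :=
  ⟨.single ⟨hx, hr, rfl⟩, hp.rank_lt x hx hr, hp.up x hx hr⟩

theorem anc_rank (hp : IsParent r g P (nodes g P) rank p) {x y : Fin k ⊕ V} (h : Anc r g P p x y) :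
    rank y ≤ rank x := by
  induction h with
  | refl => rfl
  | tail _ h ih =>
    obtain ⟨h1, h2, rfl⟩ := h
    exact (hp.rank_lt _ h1 h2).le.trans ih

theorem _root_.HairyGraphs.Anc.head {x y : Fin k ⊕ V} (h : Anc r g P p x y)
    (hne : x ≠ y) : x ∈ nodes g P ∧ x ≠ .inl r ∧ Anc r g P p (upNode g p x) y := by
  rcases Relation.ReflTransGen.cases_head h with h | ⟨z, ⟨h1, h2, rfl⟩, h3⟩
  exacts [(hne h).elim, ⟨h1, h2, h3⟩]

theorem injective (hp : IsParent r g P (nodes g P) rank p) {x y : Fin k ⊕ V} (hx : x ∈ nodes g P)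
    (hxr : x ≠ .inl r) (hy : y ∈ nodes g P) (hyr : y ≠ .inl r) (h : (p x).1 = (p y).1) : x = y := by
  by_cases h2 : (p x).2 = (p y).2
  · rw [← hp.eq x hx hxr, ← hp.eq y hy hyr, h, h2]
  · have h3 : (!(p x).2) = (p y).2 := by
      revert h2; cases (p x).2 <;> cases (p y).2 <;> simp
    have h4 : (!(p y).2) = (p x).2 := by rw [← h3, Bool.not_not]
    have h5 := hp.rank_lt x hx hxr
    have h6 := hp.rank_lt y hy hyr
    rw [h, h3, hp.eq y hy hyr] at h5
    rw [← h, h4, hp.eq x hx hxr] at h6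
    omega

theorem siblings (hp : IsParent r g P (nodes g P) rank p) {x y : Fin k ⊕ V} (hy : y ∈ nodes g P)
    (hyr : y ≠ .inl r) (h : upNode g p x = upNode g p y) (ha : Anc r g P p x y) : x = y := by
  by_contra hne
  have h1 := hp.anc_rank (ha.head hne).2.2
  rw [h] at h1
  exact absurd (hp.rank_lt y hy hyr) (not_lt.2 h1)

theorem siblings_disjoint (hp : IsParent r g P (nodes g P) rank p) {x y z : Fin k ⊕ V} (hx : x ∈ nodes g P)
    (hxr : x ≠ .inl r) (hy : y ∈ nodes g P) (hyr : y ≠ .inl r) (h : upNode g p x = upNode g p y)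
    (h1 : Anc r g P p z x) (h2 : Anc r g P p z y) : x = y := by
  rcases h1.total h2 with h3 | h3
  · exact hp.siblings hy hyr h h3
  · exact (hp.siblings hx hxr h.symm h3).symm

theorem up_inl (hp : IsParent r g P (nodes g P) rank p) (hU : UnivExt g P) {x : Fin k ⊕ V} {s : Fin k}
    (hx : x ∈ nodes g P) (hxr : x ≠ .inl r) (h : upNode g p x = .inl s) : s = r := by
  by_contra hs
  have hs' : (Sum.inl s : Fin k ⊕ V) ≠ .inl r := fun h => hs (Sum.inl_injective h)
  have h1 : p (.inl s) = ((p x).1, !(p x).2) := (hU s).unique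
    ⟨hp.mem _ (inl_mem_nodes s) hs', hp.eq _ (inl_mem_nodes s) hs'⟩ ⟨hp.mem x hx hxr, h⟩
  have h2 := hp.injective (inl_mem_nodes s) hs' hx hxr (by rw [h1])
  rw [← h2] at h1
  have h3 := congrArg Prod.snd h1
  revert h3
  cases (p (.inl s)).2 <;> simp

theorem exists_node (hp : IsParent r g P (nodes g P) rank p) (hcard : P.card + 1 = k + (verts g P).card) {i : E}
    (hi : i ∈ P) : ∃ x ∈ nodes g P, x ≠ .inl r ∧ (p x).1 = i := by
  have h1 : ((nodes g P).erase (.inl r)).image (fun x => (p x).1) = P := by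
    refine Finset.eq_of_subset_of_card_le (fun j hj => ?_) ?_
    · obtain ⟨x, hx, rfl⟩ := Finset.mem_image.1 hj
      rw [Finset.mem_erase] at hx
      exact hp.mem x hx.2 hx.1
    · rw [Finset.card_image_of_injOn, Finset.card_erase_of_mem (inl_mem_nodes r), card_nodes]
      · omega
      · intro x hx y hy h
        simp only [Finset.coe_erase, Set.mem_sdiff, Finset.mem_coe, Set.mem_singleton_iff] at hx hy
        exact hp.injective hx.1 hx.2 hy.1 hy.2 h
  rw [← h1] at hi
  obtain ⟨x, hx, rfl⟩ := Finset.mem_image.1 hi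
  rw [Finset.mem_erase] at hx
  exact ⟨x, hx.2, hx.1, rfl⟩

theorem half_cases (hp : IsParent r g P (nodes g P) rank p) (hcard : P.card + 1 = k + (verts g P).card) {i : E}
    (hi : i ∈ P) (c : Bool) : ∃ x ∈ nodes g P, x ≠ .inl r ∧ (p x).1 = i ∧
      (((p x).2 = c ∧ g i c = x) ∨ ((!(p x).2) = c ∧ g i c = upNode g p x)) := by
  obtain ⟨x, hx, hxr, rfl⟩ := hp.exists_node hcard hi
  refine ⟨x, hx, hxr, rfl, ?_⟩
  by_cases h : (p x).2 = c
  · exact .inl ⟨h, h ▸ hp.eq x hx hxr⟩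
  · have h' : (!(p x).2) = c := by revert h; cases (p x).2 <;> cases c <;> simp
    exact .inr ⟨h', h' ▸ rfl⟩

theorem exists_children (hp : IsParent r g P (nodes g P) rank p)
    (hcard : P.card + 1 = k + (verts g P).card) (ht : Trivalent g P) {w : V} (hw : w ∈ verts g P) :
    ∃ x ∈ nodes g P, ∃ y ∈ nodes g P, x ≠ .inl r ∧ y ≠ .inl r ∧ x ≠ y ∧ upNode g p x = .inr w ∧
      upNode g p y = .inr w := by
  have h1 := ht w hw
  have h2 : 1 < ((halves g P w).erase (p (.inr w))).card := by
    have := Finset.pred_card_le_card_erase (s := halves g P w) (a := p (.inr w))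
    omega
  obtain ⟨q, hq, q', hq', hne⟩ := Finset.one_lt_card.1 h2
  have key : ∀ q ∈ (halves g P w).erase (p (.inr w)), ∃ x ∈ nodes g P, x ≠ .inl r ∧
      upNode g p x = .inr w ∧ q = ((p x).1, !(p x).2) := by
    intro q hq
    rw [Finset.mem_erase, mem_halves] at hq
    obtain ⟨x, hx, hxr, h3, ⟨h4, h5⟩ | ⟨h4, h5⟩⟩ := hp.half_cases hcard hq.2.1 q.2
    · rw [hq.2.2] at h5
      refine (hq.1 ?_).elim
      rw [h5, ← Prod.mk.eta (p := q), ← h3, ← h4]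
    · rw [hq.2.2] at h5
      exact ⟨x, hx, hxr, h5.symm, by rw [h3, h4]⟩
  obtain ⟨x, hx, hxr, h3, rfl⟩ := key q hq
  obtain ⟨y, hy, hyr, h4, rfl⟩ := key q' hq'
  exact ⟨x, hx, y, hy, hxr, hyr, fun h => hne (h ▸ rfl), h3, h4⟩

theorem exists_leaf (hp : IsParent r g P (nodes g P) rank p)
    (hcard : P.card + 1 = k + (verts g P).card) (ht : Trivalent g P) {x : Fin k ⊕ V} (hx : x ∈ nodes g P) :
    ∃ s, Anc r g P p (.inl s) x := by
  classical
  obtain ⟨y, hy, hmax⟩ := Finset.exists_max_image ((nodes g P).filter fun y => Anc r g P p y x) rank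
    ⟨x, Finset.mem_filter.2 ⟨hx, .refl⟩⟩
  rw [Finset.mem_filter] at hy
  rcases y with s | w
  · exact ⟨s, hy.2⟩
  · obtain ⟨z, hz, -, -, hzr, -, -, h1, -⟩ := hp.exists_children hcard ht (inr_mem_nodes.1 hy.1)
    obtain ⟨h2, h3, -⟩ := hp.anc_up hz hzr
    rw [h1] at h2 h3
    have := hmax z (Finset.mem_filter.2 ⟨hz, h2.trans hy.2⟩)
    omega

theorem clu_ssub (hp : IsParent r g P (nodes g P) rank p)
    (hcard : P.card + 1 = k + (verts g P).card) (ht : Trivalent g P) {x : Fin k ⊕ V} (hx : x ∈ nodes g P)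
    (hxr : x ≠ .inl r) {w : V} (h : upNode g p x = .inr w) :
    (clu r g P p x).s ⊂ (clu r g P p (.inr w)).s := by
  obtain ⟨h1, -, h2⟩ := hp.anc_up hx hxr
  rw [h] at h1 h2
  refine Finset.ssubset_iff_subset_ne.2 ⟨clu_mono h1, fun heq => ?_⟩
  have key : ∃ y ∈ nodes g P, y ≠ .inl r ∧ y ≠ x ∧ upNode g p y = .inr w := by
    obtain ⟨y, hy, z, hz, hyr, hzr, hne, h3, h4⟩ := hp.exists_children hcard ht (inr_mem_nodes.1 h2)
    by_cases hyx : y = x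
    · exact ⟨z, hz, hzr, fun h => hne (hyx.trans h.symm), h4⟩
    · exact ⟨y, hy, hyr, hyx, h3⟩
  obtain ⟨y, hy, hyr, hyx, h3⟩ := key
  obtain ⟨s, hs⟩ := hp.exists_leaf hcard ht hy
  have h4 : s ∈ (clu r g P p (.inr w)).s := mem_clu.2 (hs.trans (h3 ▸ (hp.anc_up hy hyr).1))
  rw [← heq, mem_clu] at h4
  exact hyx (hp.siblings_disjoint hy hyr hx hxr (h3.trans h.symm) hs h4)

theorem clu_ssub_of_anc (hp : IsParent r g P (nodes g P) rank p) (hU : UnivExt g P)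
    (hcard : P.card + 1 = k + (verts g P).card) (ht : Trivalent g P) {x y : Fin k ⊕ V} (h : Anc r g P p x y)
    (hne : x ≠ y) (hyr : y ≠ .inl r) : (clu r g P p x).s ⊂ (clu r g P p y).s := by
  obtain ⟨h1, h2, h3⟩ := h.head hne
  rcases h4 : upNode g p x with s | w
  · rw [h4, hp.up_inl hU h1 h2 h4] at h3
    exact (hyr h3.eq_root).elim
  · rw [h4] at h3
    exact (hp.clu_ssub hcard ht h1 h2 h4).trans_subset (clu_mono h3)

theorem anc_of_clu (hp : IsParent r g P (nodes g P) rank p) (hU : UnivExt g P)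
    (hcard : P.card + 1 = k + (verts g P).card) (ht : Trivalent g P) {x y : Fin k ⊕ V} (hx : x ∈ nodes g P)
    (hxr : x ≠ .inl r) (h : (clu r g P p x).s ⊆ (clu r g P p y).s) : Anc r g P p x y := by
  obtain ⟨s, hs⟩ := hp.exists_leaf hcard ht hx
  rcases hs.total (mem_clu.1 (h (mem_clu.2 hs))) with h1 | h1
  · exact h1
  · by_cases hne : y = x
    · rw [hne]; exact .refl
    · exact ((hp.clu_ssub_of_anc hU hcard ht h1 hne hxr).not_subset h).elim

theorem clu_injective (hp : IsParent r g P (nodes g P) rank p) (hU : UnivExt g P)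
    (hcard : P.card + 1 = k + (verts g P).card) (ht : Trivalent g P) {x y : Fin k ⊕ V} (hx : x ∈ nodes g P)
    (hxr : x ≠ .inl r) (hyr : y ≠ .inl r) (h : clu r g P p x = clu r g P p y) : x = y := by
  by_contra hne
  exact (hp.clu_ssub_of_anc hU hcard ht (hp.anc_of_clu hU hcard ht hx hxr (by rw [h])) hne hyr).ne (by rw [h])

theorem _root_.HairyGraphs.clu_nested (x y : Fin k ⊕ V) :
    Nested (clu r g P p x).s (clu r g P p y).s := by
  by_cases h : Disjoint (clu r g P p x).s (clu r g P p y).s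
  · exact .inr (.inr h)
  · obtain ⟨s, hs, hs'⟩ := Finset.not_disjoint_iff.1 h
    exact ((mem_clu.1 hs).total (mem_clu.1 hs')).imp clu_mono fun h => .inl (clu_mono h)

theorem _root_.HairyGraphs.clu_sub {x : Fin k ⊕ V} (hxr : x ≠ .inl r) :
    (clu r g P p x).s ⊆ (top r).s := by
  intro s hs
  rw [mem_top]
  rintro rfl
  exact hxr (mem_clu.1 hs).eq_root

theorem clu_inl (hp : IsParent r g P (nodes g P) rank p) (hU : UnivExt g P) {s : Fin k} (hs : s ≠ r) :
    clu r g P p (.inl s) = sing s := by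
  ext t
  rw [mem_clu]
  constructor
  · intro h
    rcases Relation.ReflTransGen.cases_tail h with h1 | ⟨z, -, h1, h2, h3⟩
    · simp [sing, Sum.inl_injective h1]
    · exact (hs (hp.up_inl hU h1 h2 h3.symm)).elim
  · intro h
    rw [Finset.mem_singleton.1 h]
    exact .refl

theorem exists_trunk (hp : IsParent r g P (nodes g P) rank p) (hU : UnivExt g P)
    (hcard : P.card + 1 = k + (verts g P).card) : ∃ t ∈ nodes g P, t ≠ .inl r ∧
      clu r g P p t = top r ∧ ∀ x ∈ nodes g P, x ≠ .inl r → upNode g p x = .inl r → x = t := by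
  obtain ⟨q, ⟨hq, hqr⟩, huniq⟩ := hU r
  have hone : ∀ x ∈ nodes g P, x ≠ .inl r → upNode g p x = .inl r → (p x).1 = q.1 := by
    intro x hx hxr h
    rw [← huniq ((p x).1, !(p x).2) ⟨hp.mem x hx hxr, h⟩]
  obtain ⟨t, ht, htr, h1, ⟨-, h2⟩ | ⟨-, h2⟩⟩ := hp.half_cases hcard hq q.2
  · exact (htr (h2.symm.trans hqr)).elim
  · have huniq' : ∀ x ∈ nodes g P, x ≠ .inl r → upNode g p x = .inl r → x = t := fun x hx hxr h =>
      hp.injective hx hxr ht htr ((hone x hx hxr h).trans h1.symm)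
    refine ⟨t, ht, htr, Cl.ext ((clu_sub htr).antisymm fun s hs => ?_), huniq'⟩
    have key : ∀ m : ℕ, ∀ x ∈ nodes g P, x ≠ .inl r → rank x < m → Anc r g P p x t := by
      intro m
      induction m with
      | zero => intro x _ _ h; omega
      | succ m ih =>
        intro x hx hxr hm
        obtain ⟨h3, h4, h5⟩ := hp.anc_up hx hxr
        by_cases h6 : upNode g p x = .inl r
        · rw [huniq' x hx hxr h6]
          exact .refl
        · exact h3.trans (ih _ h5 h6 (by omega))
    exact mem_clu.2 (key _ _ (inl_mem_nodes s) (fun h => mem_top.1 hs (Sum.inl_injective h))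
      (Nat.lt_succ_self _))

end IsParent

/-- Trees are isomorphic to trees of laminar families. -/
theorem Prim.exists_tree_model (r : Fin k) (hP : Prim g P) (hU : UnivExt g P)
    (hcard : P.card + 1 = k + (verts g P).card) : ∃ L a b f, Model r id a b f g P L := by
  classical
  obtain ⟨rank, p, hp⟩ := exists_isParent (r := r) hP.linked hU
  have ht := hP.trivalent
  have : Nonempty (Fin k ⊕ V) := ⟨.inl r⟩
  choose! node hn1 hn2 hn3 using fun (i : E) (hi : i ∈ P) => hp.exists_node hcard hi
  obtain ⟨t, ht1, ht2, ht3, ht4⟩ := hp.exists_trunk hU hcard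
  have hir : ∀ w : V, (.inr w : Fin k ⊕ V) ≠ .inl r := fun w => Sum.inr_ne_inl
  set L : Finset (Cl k) := ((verts g P).image fun w => clu r g P p (.inr w)).erase (top r) with hLdef
  have hmemL : ∀ c, c ∈ L ↔ c ≠ top r ∧ ∃ w ∈ verts g P, clu r g P p (.inr w) = c := by
    intro c
    rw [hLdef, Finset.mem_erase, Finset.mem_image]
  have hns : ∀ w ∈ verts g P, ∀ s, clu r g P p (.inr w) ≠ sing s := by
    intro w hw s h
    by_cases hs : s = r
    · have h1 := clu_sub (g := g) (P := P) (p := p) (hir w)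
      rw [h, hs] at h1
      exact mem_top.1 (h1 (Finset.mem_singleton_self r)) rfl
    · rw [← hp.clu_inl hU hs] at h
      cases hp.clu_injective hU hcard ht (inr_mem_nodes.2 hw) (hir w)
        (fun h => hs (Sum.inl_injective h)) h
  have hins : ∀ w ∈ verts g P, clu r g P p (.inr w) ∈ insert (top r) L := by
    intro w hw
    by_cases h : clu r g P p (.inr w) = top r
    · exact h ▸ Finset.mem_insert_self _ _
    · exact Finset.mem_insert_of_mem ((hmemL _).2 ⟨h, w, hw, rfl⟩)
  have hL : LF r L := by
    refine ⟨fun c hc => ?_, fun c hc d hd => ?_⟩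
    · obtain ⟨hct, w, hw, rfl⟩ := (hmemL c).1 hc
      refine ⟨clu_sub (hir w), ?_, ?_, fun h => hct (Cl.ext h), ?_⟩
      · obtain ⟨s, hs⟩ := hp.exists_leaf hcard ht (inr_mem_nodes.2 hw)
        exact ⟨s, mem_clu.2 hs⟩
      · intro h
        obtain ⟨s, -, hs⟩ := Finset.mem_image.1 h
        exact hns w hw s (Cl.ext hs.symm)
      · intro x hx
        obtain ⟨s, -, rfl⟩ := Finset.mem_image.1 hx
        simp only [Finset.singleton_subset_iff, Finset.disjoint_singleton_left]
        exact em _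
    · obtain ⟨-, w, -, rfl⟩ := (hmemL c).1 hc
      obtain ⟨-, w', -, rfl⟩ := (hmemL d).1 hd
      exact clu_nested _ _
  refine ⟨L, fun i => clu r g P p (node i), fun w => clu r g P p (.inr w), fun i => !(p (node i)).2,
    hL, ⟨?_, ?_, ?_⟩, ?_⟩
  · intro i hi j hj h
    rw [← hn3 i hi, ← hn3 j hj, hp.clu_injective hU hcard ht (hn1 i hi) (hn2 i hi) (hn2 j hj) h]
  · intro v hv w hw h
    exact Sum.inr_injective (hp.clu_injective hU hcard ht (inr_mem_nodes.2 hv) (hir v) (hir w) h)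
  · intro i hi c
    have h1 := hp.eq _ (hn1 i hi) (hn2 i hi)
    rw [hn3 i hi] at h1
    cases c with
    | true =>
      simp only [Bool.true_xor, Bool.not_not, h1]
      rcases hz : node i with s | w
      · have hs : s ≠ r := fun h => hn2 i hi (by rw [hz, h])
        rw [hp.clu_inl hU hs, clGraph_true_sing]
        rfl
      · have hw : w ∈ verts g P := inr_mem_nodes.1 (hz ▸ hn1 i hi)
        rw [clGraph_true (hns w hw)]
        rfl
    | false =>
      have h2 : g i (!(p (node i)).2) = upNode g p (node i) := by
        rw [upNode, hn3 i hi]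
      simp only [Bool.false_xor, h2]
      rcases hz : upNode g p (node i) with s | w
      · have hs := hp.up_inl hU (hn1 i hi) (hn2 i hi) hz
        rw [hs] at hz
        rw [ht4 _ (hn1 i hi) (hn2 i hi) hz, ht3, clGraph_false_top, hs]
        rfl
      · have hw : w ∈ verts g P := by
          rw [← inr_mem_nodes, ← hz]
          exact (hp.anc_up (hn1 i hi) (hn2 i hi)).2.2
        have h3 := hp.clu_ssub hcard ht (hn1 i hi) (hn2 i hi) hz
        have h4 : clu r g P p (node i) ≠ top r := by
          intro h
          rw [h] at h3
          exact h3.2 (clu_sub (hir w))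
        rw [clGraph_false h4]
        refine congrArg Sum.inr (Cl.ext ((par_sub (hins w hw) h3).antisymm fun s hs => ?_))
        refine mem_par.2 ⟨mem_top.1 (clu_sub (hir w) hs), fun d hd hid => ?_⟩
        obtain ⟨-, v, hv, rfl⟩ := (hmemL d).1 hd
        have h5 := hp.anc_of_clu hU hcard ht (hn1 i hi) (hn2 i hi) hid.1
        have h6 := (h5.head fun h => hid.ne (by rw [h])).2.2
        rw [hz] at h6
        exact clu_mono h6 hs
  · have hnode : ∀ x ∈ nodes g P, x ≠ .inl r → clu r g P p x ∈ P.image fun i => clu r g P p (node i) := by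
      intro x hx hxr
      refine Finset.mem_image.2 ⟨(p x).1, hp.mem x hx hxr, ?_⟩
      rw [hp.injective (hn1 _ (hp.mem x hx hxr)) (hn2 _ (hp.mem x hx hxr)) hx hxr (hn3 _ (hp.mem x hx hxr))]
    ext c
    rw [mem_clEdges]
    constructor
    · intro hc
      obtain ⟨i, hi, rfl⟩ := Finset.mem_image.1 hc
      rcases hz : node i with s | w
      · have hs : s ≠ r := fun h => hn2 i hi (by rw [hz, h])
        exact .inr ⟨s, hs, hp.clu_inl hU hs⟩
      · exact .inl (hins w (inr_mem_nodes.1 (hz ▸ hn1 i hi)))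
    · rintro (hc | ⟨s, hs, rfl⟩)
      · rcases Finset.mem_insert.1 hc with rfl | hc
        · exact ht3 ▸ hnode t ht1 ht2
        · obtain ⟨-, w, hw, rfl⟩ := (hmemL c).1 hc
          exact hnode _ (inr_mem_nodes.2 hw) (hir w)
      · rw [← hp.clu_inl hU hs]
        exact hnode _ (inl_mem_nodes s) fun h => hs (Sum.inl_injective h)

end RootedTrees

section LabelledTrees

variable {V E : Type} [LinearOrder E] [LinearOrder V] [Fintype V] {k : ℕ}
variable {V' E' : Type} [LinearOrder E'] [LinearOrder V'] [Fintype V']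
variable {g : Graph (Fin k) V E} {P : Finset E} {i : E} {w : V} {π : Equiv.Perm (Fin k)}
  {a : E → E'} {b : V → V'} {f : E → Bool} {g' : Graph (Fin k) V' E'}

/-- The set of edges forms a tree whose leaves are labelled. -/
structure IsTree (g : Graph (Fin k) V E) (P : Finset E) : Prop where
  prim : Prim g P
  univ : UnivExt g P
  card : P.card + 1 = k + (verts g P).card

theorem IsTree.cg {u : V} (h : IsTree g P) (he : Ends g i w (.inr u)) (hi : i ∈ P) :
    IsTree (cg g w (.inr u)) (P.erase i) where
  prim := h.prim.cg he hi
  univ := by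
    have key : ∀ p : E × Bool, ∀ s, (p.1 ∈ P.erase i ∧ HairyGraphs.cg g w (.inr u) p.1 p.2 = .inl s) ↔
        p.1 ∈ P ∧ g p.1 p.2 = .inl s := by
      intro p s
      constructor
      · rintro ⟨h1, h2⟩
        refine ⟨Finset.mem_of_mem_erase h1, ?_⟩
        by_cases hw : g p.1 p.2 = .inr w
        · rw [cg_of_eq hw] at h2; cases h2
        · rwa [cg_of_ne hw] at h2
      · rintro ⟨h1, h2⟩
        have hw : g p.1 p.2 ≠ .inr w := by rw [h2]; exact Sum.inl_ne_inr
        refine ⟨Finset.mem_erase.2 ⟨?_, h1⟩, by rw [cg_of_ne hw, h2]⟩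
        rintro rfl
        have := (he.eq_of_ne hw).1
        rw [h2] at this
        cases this
    intro s
    simp only [key]
    exact h.univ s
  card := by
    have h1 := h.card
    rw [verts_cg he hi h.prim.noUniv, Finset.card_erase_of_mem (he.mem_verts hi), Finset.card_erase_of_mem hi]
    have h2 := Finset.card_pos.2 ⟨i, hi⟩
    have h3 := Finset.card_pos.2 ⟨w, he.mem_verts hi⟩
    omega

theorem GMap.isTree (M : GMap π a b f g P g') (h : IsTree g P) : IsTree g' (P.image a) where
  prim := M.prim_iff.2 h.prim
  univ s := by
    obtain ⟨p, ⟨hp, hs⟩, huniq⟩ := h.univ (π.symm s)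
    refine ⟨(a p.1, xor p.2 (f p.1)), ⟨Finset.mem_image_of_mem a hp, ?_⟩, ?_⟩
    · rw [M.map _ hp, Bool.xor_assoc, Bool.xor_self, Bool.xor_false, hs]
      simp
    · rintro ⟨j', c⟩ ⟨hj', hc⟩
      obtain ⟨j, hj, rfl⟩ := Finset.mem_image.1 hj'
      replace hc : g' (a j) c = .inl s := hc
      rw [M.map j hj] at hc
      rcases hz : g j (xor c (f j)) with t | v
      · rw [hz] at hc
        have ht : t = π.symm s := by rw [← Sum.inl_injective hc]; simp
        rw [← huniq (j, xor c (f j)) ⟨hj, by rw [hz, ht]⟩]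
        simp
      · rw [hz] at hc; cases hc
  card := by rw [M.card_edges, M.card_verts, h.card]

theorem IsTree.card_extHalves (h : IsTree g P) : (extHalves g P).card = k := by
  rw [h.univ.card, Fintype.card_fin]

theorem IsTree.exists_perm_model (r : Fin k) (h : IsTree g P) (π : Equiv.Perm (Fin k)) :
    ∃ L a b f, Model r π a b f g P L := by
  have M : GMap π id id (fun _ => false) g P (fun i c => (g i c).map π id) :=
    ⟨Function.injective_id.injOn, Function.injective_id.injOn, fun i _ c => by simp⟩
  have h' := M.isTree h
  obtain ⟨L, a, b, f, hM⟩ := h'.prim.exists_tree_model r h'.univ h'.card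
  refine ⟨L, _, _, _, hM.lf, M.comp hM.map, ?_⟩
  rw [← hM.image, Finset.image_id]
  rfl

theorem IsTree.exists_fin_model (h : IsTree g P) :
    ∃ (G : Graph (Fin k) (Fin (verts g P).card) (Fin P.card)) (π : Equiv.Perm (Fin k))
      (a : Fin _ → E) (b : Fin _ → V), GMap π a b (fun _ => false) G Finset.univ g ∧
        Finset.univ.image a = P ∧ IsPrimitive G := by
  have h1 := h.prim.exists_model
  rw [h.card_extHalves] at h1
  obtain ⟨G, σ, a, b, M, him, hG⟩ := h1
  have hs : Function.Surjective σ := by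
    intro s
    obtain ⟨p, ⟨hp, hps⟩, -⟩ := h.univ s
    rw [← him] at hp
    obtain ⟨j, -, hj⟩ := Finset.mem_image.1 hp
    rw [← hj, M.map j (Finset.mem_univ j)] at hps
    rcases hz : G j (xor p.2 false) with t | v
    · rw [hz] at hps
      exact ⟨t, Sum.inl_injective hps⟩
    · rw [hz] at hps; cases hps
  exact ⟨G, Equiv.ofBijective σ ⟨Finite.injective_iff_surjective.2 hs, hs⟩, a, b, M, him, hG⟩

theorem IsPrimitive.isTree {v e : ℕ} {G : Graph (Fin k) (Fin v) (Fin e)} (hG : IsPrimitive G)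
    (h : e + 1 = k + v) : IsTree G Finset.univ :=
  ⟨hG.prim, hG.univExt, by rw [hG.verts]; simpa using h⟩

theorem IsTree.defect_eq (h : IsTree g P) : defect g P = k - 2 - (verts g P).card := by
  have h1 := h.card
  rw [HairyGraphs.defect, h.card_extHalves]
  omega

/-- A tree that is not trivalent has an internal vertex. -/
theorem IsTree.le_of_defect (h : IsTree g P) (hd : 1 ≤ defect g P) : defect g P + 3 ≤ k := by
  have h1 := h.defect_eq
  have h2 : (verts g P).card ≠ 0 := by
    intro h0
    have h3 := two_mul_card g P
    have h4 := h.card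
    rw [h.card_extHalves, Finset.card_eq_zero.1 h0, Finset.sum_empty] at h3
    omega
  omega

end LabelledTrees

section Averages

theorem zsmul_rat_comm {M : Type*} [AddCommGroup M] [Module ℚ M] (z : ℤ) (c : ℚ) (x : M) :
    z • c • x = c • z • x := smul_comm z c x

variable {R : Type} [Ring R] [Algebra ℚ R] {K : CoeffAlgebra R}
variable {A : Type u} [NonUnitalRing A] [Module ℚ A] {D : DGCommAlgebra A}
variable {V E : Type} [LinearOrder E] [LinearOrder V] [Fintype V] {k : ℕ}
variable {V' E' : Type} [LinearOrder E'] [LinearOrder V'] [Fintype V']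
variable {g : Graph (Fin k) V E} {P : Finset E} {i : E} {w : V} {π ρ : Equiv.Perm (Fin k)}
  {a : E → E'} {b : V → V'} {f : E → Bool} {g' : Graph (Fin k) V' E'} {r : Fin k} {L : Finset (Cl k)}

open scoped Classical in
/-- The value on a labelled tree of a function on laminar families. -/
def tval (n : ℕ) (r : Fin k) (Ψ : Finset (Cl k) → Tens K D (Fin k)) (π : Equiv.Perm (Fin k))
    (g : Graph (Fin k) V E) (P : Finset E) : Tens K D (Fin k) :=
  if h : ∃ (L : _) (a : _) (b : _) (f : _), Model r π a b f g P L then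
    gsign n h.choose_spec.choose h.choose_spec.choose_spec.choose
      h.choose_spec.choose_spec.choose_spec.choose g P • Tens.rename π.symm (Ψ h.choose)
  else 0

theorem tval_eq (n : ℕ) (hk : 3 ≤ k) (Ψ : Finset (Cl k) → Tens K D (Fin k)) {a : E → Cl k} {b : V → Cl k}
    (M : Model r π a b f g P L) : tval n r Ψ π g P = gsign n a b f g P • Tens.rename π.symm (Ψ L) := by
  have h : ∃ (L : _) (a : _) (b : _) (f : _), Model r π a b f g P L := ⟨_, _, _, _, M⟩
  have h1 := h.choose_spec.choose_spec.choose_spec.choose_spec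
  rw [tval, dif_pos h, M.gsign_eq n hk h1, (M.unique hk h1).1]

theorem tval_nat (n : ℕ) (hk : 3 ≤ k) (Ψ : Finset (Cl k) → Tens K D (Fin k)) (M : GMap ρ a b f g P g')
    (hP : IsTree g P) : tval n r Ψ π g' (P.image a) =
      gsign n a b f g P • Tens.rename ρ (tval n r Ψ (π * ρ) g P) := by
  obtain ⟨L, a', b', f', M'⟩ := (M.isTree hP).exists_perm_model r π
  have M'' : Model r (π * ρ : Equiv.Perm (Fin k)) (a' ∘ a) (b' ∘ b) (fun i => xor (f i) (f' (a i))) g P L :=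
    ⟨M'.lf, M.comp M'.map, by rw [← M'.image, Finset.image_image]⟩
  rw [tval_eq n hk Ψ M', tval_eq n hk Ψ M'', gsign_comp n M M'.map, map_zsmul, smul_smul, mul_left_comm,
    gsign_mul_self, mul_one, Tens.rename_rename]
  congr 2
  refine congrArg _ (funext fun s => ?_)
  simp [Equiv.Perm.mul_def]

/-- The average over all labellings. -/
def avg (n : ℕ) (r : Fin k) (Ψ : Finset (Cl k) → Tens K D (Fin k)) (g : Graph (Fin k) V E) (P : Finset E) :
    Tens K D (Fin k) :=
  ((k.factorial : ℚ)⁻¹) • ∑ π : Equiv.Perm (Fin k), tval n r Ψ π g P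

theorem avg_nat (n : ℕ) (hk : 3 ≤ k) (Ψ : Finset (Cl k) → Tens K D (Fin k)) (M : GMap ρ a b f g P g')
    (hP : IsTree g P) : avg n r Ψ g' (P.image a) =
      gsign n a b f g P • Tens.rename ρ (avg n r Ψ g P) := by
  have h1 : ∑ π : Equiv.Perm (Fin k), tval n r Ψ π g' (P.image a) =
      gsign n a b f g P • Tens.rename ρ (∑ π : Equiv.Perm (Fin k), tval n r Ψ π g P) := by
    rw [map_sum, Finset.smul_sum]
    exact (Finset.sum_congr rfl fun π _ => tval_nat n hk Ψ M hP).trans (Equiv.sum_comp (Equiv.mulRight ρ)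
      fun π => gsign n a b f g P • Tens.rename ρ (tval n r Ψ π g P))
  rw [avg, avg, h1, map_smul]
  exact (zsmul_rat_comm _ _ _).symm

theorem tval_mem (n : ℕ) (hk : 3 ≤ k) {Ψ : Finset (Cl k) → Tens K D (Fin k)} {μ : ℤ}
    (hΨ : ∀ L, Ψ L ∈ Tens.part K D (Fin k) μ) (hP : IsTree g P) :
    tval n r Ψ π g P ∈ Tens.part K D (Fin k) μ := by
  obtain ⟨L, a, b, f, M⟩ := hP.exists_perm_model r π
  rw [tval_eq n hk Ψ M]
  refine zsmul_mem ?_ _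
  have h := hΨ L
  rw [Tens.part_eq_hd] at h ⊢
  have h1 := Tens.rename_mem_hd π.symm h
  rwa [Set.image_univ, π.symm.surjective.range_eq] at h1

theorem avg_mem (n : ℕ) (hk : 3 ≤ k) {Ψ : Finset (Cl k) → Tens K D (Fin k)} {μ : ℤ}
    (hΨ : ∀ L, Ψ L ∈ Tens.part K D (Fin k) μ) (hP : IsTree g P) :
    avg n r Ψ g P ∈ Tens.part K D (Fin k) μ :=
  Submodule.smul_mem _ _ (sum_mem fun _ _ => tval_mem n hk hΨ hP)

theorem tval_swap (n : ℕ) (hk : 3 ≤ k) (Ψ : Finset (Cl k) → Tens K D (Fin k)) (hP : IsTree g P) {u : V}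
    (he : Ends g i w (.inr u)) (hi : i ∈ P) :
    conSign n g P i u • tval n r Ψ π (cg g u (.inr w)) (P.erase i) =
      conSign n g P i w • tval n r Ψ π (cg g w (.inr u)) (P.erase i) := by
  have hne : u ≠ w := by
    rintro rfl
    exact he.1 rfl
  have h1 := tval_nat (r := r) (π := π) (ρ := 1) n hk Ψ (swapMap g P i hne) (hP.cg he hi)
  rw [Finset.image_id, mul_one] at h1
  rw [h1, Equiv.Perm.coe_one, Tens.rename_id, smul_smul, conSign_swap n he hi hP.prim.noUniv]

/-- The splitting differential of a function on laminar families is the simplicial coboundary. -/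
theorem sum_tval (n : ℕ) (hk : 3 ≤ k) (Ψ : Finset (Cl k) → Tens K D (Fin k)) (hP : IsTree g P)
    {a : E → Cl k} {b : V → Cl k} (M : Model r π a b f g P L) (T : E → Tens K D (Fin k))
    (hT : ∀ i ∈ P, ∀ w u, Ends g i w (.inr u) → T i = conSign n g P i w • tval n r Ψ π (cg g w (.inr u)) (P.erase i))
    (hT0 : ∀ i ∈ P, (¬ ∃ w u, Ends g i w (.inr u)) → T i = 0) :
    ∑ i ∈ P, T i = - gsign n a b f g P • Tens.rename π.symm (cob Ψ L) := by
  classical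
  have h1 : ∀ i ∈ P, a i ∈ L →
      T i = - gsign n a b f g P • Tens.rename π.symm (eps (a i) L • Ψ (L.erase (a i))) := by
    intro i hi hiL
    have h2 : ∃ w u, Ends g i w (.inr u) ∧ b w = a i := by
      obtain ⟨w, u, he⟩ := (M.map.ends_inr_iff hi).1 ⟨_, _, M.lf.ends hk hiL⟩
      rcases (M.lf.ends hk hiL).eq_or (M.map.ends hi he) with ⟨h3, -⟩ | ⟨-, h3⟩
      · exact ⟨w, u, he, h3.symm⟩
      · refine ⟨u, w, he.swap, Sum.inr_injective h3⟩
    obtain ⟨w, u, he, hw⟩ := h2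
    have he' := M.map.ends hi he
    have hcon := M.map.conSign_mul n hi he hP.prim.noUniv
    have hM' := M.map.cg hi he
    rw [hw] at he' hcon hM'
    have hu : (Sum.inr u : Fin k ⊕ V).map π b = .inr (par r L (a i)) := by
      rcases (M.lf.ends hk hiL).eq_or he' with ⟨-, h3⟩ | ⟨h3, -⟩
      · exact h3.symm
      · exact absurd (Sum.inr_injective h3).symm
          (fun h => (M.lf.par_mem hk (M.mem hi) (M.lf.ne_top hiL)).2.ne (by rw [← h]))
    rw [hu] at hM'
    have hM'' : Model r π a b f (cg g w (.inr u)) (P.erase i) (L.erase (a i)) := by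
      refine ⟨M.lf.erase _, ⟨hM'.injE, hM'.injV, fun j hj c => ?_⟩, ?_⟩
      · rw [← hM'.map j hj, M.lf.cg_clGraph hk hiL]
        rw [M.lf.clEdges_erase hiL, Finset.mem_erase]
        rw [Finset.mem_erase] at hj
        exact ⟨fun h => hj.1 (M.map.injE hj.2 hi h), M.mem hj.2⟩
      · rw [← M.map.image_erase hi, M.image, M.lf.clEdges_erase hiL]
    rw [hT i hi w u he, tval_eq n hk Ψ hM'', smul_smul, map_zsmul, smul_smul]
    congr 1
    rw [M.image, M.lf.conSign n hk hiL] at hcon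
    have e1 := gsign_mul_self n a b f (cg g w (.inr u)) (P.erase i)
    have e2 := gsign_mul_self n a b f g P
    set x := gsign n a b f (cg g w (.inr u)) (P.erase i)
    set y := gsign n a b f g P
    set c := HairyGraphs.conSign n g P i w
    set e := eps (a i) L
    linear_combination (-(x * y)) * hcon - e * y * e1 - c * x * e2
  have h2 : ∀ i ∈ P, a i ∉ L → T i = 0 := by
    intro i hi hiL
    refine hT0 i hi fun hex => hiL ?_
    obtain ⟨v, v', he⟩ := (M.map.ends_inr_iff hi).2 hex
    exact mem_of_ends (M.mem hi) he
  have h3 : L = (P.filter fun i => a i ∈ L).image a := by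
    ext c
    simp only [Finset.mem_image, Finset.mem_filter]
    constructor
    · intro hc
      have h4 : c ∈ P.image a := by
        rw [M.image]
        exact mem_clEdges.2 (.inl (Finset.mem_insert_of_mem hc))
      obtain ⟨i, hi, rfl⟩ := Finset.mem_image.1 h4
      exact ⟨i, ⟨hi, hc⟩, rfl⟩
    · rintro ⟨i, ⟨-, hi⟩, rfl⟩
      exact hi
  rw [cob, map_sum, Finset.smul_sum]
  conv_rhs => rw [h3]
  rw [Finset.sum_image fun i hi j hj h => M.map.injE (Finset.mem_filter.1 hi).1 (Finset.mem_filter.1 hj).1 h,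
    ← h3, Finset.sum_filter]
  refine Finset.sum_congr rfl fun i hi => ?_
  split_ifs with h4
  · exact h1 i hi h4
  · exact h2 i hi h4

end Averages

section Exactness

variable {R : Type} [Ring R] [Algebra ℚ R] {K : CoeffAlgebra R}
variable {A : Type u} [NonUnitalRing A] [Module ℚ A] {D : DGCommAlgebra A}

theorem splitA_clGraph {n : ℕ} {m : ℤ} {y : Series K D} (hy : y ∈ HGC K D n m) {k : ℕ} (hk : 3 ≤ k) {r : Fin k}
    {L : Finset (Cl k)} (hL : LF r L) : splitA n y (clGraph r L) (clEdges r L) =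
      - cob (fun L => atom y (clGraph r L) (clEdges r L)) L := by
  have hsub : L ⊆ clEdges r L := fun c hc => mem_clEdges.2 (.inl (Finset.mem_insert_of_mem hc))
  have hP := hL.prim hk
  rw [splitA, cob, ← Finset.sum_neg_distrib, ← Finset.sum_subset hsub]
  · refine Finset.sum_congr rfl fun c hc => ?_
    rw [sterm_eq hy (hL.ends hk hc) (hsub hc) hP.noUniv, sval, hL.conSign n hk hc, neg_smul,
      hL.clEdges_erase hc]
    congr 2
    refine (atom_of_eqOn hy fun j hj b => ?_).symm
    rw [← hL.clEdges_erase hc] at hj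
    exact (hL.cg_clGraph hk hc hj b).symm
  · intro c hc hcL
    exact sterm_of_not fun ⟨v, w, he⟩ => hcL (mem_of_ends hc he)

theorem Prim.splitA_eq_zero {S V E : Type} [LinearOrder E] [LinearOrder V] [Fintype V] {g : Graph S V E}
    {P : Finset E} {n : ℕ} {m : ℤ} {y : Series K D} (hy : y ∈ HGC K D n m) (hP : Prim g P)
    (h : ∀ G : Graph (Fin (extHalves g P).card) (Fin (verts g P).card) (Fin P.card), IsPrimitive G →
      splitting n _ _ _ G y = 0) : splitA n y g P = 0 := by
  obtain ⟨G, σ, a, b, M, him, hG⟩ := hP.exists_model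
  have h1 := splitA_nat hy M hG.noUniv
  rwa [him, ← splitting_eq hy hG, h G hG, map_zero, smul_zero] at h1

/-- The degree of the decorations of a tree in terms of the number of labels and the defect. -/
def treeDeg (n : ℕ) (m : ℤ) (d k : ℕ) : ℤ := ((n : ℤ) - 1) * (2 * k - 3 - d) - n * (k - 2 - d) - m

/-- Cocycles on laminar families which are not full are coboundaries. -/
theorem exists_cluster_cochain {n : ℕ} {m : ℤ} {d : ℕ} (hd : 1 ≤ d) {φ : Series K D} (hφ : φ ∈ HGC K D n m)
    (h0 : ∀ (k v e : ℕ) (G : Graph (Fin k) (Fin v) (Fin e)), IsPrimitive G → e + 1 = k + v →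
      dfct k v e = d - 1 → splitting n k v e G φ = 0) {k : ℕ} (hk : d + 3 ≤ k) (r : Fin k) :
    ∃ Ψ : Finset (Cl k) → Tens K D (Fin k), (∀ L, Ψ L ∈ Tens.part K D (Fin k) (treeDeg n m d k)) ∧
      ∀ L, LF r L → L.card = k - 3 - d → - cob Ψ L = atom φ (clGraph r L) (clEdges r L) := by
  classical
  have hk3 : 3 ≤ k := by omega
  have hmem : ∀ L, LF r L → L.card = k - 3 - d →
      atom φ (clGraph r L) (clEdges r L) ∈ Tens.part K D (Fin k) (treeDeg n m d k) := by
    intro L hL hc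
    have h1 := atom_mem hφ (clGraph r L) (clEdges r L)
    have h2 : exts (clGraph r L) (clEdges r L) = Set.univ := by
      ext s
      obtain ⟨p, ⟨hp, hs⟩, -⟩ := hL.univExt hk3 s
      simp only [Set.mem_univ, iff_true]
      exact ⟨p.1, hp, p.2, hs⟩
    have h3 : graphDeg n (clGraph r L) (clEdges r L) - m = treeDeg n m d k := by
      have h4 : (L.card : ℤ) = k - 3 - d := by omega
      rw [graphDeg, hL.card_verts hk3, hL.card_edges hk3, treeDeg]
      push_cast
      rw [h4]
      ring
    rwa [h2, h3, ← Tens.part_eq_hd] at h1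
  have : IsAddTorsionFree (Tens.part K D (Fin k) (treeDeg n m d k)) := .of_module_rat _
  let φ' : Finset (Cl k) → Tens.part K D (Fin k) (treeDeg n m d k) := fun L =>
    if h : LF r L ∧ L.card = k - 3 - d then ⟨_, hmem L h.1 h.2⟩ else 0
  have hcob : ∀ (Ψ : Finset (Cl k) → Tens.part K D (Fin k) (treeDeg n m d k)) L,
      ((cob Ψ L : Tens.part K D (Fin k) (treeDeg n m d k)) : Tens K D (Fin k)) = cob (fun L => (Ψ L : Tens K D (Fin k))) L := by
    intro Ψ L
    simp [cob]
  obtain ⟨Ψ, hΨ⟩ := exists_cob (k - 3 - d) _ (isPart_singletons r) (by rw [card_singletons]; omega) φ' (by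
    intro L hL' hc
    have hL : LF r L := hL'
    refine Subtype.ext ?_
    rw [hcob, ZeroMemClass.coe_zero]
    have h1 : splitA n φ (clGraph r L) (clEdges r L) = 0 := by
      refine (hL.prim hk3).splitA_eq_zero hφ fun G hG => h0 _ _ _ G hG ?_ ?_
      · rw [(hL.univExt hk3).card, Fintype.card_fin, hL.card_verts hk3, hL.card_edges hk3]
        omega
      · rw [dfct, (hL.univExt hk3).card, Fintype.card_fin, hL.card_verts hk3, hL.card_edges hk3]
        omega
    rw [splitA_clGraph hφ hk3 hL, neg_eq_zero] at h1
    rw [← h1]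
    refine Finset.sum_congr rfl fun c hc' => ?_
    have h2 : LF r (L.erase c) ∧ (L.erase c).card = k - 3 - d :=
      ⟨hL.erase c, by rw [Finset.card_erase_of_mem hc', hc]; rfl⟩
    simp only [φ', dif_pos h2])
  refine ⟨fun L => - (Ψ L : Tens K D (Fin k)), fun L => neg_mem (Ψ L).2, fun L hL hc => ?_⟩
  have h1 := congrArg Subtype.val (hΨ L hL hc)
  rw [hcob] at h1
  simp only [φ', dif_pos (And.intro hL hc)] at h1
  rw [← h1]
  simp [cob]

/-- The splitting differential is exact on trees that are not unitrivalent. -/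
theorem exists_splitting_eq {n : ℕ} {m : ℤ} {d : ℕ} (hd : 1 ≤ d) {φ : Series K D} (hφ : φ ∈ HGC K D n m)
    (h0 : ∀ (k v e : ℕ) (G : Graph (Fin k) (Fin v) (Fin e)), IsPrimitive G → e + 1 = k + v →
      dfct k v e = d - 1 → splitting n k v e G φ = 0) :
    ∃ ψ ∈ HGC K D n (m + 1),
      (∀ (k v e : ℕ) (G : Graph (Fin k) (Fin v) (Fin e)), dfct k v e ≠ d + 1 → ψ k v e G = 0) ∧
      (∀ (k v e : ℕ) (G : Graph (Fin k) (Fin v) (Fin e)), e + 1 ≠ k + v → ψ k v e G = 0) ∧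
      ∀ (k v e : ℕ) (G : Graph (Fin k) (Fin v) (Fin e)), IsPrimitive G → e + 1 = k + v → dfct k v e = d →
        splitting n k v e G ψ = φ k v e G := by
  classical
  choose Ψ hΨ1 hΨ2 using fun (k : ℕ) (hk : d + 3 ≤ k) =>
    exists_cluster_cochain hd hφ h0 hk ⟨0, by omega⟩
  set F : ∀ k v e : ℕ, Graph (Fin k) (Fin v) (Fin e) → Tens K D (Fin k) := fun k v e G =>
    if h : d + 3 ≤ k ∧ e + 1 = k + v ∧ dfct k v e = d + 1 then
      avg n ⟨0, by omega⟩ (Ψ k h.1) G Finset.univ else 0 with hF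
  have hψ : seriesOf F ∈ HGC K D n (m + 1) := by
    refine seriesOf_mem ?_ ?_
    · intro k v e G hG
      simp only [hF]
      split_ifs with h
      · have h1 := avg_mem (r := ⟨0, by omega⟩) n (by omega) (hΨ1 k h.1) (hG.isTree h.2.1)
        have h2 : ((n : ℤ) - 1) * e - n * v - (m + 1) = treeDeg n m d k := by
          have h3 := h.2.2
          rw [dfct] at h3
          have h4 : (v : ℤ) = k - 3 - d := by omega
          have h5 : (e : ℤ) = 2 * k - 4 - d := by omega
          rw [h4, h5, treeDeg]
          ring
        rwa [h2]
      · exact zero_mem _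
    · intro k v e G π τ σ f hG
      simp only [hF]
      split_ifs with h
      · have h1 := avg_nat (r := ⟨0, by omega⟩) n (by omega) (Ψ k h.1) (relabelMap G π τ σ f) (hG.isTree h.2.1)
        rwa [image_univ_perm, gsign_relabel n hG.verts] at h1
      · rw [map_zero, smul_zero]
  refine ⟨seriesOf F, hψ, ?_, ?_, ?_⟩
  · intro k v e G h
    unfold seriesOf
    split_ifs
    · exact dif_neg fun h' => h h'.2.2
    · rfl
  · intro k v e G h
    unfold seriesOf
    split_ifs
    · exact dif_neg fun h' => h h'.2.1
    · rfl
  · intro k v e G hG hc hdf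
    have hT := hG.isTree hc
    have hdef := hG.defect_eq
    rw [hdf] at hdef
    have hk : d + 3 ≤ k := by
      have := hT.le_of_defect (by omega)
      omega
    have hk3 : 3 ≤ k := by omega
    set r : Fin k := ⟨0, by omega⟩ with hr
    have hatom : ∀ (g : Graph (Fin k) (Fin v) (Fin e)) (P : Finset (Fin e)), IsTree g P → defect g P = d + 1 →
        atom (seriesOf F) g P = avg n r (Ψ k hk) g P := by
      intro g P hT hd
      obtain ⟨G, π, a, b, M, him, hG⟩ := hT.exists_fin_model
      have h1 := atom_nat hψ M
      have h2 : seriesOf F _ _ _ G = avg n r (Ψ k hk) G Finset.univ := by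
        rw [seriesOf, if_pos hG]
        refine dif_pos ⟨hk, hT.card, ?_⟩
        rw [defect, hT.card_extHalves] at hd
        rw [dfct, hd]
      rw [him, atom_fin hψ hG, h2, ← avg_nat n hk3 (Ψ k hk) M (hG.isTree hT.card), him] at h1
      exact h1
    let T : Equiv.Perm (Fin k) → Fin e → Tens K D (Fin k) := fun π i =>
      if h : ∃ w u, Ends G i w (.inr u) then conSign n G Finset.univ i h.choose •
        tval n r (Ψ k hk) π (cg G h.choose (.inr h.choose_spec.choose)) (Finset.univ.erase i) else 0
    have hT0 : ∀ π i, (¬ ∃ w u, Ends G i w (.inr u)) → T π i = 0 := fun π i h => dif_neg h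
    have hT1 : ∀ π i w u, Ends G i w (.inr u) →
        T π i = conSign n G Finset.univ i w • tval n r (Ψ k hk) π (cg G w (.inr u)) (Finset.univ.erase i) := by
      intro π i w u he
      have h : ∃ w u, Ends G i w (.inr u) := ⟨w, u, he⟩
      have key : ∀ w' u', Ends G i w' (.inr u') →
          conSign n G Finset.univ i w' • tval n r (Ψ k hk) π (cg G w' (.inr u')) (Finset.univ.erase i) =
          conSign n G Finset.univ i w • tval n r (Ψ k hk) π (cg G w (.inr u)) (Finset.univ.erase i) := by
        intro w' u' he'
        rcases he.eq_or he' with ⟨h1, h2⟩ | ⟨h1, h2⟩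
        · rw [h1, h2]
        · rw [h2, ← Sum.inr_injective h1]
          exact tval_swap n hk3 (Ψ k hk) hT he (Finset.mem_univ i)
      simp only [T, dif_pos h]
      exact key _ _ h.choose_spec.choose_spec
    have hsum : ∀ π, ∑ i, T π i = φ k v e G := by
      intro π
      obtain ⟨L, a, b, f, M⟩ := hT.exists_perm_model r π
      have hL : L.card = k - 3 - d := by
        have h1 := M.lf.defect hk3
        rw [← M.image, M.map.defect_eq, hdef] at h1
        omega
      rw [sum_tval n hk3 (Ψ k hk) hT M (T π) (fun i _ => hT1 π i) (fun i _ => hT0 π i), neg_smul, ← smul_neg,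
        ← map_neg, hΨ2 k hk L M.lf hL, ← M.image, atom_nat hφ M.map, map_zsmul, smul_smul, gsign_mul_self,
        one_smul, Tens.rename_rename, Equiv.symm_comp_self, Tens.rename_id, atom_fin hφ hG]
    have hst : ∀ i, sterm n (seriesOf F) G Finset.univ i = ((k.factorial : ℚ)⁻¹) • ∑ π, T π i := by
      intro i
      by_cases hex : ∃ w u, Ends G i w (.inr u)
      · obtain ⟨w, u, he⟩ := hex
        have h1 := defect_cg_inr he (Finset.mem_univ i) hG.noUniv
        rw [sterm_eq hψ he (Finset.mem_univ i) hG.noUniv, sval,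
          hatom _ _ (hT.cg he (Finset.mem_univ i)) (by rw [h1, hdef]), avg, zsmul_rat_comm, Finset.smul_sum]
        congr 1
        exact Finset.sum_congr rfl fun π _ => (hT1 π i w u he).symm
      · rw [sterm_of_not hex, Finset.sum_eq_zero fun π _ => hT0 π i hex, smul_zero]
    rw [splitting_eq hψ hG, splitA, Finset.sum_congr rfl fun i _ => hst i, ← Finset.smul_sum,
      Finset.sum_comm, Finset.sum_congr rfl fun π _ => hsum π, Finset.sum_const, Finset.card_univ,
      Fintype.card_perm, Fintype.card_fin, ← Nat.cast_smul_eq_nsmul ℚ, smul_smul, inv_mul_cancel₀, one_smul]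
    exact Nat.cast_ne_zero.2 (Nat.factorial_ne_zero k)

end Exactness

section Truncation

variable {R : Type} [Ring R] [Algebra ℚ R] {K : CoeffAlgebra R}
variable {A : Type u} [NonUnitalRing A] [Module ℚ A] {D : DGCommAlgebra A}
variable {n : ℕ} {m : ℤ}

open scoped Classical in
/-- The restriction of a series to graphs with certain numbers of vertices and edges. -/
def cut (p : ℕ → ℕ → ℕ → Prop) (y : Series K D) : Series K D := fun k v e G => if p k v e then y k v e G else 0

theorem cut_of {p : ℕ → ℕ → ℕ → Prop} (y : Series K D) {k v e : ℕ} {G : Graph (Fin k) (Fin v) (Fin e)}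
    (h : p k v e) : cut p y k v e G = y k v e G := if_pos h

theorem cut_of_not {p : ℕ → ℕ → ℕ → Prop} (y : Series K D) {k v e : ℕ} {G : Graph (Fin k) (Fin v) (Fin e)}
    (h : ¬ p k v e) : cut p y k v e G = 0 := if_neg h

theorem cut_mem (p : ℕ → ℕ → ℕ → Prop) {y : Series K D} (hy : y ∈ HGC K D n m) : cut p y ∈ HGC K D n m := by
  intro k v e G
  by_cases h : p k v e
  · refine ⟨by rw [cut_of y h]; exact (hy k v e G).1, fun h' => by rw [cut_of y h, (hy k v e G).2.1 h'],
      fun π τ σ f => by rw [cut_of y h, cut_of y h, (hy k v e G).2.2]⟩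
  · refine ⟨by rw [cut_of_not y h]; exact zero_mem _, fun h' => cut_of_not y h,
      fun π τ σ f => by rw [cut_of_not y h, cut_of_not y h, map_zero, smul_zero]⟩

/-- Vertex splitting only depends on the values on graphs of the next higher defect. -/
theorem splitting_congr {y y' : Series K D} (hy : y ∈ HGC K D n m) (hy' : y' ∈ HGC K D n m) {k v e : ℕ}
    {G : Graph (Fin k) (Fin v) (Fin e)} (hG : IsPrimitive G)
    (h : ∀ (k' v' e' : ℕ) (G' : Graph (Fin k') (Fin v') (Fin e')), IsPrimitive G' →
      dfct k' v' e' = dfct k v e + 1 → y k' v' e' G' = y' k' v' e' G') :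
    splitting n k v e G y = splitting n k v e G y' := by
  rw [splitting_eq hy hG, splitting_eq hy' hG, splitA, splitA]
  refine Finset.sum_congr rfl fun i hi => ?_
  by_cases hex : ∃ w u, Ends G i w (.inr u)
  · obtain ⟨w, u, he⟩ := hex
    rw [sterm_eq hy he hi hG.noUniv, sterm_eq hy' he hi hG.noUniv, sval, sval,
      (hG.prim.cg he hi).atom_congr hy hy' fun k' v' e' G' hG' hd => h k' v' e' G' hG' ?_]
    rw [hd, defect_cg_inr he hi hG.noUniv, hG.defect_eq]
  · rw [sterm_of_not hex, sterm_of_not hex]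

theorem splitting_eq_zero {y : Series K D} (hy : y ∈ HGC K D n m) {k v e : ℕ}
    {G : Graph (Fin k) (Fin v) (Fin e)} (hG : IsPrimitive G)
    (h : ∀ (k' v' e' : ℕ) (G' : Graph (Fin k') (Fin v') (Fin e')), IsPrimitive G' →
      dfct k' v' e' = dfct k v e + 1 → y k' v' e' G' = 0) :
    splitting n k v e G y = 0 := by
  rw [splitting_congr hy (zero_mem _) hG h, map_zero]

/-- The vertex splitting differential as a map of series. -/
def split (n : ℕ) (y : Series K D) : Series K D := seriesOf fun k v e G => splitting n k v e G y

theorem split_apply (y : Series K D) {k v e : ℕ} {G : Graph (Fin k) (Fin v) (Fin e)} (hG : IsPrimitive G) :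
    split n y k v e G = splitting n k v e G y := if_pos hG

theorem split_mem {y : Series K D} (hy : y ∈ HGC K D n (m + 1)) : split n y ∈ HGC K D n m := by
  refine seriesOf_mem ?_ ?_
  · intro k v e G hG
    rw [splitting_eq hy hG, Tens.part_eq_hd, ← exts_univ hG.univExt, splitA]
    refine sum_mem fun i hi => ?_
    by_cases hex : ∃ w u, Ends G i w (.inr u)
    · obtain ⟨w, u, he⟩ := hex
      rw [sterm_eq hy he hi hG.noUniv, sval]
      refine zsmul_mem ?_ _
      have h1 := atom_mem hy (cg G w (.inr u)) (Finset.univ.erase i)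
      rw [graphDeg_cg n he hi hG.noUniv, graphDeg_univ n hG.verts] at h1
      refine Tens.hd_mono (exts_cg he hi hG.noUniv) ?_
      rwa [add_sub_add_right_eq_sub] at h1
    · rw [sterm_of_not hex]
      exact zero_mem _
  · intro k v e G π τ σ f hG
    rw [splitting_eq hy hG, splitting_eq hy ((isPrimitive_relabel ..).2 hG)]
    have := splitA_nat hy (relabelMap G π τ σ f) hG.noUniv
    rwa [image_univ_perm, gsign_relabel n hG.verts] at this

/-- The change of the curvature if one adds a series. -/
theorem curvature_add {x w : Series K D} (hx : x ∈ HGC K D n 0) (hw : w ∈ HGC K D n 0) {k v e : ℕ}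
    {G : Graph (Fin k) (Fin v) (Fin e)} (hG : IsPrimitive G)
    (h : ∀ (k' v' e' : ℕ) (G' : Graph (Fin k') (Fin v') (Fin e')), IsPrimitive G' →
      dfct k' v' e' ≤ dfct k v e → w k' v' e' G' = 0) :
    curvature n (x + w) k v e G = curvature n x k v e G - splitting n k v e G w := by
  have h1 := hG.prim.curvA_sub (add_mem hx hw) hx fun k' v' e' G' hG' hd => by
    rw [hG.defect_eq] at hd
    show x k' v' e' G' + w k' v' e' G' = x k' v' e' G'
    rw [h k' v' e' G' hG' hd, add_zero]
  rw [add_sub_cancel_left, ← curvature_eq hx hG, ← curvature_eq (add_mem hx hw) hG, ← splitting_eq hw hG] at h1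
  rw [sub_eq_iff_eq_add.1 h1, neg_add_eq_sub]

/-- The curvature vanishes if one contracts a hair of a graph. -/
theorem curvA_hair_eq_zero {x : Series K D} (hx : x ∈ HGC K D n 0) {S V E : Type} [LinearOrder E] [LinearOrder V]
    [Fintype V] {g : Graph S V E} {P : Finset E} (hP : Prim g P)
    (h : ∀ (k' v' e' : ℕ) (G' : Graph (Fin k') (Fin v') (Fin e')), IsPrimitive G' →
      dfct k' v' e' ≤ defect g P → curvature n x k' v' e' G' = 0) {i : E} (hi : i ∈ P) {w : V} {s : S}
    (he : Ends g i w (.inl s)) : curvA n x (cg g w (.inl s)) (P.erase i) = 0 := by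
  refine curvA_eq_zero_of_comps hx (hP.noUniv.cg he hi) fun c hc => ?_
  obtain ⟨h1, h2⟩ := hP.comps_cg he hi hc
  obtain ⟨G, σ, ε, hG, -, h3⟩ := h1.atom_model (K := K) (D := D) (n := n)
  rw [h3 x hx, h _ _ _ G hG, map_zero, smul_zero]
  exact le_trans (le_of_eq rfl) h2

/-- The leading term of the curvature is a cocycle. -/
theorem splitting_curv {x : Series K D} (hx : x ∈ HGC K D n 0) {k v e : ℕ}
    {G : Graph (Fin k) (Fin v) (Fin e)} (hG : IsPrimitive G)
    (h : ∀ (k' v' e' : ℕ) (G' : Graph (Fin k') (Fin v') (Fin e')), IsPrimitive G' →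
      dfct k' v' e' ≤ dfct k v e → curvature n x k' v' e' G' = 0) :
    splitting n k v e G (curv n x) = 0 := by
  have h1 := hG.prim.d_curvA hx ⊥ fun i hi w s he => by
    rw [Submodule.mem_bot]
    refine curvA_hair_eq_zero hx hG.prim (fun k' v' e' G' hG' hd => h k' v' e' G' hG' ?_) hi he
    rwa [hG.defect_eq] at hd
  rwa [← curvature_eq hx hG, h k v e G hG le_rfl, map_zero, zero_add, Submodule.mem_bot,
    ← splitting_eq (curv_mem hx) hG] at h1

end Truncation

section Degrees

variable {R : Type} [Ring R] [Algebra ℚ R] {K : CoeffAlgebra R}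
variable {A : Type u} [NonUnitalRing A] [Module ℚ A] {D : DGCommAlgebra A}
variable {n : ℕ} {m B : ℤ} {x : Series K D} {k v e : ℕ} {G : Graph (Fin k) (Fin v) (Fin e)}

theorem HGC.eq_zero_of_lt (hK : ∀ i, K.gr i ≠ ⊥ → i ≤ B) (hD : ∀ i, D.gr i ≠ ⊥ → i + 3 ≤ n)
    (hx : x ∈ HGC K D n m) (h : B + k * (n - 3) < ((n : ℤ) - 1) * e - n * v - m) : x k v e G = 0 := by
  have h1 := (hx k v e G).1
  rw [Tens.part_eq_bot hK (N := n - 3) (fun i hi => by have := hD i hi; omega)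
    (by rw [Fintype.card_fin]; exact h)] at h1
  simpa using h1

/-- Elements of low degree vanish on graphs that are not trees. -/
theorem HGC.eq_zero_of_loop (hn : 3 ≤ n) (hK : ∀ i, K.gr i ≠ ⊥ → i ≤ B) (hD : ∀ i, D.gr i ≠ ⊥ → i + 3 ≤ n)
    (hx : x ∈ HGC K D n m) (hm : B + m < 1) (hG : IsPrimitive G) (h : e + 1 ≠ k + v) : x k v e G = 0 := by
  refine HGC.eq_zero_of_lt hK hD hx ?_
  have h1 := hG.card_le
  have h2 := hG.dfct_nonneg
  obtain ⟨⟨s, hs⟩⟩ := hG.nonempty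
  rw [dfct] at h2
  have h3 : (0 : ℤ) ≤ ((n : ℤ) - 3) * (e - v - k) := mul_nonneg (by omega) (by omega)
  have h4 : ((n : ℤ) - 1) * e - n * v - m = (n - 3) * (e - v - k) + k * (n - 3) + k + (2 * e - k - 3 * v) - m := by
    ring
  rw [h4]
  omega

/-- Elements vanish on graphs of high defect. -/
theorem HGC.eq_zero_of_defect (hn : 3 ≤ n) (hK : ∀ i, K.gr i ≠ ⊥ → i ≤ B) (hD : ∀ i, D.gr i ≠ ⊥ → i + 3 ≤ n)
    (hx : x ∈ HGC K D n m) (hG : IsPrimitive G) (h : B + n + m ≤ dfct k v e) : x k v e G = 0 := by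
  refine HGC.eq_zero_of_lt hK hD hx ?_
  have h1 := hG.card_le
  rw [dfct] at h
  have h3 : (0 : ℤ) ≤ ((n : ℤ) - 3) * (e - v - k + 1) := mul_nonneg (by omega) (by omega)
  have h4 : ((n : ℤ) - 1) * e - n * v - m = (n - 3) * (e - v - k + 1) + k * (n - 3) - (n - 3) + k +
      (2 * e - k - 3 * v) - m := by ring
  rw [h4]
  omega

/-- Graphs of defect zero which are trees are unitrivalent. -/
theorem IsPrimitive.isUnitrivalentTree (hG : IsPrimitive G) (hc : e + 1 = k + v) (hd : dfct k v e = 0) :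
    IsUnitrivalentTree G where
  isPrimitive := hG
  int_valence w := by
    rw [valence_eq]
    refine hG.prim.trivalent.card_halves_of_defect (by rw [hG.defect_eq, hd]) w ?_
    rw [hG.verts]
    exact Finset.mem_univ w
  tree := by simpa using hc

theorem IsUnitrivalentTree.card (hG : IsUnitrivalentTree G) : e + 1 = k + v := by simpa using hG.tree

theorem IsUnitrivalentTree.dfct_eq (hG : IsUnitrivalentTree G) : dfct k v e = 0 := by
  have h1 := two_mul_card G Finset.univ
  have h2 : ∀ w ∈ verts G Finset.univ, (halves G Finset.univ w).card = 3 := fun w _ => by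
    rw [← valence_eq, hG.int_valence]
  rw [Finset.sum_congr rfl h2, hG.isPrimitive.univExt.card, hG.isPrimitive.verts] at h1
  simp only [Finset.card_univ, Fintype.card_fin, Finset.sum_const, smul_eq_mul] at h1
  rw [dfct]
  omega

theorem mem_ihx_of_eqOn {y : Series K D} (hy : y ∈ HGC K D n (m + 1))
    (h : ∀ (k v e : ℕ) (G : Graph (Fin k) (Fin v) (Fin e)), IsPrimitive G → e + 1 = k + v → dfct k v e = 0 →
      x k v e G = splitting n k v e G y) : x ∈ ihx K D n m :=
  ⟨y, hy, fun k v e G hG => h k v e G hG.isPrimitive hG.card hG.dfct_eq⟩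

/-- The curvature vanishes on graphs that are not trees. -/
theorem curvature_eq_zero_of_loop (hn : 3 ≤ n) (hK : ∀ i, K.gr i ≠ ⊥ → i ≤ 1) (hD : ∀ i, D.gr i ≠ ⊥ → i + 3 ≤ n)
    (hx : x ∈ HGC K D n 0) (hG : IsPrimitive G) (h : e + 1 ≠ k + v) : curvature n x k v e G = 0 := by
  rw [← curv_apply hG]
  exact HGC.eq_zero_of_loop hn hK hD (curv_mem hx) (by norm_num) hG h

/-- Elements whose curvature vanishes up to some defect can be corrected in higher defects. -/
theorem exists_curvature_eq_zero_succ (hn : 3 ≤ n) (hK : ∀ i, K.gr i ≠ ⊥ → i ≤ 1)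
    (hD : ∀ i, D.gr i ≠ ⊥ → i + 3 ≤ n) {d : ℕ} (hx : x ∈ HGC K D n 0)
    (hC : ∀ (k v e : ℕ) (G : Graph (Fin k) (Fin v) (Fin e)), IsPrimitive G → dfct k v e ≤ d →
      curvature n x k v e G = 0) :
    ∃ x' ∈ HGC K D n 0,
      (∀ (k v e : ℕ) (G : Graph (Fin k) (Fin v) (Fin e)), dfct k v e ≤ d + 1 → x' k v e G = x k v e G) ∧
      ∀ (k v e : ℕ) (G : Graph (Fin k) (Fin v) (Fin e)), IsPrimitive G → dfct k v e ≤ d + 1 →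
        curvature n x' k v e G = 0 := by
  obtain ⟨w, hw, hw1, -, hw3⟩ := exists_splitting_eq (d := d + 1) (by omega) (curv_mem hx)
    (fun k v e G hG hc hd => splitting_curv hx hG fun k' v' e' G' hG' hd' =>
      hC k' v' e' G' hG' (by push_cast at hd; omega))
  rw [show (-1 : ℤ) + 1 = 0 from rfl] at hw
  push_cast at hw1 hw3
  refine ⟨x + w, add_mem hx hw, fun k v e G hd => ?_, fun k v e G hG hd => ?_⟩
  · show x k v e G + w k v e G = x k v e G
    rw [hw1 k v e G (by omega), add_zero]
  · by_cases hc : e + 1 = k + v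
    · rw [curvature_add hx hw hG fun k' v' e' G' hG' h' => hw1 k' v' e' G' (by omega)]
      by_cases hd' : dfct k v e = d + 1
      · rw [hw3 k v e G hG hc hd', curv_apply hG, sub_self]
      · rw [hC k v e G hG (by omega), splitting_eq_zero hw hG fun k' v' e' G' hG' h' =>
          hw1 k' v' e' G' (by omega), sub_zero]
    · exact curvature_eq_zero_of_loop hn hK hD (add_mem hx hw) hG hc

/-- Every Maurer--Cartan element of unitrivalent trees lifts. -/
theorem exists_lift (hn : 3 ≤ n) (hK : ∀ i, K.gr i ≠ ⊥ → i ≤ 1) (hD : ∀ i, D.gr i ≠ ⊥ → i + 3 ≤ n)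
    {z : Series K D} (hz : z ∈ HGC K D n 0) (hC : curvature n z ∈ ihx K D n (-1)) :
    ∃ x ∈ HGC K D n 0, x - z ∈ ihx K D n 0 ∧ ∀ (k v e : ℕ) (G : Graph (Fin k) (Fin v) (Fin e)), IsPrimitive G →
      curvature n x k v e G = 0 := by
  have key : ∀ d : ℕ, ∃ x ∈ HGC K D n 0,
      (∀ (k v e : ℕ) (G : Graph (Fin k) (Fin v) (Fin e)), dfct k v e = 0 → x k v e G = z k v e G) ∧
      ∀ (k v e : ℕ) (G : Graph (Fin k) (Fin v) (Fin e)), IsPrimitive G → dfct k v e ≤ d →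
        curvature n x k v e G = 0 := by
    intro d
    induction d with
    | zero =>
      obtain ⟨y, hy, h⟩ := hC
      rw [show (-1 : ℤ) + 1 = 0 from rfl] at hy
      have hy1 := cut_mem (fun k v e => dfct k v e = 1) hy
      refine ⟨z + cut (fun k v e => dfct k v e = 1) y, add_mem hz hy1, ?_, ?_⟩
      · intro k v e G hd
        show z k v e G + cut (fun k v e => dfct k v e = 1) y k v e G = z k v e G
        rw [cut_of_not y (by rw [hd]; norm_num), add_zero]
      · intro k v e G hG hd
        have hd : dfct k v e = 0 := le_antisymm (by exact_mod_cast hd) hG.dfct_nonneg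
        by_cases hc : e + 1 = k + v
        · rw [curvature_add hz hy1 hG fun k' v' e' G' hG' h' => cut_of_not y (by omega),
            splitting_congr hy1 hy hG fun k' v' e' G' hG' h' => cut_of y (by omega),
            h k v e G (hG.isUnitrivalentTree hc hd), sub_self]
        · exact curvature_eq_zero_of_loop hn hK hD (add_mem hz hy1) hG hc
    | succ d ih =>
      obtain ⟨x, hx, hxz, hC⟩ := ih
      obtain ⟨x', hx', h1, h2⟩ := exists_curvature_eq_zero_succ hn hK hD hx hC
      refine ⟨x', hx', fun k v e G hd => ?_, fun k v e G hG hd => h2 k v e G hG (by exact_mod_cast hd)⟩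
      rw [h1 k v e G (by omega), hxz k v e G hd]
  obtain ⟨x, hx, hxz, hx0⟩ := key n
  refine ⟨x, hx, mem_ihx_of_eqOn (zero_mem _) fun k v e G hG hc hd => ?_, fun k v e G hG => ?_⟩
  · rw [map_zero]
    exact sub_eq_zero.2 (hxz k v e G hd)
  · by_cases hd : dfct k v e ≤ n
    · exact hx0 k v e G hG hd
    · rw [← curv_apply hG]
      exact HGC.eq_zero_of_defect hn hK hD (curv_mem hx) hG (by omega)

end Degrees

section Natural

variable {R R' : Type} [Ring R] [Algebra ℚ R] [Ring R'] [Algebra ℚ R'] {K : CoeffAlgebra R} {K' : CoeffAlgebra R'}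
variable {A : Type u} [NonUnitalRing A] [Module ℚ A] {D : DGCommAlgebra A}

variable (K K' D) in
/-- Linear maps of tensor products of algebras that commute with the maps induced by maps of index sets. -/
structure NatOp where
  toFun : ∀ S : Type, Tens K D S →ₗ[ℚ] Tens K' D S
  nat : ∀ {S T : Type} (f : S → T) (x : Tens K D S), toFun T (Tens.rename f x) = Tens.rename f (toFun S x)

/-- The action of natural operators on series. -/
def NatOp.map (L : NatOp K K' D) : Series K D →ₗ[ℚ] Series K' D where
  toFun x k v e G := L.toFun (Fin k) (x k v e G)
  map_add' x y := by ext; simp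
  map_smul' c x := by ext; simp

theorem NatOp.splitting_map (L : NatOp K K' D) (n : ℕ) {k v e : ℕ} (G : Graph (Fin k) (Fin v) (Fin e))
    (x : Series K D) : splitting n k v e G (L.map x) = L.toFun _ (splitting n k v e G x) := by
  simp only [splitting, LinearMap.sum_apply, map_sum]
  refine Finset.sum_congr rfl fun i _ => ?_
  split
  · split_ifs
    · simp only [LinearMap.smul_apply, map_zsmul]
      simp [evalOn, NatOp.map, L.nat]
    · simp
  · simp

theorem NatOp.map_mem (L : NatOp K K' D) {n : ℕ} {m m' j : ℤ} (hm : m = m' + j)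
    (h : ∀ (k : ℕ) (i : ℤ) (x : Tens K D (Fin k)), x ∈ Tens.part K D (Fin k) i →
      L.toFun _ x ∈ Tens.part K' D (Fin k) (i + j)) {x : Series K D} (hx : x ∈ HGC K D n m) :
    L.map x ∈ HGC K' D n m' := by
  intro k v e G
  refine ⟨?_, fun h' => ?_, fun π τ σ f => ?_⟩
  · have := h k _ _ (hx k v e G).1
    rwa [hm, show ((n : ℤ) - 1) * e - n * v - (m' + j) + j = (n - 1) * e - n * v - m' by ring] at this
  · simp [NatOp.map, (hx k v e G).2.1 h']
  · simp only [NatOp.map, LinearMap.coe_mk, AddHom.coe_mk, (hx k v e G).2.2, map_zsmul, L.nat]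

variable (φ : CoeffHom K K')

theorem extend_map (n : ℕ) (x : Series K D) {S V E : Type} [Fintype V] [LinearOrder V]
    [Fintype E] [LinearOrder E] (G : Graph S V E) :
    extend n (Series.map φ x) G = Tens.baseChange φ (extend n x G) := by
  simp only [extend, map_zsmul, map_list_prod, List.map_map]
  congr 3
  funext c
  simp [evalOn_map, Tens.baseChange_rename]

theorem contractTerm_map (n : ℕ) (x : Series K D) {S V E : Type} [Fintype V] [LinearOrder V]
    [Fintype E] [LinearOrder E] (G : Graph S V E) (i : E) :
    contractTerm n (Series.map φ x) G i = Tens.baseChange φ (contractTerm n x G i) := by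
  simp only [contractTerm]
  split
  · simp
  · simp only [extend_map, map_zsmul]
  · simp only [extend_map, map_zsmul]
  · split_ifs
    · simp only [extend_map, map_zsmul]
    · simp

theorem curvature_map (n : ℕ) (x : Series K D) {k v e : ℕ} (G : Graph (Fin k) (Fin v) (Fin e)) :
    curvature n (Series.map φ x) k v e G = Tens.baseChange φ (curvature n x k v e G) := by
  simp only [curvature, contractTerm_map, map_sub, map_sum, ← Tens.d_baseChange]
  rfl

/-- If a series takes values in subalgebras which are preserved by the maps of index sets, then so does its
extension. -/
theorem contractTerm_mem {N : ∀ S : Type, Subalgebra ℚ (Tens K D S)}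
    (hN : ∀ {S T : Type} (f : S → T) (x : Tens K D S), x ∈ N S → Tens.rename f x ∈ N T) (n : ℕ) {x : Series K D}
    (hx : ∀ k v e G, x k v e G ∈ N (Fin k)) {S V E : Type} [Fintype V] [LinearOrder V]
    [Fintype E] [LinearOrder E] (G : Graph S V E) (i : E) : contractTerm n x G i ∈ N S := by
  have key : ∀ {S V E : Type} [Fintype V] [LinearOrder V] [Fintype E] [LinearOrder E] (G : Graph S V E),
      extend n x G ∈ N S := by
    intro S V E _ _ _ _ G
    refine zsmul_mem (list_prod_mem fun b hb => ?_) _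
    obtain ⟨c, -, rfl⟩ := List.mem_map.1 hb
    exact hN _ _ (hN _ _ (hx ..))
  simp only [contractTerm]
  split
  · exact zero_mem _
  · exact zsmul_mem (key _) _
  · exact zsmul_mem (zsmul_mem (key _) _) _
  · split_ifs
    · exact zsmul_mem (key _) _
    · exact zero_mem _

end Natural

open Polynomial

theorem ratCoeff_gr_of_ne {i : ℤ} (h : i ≠ 0) (r : ratCoeff.gr i) : r = 0 := by
  have h1 := r.2
  simp only [ratCoeff, if_neg h, Submodule.mem_bot] at h1
  exact Subtype.ext h1

/-- The inclusion of the constants. -/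
def constForms : CoeffHom ratCoeff intervalCoeff where
  toAlgHom := Algebra.ofId ℚ Forms
  map_mem := by
    intro i r hr
    by_cases h : i = 0
    · subst h
      exact mem_formsGr.2 (.inl ⟨rfl, by simp [TrivSqZeroExt.algebraMap_eq_inl']⟩)
    · rw [show r = 0 from congrArg Subtype.val (ratCoeff_gr_of_ne h ⟨r, hr⟩)]
      simp
  map_d := by
    intro r
    ext <;> simp [intervalCoeff, ratCoeff, formsD, TrivSqZeroExt.algebraMap_eq_inl']

variable {A : Type u} [NonUnitalRing A] [Module ℚ A] {D : DGCommAlgebra A} {S T : Type}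

namespace Tens

theorem base_rat (r : ℚ) (h : r ∈ ratCoeff.gr 0) :
    base ratCoeff D S 0 ⟨r, h⟩ = algebraMap ℚ _ r := by
  have : (⟨r, h⟩ : ratCoeff.gr 0) = r • ⟨1, ratCoeff.one_mem⟩ := Subtype.ext (by simp)
  rw [this, map_smul, base_one, Algebra.algebraMap_eq_smul_one]

theorem baseChange_evalForms_const (t : ℚ) (x : Tens ratCoeff D S) :
    baseChange (evalForms t) (baseChange constForms x) = x := by
  have : (baseChange (evalForms t)).comp (baseChange constForms) = AlgHom.id ℚ (Tens ratCoeff D S) := by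
    refine hom_ext fun g => ?_
    cases g with
    | base i r =>
      simp only [AlgHom.comp_apply, baseChange_gen, Gen.map, AlgHom.id_apply]
      congr 2
      refine Subtype.ext ?_
      show aeval t (TrivSqZeroExt.fst (algebraMap ℚ Forms r)) = (r : ℚ)
      simp [TrivSqZeroExt.algebraMap_eq_inl']
    | lab s i a => simp [baseChange_gen, Gen.map]
  exact DFunLike.congr_fun this x

theorem inl_mem (p : ℚ[X]) : (TrivSqZeroExt.inl p : Forms) ∈ intervalCoeff.gr 0 :=
  mem_formsGr.2 (.inl ⟨rfl, by simp⟩)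

theorem inr_mem (p : ℚ[X]) : (TrivSqZeroExt.inr p : Forms) ∈ intervalCoeff.gr 1 :=
  mem_formsGr.2 (.inr (.inl ⟨rfl, by simp⟩))

variable (D S) in
/-- Polynomial functions on the interval. -/
def fn (p : ℚ[X]) : Tens intervalCoeff D S := base intervalCoeff D S 0 ⟨TrivSqZeroExt.inl p, inl_mem p⟩

variable (D S) in
/-- Polynomial one-forms on the interval. -/
def form (p : ℚ[X]) : Tens intervalCoeff D S := base intervalCoeff D S 1 ⟨TrivSqZeroExt.inr p, inr_mem p⟩

theorem fn_mem_hd (p : ℚ[X]) : fn D S p ∈ hd intervalCoeff D 0 (∅ : Set S) := base_mem_hd _ _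

theorem form_mem_hd (p : ℚ[X]) : form D S p ∈ hd intervalCoeff D 1 (∅ : Set S) := base_mem_hd _ _

theorem fn_comm (p : ℚ[X]) (x : Tens intervalCoeff D S) : fn D S p * x = x * fn D S p := by
  induction x using induction with
  | hg g =>
    rw [hd_comm (fn_mem_hd p) (gen_mem_hd g)]
    simp
  | h1 c => exact (Algebra.commutes c _).symm
  | hadd x y hx hy => rw [mul_add, add_mul, hx, hy]
  | hmul x y hx hy => rw [← mul_assoc, hx, mul_assoc, hy, mul_assoc]

theorem fn_mul (p q : ℚ[X]) : fn D S (p * q) = fn D S p * fn D S q := by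
  rw [fn, fn, fn, ← base_mul]
  exact base_cast (add_zero 0).symm _ _ (by simp)

theorem fn_one : fn D S 1 = 1 := base_one

theorem fn_pow (p : ℚ[X]) (k : ℕ) : fn D S (p ^ k) = fn D S p ^ k := by
  induction k with
  | zero => rw [pow_zero, pow_zero, fn_one]
  | succ k ih => rw [pow_succ, fn_mul, ih, pow_succ]

theorem d_fn (p : ℚ[X]) : d (fn D S p) = form D S (derivative p) := by
  rw [fn, ← gen_base, d_gen_base, form]
  exact base_cast (zero_add 1) _ _ rfl

theorem rename_fn (f : S → T) (p : ℚ[X]) : rename f (fn D S p) = fn D T p := rename_gen_base ..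

theorem rename_form (f : S → T) (p : ℚ[X]) : rename f (form D S p) = form D T p := rename_gen_base ..

theorem eval_fn (t : ℚ) (p : ℚ[X]) : baseChange (evalForms t) (fn D S p) = algebraMap ℚ _ (p.eval t) := by
  rw [fn, ← gen_base, baseChange_gen, Gen.map, gen_base]
  refine (base_cast rfl _ ⟨p.eval t, by simp [ratCoeff]⟩ ?_).trans (base_rat _ _)
  show aeval t (TrivSqZeroExt.fst (TrivSqZeroExt.inl p : Forms)) = _
  simp [aeval_def, eval₂_eq_eval_map]

theorem eval_form (t : ℚ) (p : ℚ[X]) : baseChange (evalForms t) (form D S p) = 0 := by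
  rw [form, ← gen_base, baseChange_gen, Gen.map, gen_base, ratCoeff_gr_of_ne one_ne_zero (CoeffHom.mapGr _ _ _),
    map_zero]

/-- Polynomials with coefficients in `A_*^{⊗ S}` as forms of degree zero on the interval. -/
def polyFn : (Tens ratCoeff D S)[X] →ₐ[ℚ] Tens intervalCoeff D S :=
  eval₂AlgHom (baseChange constForms) (fn D S X) fun _ => (fn_comm X _).symm

theorem polyFn_monomial (k : ℕ) (a : Tens ratCoeff D S) :
    polyFn (monomial k a) = baseChange constForms a * fn D S (X ^ k) := by
  rw [fn_pow]
  exact eval₂_monomial ..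

theorem polyFn_C (a : Tens ratCoeff D S) : polyFn (C a) = baseChange constForms a := by
  rw [← monomial_zero_left, polyFn_monomial, pow_zero, fn_one, mul_one]

/-- The inclusion of rational polynomials. -/
def ratPoly : ℚ[X] →ₐ[ℚ] (Tens ratCoeff D S)[X] := mapAlgHom (Algebra.ofId ℚ _)

theorem ratPoly_coeff (p : ℚ[X]) (k : ℕ) : (ratPoly p : (Tens ratCoeff D S)[X]).coeff k = algebraMap ℚ _ (p.coeff k) := by
  simp [ratPoly]

theorem ratPoly_C (p : ℚ[X]) (a : Tens ratCoeff D S) : ratPoly p * C a = C a * ratPoly p := by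
  ext k
  rw [coeff_mul_C, coeff_C_mul, ratPoly_coeff, Algebra.commutes]

theorem forms_cases {i : ℤ} (r : intervalCoeff.gr i) :
    (i = 0 ∨ (r : Forms).fst = 0) ∧ (i = 1 ∨ (r : Forms).snd = 0) := by
  rcases mem_formsGr.1 r.2 with ⟨rfl, h⟩ | ⟨rfl, h⟩ | h
  · exact ⟨.inl rfl, .inr h⟩
  · exact ⟨.inr h, .inl rfl⟩
  · simp [h]

/-- The function part of a form. -/
def fnPart (i : ℤ) : intervalCoeff.gr i →ₗ[ℚ] (Tens ratCoeff D S)[X] :=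
  ratPoly.toLinearMap ∘ₗ (TrivSqZeroExt.fstHom ℚ ℚ[X] ℚ[X]).toLinearMap ∘ₗ (intervalCoeff.gr i).subtype

/-- The coefficient of `dt` of a form. -/
def dtPart (i : ℤ) : intervalCoeff.gr i →ₗ[ℚ] (Tens ratCoeff D S)[X] :=
  ratPoly.toLinearMap ∘ₗ ((TrivSqZeroExt.sndHom ℚ[X] ℚ[X]).restrictScalars ℚ) ∘ₗ (intervalCoeff.gr i).subtype

theorem fnPart_apply {i : ℤ} (r : intervalCoeff.gr i) :
    (fnPart i r : (Tens ratCoeff D S)[X]) = ratPoly (r : Forms).fst := rfl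

theorem dtPart_apply {i : ℤ} (r : intervalCoeff.gr i) :
    (dtPart i r : (Tens ratCoeff D S)[X]) = ratPoly (r : Forms).snd := rfl

/-- The algebra map which encodes the coefficient of `dt`. -/
def dtHom : Tens intervalCoeff D S →ₐ[ℚ] Matrix (Fin 2) (Fin 2) (Tens ratCoeff D S)[X] :=
  lift (fun i => triang i (fnPart i) (dtPart i)) (fun s i => triang i (CAlgHom.toLinearMap ∘ₗ lab ratCoeff D s i) 0)
    (by
      ext p q : 1
      fin_cases p <;> fin_cases q <;> simp [triang, fnPart_apply, dtPart_apply])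
    (by
      intro i j r r'
      ext p q : 1
      fin_cases p <;> fin_cases q
      · simp [triang, Matrix.mul_apply, fnPart_apply, smul_smul, sign_mul, mul_comm]
      · rcases (forms_cases r).1 with rfl | h
        · simp [triang, Matrix.mul_apply, fnPart_apply, dtPart_apply, ← map_mul, mul_comm, add_comm]
        · simp [triang, Matrix.mul_apply, fnPart_apply, dtPart_apply, ← map_mul, mul_comm, h]
      · simp [triang, Matrix.mul_apply]
      · simp [triang, Matrix.mul_apply, fnPart_apply])
    (by
      intro s i j r r'
      ext p q : 1
      fin_cases p <;> fin_cases q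
      · simp only [triang, Matrix.mul_apply, LinearMap.coe_mk, AddHom.coe_mk]
        simp [lab_mul, sign_mul, ← smul_mul_smul_comm]
      · simp [triang, Matrix.mul_apply]
      · simp [triang, Matrix.mul_apply]
      · simp [triang, Matrix.mul_apply, lab_mul])
    (by
      intro s i j r a
      refine triang_comm i j _ _ _ _ _ _ ?_ (by simp) ?_
      · rcases (forms_cases r).1 with rfl | h
        · simp [fnPart_apply, ratPoly_C]
        · simp [fnPart_apply, h]
      · rcases (forms_cases r).2 with rfl | h
        · simp [dtPart_apply, ratPoly_C, zpow_mul]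
        · simp [dtPart_apply, h])
    (by
      intro s t i j r a
      refine triang_comm i j _ _ _ _ _ _ ?_ (by simp) (by simp)
      simp [← map_mul, lab_lab s t r a])

theorem dtHom_base (i : ℤ) (r : intervalCoeff.gr i) :
    dtHom (base intervalCoeff D S i r) = triang i (fnPart i) (dtPart i) r := by
  rw [← gen_base]
  simp only [dtHom, lift_gen]

theorem dtHom_lab (s : S) (i : ℤ) (a : D.gr i) :
    dtHom (lab intervalCoeff D s i a) = triang i (CAlgHom.toLinearMap ∘ₗ lab ratCoeff D s i) 0 a := by
  rw [← gen_lab]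
  simp only [dtHom, lift_gen]

theorem dtHom_fn (p : ℚ[X]) : dtHom (fn D S p) = !![ratPoly p, 0; 0, ratPoly p] := by
  rw [fn, dtHom_base]
  simp [triang, fnPart_apply, dtPart_apply]

theorem dtHom_form (p : ℚ[X]) : dtHom (form D S p) = !![0, ratPoly p; 0, 0] := by
  rw [form, dtHom_base]
  simp [triang, fnPart_apply, dtPart_apply]

theorem dtHom_const (x : Tens ratCoeff D S) : dtHom (baseChange constForms x) = !![C (theta x), 0; 0, C x] := by
  have hc : ∀ c : ℚ, dtHom (baseChange constForms (algebraMap ℚ (Tens ratCoeff D S) c)) =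
      !![C (theta (algebraMap ℚ (Tens ratCoeff D S) c)), 0; 0, C (algebraMap ℚ (Tens ratCoeff D S) c)] := by
    intro c
    rw [AlgHom.commutes, AlgHom.commutes, AlgHom.commutes, Matrix.algebraMap_eq_diagonal]
    ext p q : 1
    fin_cases p <;> fin_cases q
    · exact Polynomial.algebraMap_apply c
    · rfl
    · rfl
    · exact Polynomial.algebraMap_apply c
  induction x using induction with
  | hg g =>
    cases g with
    | base i r =>
      by_cases h : i = 0
      · subst h
        obtain ⟨r, hr⟩ := r
        rw [gen_base, base_rat r hr]
        exact hc r
      · rw [ratCoeff_gr_of_ne h r, gen_base]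
        ext p q : 1
        fin_cases p <;> fin_cases q <;> simp
    | lab s i a =>
      rw [baseChange_gen, Gen.map, gen_lab, dtHom_lab, theta_gen]
      ext p q : 1
      fin_cases p <;> fin_cases q <;> simp [triang, Gen.deg, gen_lab, ← smul_C]
  | h1 c => exact hc c
  | hadd x y hx hy =>
    rw [map_add, map_add, hx, hy]
    ext p q : 1
    fin_cases p <;> fin_cases q <;> simp
  | hmul x y hx hy =>
    rw [map_mul, map_mul, hx, hy]
    ext p q : 1
    fin_cases p <;> fin_cases q <;> simp [Matrix.mul_apply]

/-- The coefficient of `dt`. -/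
def dtCoeff : Tens intervalCoeff D S →ₗ[ℚ] (Tens ratCoeff D S)[X] :=
  Matrix.entryLinearMap ℚ _ 0 1 ∘ₗ dtHom.toLinearMap

theorem dtCoeff_apply (x : Tens intervalCoeff D S) : dtCoeff x = dtHom x 0 1 := rfl

theorem dtCoeff_polyFn (f : (Tens ratCoeff D S)[X]) : dtCoeff (polyFn f) = 0 := by
  induction f using Polynomial.induction_on' with
  | add f g hf hg => rw [map_add, map_add, hf, hg, add_zero]
  | monomial k a =>
    rw [polyFn_monomial, dtCoeff_apply, map_mul, dtHom_fn, dtHom_const]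
    simp [Matrix.mul_apply]

theorem dtCoeff_d_polyFn (f : (Tens ratCoeff D S)[X]) : dtCoeff (d (polyFn f)) = derivative f := by
  induction f using Polynomial.induction_on' with
  | add f g hf hg => rw [map_add, map_add, map_add, hf, hg, map_add]
  | monomial k a =>
    rw [polyFn_monomial, d_mul, d_fn, d_baseChange, map_add, theta_baseChange, dtCoeff_apply, dtCoeff_apply,
      map_mul, map_mul, dtHom_fn, dtHom_const, dtHom_const, dtHom_form]
    simp [Matrix.mul_apply, theta_theta]
    have h : (ratPoly (X ^ k) : (Tens ratCoeff D S)[X]) = X ^ k := by simp [ratPoly]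
    have h' : (ratPoly (derivative (X ^ k)) : (Tens ratCoeff D S)[X]) = derivative (X ^ k) := by
      rw [← h, ratPoly]
      exact (derivative_map _ _).symm
    rw [h', ← C_mul_X_pow_eq_monomial, derivative_C_mul]

/-- Integration from zero. -/
def integ : (Tens ratCoeff D S)[X] →ₗ[ℚ] (Tens ratCoeff D S)[X] :=
  Polynomial.lsum fun k => ((k + 1 : ℚ)⁻¹) • (monomial (k + 1)).restrictScalars ℚ

theorem integ_monomial (k : ℕ) (a : Tens ratCoeff D S) :
    integ (monomial k a) = monomial (k + 1) ((k + 1 : ℚ)⁻¹ • a) := by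
  rw [integ, lsum_apply, sum_monomial_index a _ (by exact LinearMap.map_zero _)]
  exact (smul_monomial _ _ _)

theorem integ_derivative (f : (Tens ratCoeff D S)[X]) : integ (derivative f) = f - C (f.coeff 0) := by
  induction f using Polynomial.induction_on' with
  | add f g hf hg =>
    rw [map_add, map_add, hf, hg, coeff_add, C_add]
    abel
  | monomial k a =>
    cases k with
    | zero => simp
    | succ k =>
      rw [derivative_monomial, Nat.add_sub_cancel, integ_monomial, coeff_monomial_of_ne _ (by omega), C_0, sub_zero]
      have h : a * ((k + 1 : ℕ) : Tens ratCoeff D S) = ((k + 1 : ℕ) : ℚ) • a := by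
        rw [Algebra.smul_def, map_natCast]
        exact (Nat.cast_commute _ _).symm
      rw [h, smul_smul, Nat.cast_add, Nat.cast_one, inv_mul_cancel₀ (by positivity), one_smul]

theorem eval_polyFn (f : (Tens ratCoeff D S)[X]) : baseChange (evalForms 0) (polyFn f) = f.coeff 0 := by
  induction f using Polynomial.induction_on' with
  | add f g hf hg => rw [map_add, map_add, hf, hg, coeff_add]
  | monomial k a =>
    rw [polyFn_monomial, map_mul, baseChange_evalForms_const, eval_fn]
    cases k with
    | zero => simp
    | succ k => simp [coeff_monomial]

theorem polyFn_map (f : S → T) (g : (Tens ratCoeff D S)[X]) :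
    polyFn (mapAlgHom (rename f) g) = rename f (polyFn g) := by
  induction g using Polynomial.induction_on' with
  | add f g hf hg => rw [map_add, map_add, map_add, hf, hg, map_add]
  | monomial k a =>
    rw [polyFn_monomial, map_mul, rename_fn, ← baseChange_rename, ← polyFn_monomial]
    congr 1
    exact map_monomial _

theorem integ_map (f : S → T) (g : (Tens ratCoeff D S)[X]) :
    integ (mapAlgHom (rename f) g) = mapAlgHom (rename f) (integ g) := by
  induction g using Polynomial.induction_on' with
  | add f g hf hg => rw [map_add, map_add, hf, hg, map_add, map_add]
  | monomial k a =>
    have h (k : ℕ) (a : Tens ratCoeff D S) : mapAlgHom (rename f) (monomial k a) = monomial k (rename f a) :=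
      map_monomial _
    rw [h, integ_monomial, integ_monomial, h, map_smul (rename f) _ a]

theorem dtCoeff_rename (f : S → T) (x : Tens intervalCoeff D S) :
    dtCoeff (rename f x) = mapAlgHom (rename f) (dtCoeff x) := by
  have h : (mapAlgHom (rename f)).mapMatrix.comp dtHom =
      (dtHom.comp (rename f) : Tens intervalCoeff D S →ₐ[ℚ] Matrix (Fin 2) (Fin 2) (Tens ratCoeff D T)[X]) := by
    have hr (p : ℚ[X]) : mapAlgHom (rename f) (ratPoly p : (Tens ratCoeff D S)[X]) = ratPoly p := by
      ext k
      rw [ratPoly_coeff]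
      refine (coeff_map _ _).trans ?_
      rw [ratPoly_coeff]
      exact (rename f).commutes _
    have hC (a : Tens ratCoeff D S) : mapAlgHom (rename f) (C a) = C (rename f a) := map_C _
    have hl (s : S) (i : ℤ) (a : D.gr i) : rename f (lab ratCoeff D s i a) = lab ratCoeff D (f s) i a := by
      exact rename_gen_lab ..
    generalize (mapAlgHom (rename f) : (Tens ratCoeff D S)[X] →ₐ[ℚ] (Tens ratCoeff D T)[X]) = M at hr hC ⊢
    refine hom_ext fun g => ?_
    cases g with
    | base i r =>
      rw [AlgHom.comp_apply, AlgHom.comp_apply, rename_gen_base, gen_base, gen_base, dtHom_base, dtHom_base]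
      ext p q : 1
      fin_cases p <;> fin_cases q <;> simp [triang, fnPart_apply, dtPart_apply, hr]
    | lab s i a =>
      rw [AlgHom.comp_apply, AlgHom.comp_apply, rename_gen_lab, gen_lab, gen_lab, dtHom_lab, dtHom_lab]
      ext p q : 1
      fin_cases p <;> fin_cases q <;> simp [triang, hC, hl]
  exact congrArg (fun M => M 0 1) (DFunLike.congr_fun h x).symm

/-- The contracting homotopy which integrates forms from zero. -/
def homot : Tens intervalCoeff D S →ₗ[ℚ] Tens intervalCoeff D S := polyFn.toLinearMap ∘ₗ integ ∘ₗ dtCoeff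

theorem homot_rename (f : S → T) (x : Tens intervalCoeff D S) : homot (rename f x) = rename f (homot x) := by
  simp only [homot, LinearMap.comp_apply, AlgHom.toLinearMap_apply, dtCoeff_rename, integ_map, polyFn_map]

theorem homot_of_mem {x : Tens intervalCoeff D S} (hx : x ∈ polyFn.range) : homot x = 0 := by
  obtain ⟨f, rfl⟩ := hx
  simp only [homot, LinearMap.comp_apply]
  erw [dtCoeff_polyFn]
  simp

theorem homot_d_of_mem {x : Tens intervalCoeff D S} (hx : x ∈ polyFn.range) :
    homot (d x) = x - baseChange constForms (baseChange (evalForms 0) x) := by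
  obtain ⟨f, rfl⟩ := hx
  show polyFn (integ (dtCoeff (d (polyFn f)))) = polyFn f - baseChange constForms (baseChange _ (polyFn f))
  rw [dtCoeff_d_polyFn, integ_derivative, map_sub, polyFn_C, eval_polyFn]

/-- The polynomials whose coefficients have degree `m` and are divisible by the labels in `U`. -/
def polyHd (m : ℤ) (U : Set S) (f : (Tens ratCoeff D S)[X]) : Prop := ∀ k, f.coeff k ∈ hd ratCoeff D m U

theorem polyHd_mul {m m' : ℤ} {U U' : Set S} {f g : (Tens ratCoeff D S)[X]} (hf : polyHd m U f) (hg : polyHd m' U' g) :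
    polyHd (m + m') (U ∪ U') (f * g) := by
  intro k
  rw [coeff_mul]
  exact sum_mem fun p _ => hd_mul (hf _) (hg _)

theorem polyHd_ratPoly (p : ℚ[X]) : polyHd 0 (∅ : Set S) (ratPoly p : (Tens ratCoeff D S)[X]) := by
  intro k
  rw [ratPoly_coeff, Algebra.algebraMap_eq_smul_one]
  exact Submodule.smul_mem _ _ one_mem_hd

theorem polyHd_zero (m : ℤ) (U : Set S) : polyHd m U (0 : (Tens ratCoeff D S)[X]) := fun k => by
  rw [coeff_zero]
  exact zero_mem _

theorem polyHd_C {m : ℤ} {U : Set S} {x : Tens ratCoeff D S} (hx : x ∈ hd ratCoeff D m U) : polyHd m U (C x) := by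
  intro k
  rw [coeff_C]
  split_ifs
  · exact hx
  · exact zero_mem _

theorem polyHd_smul (c : ℚ) {m : ℤ} {U : Set S} {f : (Tens ratCoeff D S)[X]} (hf : polyHd m U f) : polyHd m U (c • f) :=
  fun k => by
    rw [coeff_smul]
    exact Submodule.smul_mem _ _ (hf k)

theorem polyHd_dtHom_gen (g : Gen intervalCoeff D S) :
    polyHd (g.deg intervalCoeff D) {s : S | ∃ i a, Gen.lab s i a = g} (dtHom (gen g) 0 0) ∧
    polyHd (g.deg intervalCoeff D) {s : S | ∃ i a, Gen.lab s i a = g} (dtHom (gen g) 1 1) ∧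
    polyHd (g.deg intervalCoeff D - 1) {s : S | ∃ i a, Gen.lab s i a = g} (dtHom (gen g) 0 1) := by
  cases g with
  | base i r =>
    have h0 : {s : S | ∃ j a, (Gen.lab s j a : Gen intervalCoeff D S) = .base i r} = ∅ := by simp
    rw [h0, gen_base, dtHom_base]
    have h1 : polyHd i (∅ : Set S) (fnPart i r : (Tens ratCoeff D S)[X]) := by
      rw [fnPart_apply]
      rcases (forms_cases r).1 with rfl | h
      · exact polyHd_ratPoly _
      · rw [h, map_zero]
        exact polyHd_zero _ _
    refine ⟨polyHd_smul _ h1, h1, ?_⟩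
    show polyHd (i - 1) _ (dtPart i r)
    rw [dtPart_apply]
    rcases (forms_cases r).2 with rfl | h
    · exact polyHd_ratPoly _
    · rw [h, map_zero]
      exact polyHd_zero _ _
  | lab s i a =>
    have h0 : {t : S | ∃ j b, (Gen.lab t j b : Gen intervalCoeff D S) = .lab s i a} ⊆ {s} := by
      rintro t ⟨j, b, h⟩
      cases h
      rfl
    rw [gen_lab, dtHom_lab]
    have h1 : polyHd i {t : S | ∃ j b, (Gen.lab t j b : Gen intervalCoeff D S) = .lab s i a}
        (C (lab ratCoeff D s i a)) := polyHd_C (hd_mono h0 (lab_mem_hd s i a))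
    exact ⟨polyHd_smul _ h1, h1, polyHd_zero _ _⟩

theorem dtHom_one_zero (x : Tens intervalCoeff D S) : dtHom x 1 0 = 0 := by
  induction x using induction with
  | hg g =>
    cases g with
    | base i r => rw [gen_base, dtHom_base]; rfl
    | lab s i a => rw [gen_lab, dtHom_lab]; rfl
  | h1 c =>
    rw [AlgHom.commutes, Matrix.algebraMap_eq_diagonal]
    rfl
  | hadd x y hx hy => rw [map_add, Matrix.add_apply, hx, hy, add_zero]
  | hmul x y hx hy => simp [Matrix.mul_apply, hx, hy]

theorem polyHd_dtHom_word (w : List (Gen intervalCoeff D S)) :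
    polyHd (w.map (Gen.deg intervalCoeff D)).sum {s : S | ∃ i a, Gen.lab s i a ∈ w} (dtHom (w.map gen).prod 0 0) ∧
    polyHd (w.map (Gen.deg intervalCoeff D)).sum {s : S | ∃ i a, Gen.lab s i a ∈ w} (dtHom (w.map gen).prod 1 1) ∧
    polyHd ((w.map (Gen.deg intervalCoeff D)).sum - 1) {s : S | ∃ i a, Gen.lab s i a ∈ w}
      (dtHom (w.map gen).prod 0 1) := by
  induction w with
  | nil =>
    have h1 : polyHd 0 (∅ : Set S) (1 : (Tens ratCoeff D S)[X]) := by
      rw [← C_1]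
      exact polyHd_C one_mem_hd
    simpa using ⟨h1, polyHd_zero _ _⟩
  | cons g w ih =>
    obtain ⟨g1, g2, g3⟩ := polyHd_dtHom_gen g
    obtain ⟨w1, w2, w3⟩ := ih
    have e : {s | ∃ i a, Gen.lab s i a ∈ g :: w} =
        {s | ∃ i a, Gen.lab s i a = g} ∪ {s | ∃ i a, Gen.lab s i a ∈ w} := by
      ext s
      simp only [List.mem_cons, Set.mem_union, Set.mem_ofPred_eq, exists_or]
    simp only [List.map_cons, List.prod_cons, List.sum_cons, map_mul, Matrix.mul_apply, Fin.sum_univ_two, e,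
      dtHom_one_zero, mul_zero, zero_mul, add_zero, zero_add]
    refine ⟨polyHd_mul g1 w1, polyHd_mul g2 w2, fun k => ?_⟩
    rw [coeff_add]
    refine add_mem ?_ ?_
    · have := polyHd_mul g1 w3 k
      rwa [← add_sub_assoc] at this
    · have := polyHd_mul g3 w2 k
      rwa [sub_add_eq_add_sub] at this

theorem homot_mem_part {m : ℤ} {x : Tens intervalCoeff D S} (hx : x ∈ part intervalCoeff D S m) :
    homot x ∈ part intervalCoeff D S (m - 1) := by
  have key : ∀ f : (Tens ratCoeff D S)[X], polyHd (m - 1) Set.univ f → polyFn (integ f) ∈ part intervalCoeff D S (m - 1) := by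
    intro f hf
    rw [← sum_monomial_eq f, Polynomial.sum, map_sum, map_sum]
    refine sum_mem fun k _ => ?_
    have h1 : baseChange constForms (f.coeff k) ∈ part intervalCoeff D S (m - 1) :=
      baseChange_mem_part constForms (by rw [part_eq_hd]; exact hf k)
    rw [integ_monomial, polyFn_monomial, map_smul, smul_mul_assoc]
    rw [part_eq_hd] at h1 ⊢
    have h2 := hd_mul h1 (fn_mem_hd (D := D) (S := S) (X ^ (k + 1)))
    rw [add_zero, Set.union_empty] at h2
    exact Submodule.smul_mem _ _ h2
  refine key _ ?_
  refine Submodule.span_induction (p := fun b _ => polyHd (m - 1) Set.univ (dtCoeff b)) ?_ ?_ ?_ ?_ hx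
  · rintro _ ⟨w, rfl, h2, rfl⟩ k
    exact hd_mono (fun s _ => h2 s) ((polyHd_dtHom_word w).2.2 k)
  · rw [map_zero]
    exact polyHd_zero _ _
  · intro x y _ _ hx hy k
    rw [map_add, coeff_add]
    exact add_mem (hx k) (hy k)
  · intro c x _ hx
    rw [map_smul]
    exact polyHd_smul c hx

end Tens

variable (D) in
/-- The contracting homotopy as a natural operator. -/
def homotOp : NatOp intervalCoeff intervalCoeff D := ⟨fun _ => Tens.homot, Tens.homot_rename⟩

variable (D) in
/-- Extension of scalars, followed by multiplication with a function. -/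
def fnOp (p : ℚ[X]) : NatOp ratCoeff intervalCoeff D :=
  ⟨fun S => LinearMap.mulLeft ℚ (Tens.fn D S p) ∘ₗ (Tens.baseChange constForms).toLinearMap, fun f x => by
    simp [Tens.baseChange_rename, Tens.rename_fn]⟩

variable (D) in
/-- Extension of scalars, followed by multiplication with a one-form. -/
def formOp (p : ℚ[X]) : NatOp ratCoeff intervalCoeff D :=
  ⟨fun S => LinearMap.mulLeft ℚ (Tens.form D S p) ∘ₗ (Tens.baseChange constForms).toLinearMap, fun f x => by
    simp [Tens.baseChange_rename, Tens.rename_form]⟩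

theorem homotOp_mem {n : ℕ} {m m' : ℤ} (hm : m + 1 = m') {x : Series intervalCoeff D} (hx : x ∈ HGC intervalCoeff D n m) :
    (homotOp D).map x ∈ HGC intervalCoeff D n m' :=
  (homotOp D).map_mem (j := -1) (by omega) (fun _ _ _ h => Tens.homot_mem_part h) hx

theorem fnOp_mem (p : ℚ[X]) {n : ℕ} {m : ℤ} {x : Series ratCoeff D} (hx : x ∈ HGC ratCoeff D n m) :
    (fnOp D p).map x ∈ HGC intervalCoeff D n m := by
  refine (fnOp D p).map_mem (j := 0) (by omega) (fun k i x h => ?_) hx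
  have := Tens.baseChange_mem_part constForms h
  rw [Tens.part_eq_hd] at this ⊢
  have := Tens.hd_mul (Tens.fn_mem_hd p) this
  rwa [Set.empty_union, add_comm] at this

theorem formOp_mem (p : ℚ[X]) {n : ℕ} {m m' : ℤ} (hm : m = m' + 1) {x : Series ratCoeff D}
    (hx : x ∈ HGC ratCoeff D n m) : (formOp D p).map x ∈ HGC intervalCoeff D n m' := by
  refine (formOp D p).map_mem hm (fun k i x h => ?_) hx
  have := Tens.baseChange_mem_part constForms h
  rw [Tens.part_eq_hd] at this ⊢
  have := Tens.hd_mul (Tens.form_mem_hd p) this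
  rwa [Set.empty_union, add_comm] at this

theorem formOp_apply (p : ℚ[X]) (x : Series ratCoeff D) (k v e : ℕ) (G : Graph (Fin k) (Fin v) (Fin e)) :
    (formOp D p).map x k v e G = Tens.form D _ p * Tens.baseChange constForms (x k v e G) := rfl

theorem eval_fnOp (t : ℚ) (p : ℚ[X]) (x : Series ratCoeff D) :
    Series.map (evalForms t) ((fnOp D p).map x) = p.eval t • x := by
  ext k v e G
  show Tens.baseChange _ (Tens.fn D _ p * Tens.baseChange constForms (x k v e G)) = p.eval t • x k v e G
  rw [map_mul, Tens.eval_fn, Tens.baseChange_evalForms_const, ← Algebra.smul_def]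

theorem eval_formOp (t : ℚ) (p : ℚ[X]) (x : Series ratCoeff D) :
    Series.map (evalForms t) ((formOp D p).map x) = 0 := by
  ext k v e G
  show Tens.baseChange _ (Tens.form D _ p * Tens.baseChange constForms (x k v e G)) = 0
  rw [map_mul, Tens.eval_form, zero_mul]

section Paths

open Polynomial

theorem ratCoeff_le (i : ℤ) (h : ratCoeff.gr i ≠ ⊥) : i ≤ 0 := by
  by_contra hi
  exact h (if_neg (by omega))

theorem intervalCoeff_le (i : ℤ) (h : intervalCoeff.gr i ≠ ⊥) : i ≤ 1 := by
  by_contra hi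
  refine h ((Submodule.eq_bot_iff _).2 fun r hr => ?_)
  rcases mem_formsGr.1 hr with ⟨h0, -⟩ | ⟨h0, -⟩ | h0
  · omega
  · omega
  · exact h0

variable {A : Type u} [NonUnitalRing A] [Module ℚ A] {D : DGCommAlgebra A} {n : ℕ}

theorem Tens.mem_range_const {S : Type} (x : Tens ratCoeff D S) :
    Tens.baseChange constForms x ∈ (Tens.polyFn (D := D) (S := S)).range := ⟨C x, Tens.polyFn_C x⟩

theorem Tens.mem_range_fn_X {S : Type} : Tens.fn D S X ∈ (Tens.polyFn (D := D) (S := S)).range :=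
  ⟨monomial 1 1, by
    show Tens.polyFn (monomial 1 1) = _
    rw [Tens.polyFn_monomial, map_one, one_mul, pow_one]⟩

theorem Tens.mem_range_rename {S T : Type} (f : S → T) (x : Tens intervalCoeff D S)
    (hx : x ∈ (Tens.polyFn (D := D) (S := S)).range) : Tens.rename f x ∈ (Tens.polyFn (D := D) (S := T)).range := by
  obtain ⟨g, rfl⟩ := hx
  exact ⟨_, Tens.polyFn_map f g⟩

/-- If the class of an element modulo `IHX` does not depend on `dt`, then the same holds for the curvature. -/
theorem curvature_eq_splitting_homot {z₀ w z : Series intervalCoeff D} (hz₀ : z₀ ∈ HGC intervalCoeff D n 0)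
    (hw : w ∈ HGC intervalCoeff D n 0) (hz : z = z₀ + w)
    (hz₀' : ∀ k v e G, z₀ k v e G ∈ (Tens.polyFn (D := D) (S := Fin k)).range)
    (hw' : ∀ (k v e : ℕ) (G : Graph (Fin k) (Fin v) (Fin e)), dfct k v e ≤ 0 → w k v e G = 0)
    (hd : ∀ (k v e : ℕ) (G : Graph (Fin k) (Fin v) (Fin e)), IsPrimitive G → dfct k v e = 0 →
      Tens.d (z₀ k v e G) - splitting n k v e G w ∈ (Tens.polyFn (D := D) (S := Fin k)).range)
    {k v e : ℕ} {G : Graph (Fin k) (Fin v) (Fin e)} (hG : IsPrimitive G) (hG0 : dfct k v e = 0)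
    (h0 : Tens.baseChange (evalForms 0) (curvature n z k v e G) = 0) :
    curvature n z k v e G = - splitting n k v e G ((homotOp D).map (curv n z)) := by
  have hzm : z ∈ HGC intervalCoeff D n 0 := hz ▸ add_mem hz₀ hw
  have hzz : ∀ (k v e : ℕ) (G : Graph (Fin k) (Fin v) (Fin e)), dfct k v e ≤ 0 → z k v e G = z₀ k v e G := by
    intro k v e G h
    rw [hz]
    show z₀ k v e G + w k v e G = _
    rw [hw' k v e G h, add_zero]
  have hC : ∀ (k v e : ℕ) (G : Graph (Fin k) (Fin v) (Fin e)), IsPrimitive G → dfct k v e = 0 →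
      curvature n z k v e G ∈ (Tens.polyFn (D := D) (S := Fin k)).range := by
    intro k v e G hG hG0
    rw [hz, curvature_add hz₀ hw hG fun k' v' e' G' _ h => hw' k' v' e' G' (by omega), curvature, sub_right_comm]
    refine sub_mem (hd k v e G hG hG0) (sum_mem fun i _ => ?_)
    exact contractTerm_mem (N := fun S => Tens.polyFn.range) Tens.mem_range_rename n hz₀' G i
  have h1 := hG.prim.d_curvA hzm (Subalgebra.toSubmodule Tens.polyFn.range) fun i hi w' s he => by
    refine (curvA_mem_of_comps hzm Tens.polyFn.range (Subalgebra.toSubmodule Tens.polyFn.range)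
      (fun a ha b hb => Subalgebra.mul_mem _ ha hb) (fun a ha b hb => Subalgebra.mul_mem _ hb ha) _ (hG.noUniv.cg he hi) fun c hc => ?_).2
    obtain ⟨h1, h2⟩ := hG.prim.comps_cg he hi hc
    obtain ⟨G', σ, ε, hG', h3, h4⟩ := h1.atom_model (K := intervalCoeff) (D := D) (n := n)
    rw [hG.defect_eq, hG0] at h2
    have h5 : dfct _ _ _ ≤ 0 := le_trans (le_of_eq rfl) h2
    rw [Fa_of_linked n z h1.nonempty h1.linked, h3 0 z hzm, h4 z hzm]
    refine ⟨zsmul_mem (Tens.mem_range_rename _ _ ?_) _, zsmul_mem (Tens.mem_range_rename _ _ ?_) _⟩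
    · rw [hzz _ _ _ _ h5]
      exact hz₀' _ _ _ _
    · exact hC _ _ _ _ hG' (le_antisymm h5 hG'.dfct_nonneg)
  rw [← curvature_eq hzm hG, ← splitting_eq (curv_mem hzm) hG] at h1
  have h2 := Tens.homot_of_mem h1
  rw [map_add, Tens.homot_d_of_mem (hC k v e G hG hG0), h0, map_zero, sub_zero] at h2
  rw [(homotOp D).splitting_map]
  exact eq_neg_of_add_eq_zero_left h2

/-- Maurer--Cartan elements which are equal modulo `IHX` are joined by a path on graphs of defect zero. -/
theorem exists_path_defect_zero (hn : 3 ≤ n) (hD : ∀ i, D.gr i ≠ ⊥ → i + 3 ≤ n) {x x' : Series ratCoeff D}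
    (hx : x ∈ HGC ratCoeff D n 0) (hx' : x' ∈ HGC ratCoeff D n 0)
    (hC : ∀ (k v e : ℕ) (G : Graph (Fin k) (Fin v) (Fin e)), IsPrimitive G → curvature n x' k v e G = 0)
    (h : x - x' ∈ ihx ratCoeff D n 0) :
    ∃ p ∈ HGC intervalCoeff D n 0,
      (∀ (k v e : ℕ) (G : Graph (Fin k) (Fin v) (Fin e)), dfct k v e ≤ 0 →
        Series.map (evalForms 0) p k v e G = x' k v e G ∧ Series.map (evalForms 1) p k v e G = x k v e G) ∧
      ∀ (k v e : ℕ) (G : Graph (Fin k) (Fin v) (Fin e)), IsPrimitive G → dfct k v e ≤ 0 →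
        curvature n p k v e G = 0 := by
  obtain ⟨y, hy, hxy⟩ := h
  have hy1 := cut_mem (fun k v e => dfct k v e = 1) hy
  obtain ⟨y1, hy1e⟩ : ∃ y1, y1 = cut (fun k v e => dfct k v e = 1) y := ⟨_, rfl⟩
  rw [← hy1e] at hy1
  have hs := split_mem hy1
  have hfm := fnOp_mem 1 hx'
  have hz₀ := add_mem hfm (fnOp_mem X hs)
  have hw := formOp_mem (m' := 0) 1 rfl hy1
  have hw' : ∀ (k v e : ℕ) (G : Graph (Fin k) (Fin v) (Fin e)), dfct k v e ≤ 0 → (formOp D 1).map y1 k v e G = 0 := by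
    intro k v e G hd
    rw [formOp_apply, hy1e, cut_of_not y (by omega), map_zero, mul_zero]
  obtain ⟨z₀, hz₀e⟩ : ∃ z₀, z₀ = (fnOp D 1).map x' + (fnOp D X).map (split n y1) := ⟨_, rfl⟩
  rw [← hz₀e] at hz₀
  have hz₀G : ∀ (k v e : ℕ) (G : Graph (Fin k) (Fin v) (Fin e)), z₀ k v e G =
      Tens.baseChange constForms (x' k v e G) + Tens.fn D _ X * Tens.baseChange constForms (split n y1 k v e G) := by
    intro k v e G
    rw [hz₀e]
    show Tens.fn D _ 1 * _ + _ = _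
    rw [Tens.fn_one, one_mul]
    rfl
  obtain ⟨z, hze⟩ : ∃ z, z = z₀ + (formOp D 1).map y1 := ⟨_, rfl⟩
  have hz : z ∈ HGC intervalCoeff D n 0 := hze ▸ add_mem hz₀ hw
  have hev (t : ℚ) : Series.map (evalForms t) z = x' + t • split n y1 := by
    rw [hze, hz₀e, map_add, map_add, eval_fnOp, eval_fnOp, eval_formOp]
    simp
  have hsplit : ∀ (k v e : ℕ) (G : Graph (Fin k) (Fin v) (Fin e)), IsPrimitive G → dfct k v e = 0 →
      curvature n z k v e G = - splitting n k v e G ((homotOp D).map (curv n z)) := by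
    intro k v e G hG hG0
    refine curvature_eq_splitting_homot hz₀ hw hze (fun k v e G => ?_) hw' (fun k v e G hG hG0 => ?_) hG hG0 ?_
    · rw [hz₀G]
      exact add_mem (Tens.mem_range_const _) (mul_mem Tens.mem_range_fn_X (Tens.mem_range_const _))
    · rw [hz₀G, (formOp D 1).splitting_map, map_add, Tens.d_mul, Tens.d_fn, Tens.d_baseChange, Tens.d_baseChange,
        Tens.theta_of_mem (Tens.fn_mem_hd X), zpow_zero, one_smul, derivative_X, split_apply y1 hG]
      show _ + (_ + _) - Tens.form D _ 1 * Tens.baseChange constForms _ ∈ _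
      rw [← add_assoc, add_sub_cancel_right]
      exact add_mem (Tens.mem_range_const _) (mul_mem Tens.mem_range_fn_X (Tens.mem_range_const _))
    · rw [← curvature_map, hev, zero_smul, add_zero]
      exact hC k v e G hG
  have hY := neg_mem (homotOp_mem (show (-1 : ℤ) + 1 = 0 from rfl) (curv_mem hz))
  have hY1 := cut_mem (fun k v e => dfct k v e = 1) hY
  have hp (t : ℚ) (k v e : ℕ) (G : Graph (Fin k) (Fin v) (Fin e)) (hd : dfct k v e ≤ 0) :
      Series.map (evalForms t) (z + cut (fun k v e => dfct k v e = 1) (-(homotOp D).map (curv n z))) k v e G =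
        x' k v e G + t • split n y1 k v e G := by
    rw [map_add, hev]
    show _ + Tens.baseChange _ (cut _ _ k v e G) = _
    rw [cut_of_not _ (by omega), map_zero, add_zero]
    rfl
  refine ⟨_, add_mem hz hY1, fun k v e G hd => ⟨?_, ?_⟩, fun k v e G hG hd => ?_⟩
  · rw [hp 0 k v e G hd, zero_smul, add_zero]
  · rw [hp 1 k v e G hd, one_smul]
    by_cases hG : IsPrimitive G
    · by_cases hc : e + 1 = k + v
      · have hd0 : dfct k v e = 0 := le_antisymm hd hG.dfct_nonneg
        have h1 := hxy k v e G (hG.isUnitrivalentTree hc hd0)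
        rw [split_apply y1 hG, splitting_congr hy1 hy hG fun k' v' e' G' _ h' => by
          rw [hy1e, cut_of y (by omega)], ← h1]
        exact add_sub_cancel _ _
      · rw [HGC.eq_zero_of_loop hn ratCoeff_le hD hx (by norm_num) hG hc,
          HGC.eq_zero_of_loop hn ratCoeff_le hD hx' (by norm_num) hG hc,
          HGC.eq_zero_of_loop hn ratCoeff_le hD hs (by norm_num) hG hc, add_zero]
    · rw [(hx k v e G).2.1 hG, (hx' k v e G).2.1 hG, (hs k v e G).2.1 hG, add_zero]
  · have hd0 : dfct k v e = 0 := le_antisymm hd hG.dfct_nonneg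
    rw [curvature_add hz hY1 hG fun k' v' e' G' _ h' => cut_of_not _ (by omega),
      splitting_congr hY1 hY hG fun k' v' e' G' _ h' => cut_of _ (by omega), hsplit k v e G hG hd0, map_neg, sub_self]

/-- The leading term of the difference of two Maurer--Cartan elements is a cocycle. -/
theorem splitting_cut_sub {x a : Series ratCoeff D} (hx : x ∈ HGC ratCoeff D n 0) (ha : a ∈ HGC ratCoeff D n 0) {d : ℤ}
    (hC : ∀ (k v e : ℕ) (G : Graph (Fin k) (Fin v) (Fin e)), IsPrimitive G → dfct k v e ≤ d → curvature n x k v e G = 0)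
    (hC' : ∀ (k v e : ℕ) (G : Graph (Fin k) (Fin v) (Fin e)), IsPrimitive G → dfct k v e ≤ d → curvature n a k v e G = 0)
    (h : ∀ (k v e : ℕ) (G : Graph (Fin k) (Fin v) (Fin e)), dfct k v e ≤ d → a k v e G = x k v e G)
    {k v e : ℕ} {G : Graph (Fin k) (Fin v) (Fin e)} (hG : IsPrimitive G) :
    splitting n k v e G (cut (fun k v e => dfct k v e = d + 1) (a - x)) = 0 := by
  have hax := sub_mem ha hx
  by_cases hd : dfct k v e = d
  · rw [splitting_congr (cut_mem _ hax) hax hG fun k' v' e' G' _ h' => cut_of _ (by omega)]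
    have h1 := curvature_add hx hax hG fun k' v' e' G' _ h' => sub_eq_zero.2 (h k' v' e' G' (by omega))
    rw [add_sub_cancel, hC k v e G hG hd.le, hC' k v e G hG hd.le, zero_sub, eq_comm, neg_eq_zero] at h1
    exact h1
  · exact splitting_eq_zero (cut_mem _ hax) hG fun k' v' e' G' _ h' => cut_of_not _ (by omega)

/-- Maurer--Cartan elements which are equal modulo `IHX` are joined by a path. -/
theorem exists_path (hn : 3 ≤ n) (hD : ∀ i, D.gr i ≠ ⊥ → i + 3 ≤ n) {x x' : Series ratCoeff D}
    (hx : x ∈ HGC ratCoeff D n 0) (hx' : x' ∈ HGC ratCoeff D n 0)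
    (hC : ∀ (k v e : ℕ) (G : Graph (Fin k) (Fin v) (Fin e)), IsPrimitive G → curvature n x k v e G = 0)
    (hC' : ∀ (k v e : ℕ) (G : Graph (Fin k) (Fin v) (Fin e)), IsPrimitive G → curvature n x' k v e G = 0)
    (h : x - x' ∈ ihx ratCoeff D n 0) (d : ℕ) :
    ∃ p ∈ HGC intervalCoeff D n 0,
      (∀ (k v e : ℕ) (G : Graph (Fin k) (Fin v) (Fin e)), dfct k v e ≤ d →
        Series.map (evalForms 0) p k v e G = x' k v e G ∧ Series.map (evalForms 1) p k v e G = x k v e G) ∧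
      ∀ (k v e : ℕ) (G : Graph (Fin k) (Fin v) (Fin e)), IsPrimitive G → dfct k v e ≤ d →
        curvature n p k v e G = 0 := by
  induction d with
  | zero => exact_mod_cast exists_path_defect_zero hn hD hx hx' hC' h
  | succ d ih =>
    obtain ⟨p, hp, hpe, hpC⟩ := ih
    have he (t : ℚ) : ∀ (k v e : ℕ) (G : Graph (Fin k) (Fin v) (Fin e)), IsPrimitive G → dfct k v e ≤ d →
        curvature n (Series.map (evalForms t) p) k v e G = 0 := by
      intro k v e G hG hd
      rw [curvature_map, hpC k v e G hG hd, map_zero]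
    have ha (t : ℚ) := map_mem_HGC (evalForms t) hp
    have hc0 := fun (k v e : ℕ) (G : Graph (Fin k) (Fin v) (Fin e)) (hG : IsPrimitive G) =>
      splitting_cut_sub hx' (ha 0) (fun k v e G hG _ => hC' k v e G hG) (he 0) (fun k v e G hd => (hpe k v e G hd).1) hG
    have hc1 := fun (k v e : ℕ) (G : Graph (Fin k) (Fin v) (Fin e)) (hG : IsPrimitive G) =>
      splitting_cut_sub hx (ha 1) (fun k v e G hG _ => hC k v e G hG) (he 1) (fun k v e G hd => (hpe k v e G hd).2) hG
    have hr0 := cut_mem (fun k v e => dfct k v e = d + 1) (sub_mem (ha 0) hx')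
    have hr1 := cut_mem (fun k v e => dfct k v e = d + 1) (sub_mem (ha 1) hx)
    obtain ⟨r0, hr0e⟩ : ∃ r, r = cut (fun k v e => dfct k v e = d + 1) (Series.map (evalForms 0) p - x') := ⟨_, rfl⟩
    obtain ⟨r1, hr1e⟩ : ∃ r, r = cut (fun k v e => dfct k v e = d + 1) (Series.map (evalForms 1) p - x) := ⟨_, rfl⟩
    rw [← hr0e] at hr0 hc0
    rw [← hr1e] at hr1 hc1
    have hw := neg_mem (add_mem (fnOp_mem (1 - X) hr0) (fnOp_mem X hr1))
    obtain ⟨w, hwe⟩ : ∃ w, w = -((fnOp D (1 - X)).map r0 + (fnOp D X).map r1) := ⟨_, rfl⟩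
    rw [← hwe] at hw
    have hwG : ∀ (k v e : ℕ) (G : Graph (Fin k) (Fin v) (Fin e)), dfct k v e ≤ d → w k v e G = 0 := by
      intro k v e G hd
      rw [hwe]
      show -(Tens.fn D _ _ * Tens.baseChange constForms (r0 k v e G) +
        Tens.fn D _ _ * Tens.baseChange constForms (r1 k v e G)) = 0
      rw [hr0e, hr1e, cut_of_not _ (by omega), cut_of_not _ (by omega)]
      simp
    have hev (t : ℚ) : Series.map (evalForms t) w = -((1 - t) • r0 + t • r1) := by
      rw [hwe, map_neg, map_add, eval_fnOp, eval_fnOp]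
      simp
    obtain ⟨p', hp', hpp, hpC'⟩ := exists_curvature_eq_zero_succ (d := d) hn intervalCoeff_le hD (add_mem hp hw)
      fun k v e G hG hd => by
        rw [curvature_add hp hw hG fun k' v' e' G' _ h' => hwG k' v' e' G' (by omega), hpC k v e G hG hd, hwe, map_neg,
          map_add, NatOp.splitting_map, NatOp.splitting_map, hc0 k v e G hG, hc1 k v e G hG]
        simp
    refine ⟨p', hp', fun k v e G hd => ?_, fun k v e G hG hd => hpC' k v e G hG (by exact_mod_cast hd)⟩
    have h1 (t : ℚ) : Series.map (evalForms t) p' k v e G =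
        Series.map (evalForms t) p k v e G - ((1 - t) • r0 k v e G + t • r1 k v e G) := by
      show Tens.baseChange _ (p' k v e G) = _
      rw [hpp k v e G (by exact_mod_cast hd)]
      have h2 := congrFun (congrFun (congrFun (congrFun (hev t) k) v) e) G
      show Tens.baseChange _ (p k v e G + w k v e G) = _
      rw [map_add, sub_eq_add_neg]
      exact congrArg _ h2
    rw [h1, h1]
    simp only [sub_zero, one_smul, zero_smul, add_zero, sub_self, zero_add]
    by_cases hd' : dfct k v e = d + 1
    · rw [hr0e, hr1e, cut_of _ hd', cut_of _ hd']
      exact ⟨sub_sub_cancel _ _, sub_sub_cancel _ _⟩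
    · rw [hr0e, hr1e, cut_of_not _ hd', cut_of_not _ hd', sub_zero, sub_zero]
      exact hpe k v e G (by push_cast at hd; omega)

/-- Maurer--Cartan elements which are equal modulo `IHX` are gauge equivalent. -/
theorem gaugeHGC_of_sub_mem_ihx (hn : 3 ≤ n) (hD : ∀ i, D.gr i ≠ ⊥ → i + 3 ≤ n) (x x' : MCHGC ratCoeff D n)
    (h : x.1.1 - x'.1.1 ∈ ihx ratCoeff D n 0) : gaugeHGC D n x' x := by
  obtain ⟨p, hp, hpe, hpC⟩ := exists_path hn hD x.1.2 x'.1.2 x.2 x'.2 h n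
  have he (t : ℚ) (y : HGC ratCoeff D n 0) (hy : ∀ (k v e : ℕ) (G : Graph (Fin k) (Fin v) (Fin e)), dfct k v e ≤ n →
      Series.map (evalForms t) p k v e G = y.1 k v e G) : HGC.map (evalForms t) n 0 ⟨p, hp⟩ = y := by
    refine Subtype.ext ?_
    show Series.map (evalForms t) p = y.1
    funext k v e G
    by_cases hd : dfct k v e ≤ n
    · exact hy k v e G hd
    · have hm := map_mem_HGC (evalForms t) hp
      by_cases hG : IsPrimitive G
      · rw [HGC.eq_zero_of_defect hn ratCoeff_le hD hm hG (by omega),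
          HGC.eq_zero_of_defect hn ratCoeff_le hD y.2 hG (by omega)]
      · rw [(hm k v e G).2.1 hG, (y.2 k v e G).2.1 hG]
  refine ⟨⟨p, hp⟩, fun k v e G hG => ?_, he 0 _ fun k v e G hd => (hpe k v e G hd).1,
    he 1 _ fun k v e G hd => (hpe k v e G hd).2⟩
  by_cases hd : dfct k v e ≤ n
  · exact hpC k v e G hG hd
  · rw [← curv_apply hG]
    exact HGC.eq_zero_of_defect hn intervalCoeff_le hD (curv_mem hp) hG (by omega)

theorem MCHGC.toUTT_eq_iff {x x' : MCHGC ratCoeff D n} : MCHGC.toUTT x = MCHGC.toUTT x' ↔ x.1.1 - x'.1.1 ∈ ihx ratCoeff D n 0 := by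
  rw [Subtype.ext_iff]
  exact Submodule.Quotient.eq _

theorem MCHGC.toUTT_surjective (hn : 3 ≤ n) (hD : ∀ i, D.gr i ≠ ⊥ → i + 3 ≤ n) :
    Function.Surjective (MCHGC.toUTT : MCHGC ratCoeff D n → MCUTT ratCoeff D n) := by
  rintro ⟨_, z, rfl, hz⟩
  obtain ⟨x, hx, hxz, hC⟩ := exists_lift hn (fun i hi => (ratCoeff_le i hi).trans zero_le_one) hD z.2 hz
  exact ⟨⟨⟨x, hx⟩, hC⟩, Subtype.ext ((Submodule.Quotient.eq _).2 hxz)⟩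

theorem gaugeHGC_of_gaugeUTT (hn : 3 ≤ n) (hD : ∀ i, D.gr i ≠ ⊥ → i + 3 ≤ n) {x x' : MCHGC ratCoeff D n}
    (h : gaugeUTT D n (MCHGC.toUTT x) (MCHGC.toUTT x')) : Relation.EqvGen (gaugeHGC D n) x x' := by
  obtain ⟨_, ⟨z, rfl, hz⟩, h0, h1⟩ := h
  obtain ⟨p, hp, hpz, hC⟩ := exists_lift hn intervalCoeff_le hD z.2 hz
  have hpt (t : ℚ) : HGC.map (evalForms t) n 0 ⟨p, hp⟩ ∈ MCHGC ratCoeff D n := by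
    intro k v e G hG
    show curvature n (Series.map (evalForms t) p) k v e G = 0
    rw [curvature_map, hC k v e G hG, map_zero]
  have ht (t : ℚ) (y : MCHGC ratCoeff D n) (hy : UTT.map (evalForms t) n 0 (Submodule.Quotient.mk z) = MCHGC.toUTT y) :
      y.1.1 - Series.map (evalForms t) p ∈ ihx ratCoeff D n 0 := by
    have h1 : HGC.map (evalForms t) n 0 z - y.1 ∈ (ihx ratCoeff D n 0).submoduleOf (HGC ratCoeff D n 0) :=
      (Submodule.Quotient.eq _).1 hy
    have h2 : Series.map (evalForms t) z.1 - y.1.1 ∈ ihx ratCoeff D n 0 := h1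
    have h3 := neg_mem (add_mem (map_mem_ihx (evalForms t) hpz) h2)
    rw [map_sub] at h3
    simpa using h3
  refine .trans _ _ _ (.symm _ _ (.rel _ _ (gaugeHGC_of_sub_mem_ihx hn hD x ⟨_, hpt 0⟩ (ht 0 x h0)))) ?_
  refine .trans _ ⟨_, hpt 1⟩ _ (.rel _ _ ⟨⟨p, hp⟩, hC, rfl, rfl⟩) ?_
  exact .rel _ _ (gaugeHGC_of_sub_mem_ihx hn hD x' ⟨_, hpt 1⟩ (ht 1 x' h1))

theorem gaugeClassesMap_injective (hn : 3 ≤ n) (hD : ∀ i, D.gr i ≠ ⊥ → i + 3 ≤ n) :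
    Function.Injective (gaugeClassesMap D n) := by
  have key (ξ ξ' : MCUTT ratCoeff D n) (h : Relation.EqvGen (gaugeUTT D n) ξ ξ') :
      ∀ x x' : MCHGC ratCoeff D n, MCHGC.toUTT x = ξ → MCHGC.toUTT x' = ξ' → Relation.EqvGen (gaugeHGC D n) x x' := by
    induction h with
    | rel ξ ξ' h =>
      rintro x x' rfl rfl
      exact gaugeHGC_of_gaugeUTT hn hD h
    | refl ξ =>
      intro x x' h h'
      exact .symm _ _ (.rel _ _ (gaugeHGC_of_sub_mem_ihx hn hD x x' (MCHGC.toUTT_eq_iff.1 (h.trans h'.symm))))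
    | symm ξ ξ' _ ih => exact fun x x' h h' => .symm _ _ (ih x' x h' h)
    | trans ξ₁ ξ₂ ξ₃ _ _ ih ih' =>
      intro x x' h h'
      obtain ⟨y, hy⟩ := MCHGC.toUTT_surjective hn hD ξ₂
      exact .trans _ _ _ (ih x y h hy) (ih' y x' hy h')
  rintro ⟨x⟩ ⟨x'⟩ h
  exact Quot.eqvGen_sound (key _ _ (Quot.eqvGen_exact h) x x' rfl rfl)

theorem gaugeClassesMap_surjective (hn : 3 ≤ n) (hD : ∀ i, D.gr i ≠ ⊥ → i + 3 ≤ n) :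
    Function.Surjective (gaugeClassesMap D n) := by
  rintro ⟨ξ⟩
  obtain ⟨x, rfl⟩ := MCHGC.toUTT_surjective hn hD ξ
  exact ⟨Quot.mk _ x, rfl⟩

end Paths

end HairyGraphs
end

/-- If `n - dim A ≥ 3`, then the quotient map from hairy graphs to unitrivalent trees modulo `IHX`
induces a bijection on gauge equivalence classes of Maurer--Cartan elements. -/
theorem proposition5p3 {A : Type*} [NonUnitalRing A] [Module ℚ A]
    (D : HairyGraphs.DGCommAlgebra A) (n : ℕ) (hn : 3 ≤ n)
    (hdim : ∀ i : ℤ, D.gr i ≠ ⊥ → i + 3 ≤ n) :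
    Function.Bijective (HairyGraphs.gaugeClassesMap D n) :=
  ⟨HairyGraphs.gaugeClassesMap_injective hn hdim, HairyGraphs.gaugeClassesMap_surjective hn hdim⟩
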